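/- **Generalisation of the Page metric by analytic continuation of the near-horizon geometry of extremal Kerr–Newman–$\Lambda$.** *Near-horizon geometry.* For parameters $\Lambda,\ell,k,\beta,Q$ let $A_0=-\ell^{-2}$, $\Gamma(x)=\frac{k^2}{\beta}+\frac{\beta x^2}{4}$, $$P_{NH}(x)=-\tfrac{\beta\Lambda x^4}{12}+\bigl(A_0-\tfrac{2\Lambda k^2}{\beta}\bigr)x^2-\tfrac{4k^2}{\beta^2}\bigl(A_0-\tfrac{\Lambda k^2}{\beta}\bigr)-Q ,$$ $$g_{NH}=\ell^2\Gamma\,(-\cosh^2\!\rho\,dt^2+d\rho^2)+\frac{\Gamma}{P_{NH}}dx^2+\frac{P_{NH}}{\Gamma}(d\phi+\ell^2k\sinh\rho\,dt)^2 .$$ (1) Let a rotating Kerr–Newman–$\Lambda$ black hole with rotation parameter $a>0$, mass parameter $M$, charge parameter $q$ ($q^2$ the sum of the squared electric and magnetic charge parameters) and $1+\Lambda a^2/3>0$ have a degenerate horizon at $r_+>0$, i.e. $\Delta_r(r_+)=\Delta_r'(r_+)=0$ with $C=\frac12\Delta_r''(r_+)=1-\frac{\Lambda a^2}{3}-2\Lambda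 r_+^2>0$, where $\Delta_r=(r^2+a^2)(1-\Lambda r^2/3)-2Mr+q^2$. Then for all $s,\mu>0$ its near-horizon limit at $r_+$, written in global $\mathrm{AdS}_2$ coordinates (with $a\cos\theta=s\,x$, on the part $|t|<\pi$, $\cosh\rho\cos t+\sinh\rho>0$ covered by the near-horizon scaling), is $g_{NH}$ with $k=2\mu r_+s$, $\beta=4\mu s^2$, $\ell^2=1/(\mu C)$, $Q=\mu q^2/s^2$. (2) Let $\alpha,\ell>0$ and $\Lambda,c\in\mathbb R$. Setting $\ell^2k=2i\alpha^2$, $\ell^2\beta=4\alpha^2$, $\ell^2Q=c$ in $g_{NH}$ and substituting $\rho= i(\theta-\frac{\pi}{2})$, $t\to\phi$, $\phi\to2\alpha^2\psi$ gives $$g=\frac{\alpha^2(1-x^2)}{P}dx^2+\frac{4\alpha^2P}{1-x^2}(d\psi+\cos\theta\,d\phi)^2+\alpha^2(1-x^2)(d\theta^2+\sin^2\!\theta\,d\phi^2),$$ $$P(x)=1+x^2+c-\bigl(1+2x^2-\tfrac13x^4\bigr)\alpha^2\Lambda .$$ (3) On $\{|x|<1,\ P(x)>0,\ 0<\theta<\pi\}$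 the metric $g$ is Riemannian, has constant scalar curvature $4\Lambda$, and together with some Maxwell two-form $F$ solves the Einstein–Maxwell equations $R_{\mu\nu}=\Lambda g_{\mu\nu}+2(F_{\mu\rho}F_\nu{}^\rho-\frac14F^2g_{\mu\nu})$, $dF=0$, $d\star F=0$. Call $(\alpha,\Lambda,c,x_1)$ *admissible* if $\alpha>0$, $0<x_1<1$, $P(x_1)=0$ and $P>0$ on $(-x_1,x_1)$. For an integer $m\ge1$ the *integrality condition* is $$m=\frac{4x_1(3+x_1^2)}{3+6x_1^2-x_1^4}+\frac{8c(3-x_1^2)x_1}{(1-x_1^2)(3+6x_1^2-x_1^4)} .\qquad(*)$$ (4) For admissible parameters and $m\geq 1$, $(*)$ holds if and only if, with $\psi$ of period $4\pi/m$, the $(x,\psi)$ part of $g$ has no conical singularity (the cone angle is $2\pi$) at $x=\pm x_1$. (5) If the parameters are admissible and $(*)$ holds, then $\Lambda>0$, and $g$ on $-x_1<x<x_1$, with $(\psi,\phi)$ taken modulo the lattice generated by $(4\pi/m,0)$ and $(2\pi,2\pi)$, extends smoothly: there are a compact smooth four-manifold $\mathcal M$, a smooth $S^2$-bundle $\pi:\mathcal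 M\to S^2$, and a smooth Riemannian metric and two-form on $\mathcal M$ solving the Einstein–Maxwell equations with cosmological constant $\Lambda$ everywhere, such that $(x,\psi,\theta,\phi)$ parametrise a dense open subset of $\mathcal M$ on which the metric is $g$ and on which $\pi$ is the map to the point with spherical coordinates $(\theta,\phi)$. For $m$ even the bundle is smoothly trivial, $\mathcal M\cong S^2\times S^2$ over $S^2$; for $m$ odd $\mathcal M$ is diffeomorphic to $\mathbb{CP}^2\#\overline{\mathbb{CP}^2}$. (6) If $c>0$, then for every $\Lambda>0$ and every integer $m\ge1$ there is exactly one pair $(\alpha,x_1)$ such that the parameters are admissible and $(*)$ holds. (7) If $c<0$, admissible parameters can satisfy $(*)$ only for $m=1$; and there exists $c<0$ such that for every $\Lambda>0$ there are exactly two pairs $(\alpha,x_1)$ which are admissible and satisfy $(*)$ with $m=1$. -/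

import Mathlib

open Real Set Filter Topology Manifold
open scoped ContDiff LinearAlgebra.Projectivization Matrix

noncomputable section

/-! ### Tensor calculus in coordinates on `ℝ⁴` -/

/-- Four-dimensional real coordinate space. -/
abbrev E4 : Type := EuclideanSpace ℝ (Fin 4)

/-- The `i`-th coordinate vector of `𝕜⁴`. -/
def coordVec (𝕜 : Type*) [RCLike 𝕜] (i : Fin 4) : EuclideanSpace 𝕜 (Fin 4) :=
  EuclideanSpace.single i 1

/-- The partial derivative `∂ᵢ f`. -/
def pd (i : Fin 4) (f : E4 → ℝ) (p : E4) : ℝ := fderiv ℝ f p (coordVec ℝ i)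

/-- Christoffel symbols `Γᵏᵢⱼ` of the Levi-Civita connection of the metric `g`. -/
def christoffel (g : E4 → Matrix (Fin 4) (Fin 4) ℝ) (k i j : Fin 4) (p : E4) : ℝ :=
  (1 / 2) * ∑ l, (g p)⁻¹ k l *
    (pd i (fun q => g q j l) p + pd j (fun q => g q i l) p - pd l (fun q => g q i j) p)

/-- The Ricci tensor `Rᵢⱼ` (positive on round spheres). -/
def ricci (g : E4 → Matrix (Fin 4) (Fin 4) ℝ) (i j : Fin 4) (p : E4) : ℝ :=
  ∑ k, (pd k (christoffel g k i j) p - pd j (christoffel g k i k) p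
    + ∑ l, (christoffel g k k l p * christoffel g l i j p
      - christoffel g k j l p * christoffel g l i k p))

/-- The scalar curvature `gⁱʲ Rᵢⱼ`. -/
def scalarCurvature (g : E4 → Matrix (Fin 4) (Fin 4) ℝ) (p : E4) : ℝ :=
  ∑ i, ∑ j, (g p)⁻¹ i j * ricci g i j p

/-- The two-form with both indices raised, `Fⁱʲ = gⁱᵏ gʲˡ Fₖₗ`. -/
def raised (g F : E4 → Matrix (Fin 4) (Fin 4) ℝ) (i j : Fin 4) (p : E4) : ℝ :=
  ∑ k, ∑ l, (g p)⁻¹ i k * (g p)⁻¹ j l * F p k l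

/-- The Maxwell energy-momentum tensor `Tᵢⱼ = 2 (Fᵢₖ Fⱼᵏ - ¼ F² gᵢⱼ)`. -/
def maxwellStress (g F : E4 → Matrix (Fin 4) (Fin 4) ℝ) (i j : Fin 4) (p : E4) : ℝ :=
  2 * (∑ k, ∑ l, (g p)⁻¹ k l * F p i k * F p j l
    - (1 / 4) * (∑ k, ∑ l, F p k l * raised g F k l p) * g p i j)

/-- The metric `g` and the Maxwell two-form `F` solve the four-dimensional Einstein–Maxwell
equations with cosmological constant `Λ` on the open set `U`:
`Rᵢⱼ = Λ gᵢⱼ + Tᵢⱼ - ½ (tr T) gᵢⱼ`, `dF = 0` and `d ⋆ F = 0`, the last one in the divergence form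
`∂ᵢ (√|det g| Fⁱʲ) = 0`. -/
structure SolvesEinsteinMaxwell (Λ : ℝ) (g F : E4 → Matrix (Fin 4) (Fin 4) ℝ) (U : Set E4) :
    Prop where
  smooth_metric : ∀ i j, ContDiffOn ℝ ∞ (fun p => g p i j) U
  smooth_field : ∀ i j, ContDiffOn ℝ ∞ (fun p => F p i j) U
  symm : ∀ p ∈ U, ∀ i j, g p i j = g p j i
  nondegenerate : ∀ p ∈ U, (g p).det ≠ 0
  antisymm : ∀ p ∈ U, ∀ i j, F p i j = - F p j i
  einstein : ∀ p ∈ U, ∀ i j, ricci g i j p = Λ * g p i j + maxwellStress g F i j p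
    - (1 / 2) * (∑ k, ∑ l, (g p)⁻¹ k l * maxwellStress g F k l p) * g p i j
  bianchi : ∀ p ∈ U, ∀ i j k,
    pd i (fun q => F q j k) p + pd j (fun q => F q k i) p + pd k (fun q => F q i j) p = 0
  maxwell : ∀ p ∈ U, ∀ j, ∑ i, pd i (fun q => √|(g q).det| * raised g F i j q) p = 0

/-- The symmetric square `w ⊗ w` of the covector with components `w`. -/
def cosq {K : Type*} [Mul K] (w : Fin 4 → K) : Matrix (Fin 4) (Fin 4) K := Matrix.vecMulVec w w

/-- Components of the pull-back of a metric along a map between coordinate spaces (holomorphic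
pull-back for `𝕜 = ℂ`). -/
def coordPullback (𝕜 : Type*) [RCLike 𝕜]
    (Ψ : EuclideanSpace 𝕜 (Fin 4) → EuclideanSpace 𝕜 (Fin 4))
    (g : EuclideanSpace 𝕜 (Fin 4) → Matrix (Fin 4) (Fin 4) 𝕜)
    (p : EuclideanSpace 𝕜 (Fin 4)) : Matrix (Fin 4) (Fin 4) 𝕜 :=
  Matrix.of fun i j => ∑ a, ∑ b,
    g (Ψ p) a b * fderiv 𝕜 Ψ p (coordVec 𝕜 i) a * fderiv 𝕜 Ψ p (coordVec 𝕜 j) b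

/-! ### The Kerr–Newman–`Λ` black hole and its near-horizon geometry -/

/-- The radial function `Δᵣ` of the Kerr–Newman–`Λ` metric; `q² = e² + b²` is the sum of the
squares of the electric and magnetic charge parameters. -/
def knDelta (Λ a M q r : ℝ) : ℝ :=
  (r ^ 2 + a ^ 2) * (1 - Λ * r ^ 2 / 3) - 2 * M * r + q ^ 2

/-- The constant `Ξ = 1 + Λ a² / 3`. -/
def knXi (Λ a : ℝ) : ℝ := 1 + Λ * a ^ 2 / 3

/-- The Kerr–Newman–`Λ` metric in Boyer–Lindquist coordinates `(t, r, θ, φ)`. -/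
def knMetric (Λ a M q : ℝ) (p : E4) : Matrix (Fin 4) (Fin 4) ℝ :=
  (-knDelta Λ a M q (p 1) / (p 1 ^ 2 + a ^ 2 * cos (p 2) ^ 2)) •
      cosq ![1, 0, 0, -(a * sin (p 2) ^ 2 / knXi Λ a)]
    + ((p 1 ^ 2 + a ^ 2 * cos (p 2) ^ 2) / knDelta Λ a M q (p 1)) • cosq ![0, 1, 0, 0]
    + ((p 1 ^ 2 + a ^ 2 * cos (p 2) ^ 2) / (1 + Λ * a ^ 2 * cos (p 2) ^ 2 / 3)) •
      cosq ![0, 0, 1, 0]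
    + ((1 + Λ * a ^ 2 * cos (p 2) ^ 2 / 3) * sin (p 2) ^ 2 /
        (p 1 ^ 2 + a ^ 2 * cos (p 2) ^ 2)) •
      cosq ![a, 0, 0, -((p 1 ^ 2 + a ^ 2) / knXi Λ a)]

/-- Half the second derivative of `Δᵣ` at a double root `r₀`. -/
def knC (Λ a r₀ : ℝ) : ℝ := 1 - Λ * a ^ 2 / 3 - 2 * Λ * r₀ ^ 2

/-- The Poincaré radial coordinate of `AdS₂` in terms of the global coordinates `(t, ρ)`. -/
def adsR (t ρ : ℝ) : ℝ := cosh ρ * cos t + sinh ρ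

/-- The near-horizon scaling with parameter `ε` about a degenerate horizon `r = r₀`, in coordinates
`(t, ρ, x, φ)` with `(t, ρ)` global on `AdS₂`. With `R = adsR t ρ`, `τ = cosh ρ sin t / R`, and
`R dτ = sinh ρ dt + dγ`, it is: Boyer–Lindquist time `(r₀² + a²) τ / (C ε)`, radius `r₀ + ε R`,
`a cos θ = s x` (`s` is a free scale of the coordinate `x`), and azimuth corotating with the
horizon. -/
def nearHorizonMap (Λ a r₀ s ε : ℝ) (p : E4) : E4 :=
  let R := adsR (p 0) (p 1)
  let τ := cosh (p 1) * sin (p 0) / R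
  let γ := log ((exp (p 1) + tan (p 0 / 2)) / (exp (p 1) - tan (p 0 / 2)))
  let T := (r₀ ^ 2 + a ^ 2) * τ / (knC Λ a r₀ * ε)
  !₂[T, r₀ + ε * R, arccos (s * p 2 / a),
    a * knXi Λ a / (r₀ ^ 2 + a ^ 2) * (p 3 / s - 2 * r₀ / knC Λ a r₀ * γ + T)]

/-- `Γ(x) = k² / β + β x² / 4`. -/
def nhGamma (k β x : ℂ) : ℂ := k ^ 2 / β + β * x ^ 2 / 4

/-- The quartic `P(x)` of the near-horizon geometry of extremal Kerr–Newman–`Λ`, where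
`A₀ = -1 / L`, `L = ℓ²`, and `Q` is the contribution of the charges. -/
def nhP (Λ L k β Q x : ℂ) : ℂ :=
  -(β * Λ * x ^ 4 / 12) + (-1 / L - 2 * Λ * k ^ 2 / β) * x ^ 2
    - 4 * k ^ 2 / β ^ 2 * (-1 / L - Λ * k ^ 2 / β) - Q

/-- The near-horizon geometry of extremal Kerr–Newman–`Λ` in global `AdS₂` coordinates
`(t, ρ, x, φ)`,
`ℓ² Γ (-cosh² ρ dt² + dρ²) + (Γ / P) dx² + (P / Γ) (dφ + ℓ² k sinh ρ dt)²`, with `L = ℓ²`.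
The components are analytic in the parameters and coordinates and are written for complex values
of both; real values give the Lorentzian metric. -/
def nhMetric (Λ L k β Q : ℂ) (p : EuclideanSpace ℂ (Fin 4)) : Matrix (Fin 4) (Fin 4) ℂ :=
  (-(L * nhGamma k β (p 2) * Complex.cosh (p 1) ^ 2)) • cosq ![1, 0, 0, 0]
    + (L * nhGamma k β (p 2)) • cosq ![0, 1, 0, 0]
    + (nhGamma k β (p 2) / nhP Λ L k β Q (p 2)) • cosq ![0, 0, 1, 0]
    + (nhP Λ L k β Q (p 2) / nhGamma k β (p 2)) • cosq ![L * k * Complex.sinh (p 1), 0, 0, 1]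

/-- A real point regarded as a complex one. -/
def toComplexPoint (p : E4) : EuclideanSpace ℂ (Fin 4) := WithLp.toLp 2 fun i => (p i : ℂ)

/-- The complex change of coordinates `(x, ψ, θ, φ) ↦ (t, ρ, x, φ)` with `t = φ`,
`ρ = i (θ - π / 2)` and azimuth `2 α² ψ`. -/
def continuationMap (α : ℝ) (p : EuclideanSpace ℂ (Fin 4)) : EuclideanSpace ℂ (Fin 4) :=
  !₂[p 3, Complex.I * (p 2 - (π : ℂ) / 2), p 0, 2 * (α : ℂ) ^ 2 * p 1]

/-! ### The Riemannian metrics -/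

/-- `P(x) = 1 + x² + c - (1 + 2 x² - x⁴ / 3) α² Λ`. -/
def pageP (α Λ c x : ℝ) : ℝ := 1 + x ^ 2 + c - (1 + 2 * x ^ 2 - x ^ 4 / 3) * (α ^ 2 * Λ)

/-- The metric
`α² (1 - x²) dx² / P + 4 α² P / (1 - x²) (dψ + cos θ dφ)² + α² (1 - x²) (dθ² + sin² θ dφ²)`
in the coordinates `(x, ψ, θ, φ)`. -/
def pageMetric (α Λ c : ℝ) (p : E4) : Matrix (Fin 4) (Fin 4) ℝ :=
  (α ^ 2 * (1 - p 0 ^ 2) / pageP α Λ c (p 0)) • cosq ![1, 0, 0, 0]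
    + (4 * α ^ 2 * pageP α Λ c (p 0) / (1 - p 0 ^ 2)) • cosq ![0, 1, 0, cos (p 2)]
    + (α ^ 2 * (1 - p 0 ^ 2)) • (cosq ![0, 0, 1, 0] + sin (p 2) ^ 2 • cosq ![0, 0, 0, 1])

/-- The points `(x, ψ, θ, φ)` with `|x| < 1`, `P(x) > 0` and `0 < θ < π`. -/
def pageDomain (α Λ c : ℝ) : Set E4 :=
  {p | |p 0| < 1 ∧ 0 < pageP α Λ c (p 0) ∧ 0 < p 2 ∧ p 2 < π}

/-- The points `(x, ψ, θ, φ)` with `-x₁ < x < x₁` and `0 < θ < π`. -/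
def coordBox (x₁ : ℝ) : Set E4 := {p | -x₁ < p 0 ∧ p 0 < x₁ ∧ 0 < p 2 ∧ p 2 < π}

/-- The right-hand side of the integrality condition. -/
def regularityValue (c x₁ : ℝ) : ℝ :=
  4 * x₁ * (3 + x₁ ^ 2) / (3 + 6 * x₁ ^ 2 - x₁ ^ 4)
    + 8 * c * (3 - x₁ ^ 2) * x₁ / ((1 - x₁ ^ 2) * (3 + 6 * x₁ ^ 2 - x₁ ^ 4))

/-- `±x₁` are adjacent roots of `P` with `0 < x₁ < 1`, between which `P` is positive. -/
structure IsAdmissible (α Λ c x₁ : ℝ) : Prop where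
  scale_pos : 0 < α
  pos : 0 < x₁
  lt_one : x₁ < 1
  root : pageP α Λ c x₁ = 0
  positive : ∀ x, -x₁ < x → x < x₁ → 0 < pageP α Λ c x

/-- Admissible parameters which satisfy the integrality condition with the positive integer `m`. -/
structure IsRegularSolution (α Λ c x₁ : ℝ) (m : ℕ) : Prop extends IsAdmissible α Λ c x₁ where
  one_le : 1 ≤ m
  integrality : (m : ℝ) = regularityValue c x₁

/-- Proper length of the circle of constant `x`, `θ`, `φ` when `ψ` has period `4π/m`. -/
def fibreCircumference (α Λ c : ℝ) (m : ℕ) (x : ℝ) : ℝ :=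
  4 * π / m * √(4 * α ^ 2 * pageP α Λ c x / (1 - x ^ 2))

/-- Proper length of the segment from `x = u` to `x = v` at constant `ψ`, `θ`, `φ`. -/
def fibreLength (α Λ c u v : ℝ) : ℝ :=
  ∫ x in u..v, √(α ^ 2 * (1 - x ^ 2) / pageP α Λ c x)

/-- With `ψ` of period `4π/m`, the `(x, ψ)` part of the metric has cone angle `2π` at `x = ±x₁`:
the ratio of the circumference of small circles to their proper radius tends to `2π`. -/
def HasNoConicalSingularity (α Λ c x₁ : ℝ) (m : ℕ) : Prop :=
  Tendsto (fun x => fibreCircumference α Λ c m x / fibreLength α Λ c x x₁) (𝓝[<] x₁)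
    (𝓝 (2 * π)) ∧
  Tendsto (fun x => fibreCircumference α Λ c m x / fibreLength α Λ c (-x₁) x) (𝓝[>] (-x₁))
    (𝓝 (2 * π))

/-! ### Sphere bundles over the sphere -/

/-- The two-sphere. -/
abbrev S2 : Type := Metric.sphere (0 : EuclideanSpace ℝ (Fin 3)) 1

section Manifold

variable {M : Type} [TopologicalSpace M] [ChartedSpace E4 M]

/-- A smooth fibre bundle over `S²` with fibre `S²`: smoothly locally trivial. -/
def IsSmoothSphereBundle (proj : M → S2) : Prop :=
  ContMDiff (𝓡 4) (𝓡 2) ∞ proj ∧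
    ∀ b : S2, ∃ e : Bundle.Trivialization S2 proj, b ∈ e.baseSet ∧
      ContMDiffOn (𝓡 4) ((𝓡 2).prod (𝓡 2)) ∞ e e.source ∧
      ContMDiffOn ((𝓡 2).prod (𝓡 2)) (𝓡 4) ∞ e.toOpenPartialHomeomorph.symm e.target

/-- The bundle is smoothly isomorphic, over the base, to the product `S² × S²`. -/
def IsTrivialSphereBundle (proj : M → S2) : Prop :=
  ∃ d : M ≃ₘ^∞⟮𝓡 4, (𝓡 2).prod (𝓡 2)⟯ (S2 × S2), ∀ p, (d p).1 = proj p

/-- A (not necessarily symmetric) bilinear form on each tangent space of `M`. -/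
abbrev BilinField (M : Type) [TopologicalSpace M] [ChartedSpace E4 M] : Type :=
  (p : M) → TangentSpace (𝓡 4) p →L[ℝ] TangentSpace (𝓡 4) p →L[ℝ] ℝ

/-- Components of the pull-back of a field of bilinear forms along a parametrization
`Φ : ℝ⁴ → M`. -/
def pullbackForm (Φ : E4 → M) (b : BilinField M) (y : E4) : Matrix (Fin 4) (Fin 4) ℝ :=
  Matrix.of fun i j => b (Φ y) (mfderiv (𝓡 4) (𝓡 4) Φ y (coordVec ℝ i))
    (mfderiv (𝓡 4) (𝓡 4) Φ y (coordVec ℝ j))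

/-- The Riemannian metric `g` and the two-form `F` on `M` solve the Einstein–Maxwell equations,
in every chart of the atlas. -/
def SolvesEinsteinMaxwellOn [IsManifold (𝓡 4) ∞ M] (Λ : ℝ)
    (g : Bundle.ContMDiffRiemannianMetric (𝓡 4) ∞ E4 (fun p : M => TangentSpace (𝓡 4) p))
    (F : BilinField M) : Prop :=
  ∀ e ∈ atlas E4 M, SolvesEinsteinMaxwell Λ (pullbackForm e.symm g.inner)
    (pullbackForm e.symm F) e.target

/-- `M`, with the projection `proj` and the Riemannian metric `g`, is a smooth `S²`-bundle over
`S²` to which the metric `pageMetric α Λ c` on `-x₁ < x < x₁` extends, with `ψ` of period `4π/m`.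
Here `Φ` is the coordinate parametrization of a dense open set: it identifies exactly the points
which differ by the Euler-angle lattice of `(ψ, φ)` generated by `(4π/m, 0)` and `(2π, 2π)`, and
`(θ, φ)` are spherical coordinates of the base. -/
structure IsSphereBundleExtension [IsManifold (𝓡 4) ∞ M] (α Λ c x₁ : ℝ) (m : ℕ)
    (proj : M → S2)
    (g : Bundle.ContMDiffRiemannianMetric (𝓡 4) ∞ E4 (fun p : M => TangentSpace (𝓡 4) p))
    (Φ : E4 → M) : Prop where
  bundle : IsSmoothSphereBundle proj
  smooth : ContMDiffOn (𝓡 4) (𝓡 4) ∞ Φ (coordBox x₁)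
  isometry : ∀ y ∈ coordBox x₁, pullbackForm Φ g.inner y = pageMetric α Λ c y
  identify : ∀ y ∈ coordBox x₁, ∀ z ∈ coordBox x₁, Φ y = Φ z ↔
    z 0 = y 0 ∧ z 2 = y 2 ∧ ∃ k l : ℤ,
      z 1 = y 1 + 4 * π / m * k + 2 * π * l ∧ z 3 = y 3 + 2 * π * l
  base : ∀ y ∈ coordBox x₁, (proj (Φ y) : EuclideanSpace ℝ (Fin 3)) =
    !₂[sin (y 2) * cos (y 3), sin (y 2) * sin (y 3), cos (y 2)]
  dense : Dense (Φ '' coordBox x₁)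

end Manifold

/-! ### The complex projective plane and connected sums -/

/-- The complex projective plane. -/
def CP2 : Type := ℙ ℂ (Fin 3 → ℂ)

namespace CP2

/-- `ℂ²` with its Euclidean norm. -/
abbrev C2 : Type := EuclideanSpace ℂ (Fin 2)

/-- Nonzero vectors of `ℂ³`. -/
abbrev Vec : Type := {v : Fin 3 → ℂ // v ≠ 0}

/-- The point with given homogeneous coordinates. -/
def mk (v : Vec) : CP2 := Projectivization.mk' ℂ v

theorem continuous_entry (k : Fin 3) : Continuous fun v : Vec => v.1 k :=
  (continuous_apply k).comp continuous_subtype_val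

/-- The quotient topology. -/
instance : TopologicalSpace CP2 := TopologicalSpace.coinduced mk inferInstance

theorem isQuotientMap_mk : IsQuotientMap mk :=
  ⟨⟨rfl⟩, fun p => by
    obtain ⟨v, hv⟩ := Quotient.exists_rep (s := projectivizationSetoid ℂ (Fin 3 → ℂ)) p
    exact ⟨v, hv⟩⟩

theorem mk_eq_iff (v w : Vec) : mk v = mk w ↔ ∃ a : ℂ, a • (w : Fin 3 → ℂ) = v :=
  Projectivization.mk_eq_mk_iff' ℂ v.1 w.1 v.2 w.2

/-- The affine coordinates `v ↦ (v_j / v_i)_{j ≠ i}`. -/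
def coord (i : Fin 3) (p : CP2) : C2 :=
  Projectivization.lift (fun v : Vec => (WithLp.toLp 2 fun j => v.1 (i.succAbove j) / v.1 i : C2))
    (by
      rintro ⟨v, hv⟩ ⟨w, hw⟩ t (h : v = t • w)
      have ht : t ≠ 0 := by
        rintro rfl
        exact hv (by simpa using h)
      ext j
      simp only [h, Pi.smul_apply, smul_eq_mul]
      rw [mul_div_mul_left _ _ ht]) p

theorem coord_mk (i : Fin 3) (v : Vec) :
    coord i (mk v) = WithLp.toLp 2 fun j => v.1 (i.succAbove j) / v.1 i := rfl

/-- The vector with `i`-th entry `1` and the other entries given by `w`. -/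
def homog (i : Fin 3) (w : C2) : Vec :=
  ⟨i.insertNth (α := fun _ => ℂ) 1 (fun j => w j), fun h => by
    have := congrFun h i
    simp at this⟩

/-- The affine parametrization, for `i = 0` the map `w ↦ [1 : w₀ : w₁]`. -/
def affine (i : Fin 3) (w : C2) : CP2 := mk (homog i w)

/-- The set of points whose `i`-th homogeneous coordinate does not vanish. -/
def dom (i : Fin 3) : Set CP2 := {p | ∃ v : Vec, mk v = p ∧ v.1 i ≠ 0}

theorem mk_mem_dom (i : Fin 3) (v : Vec) : mk v ∈ dom i ↔ v.1 i ≠ 0 := by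
  refine ⟨?_, fun h => ⟨v, rfl, h⟩⟩
  rintro ⟨w, hw, hi⟩ h0
  obtain ⟨a, ha⟩ := (mk_eq_iff w v).1 hw
  apply hi
  rw [← ha]
  simp [h0]

theorem isOpen_dom (i : Fin 3) : IsOpen (dom i) := by
  rw [← isQuotientMap_mk.isOpen_preimage]
  have : mk ⁻¹' dom i = {v : Vec | v.1 i ≠ 0} := by
    ext v
    exact mk_mem_dom i v
  rw [this]
  exact isOpen_ne.preimage (continuous_entry i)

theorem continuous_homog (i : Fin 3) : Continuous (homog i) := by
  refine Continuous.subtype_mk ?_ _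
  refine continuous_pi fun k => ?_
  rcases Fin.eq_self_or_eq_succAbove i k with rfl | ⟨j, rfl⟩
  · simpa using continuous_const
  · simpa using (by fun_prop : Continuous fun w : C2 => w j)

/-- The affine chart on the complement of the `i`-th coordinate line. -/
def affineChart (i : Fin 3) : OpenPartialHomeomorph CP2 C2 where
  toFun := coord i
  invFun := affine i
  source := dom i
  target := univ
  map_source' _ _ := mem_univ _
  map_target' w _ := (mk_mem_dom i _).2 (by simp [homog])
  left_inv' p := by
    rintro ⟨v, rfl, hv⟩
    refine (mk_eq_iff _ _).2 ⟨(v.1 i)⁻¹, ?_⟩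
    funext k
    rcases Fin.eq_self_or_eq_succAbove i k with rfl | ⟨j, rfl⟩
    · simp [homog, hv]
    · simp [homog, coord_mk, div_eq_inv_mul]
  right_inv' w _ := by
    ext j
    simp [affine, coord_mk, homog]
  open_source := isOpen_dom i
  open_target := isOpen_univ
  continuousOn_toFun := by
    rw [isQuotientMap_mk.continuousOn_isOpen_iff (isOpen_dom i)]
    refine (PiLp.continuous_toLp 2 _).comp_continuousOn (continuousOn_pi.2 fun j => ?_)
    refine ContinuousOn.div (continuous_entry _).continuousOn (continuous_entry i).continuousOn fun v hv => (mk_mem_dom i v).1 hv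
  continuousOn_invFun :=
    (isQuotientMap_mk.continuous.comp (continuous_homog i)).continuousOn

/-- The standard atlas of three affine charts. -/
instance : ChartedSpace C2 CP2 where
  atlas := range affineChart
  chartAt p := affineChart (Classical.epsilon fun i => p ∈ dom i)
  mem_chart_source p := by
    refine Classical.epsilon_spec (p := fun i => p ∈ dom i) ?_
    obtain ⟨v, rfl⟩ := isQuotientMap_mk.surjective p
    obtain ⟨i, hi⟩ := Function.ne_iff.1 v.2
    exact ⟨i, (mk_mem_dom i v).2 hi⟩
  chart_mem_atlas _ := mem_range_self _

theorem contDiff_homog (i k : Fin 3) : ContDiff ℝ ∞ fun w : C2 => (homog i w).1 k := by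
  rcases Fin.eq_self_or_eq_succAbove i k with rfl | ⟨j, rfl⟩
  · simpa [homog] using contDiff_const
  · simpa [homog] using (by fun_prop : ContDiff ℝ ∞ fun w : C2 => w j)

/-- The complex projective plane is a smooth real four-manifold. -/
instance : IsManifold 𝓘(ℝ, C2) ∞ CP2 := by
  refine isManifold_of_contDiffOn _ _ _ ?_
  rintro _ _ ⟨i, rfl⟩ ⟨j, rfl⟩
  simp only [modelWithCornersSelf_coe, modelWithCornersSelf_coe_symm, Function.comp_id,
    Function.id_comp, range_id, inter_univ, preimage_id_eq, id_eq]
  refine contDiffOn_piLp 2 |>.2 fun k => ?_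
  have key : ∀ w : C2, coord j (affine i w) k
      = (homog i w).1 (j.succAbove k) / (homog i w).1 j := fun w => rfl
  have inv : ContDiffOn ℝ ∞ (fun w : C2 => ((homog i w).1 j)⁻¹)
      ((affineChart i).symm.trans (affineChart j)).source := by
    refine ContDiffOn.inv (contDiff_homog i j).contDiffOn ?_
    intro w hw
    have hw' : affine i w ∈ dom j := hw.2
    exact (mk_mem_dom j _).1 hw'
  refine ((contDiff_homog i (j.succAbove k)).contDiffOn.mul inv).congr fun w _ => ?_
  exact (key w).trans (div_eq_mul_inv _ _)

end CP2

/-- `M` is the connected sum of `A` and `B` formed along the smoothly embedded discs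
`h₁ : V → A` and `h₂ : V → B`: it is the union of open copies of `A \ {h₁ 0}` and `B \ {h₂ 0}`,
which overlap exactly in the punctured discs, `h₁ v` being identified with `h₂ (v / ‖v‖²)`. -/
def IsConnectedSum {V A B M HA HB HM EA EB EM : Type*}
    [NormedAddCommGroup V] [NormedSpace ℝ V]
    [NormedAddCommGroup EA] [NormedSpace ℝ EA] [TopologicalSpace HA]
    [NormedAddCommGroup EB] [NormedSpace ℝ EB] [TopologicalSpace HB]
    [NormedAddCommGroup EM] [NormedSpace ℝ EM] [TopologicalSpace HM]
    (IA : ModelWithCorners ℝ EA HA) (IB : ModelWithCorners ℝ EB HB)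
    (IM : ModelWithCorners ℝ EM HM)
    [TopologicalSpace A] [ChartedSpace HA A] [TopologicalSpace B] [ChartedSpace HB B]
    [TopologicalSpace M] [ChartedSpace HM M] (h₁ : V → A) (h₂ : V → B) : Prop :=
  ∃ (i : OpenPartialHomeomorph A M) (j : OpenPartialHomeomorph B M),
    i.source = {h₁ 0}ᶜ ∧ j.source = {h₂ 0}ᶜ ∧
    ContMDiffOn IA IM ∞ i i.source ∧ ContMDiffOn IM IA ∞ i.symm i.target ∧
    ContMDiffOn IB IM ∞ j j.source ∧ ContMDiffOn IM IB ∞ j.symm j.target ∧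
    i.target ∪ j.target = univ ∧
    i.target ∩ j.target = (fun v => i (h₁ v)) '' {0}ᶜ ∧
    ∀ v : V, v ≠ 0 → i (h₁ v) = j (h₂ ((‖v‖ ^ 2)⁻¹ • v))

/-- `M` is diffeomorphic to the connected sum of the complex projective plane and the complex
projective plane with the opposite orientation. The map `v ↦ v / ‖v‖²` reverses orientation, so
the gluing recipe for oriented manifolds asks for a disc that preserves the orientation of the
first summand and a disc that reverses the orientation of the second one; the affine disc
`w ↦ [1 : w]` is holomorphic, so it does the first for the complex orientation and the second for
its opposite. -/
def IsCP2SumCP2bar (M : Type) [TopologicalSpace M] [ChartedSpace E4 M] : Prop :=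
  IsConnectedSum 𝓘(ℝ, CP2.C2) 𝓘(ℝ, CP2.C2) (𝓡 4) (M := M) (CP2.affine 0) (CP2.affine 0)

end

/-! The near-horizon limit is a cancellation of powers of ε. At a double root Δ_r(r₀ + εR) = ε²R²(C
+ O(ε)), while the covector multiplied by Δ_r pulls back to 1/ε times a regular one. In the other
rotating covector the 1/ε terms cancel, because the azimuth corotates with the horizon. The
pull-back therefore extends continuously to ε = 0, where it is evaluated
(`tendsto_coordPullback_nearHorizonMap`); `adsMetric_eq` turns the Poincaré form of AdS₂ into the
global one. The analytic continuation is then a substitution.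

The continued metrics have the form A dx² + B (dψ + cos θ dφ)² + C (dθ² + sin²θ dφ²) with AB
constant. Their Ricci tensor is Λg plus a traceless part, which is ±c/(α²(1 - x²)²) times the
metric, with + on the (x, ψ) directions and - on the sphere (`ricci_pageMetric`). The potential
h(x)(dψ + cos θ dφ) with h = a(1+x)/(1-x) + b(1-x)/(1+x) is a sum of two parts of opposite duality:
its Hodge dual is the field with -a in place of a, and its stress depends on ab only. The choice ab
= -cα²/4 solves the Einstein equation, and both Maxwell equations become instances of d² = 0.

Write P = (x₁² - x²) N(x). The integrality condition is m(1 - x₁²) = 4x₁N(x₁), which is also the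
cone-angle condition read off from the first-order behaviour of P at x₁. As a function of x₁ alone
its right-hand side is f₁ + c f₂ with f₁, f₂ increasing, f₁ < 2 and f₂ unbounded; the root equation
then determines α. This gives existence and uniqueness for c > 0 and m = 1 for c < 0. For c = -9/64
and m = 1 the equation splits into 2x - 1 and a monotone quintic.

The manifold is the quotient of S³ × S² by the circle action (λz₀, λz₁, λᵐζ, t), realised as the
image of its invariants in a vector space and covered by four charts ℂ². In w = tan(θ/2) e^{iφ} and
z = √((x₁-x)/(x₁+x)) e^{im(ψ+φ)/2} the metric is smooth across z = 0 precisely because of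
integrality (`IsRegularSolution.fibreCoeff_add`). The field equations are carried to these
coordinates on a dense set by covariance (`ricci_pullback`, `IsElectrovacAt.of_pullback`) and extend
by continuity. The flips exchanging the poles of base and fibre preserve the metric and permute a
and b in the field, so that one local formula serves all four charts.

Rotating the fibres by the quaternion with entries z₁ᵏ and z₀^{k+e} identifies degree 2k + e with
degree e (`Hirz.twist`). Degree 0 is a product. Degree 1 is ℂP² blown up at a point: the complements
of its sections t = -1 and t = 1 are two copies of ℂP² minus a point, glued by inversion. -/

noncomputable section

/-! ### Gradients and Jacobians in coordinates -/

/-- The linear form with coefficients `v`. -/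
def linForm {𝕜 : Type*} [RCLike 𝕜] (v : Fin 4 → 𝕜) : EuclideanSpace 𝕜 (Fin 4) →L[𝕜] 𝕜 :=
  ∑ i, v i • (EuclideanSpace.proj i : EuclideanSpace 𝕜 (Fin 4) →L[𝕜] 𝕜)

/-- `f` is differentiable at `p` with partial derivatives `v`. -/
def HasGrad {𝕜 : Type*} [RCLike 𝕜] (f : EuclideanSpace 𝕜 (Fin 4) → 𝕜) (v : Fin 4 → 𝕜)
    (p : EuclideanSpace 𝕜 (Fin 4)) : Prop :=
  HasFDerivAt f (linForm v) p

section HasGrad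

variable {𝕜 : Type*} [RCLike 𝕜] {f g : EuclideanSpace 𝕜 (Fin 4) → 𝕜} {v w : Fin 4 → 𝕜}
  {p : EuclideanSpace 𝕜 (Fin 4)}

theorem linForm_apply (v : Fin 4 → 𝕜) (x : EuclideanSpace 𝕜 (Fin 4)) :
    linForm v x = ∑ i, v i * x i := by
  simp [linForm]

theorem linForm_coordVec (v : Fin 4 → 𝕜) (i : Fin 4) : linForm v (coordVec 𝕜 i) = v i := by
  simp [linForm_apply, coordVec]

theorem HasGrad.fderiv_apply (h : HasGrad f v p) (i : Fin 4) :
    fderiv 𝕜 f p (coordVec 𝕜 i) = v i := by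
  rw [HasFDerivAt.fderiv h, linForm_coordVec]

theorem eq_sum_coordVec (u : EuclideanSpace 𝕜 (Fin 4)) : u = ∑ b, u b • coordVec 𝕜 b := by
  ext j
  simp [coordVec, Pi.single_apply]

theorem HasGrad.congr (h : HasGrad f v p) (e : v = w) : HasGrad f w p := e ▸ h

/-- A derivative is recognised by its values on vectors, so each calculus rule below only has to
match finite sums with an explicit gradient vector. -/
theorem HasFDerivAt.hasGrad {L : EuclideanSpace 𝕜 (Fin 4) →L[𝕜] 𝕜} (h : HasFDerivAt f L p)
    (e : ∀ x, L x = ∑ i, v i * x i) : HasGrad f v p := by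
  have : L = linForm v := by
    ext x
    rw [e, linForm_apply]
  unfold HasGrad
  rw [← this]
  exact h

theorem hasGrad_const (c : 𝕜) : HasGrad (fun _ => c) 0 p :=
  (hasFDerivAt_const c p).hasGrad fun x => by simp

theorem hasGrad_coord (i : Fin 4) : HasGrad (fun q => q i) (Pi.single i 1) p :=
  ((EuclideanSpace.proj i : EuclideanSpace 𝕜 (Fin 4) →L[𝕜] 𝕜).hasFDerivAt (x := p)).hasGrad
    fun x => by simp [Pi.single_apply]

theorem HasGrad.add (hf : HasGrad f v p) (hg : HasGrad g w p) :
    HasGrad (fun q => f q + g q) (v + w) p :=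
  (HasFDerivAt.fun_add hf hg).hasGrad fun x => by
    simp [linForm_apply, add_mul, Finset.sum_add_distrib]

theorem HasGrad.sub (hf : HasGrad f v p) (hg : HasGrad g w p) :
    HasGrad (fun q => f q - g q) (v - w) p :=
  (HasFDerivAt.fun_sub hf hg).hasGrad fun x => by
    simp [linForm_apply, sub_mul, Finset.sum_sub_distrib]

theorem HasGrad.mul (hf : HasGrad f v p) (hg : HasGrad g w p) :
    HasGrad (fun q => f q * g q) (f p • w + g p • v) p :=
  (HasFDerivAt.fun_mul hf hg).hasGrad fun x => by
    simp [linForm_apply, add_mul, Finset.sum_add_distrib, Finset.mul_sum, mul_assoc]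

theorem HasGrad.comp {h : 𝕜 → 𝕜} {h' : 𝕜} (hf : HasGrad f v p) (hh : HasDerivAt h h' (f p)) :
    HasGrad (fun q => h (f q)) (h' • v) p :=
  (hh.comp_hasFDerivAt p hf).hasGrad fun x => by
    simp [linForm_apply, Finset.mul_sum, mul_assoc]

theorem HasGrad.neg (hf : HasGrad f v p) : HasGrad (fun q => -f q) (-v) p :=
  (hf.comp (hasDerivAt_neg (f p))).congr (by simp)

theorem HasGrad.const_mul (c : 𝕜) (hf : HasGrad f v p) : HasGrad (fun q => c * f q) (c • v) p :=
  ((hasGrad_const (p := p) c).mul hf).congr (by simp)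

theorem HasGrad.inv (hf : HasGrad f v p) (h0 : f p ≠ 0) :
    HasGrad (fun q => (f q)⁻¹) (-(f p ^ 2)⁻¹ • v) p :=
  hf.comp (hasDerivAt_inv h0)

theorem HasGrad.div (hf : HasGrad f v p) (hg : HasGrad g w p) (h0 : g p ≠ 0) :
    HasGrad (fun q => f q / g q) ((g p)⁻¹ • v - (f p / g p ^ 2) • w) p := by
  have := hf.mul (hg.inv h0)
  simp only [div_eq_mul_inv]
  convert this using 1
  ext i
  simp [Pi.add_apply]
  ring

theorem HasGrad.congr_of_eventuallyEq (hf : HasGrad f v p) (h : g =ᶠ[𝓝 p] f) : HasGrad g v p :=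
  HasFDerivAt.congr_of_eventuallyEq hf h

theorem DifferentiableAt.hasGrad (hf : DifferentiableAt 𝕜 f p) :
    HasGrad f (fun i => fderiv 𝕜 f p (coordVec 𝕜 i)) p :=
  HasFDerivAt.hasGrad hf.hasFDerivAt fun x => by
    conv_lhs => rw [eq_sum_coordVec x]
    simp [mul_comm]

/-- The Jacobian matrix `∂ᵢ Ψᵃ`. -/
def jacobian (𝕜 : Type*) [RCLike 𝕜]
    (Ψ : EuclideanSpace 𝕜 (Fin 4) → EuclideanSpace 𝕜 (Fin 4)) (p : EuclideanSpace 𝕜 (Fin 4)) :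
    Matrix (Fin 4) (Fin 4) 𝕜 :=
  Matrix.of fun a i => fderiv 𝕜 Ψ p (coordVec 𝕜 i) a

variable {Ψ : EuclideanSpace 𝕜 (Fin 4) → EuclideanSpace 𝕜 (Fin 4)}

theorem differentiableAt_of_hasGrad {J : Matrix (Fin 4) (Fin 4) 𝕜}
    (h : ∀ a, HasGrad (fun q => Ψ q a) (J a) p) : DifferentiableAt 𝕜 Ψ p :=
  differentiableAt_euclidean.2 fun a => (h a).differentiableAt

theorem fderiv_coord (h : DifferentiableAt 𝕜 Ψ p) (a : Fin 4) (v : EuclideanSpace 𝕜 (Fin 4)) :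
    fderiv 𝕜 (fun q => Ψ q a) p v = fderiv 𝕜 Ψ p v a := by
  have := ((EuclideanSpace.proj a : EuclideanSpace 𝕜 (Fin 4) →L[𝕜] 𝕜).hasFDerivAt
    (x := Ψ p)).comp p h.hasFDerivAt
  have e := this.fderiv
  exact congrArg (fun L => L v) e

theorem jacobian_eq_of_hasGrad {J : Matrix (Fin 4) (Fin 4) 𝕜}
    (h : ∀ a, HasGrad (fun q => Ψ q a) (J a) p) : jacobian 𝕜 Ψ p = J := by
  ext a i
  rw [← (h a).fderiv_apply i, fderiv_coord (differentiableAt_of_hasGrad h)]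
  rfl

theorem coordPullback_eq (g : EuclideanSpace 𝕜 (Fin 4) → Matrix (Fin 4) (Fin 4) 𝕜) :
    coordPullback 𝕜 Ψ g p = (jacobian 𝕜 Ψ p)ᵀ * g (Ψ p) * jacobian 𝕜 Ψ p := by
  ext i j
  simp only [coordPullback, Matrix.of_apply, Matrix.mul_apply, Matrix.transpose_apply, jacobian,
    Finset.sum_mul]
  rw [Finset.sum_comm]
  refine Finset.sum_congr rfl fun a _ => Finset.sum_congr rfl fun b _ => ?_
  ring

theorem jacobian_comp {Ξ : EuclideanSpace 𝕜 (Fin 4) → EuclideanSpace 𝕜 (Fin 4)}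
    (hΞ : DifferentiableAt 𝕜 Ξ (Ψ p)) (hΨ : DifferentiableAt 𝕜 Ψ p) :
    jacobian 𝕜 (fun q => Ξ (Ψ q)) p = jacobian 𝕜 Ξ (Ψ p) * jacobian 𝕜 Ψ p := by
  refine jacobian_eq_of_hasGrad (J := _) fun a => ?_
  have h1 := (hΞ.hasFDerivAt).comp p hΨ.hasFDerivAt
  have h2 : DifferentiableAt 𝕜 (fun q => Ξ (Ψ q)) p := h1.differentiableAt
  have h3 : DifferentiableAt 𝕜 (fun q => Ξ (Ψ q) a) p := differentiableAt_euclidean.1 h2 a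
  refine h3.hasGrad.congr ?_
  ext i
  rw [fderiv_coord h2]
  have h4 : fderiv 𝕜 (fun q => Ξ (Ψ q)) p = (fderiv 𝕜 Ξ (Ψ p)).comp (fderiv 𝕜 Ψ p) := h1.fderiv
  rw [h4, ContinuousLinearMap.comp_apply]
  conv_lhs => rw [eq_sum_coordVec (fderiv 𝕜 Ψ p (coordVec 𝕜 i))]
  simp [Matrix.mul_apply, jacobian, mul_comm]

/-- This is the reason for writing metrics as sums of squares of covectors: pull-back acts on each
square separately, by a row vector times the Jacobian. -/
theorem transpose_mul_cosq_mul (J : Matrix (Fin 4) (Fin 4) 𝕜) (w : Fin 4 → 𝕜) :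
    Jᵀ * cosq w * J = cosq (w ᵥ* J) := by
  rw [cosq, cosq, Matrix.mul_vecMulVec, Matrix.vecMulVec_mul, Matrix.mulVec_transpose]

end HasGrad

theorem HasGrad.pd {f : E4 → ℝ} {v : Fin 4 → ℝ} {p : E4} (h : HasGrad f v p) (i : Fin 4) :
    pd i f p = v i :=
  h.fderiv_apply i

theorem cosq_apply {K : Type*} [Mul K] (w : Fin 4 → K) (i j : Fin 4) :
    cosq w i j = w i * w j := rfl

theorem vecMul_four {K : Type*} [CommSemiring K] (x : Fin 4 → K) (M : Matrix (Fin 4) (Fin 4) K)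
    (j : Fin 4) : (x ᵥ* M) j = x 0 * M 0 j + x 1 * M 1 j + x 2 * M 2 j + x 3 * M 3 j := by
  simp [Matrix.vecMul, dotProduct, Fin.sum_univ_four]


/-! ### Analytic continuation of the near-horizon geometry -/

theorem jacobian_continuationMap (α : ℝ) (p : EuclideanSpace ℂ (Fin 4)) :
    jacobian ℂ (continuationMap α) p =
      !![0, 0, 0, 1; 0, 0, Complex.I, 0; 1, 0, 0, 0; 0, 2 * (α : ℂ) ^ 2, 0, 0] := by
  refine jacobian_eq_of_hasGrad fun a => ?_
  fin_cases a
  · exact (hasGrad_coord 3).congr (by ext i; fin_cases i <;> simp)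
  · exact (((hasGrad_coord 2).sub (hasGrad_const ((π : ℂ) / 2))).const_mul Complex.I).congr
      (by ext i; fin_cases i <;> simp)
  · exact (hasGrad_coord 0).congr (by ext i; fin_cases i <;> simp)
  · exact ((hasGrad_coord 1).const_mul (2 * (α : ℂ) ^ 2)).congr
      (by ext i; fin_cases i <;> simp)

theorem abs_lt_one_sq {x : ℝ} (h : |x| < 1) : 0 < 1 - x ^ 2 := by
  have := (sq_lt_one_iff_abs_lt_one x).2 h
  linarith

/-- Since k is imaginary, Γ becomes -α²(1 - x²)/ℓ² and the quartic becomes -P/ℓ². The signs cancel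
in the two quotients. In the AdS₂ part dρ² = -dθ² and cosh²ρ = sin²θ make the negative Γ a positive
sphere factor, and ℓ²k sinh ρ = (2iα²)(-i cos θ) is real. -/
theorem coordPullback_continuationMap_nhMetric (α Λ c ℓ : ℝ) (hα : 0 < α) (hℓ : 0 < ℓ) (p : E4)
    (hp : p ∈ pageDomain α Λ c) (i j : Fin 4) :
    coordPullback ℂ (continuationMap α)
      (nhMetric Λ ((ℓ : ℂ) ^ 2) (2 * Complex.I * (α : ℂ) ^ 2 / (ℓ : ℂ) ^ 2)
        (4 * (α : ℂ) ^ 2 / (ℓ : ℂ) ^ 2) ((c : ℂ) / (ℓ : ℂ) ^ 2))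
      (toComplexPoint p) i j = ((pageMetric α Λ c p i j : ℝ) : ℂ) := by
  obtain ⟨hx, hP, -, -⟩ := hp
  have hα' : (α : ℂ) ≠ 0 := by exact_mod_cast hα.ne'
  have hℓ' : (ℓ : ℂ) ≠ 0 := by exact_mod_cast hℓ.ne'
  have hx' : (1 - (p 0 : ℂ) ^ 2) ≠ 0 := by exact_mod_cast (abs_lt_one_sq hx).ne'
  have hP' : ((pageP α Λ c (p 0) : ℝ) : ℂ) ≠ 0 := by exact_mod_cast hP.ne'
  have hΓ : nhGamma (2 * Complex.I * (α : ℂ) ^ 2 / (ℓ : ℂ) ^ 2) (4 * (α : ℂ) ^ 2 / (ℓ : ℂ) ^ 2)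
      (p 0) = -((α : ℂ) ^ 2 * (1 - (p 0 : ℂ) ^ 2) / (ℓ : ℂ) ^ 2) := by
    unfold nhGamma
    field_simp
    linear_combination 4 * Complex.I_sq
  have hPP : nhP Λ ((ℓ : ℂ) ^ 2) (2 * Complex.I * (α : ℂ) ^ 2 / (ℓ : ℂ) ^ 2)
        (4 * (α : ℂ) ^ 2 / (ℓ : ℂ) ^ 2) ((c : ℂ) / (ℓ : ℂ) ^ 2) (p 0)
      = -(((pageP α Λ c (p 0) : ℝ) : ℂ) / (ℓ : ℂ) ^ 2) := by
    have e1 : (2 * Complex.I * (α : ℂ) ^ 2 / (ℓ : ℂ) ^ 2) ^ 2 = -4 * (α : ℂ) ^ 4 / (ℓ : ℂ) ^ 4 := by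
      rw [div_pow, mul_pow, mul_pow, Complex.I_sq]
      ring
    unfold nhP pageP
    rw [e1]
    push_cast
    field_simp
    ring
  have hc : Complex.cosh (Complex.I * ((p 2 : ℂ) - (π : ℂ) / 2)) = Complex.sin (p 2) := by
    rw [mul_comm, Complex.cosh_mul_I, Complex.cos_sub_pi_div_two]
  have hs : Complex.sinh (Complex.I * ((p 2 : ℂ) - (π : ℂ) / 2))
      = -Complex.cos (p 2) * Complex.I := by
    rw [mul_comm, Complex.sinh_mul_I, Complex.sin_sub_pi_div_two]
  have h1 : continuationMap α (toComplexPoint p) 1 = Complex.I * ((p 2 : ℂ) - (π : ℂ) / 2) := rfl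
  have h2 : continuationMap α (toComplexPoint p) 2 = (p 0 : ℂ) := rfl
  rw [coordPullback_eq, jacobian_continuationMap, nhMetric, h1, h2, hΓ, hPP, hc, hs]
  simp only [mul_add, add_mul, Matrix.mul_smul, Matrix.smul_mul, transpose_mul_cosq_mul]
  have k1 : (ℓ : ℂ) ^ 2 * (-((α : ℂ) ^ 2 * (1 - (p 0 : ℂ) ^ 2) / (ℓ : ℂ) ^ 2))
      = -((α : ℂ) ^ 2 * (1 - (p 0 : ℂ) ^ 2)) := by field_simp
  have k2 : (ℓ : ℂ) ^ 2 * (2 * Complex.I * (α : ℂ) ^ 2 / (ℓ : ℂ) ^ 2)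
      = 2 * Complex.I * (α : ℂ) ^ 2 := by field_simp
  have k3 : -((α : ℂ) ^ 2 * (1 - (p 0 : ℂ) ^ 2) / (ℓ : ℂ) ^ 2) /
      -(((pageP α Λ c (p 0) : ℝ) : ℂ) / (ℓ : ℂ) ^ 2)
      = (α : ℂ) ^ 2 * (1 - (p 0 : ℂ) ^ 2) / ((pageP α Λ c (p 0) : ℝ) : ℂ) := by field_simp
  have k4 : -(((pageP α Λ c (p 0) : ℝ) : ℂ) / (ℓ : ℂ) ^ 2) /
      -((α : ℂ) ^ 2 * (1 - (p 0 : ℂ) ^ 2) / (ℓ : ℂ) ^ 2)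
      = ((pageP α Λ c (p 0) : ℝ) : ℂ) / ((α : ℂ) ^ 2 * (1 - (p 0 : ℂ) ^ 2)) := by field_simp
  rw [k1, k2, k3, k4]
  have hI := Complex.I_sq
  simp only [pageMetric, Matrix.add_apply, Matrix.smul_apply, cosq_apply, vecMul_four, smul_eq_mul]
  fin_cases i <;> fin_cases j <;> simp
  · field_simp
    norm_num
  · field_simp
    linear_combination (-4 * Complex.cos (p 2)) * hI
  · field_simp
    linear_combination (-4 * Complex.cos (p 2)) * hI
  · field_simp
    linear_combination (4 * ((pageP α Λ c (p 0) : ℝ) : ℂ) * Complex.cos (p 2) ^ 2 *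
      (Complex.I ^ 2 - 1)) * hI

/-! ### The solutions of the integrality condition -/

theorem regularity_denom_pos {x : ℝ} (h0 : 0 < x) (h1 : x < 1) : 0 < 3 + 6 * x ^ 2 - x ^ 4 := by
  have : x ^ 4 ≤ 1 := pow_le_one₀ h0.le h1.le
  nlinarith [sq_nonneg x]

/-- The integrality condition as a condition on the quadratic factor of `P`. -/
theorem regularityValue_eq {α Λ c x : ℝ} (h0 : 0 < x) (h1 : x < 1) (h : pageP α Λ c x = 0) :
    regularityValue c x = 4 * x * (α ^ 2 * Λ * (2 - 2 * x ^ 2 / 3) - 1) / (1 - x ^ 2) := by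
  have hd := regularity_denom_pos h0 h1
  have hx : 0 < 1 - x ^ 2 := by nlinarith
  -- The root equation, solved for the combination of α²Λ and c in which c can be eliminated.
  have hl : α ^ 2 * Λ * (3 + 6 * x ^ 2 - x ^ 4) = 3 * (1 + x ^ 2 + c) := by
    unfold pageP at h
    linarith
  have hd' := hd.ne'
  have hx' := hx.ne'
  unfold regularityValue
  rw [div_add_div _ _ hd' (mul_ne_zero hx' hd'), div_eq_div_iff (by positivity) hx']
  linear_combination (-4 * x * (2 - 2 * x ^ 2 / 3) * (1 - x ^ 2) * (3 + 6 * x ^ 2 - x ^ 4)) * hl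

/-- P is a quadratic polynomial in x², so one root determines the other factor. That factor N
controls everything at the poles: P'(x₁) = -2x₁N(x₁), and N(x₁) = 0 means a double root. -/
theorem pageP_factor {α Λ c x₁ : ℝ} (h : pageP α Λ c x₁ = 0) (x : ℝ) :
    pageP α Λ c x = (x₁ ^ 2 - x ^ 2) * (2 * (α ^ 2 * Λ) - 1 - α ^ 2 * Λ * (x₁ ^ 2 + x ^ 2) / 3) := by
  unfold pageP at *
  linear_combination h

/-- The integrality condition reads m = 4x₁N(x₁)/(1 - x₁²), so N(x₁) has the sign of m. Positivity
of N(x₁) is what excludes double roots and forces Λ > 0. -/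
theorem IsRegularSolution.factor_pos {α Λ c x₁ : ℝ} {m : ℕ} (h : IsRegularSolution α Λ c x₁ m) :
    0 < α ^ 2 * Λ * (2 - 2 * x₁ ^ 2 / 3) - 1 := by
  have hx : 0 < 1 - x₁ ^ 2 := by nlinarith [h.pos, h.lt_one]
  have hm : (1 : ℝ) ≤ m := by exact_mod_cast h.one_le
  have e := h.integrality
  rw [regularityValue_eq h.pos h.lt_one h.root] at e
  have : 0 < 4 * x₁ * (α ^ 2 * Λ * (2 - 2 * x₁ ^ 2 / 3) - 1) / (1 - x₁ ^ 2) := by linarith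
  rw [div_pos_iff_of_pos_right hx] at this
  exact (pos_iff_pos_of_mul_pos this).1 (by linarith [h.pos])

theorem IsRegularSolution.scaled_lambda_pos {α Λ c x₁ : ℝ} {m : ℕ}
    (h : IsRegularSolution α Λ c x₁ m) : 0 < α ^ 2 * Λ := by
  have h1 := h.factor_pos
  have : 0 < 2 - 2 * x₁ ^ 2 / 3 := by nlinarith [h.pos, h.lt_one]
  by_contra hn
  nlinarith

theorem IsRegularSolution.lambda_pos {α Λ c x₁ : ℝ} {m : ℕ} (h : IsRegularSolution α Λ c x₁ m) :
    0 < Λ :=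
  (pos_iff_pos_of_mul_pos h.scaled_lambda_pos).1 (by have := h.scale_pos; positivity)

/-- Regular solutions correspond to roots of the integrality condition. -/
theorem isRegularSolution_iff {α Λ c x : ℝ} {m : ℕ} (hΛ : 0 < Λ) (hc : -1 < c) (hm : 1 ≤ m) :
    IsRegularSolution α Λ c x m ↔ 0 < x ∧ x < 1 ∧ (m : ℝ) = regularityValue c x ∧
      α = √(3 * (1 + x ^ 2 + c) / ((3 + 6 * x ^ 2 - x ^ 4) * Λ)) := by
  constructor
  · intro h
    refine ⟨h.pos, h.lt_one, h.integrality, ?_⟩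
    have hd := regularity_denom_pos h.pos h.lt_one
    have e : α ^ 2 = 3 * (1 + x ^ 2 + c) / ((3 + 6 * x ^ 2 - x ^ 4) * Λ) := by
      have := h.root
      unfold pageP at this
      rw [eq_div_iff (by positivity)]
      linarith
    rw [← e, Real.sqrt_sq h.scale_pos.le]
  · rintro ⟨h0, h1, hr, ha⟩
    have hd := regularity_denom_pos h0 h1
    have hq : 0 < 3 * (1 + x ^ 2 + c) / ((3 + 6 * x ^ 2 - x ^ 4) * Λ) :=
      div_pos (by nlinarith [sq_nonneg x]) (by positivity)
    have hα : 0 < α := ha ▸ Real.sqrt_pos.2 hq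
    have e : α ^ 2 = 3 * (1 + x ^ 2 + c) / ((3 + 6 * x ^ 2 - x ^ 4) * Λ) := by
      rw [ha, Real.sq_sqrt hq.le]
    have hroot : pageP α Λ c x = 0 := by
      have e' : α ^ 2 * Λ * (3 + 6 * x ^ 2 - x ^ 4) = 3 * (1 + x ^ 2 + c) := by
        rw [e, div_mul_eq_mul_div, div_mul_eq_mul_div, div_eq_iff (by positivity)]
        ring
      unfold pageP
      linear_combination -e' / 3
    have hx : 0 < 1 - x ^ 2 := by nlinarith
    have hm' : (1 : ℝ) ≤ m := by exact_mod_cast hm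
    have hr' := hr
    rw [regularityValue_eq h0 h1 hroot] at hr'
    have : 0 < 4 * x * (α ^ 2 * Λ * (2 - 2 * x ^ 2 / 3) - 1) / (1 - x ^ 2) := by linarith
    rw [div_pos_iff_of_pos_right hx] at this
    have hN : 0 < α ^ 2 * Λ * (2 - 2 * x ^ 2 / 3) - 1 :=
      (pos_iff_pos_of_mul_pos this).1 (by linarith)
    refine ⟨⟨hα, h0, h1, hroot, fun y hy1 hy2 => ?_⟩, hm, hr⟩
    have hy : y ^ 2 < x ^ 2 := sq_lt_sq' hy1 hy2
    rw [pageP_factor hroot]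
    have hαΛ : 0 < α ^ 2 * Λ := by positivity
    -- The quadratic factor decreases in y², so for |y| < x it exceeds its value at x, which the
    -- integrality condition makes positive.
    exact mul_pos (by linarith) (by nlinarith)

theorem hasDerivAt_regular_fst {x : ℝ} (hd : 3 + 6 * x ^ 2 - x ^ 4 ≠ 0) :
    HasDerivAt (fun x : ℝ => 4 * x * (3 + x ^ 2) / (3 + 6 * x ^ 2 - x ^ 4))
      (4 * (9 - 9 * x ^ 2 + 15 * x ^ 4 + x ^ 6) / (3 + 6 * x ^ 2 - x ^ 4) ^ 2) x := by
  have hx := hasDerivAt_id' x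
  have h1 := ((hx.const_mul 4).mul ((hx.pow 2).const_add 3))
  have h2 := (((hx.pow 2).const_mul 6).const_add 3).sub (hx.pow 4)
  refine (h1.div h2 hd).congr_deriv ?_
  simp
  field_simp
  ring

theorem hasDerivAt_regular_snd {x : ℝ} (hd : (1 - x ^ 2) * (3 + 6 * x ^ 2 - x ^ 4) ≠ 0) :
    HasDerivAt (fun x : ℝ => 8 * (3 - x ^ 2) * x / ((1 - x ^ 2) * (3 + 6 * x ^ 2 - x ^ 4)))
      (8 * (9 - 18 * x ^ 2 + 60 * x ^ 4 - 22 * x ^ 6 + 3 * x ^ 8) /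
        ((1 - x ^ 2) * (3 + 6 * x ^ 2 - x ^ 4)) ^ 2) x := by
  have hx := hasDerivAt_id' x
  have h1 := (((hx.pow 2).const_sub 3).const_mul 8).mul hx
  have h2 := ((hx.pow 2).const_sub 1).mul
    ((((hx.pow 2).const_mul 6).const_add 3).sub (hx.pow 4))
  refine (h1.div h2 hd).congr_deriv ?_
  simp
  field_simp
  ring

theorem strictMonoOn_regular_fst :
    StrictMonoOn (fun x : ℝ => 4 * x * (3 + x ^ 2) / (3 + 6 * x ^ 2 - x ^ 4)) (Icc 0 1) := by
  have hd : ∀ x ∈ Icc (0 : ℝ) 1, 0 < 3 + 6 * x ^ 2 - x ^ 4 := fun x hx => by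
    have : x ^ 4 ≤ 1 := pow_le_one₀ hx.1 hx.2
    nlinarith [sq_nonneg x]
  refine strictMonoOn_of_deriv_pos (convex_Icc 0 1) (fun x hx =>
    (hasDerivAt_regular_fst (hd x hx).ne').continuousAt.continuousWithinAt) fun x hx => ?_
  rw [interior_Icc] at hx
  have h := hd x (Ioo_subset_Icc_self hx)
  rw [(hasDerivAt_regular_fst h.ne').deriv]
  have : 0 < 9 - 9 * x ^ 2 + 15 * x ^ 4 + x ^ 6 := by
    have : x ^ 2 < 1 := by nlinarith [hx.1, hx.2]
    have := hx.1
    nlinarith [show 0 < x ^ 6 by positivity, show 0 < x ^ 4 by positivity]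
  positivity

theorem strictMonoOn_regular_snd :
    StrictMonoOn (fun x : ℝ => 8 * (3 - x ^ 2) * x / ((1 - x ^ 2) * (3 + 6 * x ^ 2 - x ^ 4)))
      (Ico 0 1) := by
  have hd : ∀ x ∈ Ico (0 : ℝ) 1, 0 < (1 - x ^ 2) * (3 + 6 * x ^ 2 - x ^ 4) := fun x hx => by
    have : x ^ 4 ≤ 1 := pow_le_one₀ hx.1 hx.2.le
    exact mul_pos (by nlinarith [hx.1, hx.2]) (by nlinarith [sq_nonneg x])
  refine strictMonoOn_of_deriv_pos (convex_Ico 0 1) (fun x hx =>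
    (hasDerivAt_regular_snd (hd x hx).ne').continuousAt.continuousWithinAt) fun x hx => ?_
  rw [interior_Ico] at hx
  have h := hd x (Ioo_subset_Ico_self hx)
  rw [(hasDerivAt_regular_snd h.ne').deriv]
  have : 0 < 9 - 18 * x ^ 2 + 60 * x ^ 4 - 22 * x ^ 6 + 3 * x ^ 8 := by
    have h2 : x ^ 2 < 1 := by nlinarith [hx.1, hx.2]
    have h0 := hx.1
    have h4 : 0 < x ^ 4 := by positivity
    nlinarith [sq_nonneg (1 - x ^ 2), show 0 < x ^ 8 by positivity, mul_pos h4 (sub_pos.2 h2)]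
  positivity

theorem regularityValue_eq_add (c x : ℝ) :
    regularityValue c x = 4 * x * (3 + x ^ 2) / (3 + 6 * x ^ 2 - x ^ 4)
      + c * (8 * (3 - x ^ 2) * x / ((1 - x ^ 2) * (3 + 6 * x ^ 2 - x ^ 4))) := by
  unfold regularityValue
  ring

theorem strictMonoOn_regularityValue {c : ℝ} (hc : 0 < c) :
    StrictMonoOn (regularityValue c) (Ico 0 1) := by
  intro x hx y hy hxy
  rw [regularityValue_eq_add, regularityValue_eq_add]
  have h1 := strictMonoOn_regular_fst (Ico_subset_Icc_self hx) (Ico_subset_Icc_self hy) hxy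
  have h2 := mul_lt_mul_of_pos_left (strictMonoOn_regular_snd hx hy hxy) hc
  exact add_lt_add h1 h2

theorem continuousOn_regularityValue (c : ℝ) : ContinuousOn (regularityValue c) (Ico 0 1) := by
  have hd : ∀ x ∈ Ico (0 : ℝ) 1, 3 + 6 * x ^ 2 - x ^ 4 ≠ 0 := fun x hx => by
    have : x ^ 4 ≤ 1 := pow_le_one₀ hx.1 hx.2.le
    nlinarith [sq_nonneg x]
  have hd2 : ∀ x ∈ Ico (0 : ℝ) 1, (1 - x ^ 2) * (3 + 6 * x ^ 2 - x ^ 4) ≠ 0 := fun x hx =>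
    mul_ne_zero (by nlinarith [hx.1, hx.2]) (hd x hx)
  unfold regularityValue
  exact (ContinuousOn.div (by fun_prop) (by fun_prop) hd).add
    (ContinuousOn.div (by fun_prop) (by fun_prop) hd2)

theorem existsUnique_isRegularSolution {c : ℝ} (hc : 0 < c) {Λ : ℝ} (hΛ : 0 < Λ) {m : ℕ}
    (hm : 1 ≤ m) : ∃! s : ℝ × ℝ, IsRegularSolution s.1 Λ c s.2 m := by
  have hm' : (1 : ℝ) ≤ m := by exact_mod_cast hm
  obtain ⟨x, hx, hxm⟩ : ∃ x ∈ Ico (0 : ℝ) 1, regularityValue c x = m := by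
    -- The endpoint for the intermediate value theorem. The choice 1 - b² ≤ c/m absorbs m into the
    -- pole of the second summand at x = 1, and the cap 1/2 keeps b ≥ 1/2, where 8(3 - b²)b
    -- dominates 3 + 6b² - b⁴.
    set b : ℝ := √(1 - min (1 / 2) (c / m)) with hb
    have hk0 : 0 < min (1 / 2) (c / m) := lt_min (by norm_num) (by positivity)
    have hk1 : min (1 / 2) (c / m) ≤ 1 / 2 := min_le_left _ _
    have hk2 : min (1 / 2) (c / m) * m ≤ c := by
      have := min_le_right (1 / 2) (c / m)
      rwa [le_div_iff₀ (by positivity)] at this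
    have hb2 : b ^ 2 = 1 - min (1 / 2) (c / m) := Real.sq_sqrt (by linarith)
    have hb0 : 0 < b := Real.sqrt_pos.2 (by linarith)
    have hb1 : b < 1 := by nlinarith
    have hbh : 1 / 2 ≤ b := by nlinarith
    have hle : (m : ℝ) ≤ regularityValue c b := by
      have hd := regularity_denom_pos hb0 hb1
      have h1b : 0 < 1 - b ^ 2 := by linarith
      have e1 : 0 ≤ 4 * b * (3 + b ^ 2) / (3 + 6 * b ^ 2 - b ^ 4) := by positivity
      have e2 : (m : ℝ) ≤ 8 * c * (3 - b ^ 2) * b / ((1 - b ^ 2) * (3 + 6 * b ^ 2 - b ^ 4)) := by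
        rw [le_div_iff₀ (by positivity)]
        have e3 : (m : ℝ) * (1 - b ^ 2) ≤ c := by rw [hb2]; linarith
        have e4 : 3 + 6 * b ^ 2 - b ^ 4 ≤ 8 * (3 - b ^ 2) * b := by
          have : b ^ 2 ≤ 1 := by linarith
          nlinarith [sq_nonneg (b ^ 2)]
        nlinarith [mul_le_mul e3 e4 hd.le hc.le]
      unfold regularityValue
      linarith
    have := intermediate_value_Icc hb0.le ((continuousOn_regularityValue c).mono
      (Icc_subset_Ico_right hb1))
    obtain ⟨x, hx, e⟩ := this ⟨by simp [regularityValue], hle⟩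
    exact ⟨x, ⟨hx.1, hx.2.trans_lt hb1⟩, e⟩
  have hx0 : 0 < x := by
    rcases hx.1.eq_or_lt with h | h
    · rw [← h] at hxm
      simp [regularityValue] at hxm
      rw [← hxm] at hm'
      norm_num at hm'
    · exact h
  refine ⟨(√(3 * (1 + x ^ 2 + c) / ((3 + 6 * x ^ 2 - x ^ 4) * Λ)), x),
    (isRegularSolution_iff hΛ (by linarith) hm).2 ⟨hx0, hx.2, hxm.symm, rfl⟩, ?_⟩
  rintro ⟨α, y⟩ h
  obtain ⟨h0, h1, hr, ha⟩ := (isRegularSolution_iff hΛ (by linarith) hm).1 h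
  have : y = x := (strictMonoOn_regularityValue hc).injOn ⟨h0.le, h1⟩ hx (hr.symm.trans hxm.symm)
  simp only at ha
  rw [ha, this]

/-- The first summand increases to the value 2 at x = 1 and a negative c only lowers it, so 1 ≤ m <
2. -/
theorem IsRegularSolution.eq_one_of_neg {c : ℝ} (hc : c < 0) {α Λ x₁ : ℝ} {m : ℕ}
    (h : IsRegularSolution α Λ c x₁ m) : m = 1 := by
  have hd := regularity_denom_pos h.pos h.lt_one
  have hx : 0 < 1 - x₁ ^ 2 := by nlinarith [h.pos, h.lt_one]
  have e := h.integrality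
  rw [regularityValue_eq_add] at e
  have h1 := strictMonoOn_regular_fst ⟨h.pos.le, h.lt_one.le⟩ ⟨zero_le_one, le_rfl⟩ h.lt_one
  norm_num at h1
  have h2 : 0 < 8 * (3 - x₁ ^ 2) * x₁ / ((1 - x₁ ^ 2) * (3 + 6 * x₁ ^ 2 - x₁ ^ 4)) :=
    div_pos (mul_pos (by nlinarith) h.pos) (by positivity)
  have h3 : (m : ℝ) < 2 := by nlinarith
  have h4 : m < 2 := by exact_mod_cast h3
  have := h.one_le
  omega

/-- This polynomial is the cofactor of 2x - 1 in the equation for c = -9/64 and m = 1; monotonicity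
leaves room for only one further solution. -/
theorem strictMonoOn_quintic :
    StrictMonoOn (fun x : ℝ => 4 * x ^ 5 + 18 * x ^ 4 - 19 * x ^ 3 + 18 * x ^ 2 + 21 * x - 24)
      (Icc 0 1) := by
  intro x hx y hy hxy
  -- The product is the difference of the values at y and x with y - x factored out; positivity of
  -- the second factor is an inequality between polynomials on the unit square.
  have key : 0 < (y - x) * (4 * (y ^ 4 + y ^ 3 * x + y ^ 2 * x ^ 2 + y * x ^ 3 + x ^ 4)
      + 18 * (y ^ 3 + y ^ 2 * x + y * x ^ 2 + x ^ 3) - 19 * (y ^ 2 + y * x + x ^ 2)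
      + 18 * (y + x) + 21) := by
    have hx0 := hx.1
    have hy0 : 0 < y := hx0.trans_lt hxy
    have h1 : 0 ≤ y ^ 2 * x + y * x ^ 2 + x ^ 3 := by positivity
    have h2 : 0 ≤ y ^ 4 + y ^ 3 * x + y ^ 2 * x ^ 2 + y * x ^ 3 + x ^ 4 := by positivity
    refine mul_pos (sub_pos.2 hxy) ?_
    nlinarith [mul_nonneg hy0.le (sq_nonneg (y - 1 / 2)), mul_nonneg hx0 (sq_nonneg (x - 1 / 2)),
      mul_nonneg hx0 (sub_nonneg.2 hy.2), mul_nonneg hx0 (sub_nonneg.2 hx.2),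
      mul_nonneg hy0.le (sub_nonneg.2 hy.2), hx.2, hy.2]
  simp only
  linarith

/-- The value c = -9/64 is the one for which x = 1/2 solves the equation with m = 1, so that the
resulting sextic has an explicit linear factor. -/
theorem regularityValue_eq_one_iff {x : ℝ} (h0 : 0 < x) (h1 : x < 1) :
    1 = regularityValue (-9 / 64) x ↔
      (2 * x - 1) * (4 * x ^ 5 + 18 * x ^ 4 - 19 * x ^ 3 + 18 * x ^ 2 + 21 * x - 24) = 0 := by
  have hd := (regularity_denom_pos h0 h1).ne'
  have hx : (1 - x ^ 2) ≠ 0 := by nlinarith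
  have e : regularityValue (-9 / 64) x - 1 =
      -((2 * x - 1) * (4 * x ^ 5 + 18 * x ^ 4 - 19 * x ^ 3 + 18 * x ^ 2 + 21 * x - 24)) /
        (8 * ((1 - x ^ 2) * (3 + 6 * x ^ 2 - x ^ 4))) := by
    unfold regularityValue
    rw [div_add_div _ _ hd (mul_ne_zero hx hd), div_sub_one (by positivity),
      div_eq_div_iff (by positivity) (by positivity)]
    ring
  have hq : (8 * ((1 - x ^ 2) * (3 + 6 * x ^ 2 - x ^ 4))) ≠ 0 := by positivity
  constructor
  · intro h
    rw [← h, sub_self, eq_comm, div_eq_zero_iff] at e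
    exact neg_eq_zero.1 (e.resolve_right hq)
  · intro h
    rw [h, neg_zero, zero_div] at e
    linarith

theorem exists_ncard_isRegularSolution_eq_two :
    ∃ c : ℝ, c < 0 ∧ ∀ Λ : ℝ, 0 < Λ →
      {s : ℝ × ℝ | IsRegularSolution s.1 Λ c s.2 1}.ncard = 2 := by
  refine ⟨-9 / 64, by norm_num, fun Λ hΛ => ?_⟩
  -- The quintic is negative at 1/2 and positive at 1, so the second solution differs from 1/2 and
  -- lies below 1.
  obtain ⟨x₀, hx₀, hr⟩ : ∃ x ∈ Icc (1 / 2 : ℝ) 1,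
      4 * x ^ 5 + 18 * x ^ 4 - 19 * x ^ 3 + 18 * x ^ 2 + 21 * x - 24 = 0 :=
    intermediate_value_Icc (f := fun x : ℝ =>
      4 * x ^ 5 + 18 * x ^ 4 - 19 * x ^ 3 + 18 * x ^ 2 + 21 * x - 24) (by norm_num)
      (by fun_prop) ⟨by norm_num, by norm_num⟩
  have hne : x₀ ≠ 1 / 2 := by
    rintro rfl
    norm_num at hr
  have hne1 : x₀ < 1 := by
    rcases hx₀.2.eq_or_lt with h | h
    · rw [h] at hr
      norm_num at hr
    · exact h
  set a : ℝ → ℝ := fun x => √(3 * (1 + x ^ 2 + -9 / 64) / ((3 + 6 * x ^ 2 - x ^ 4) * Λ))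
  have : {s : ℝ × ℝ | IsRegularSolution s.1 Λ (-9 / 64) s.2 1}
      = {(a (1 / 2), 1 / 2), (a x₀, x₀)} := by
    ext ⟨α, x⟩
    simp only [mem_ofPred_eq, mem_insert_iff, mem_singleton_iff, Prod.mk.injEq]
    rw [isRegularSolution_iff hΛ (by norm_num) le_rfl]
    constructor
    · rintro ⟨h0, h1, h, ha⟩
      rw [Nat.cast_one, regularityValue_eq_one_iff h0 h1] at h
      have ha' : α = a x := ha
      rcases mul_eq_zero.1 h with h | h
      · have : x = 1 / 2 := by linarith
        subst this
        exact Or.inl ⟨ha', rfl⟩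
      · have : x = x₀ := strictMonoOn_quintic.injOn ⟨h0.le, h1.le⟩
          ⟨by linarith [hx₀.1], hx₀.2⟩ (h.trans hr.symm)
        subst this
        exact Or.inr ⟨ha', rfl⟩
    · rintro (⟨rfl, rfl⟩ | ⟨rfl, rfl⟩)
      · refine ⟨by norm_num, by norm_num, ?_, rfl⟩
        rw [Nat.cast_one, regularityValue_eq_one_iff (by norm_num) (by norm_num)]
        norm_num
      · have h0 : 0 < x := by linarith [hx₀.1]
        refine ⟨h0, hne1, ?_, rfl⟩
        rw [Nat.cast_one, regularityValue_eq_one_iff h0 hne1, hr, mul_zero]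
  rw [this]
  exact ncard_pair fun h => hne (Prod.ext_iff.1 h).2.symm


/-! ### Conical singularities -/

theorem integral_sub_rpow_neg_half {b x : ℝ} (h : x ≤ b) :
    ∫ y in x..b, (b - y) ^ (-(1 / 2) : ℝ) = 2 * √(b - x) := by
  rw [intervalIntegral.integral_comp_sub_left (fun y => y ^ (-(1 / 2) : ℝ)) b,
    integral_rpow (Or.inl (by norm_num)), sub_self, Real.sqrt_eq_rpow]
  norm_num
  ring

theorem intervalIntegrable_sub_rpow_neg_half (b x : ℝ) :
    IntervalIntegrable (fun y => (b - y) ^ (-(1 / 2) : ℝ)) MeasureTheory.volume x b := by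
  have h := (intervalIntegral.intervalIntegrable_rpow' (r := -(1 / 2)) (a := b - x) (b := b - b)
    (by norm_num)).comp_sub_left b
  simpa using h

/-- The integral of `h / √(b - y)` near the endpoint `b`. -/
theorem tendsto_integral_div_sqrt {f h : ℝ → ℝ} {a b : ℝ} (hab : a < b)
    (hh : ContinuousOn h (Icc a b))
    (hf : ∀ x ∈ Ioo a b, f x = h x * (b - x) ^ (-(1 / 2) : ℝ)) :
    Tendsto (fun x => (∫ y in x..b, f y) / √(b - x)) (𝓝[<] b) (𝓝 (2 * h b)) := by
  rw [Metric.tendsto_nhds]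
  intro ε hε
  have hc := hh b ⟨hab.le, le_rfl⟩
  have h1 : ∀ᶠ y in 𝓝[Icc a b] b, dist (h y) (h b) < ε / 4 :=
    hc (Metric.ball_mem_nhds _ (by linarith))
  obtain ⟨δ, hδ, hball⟩ := Metric.mem_nhdsWithin_iff.1 h1
  have h2 : ∀ᶠ x in 𝓝[<] b, max a (b - δ) < x :=
    mem_of_superset (Ioo_mem_nhdsLT (max_lt hab (by linarith))) fun x hx => hx.1
  filter_upwards [h2, self_mem_nhdsWithin] with x hx hxb
  have hxb' : x < b := hxb
  have hax : a < x := (le_max_left _ _).trans_lt hx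
  have hδx : b - δ < x := (le_max_right _ _).trans_lt hx
  have hs : 0 < √(b - x) := Real.sqrt_pos.2 (by linarith)
  have e1 : ∫ y in x..b, f y = ∫ y in x..b, h y * (b - y) ^ (-(1 / 2) : ℝ) := by
    refine intervalIntegral.integral_congr_ae ?_
    have hne : ∀ᵐ y : ℝ, y ≠ b := MeasureTheory.Measure.ae_ne MeasureTheory.volume b
    filter_upwards [hne] with y hy hyx
    rw [uIoc_of_le hxb'.le] at hyx
    exact hf y ⟨hax.trans hyx.1, lt_of_le_of_ne hyx.2 hy⟩
  have i0 := intervalIntegrable_sub_rpow_neg_half b x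
  have i1 : IntervalIntegrable (fun y => h y * (b - y) ^ (-(1 / 2) : ℝ)) MeasureTheory.volume x b :=
    i0.continuousOn_mul (hh.mono (by rw [uIcc_of_le hxb'.le]; exact Icc_subset_Icc_left hax.le))
  -- Comparison with the model integral of h(b)(b - y)^(-1/2), which equals 2h(b)√(b - x). The error
  -- is controlled by the oscillation of h near b times the same model integral.
  have e2 : (∫ y in x..b, f y) - 2 * h b * √(b - x)
      = ∫ y in x..b, (h y * (b - y) ^ (-(1 / 2) : ℝ) - h b * (b - y) ^ (-(1 / 2) : ℝ)) := by
    rw [intervalIntegral.integral_sub i1 (i0.const_mul _), intervalIntegral.integral_const_mul,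
      integral_sub_rpow_neg_half hxb'.le, e1]
    ring
  have e3 : |(∫ y in x..b, f y) - 2 * h b * √(b - x)| ≤ ε / 4 * (2 * √(b - x)) := by
    rw [e2, ← Real.norm_eq_abs, ← integral_sub_rpow_neg_half hxb'.le, ← intervalIntegral.integral_const_mul]
    refine intervalIntegral.norm_integral_le_of_norm_le hxb'.le (Filter.Eventually.of_forall ?_)
      (i0.const_mul _)
    intro y hy
    have hy0 : 0 ≤ (b - y) ^ (-(1 / 2) : ℝ) := Real.rpow_nonneg (by linarith [hy.2]) _
    rw [← sub_mul, norm_mul, Real.norm_of_nonneg hy0]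
    refine mul_le_mul_of_nonneg_right ?_ hy0
    have : y ∈ Metric.ball b δ ∩ Icc a b := by
      refine ⟨?_, hax.le.trans hy.1.le, hy.2⟩
      rw [Metric.mem_ball, Real.dist_eq, abs_lt]
      constructor <;> linarith [hy.1, hy.2]
    exact (hball this).le
  rw [Real.dist_eq]
  have e4 : (∫ y in x..b, f y) / √(b - x) - 2 * h b
      = ((∫ y in x..b, f y) - 2 * h b * √(b - x)) / √(b - x) := by
    field_simp
  rw [e4, abs_div, abs_of_pos hs, div_lt_iff₀ hs]
  nlinarith

theorem pageP_neg (α Λ c x : ℝ) : pageP α Λ c (-x) = pageP α Λ c x := by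
  unfold pageP
  ring

theorem fibreCircumference_neg (α Λ c : ℝ) (m : ℕ) (x : ℝ) :
    fibreCircumference α Λ c m (-x) = fibreCircumference α Λ c m x := by
  simp [fibreCircumference, pageP_neg]

theorem fibreLength_neg (α Λ c u v : ℝ) : fibreLength α Λ c (-v) (-u) = fibreLength α Λ c u v := by
  unfold fibreLength
  rw [← intervalIntegral.integral_comp_neg]
  simp [pageP_neg]

/-- By reflection symmetry the condition at `-x₁` follows from the one at `x₁`. -/
theorem hasNoConicalSingularity_iff (α Λ c x₁ : ℝ) (m : ℕ) :
    HasNoConicalSingularity α Λ c x₁ m ↔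
      Tendsto (fun x => fibreCircumference α Λ c m x / fibreLength α Λ c x x₁) (𝓝[<] x₁)
        (𝓝 (2 * π)) := by
  refine ⟨And.left, fun h => ⟨h, ?_⟩⟩
  have hn : Tendsto (fun x : ℝ => -x) (𝓝[>] (-x₁)) (𝓝[<] x₁) := by
    simpa using tendsto_neg_nhdsGT (a := -x₁)
  refine (h.comp hn).congr fun x => ?_
  have := fibreLength_neg α Λ c (-x₁) x
  rw [neg_neg] at this
  simp only [Function.comp_apply, fibreCircumference_neg, this]

/-- Positivity of P just inside x₁ is positivity of N there, and the limit at x₁ keeps only the weak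
inequality. The case of equality is a double root, which admissibility does not exclude. -/
theorem IsAdmissible.factor_nonneg {α Λ c x₁ : ℝ} (h : IsAdmissible α Λ c x₁) :
    0 ≤ α ^ 2 * Λ * (2 - 2 * x₁ ^ 2 / 3) - 1 := by
  have h0 := h.pos
  have key : ∀ᶠ x in 𝓝[<] x₁, 0 ≤ 2 * (α ^ 2 * Λ) - 1 - α ^ 2 * Λ * (x₁ ^ 2 + x ^ 2) / 3 := by
    filter_upwards [Ioo_mem_nhdsLT h0] with x hx
    have hp := h.positive x (by linarith [hx.1]) hx.2
    rw [pageP_factor h.root] at hp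
    exact ((pos_iff_pos_of_mul_pos hp).1 (by nlinarith [hx.1, hx.2])).le
  have hc : Tendsto (fun x : ℝ => 2 * (α ^ 2 * Λ) - 1 - α ^ 2 * Λ * (x₁ ^ 2 + x ^ 2) / 3) (𝓝[<] x₁)
      (𝓝 (2 * (α ^ 2 * Λ) - 1 - α ^ 2 * Λ * (x₁ ^ 2 + x₁ ^ 2) / 3)) :=
    (Continuous.tendsto (by fun_prop) x₁).mono_left nhdsWithin_le_nhds
  have := ge_of_tendsto hc key
  linarith

/-- At a simple root the circumference and the proper distance to the pole are both √(x₁ - x) times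
a function with a limit at x₁; the square roots cancel in the quotient and only the ratio of the two
limits remains. -/
theorem tendsto_circumference_div_length {α Λ c x₁ : ℝ} (h : IsAdmissible α Λ c x₁) {m : ℕ}
    (hN : 0 < α ^ 2 * Λ * (2 - 2 * x₁ ^ 2 / 3) - 1) :
    Tendsto (fun x => fibreCircumference α Λ c m x / fibreLength α Λ c x x₁) (𝓝[<] x₁)
      (𝓝 (4 * π / m * (2 * x₁ * (α ^ 2 * Λ * (2 - 2 * x₁ ^ 2 / 3) - 1) / (1 - x₁ ^ 2)))) := by
  have h0 := h.pos
  have h1 := h.lt_one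
  have hα := h.scale_pos
  have hl : 0 < α ^ 2 * Λ := by
    have : 0 < 2 - 2 * x₁ ^ 2 / 3 := by nlinarith
    by_contra hn
    nlinarith
  set N : ℝ → ℝ := fun x => 2 * (α ^ 2 * Λ) - 1 - α ^ 2 * Λ * (x₁ ^ 2 + x ^ 2) / 3 with hNdef
  have hN1 : N x₁ = α ^ 2 * Λ * (2 - 2 * x₁ ^ 2 / 3) - 1 := by simp only [hNdef]; ring
  have hNpos : ∀ x ∈ Icc 0 x₁, 0 < N x := fun x hx => by
    have : x ^ 2 ≤ x₁ ^ 2 := pow_le_pow_left₀ hx.1 hx.2 2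
    have : N x₁ ≤ N x := by simp only [hNdef]; nlinarith
    linarith
  have hPf : ∀ x, pageP α Λ c x = (x₁ - x) * ((x₁ + x) * N x) := fun x => by
    rw [pageP_factor h.root]
    simp only [hNdef]
    ring
  have hx2 : ∀ x ∈ Icc 0 x₁, 0 < 1 - x ^ 2 := fun x hx => by
    have : x ^ 2 ≤ x₁ ^ 2 := pow_le_pow_left₀ hx.1 hx.2 2
    nlinarith
  have hden : ∀ x ∈ Icc 0 x₁, 0 < (x₁ + x) * N x := fun x hx =>
    mul_pos (by linarith [hx.1]) (hNpos x hx)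
  set k : ℝ → ℝ := fun x => √(α ^ 2 * (1 - x ^ 2) / ((x₁ + x) * N x)) with hk
  have hkc : ContinuousOn k (Icc 0 x₁) :=
    (ContinuousOn.div (by fun_prop) (by fun_prop) fun x hx => (hden x hx).ne').sqrt
  have hL : Tendsto (fun x => fibreLength α Λ c x x₁ / √(x₁ - x)) (𝓝[<] x₁) (𝓝 (2 * k x₁)) := by
    refine tendsto_integral_div_sqrt h0 hkc fun x hx => ?_
    have hx' := Ioo_subset_Icc_self hx
    have hpos : 0 < x₁ - x := by linarith [hx.2]
    rw [hPf, hk, Real.rpow_neg hpos.le, ← Real.sqrt_eq_rpow, ← div_eq_mul_inv,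
      ← Real.sqrt_div (div_nonneg (mul_nonneg (sq_nonneg α) (hx2 x hx').le) (hden x hx').le),
      div_div, mul_comm (x₁ - x)]
  have hC : Tendsto (fun x => fibreCircumference α Λ c m x / √(x₁ - x)) (𝓝[<] x₁)
      (𝓝 (4 * π / m * √(4 * α ^ 2 * ((x₁ + x₁) * N x₁) / (1 - x₁ ^ 2)))) := by
    have hcont : ContinuousAt (fun x => 4 * π / m * √(4 * α ^ 2 * ((x₁ + x) * N x) / (1 - x ^ 2)))
        x₁ := by
      have : (1 - x₁ ^ 2) ≠ 0 := (hx2 x₁ ⟨h0.le, le_rfl⟩).ne'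
      exact continuousAt_const.mul (ContinuousAt.sqrt
        (ContinuousAt.div (by fun_prop) (by fun_prop) this))
    refine (hcont.tendsto.mono_left nhdsWithin_le_nhds).congr' ?_
    filter_upwards [Ioo_mem_nhdsLT h0] with x hx
    have hx' := Ioo_subset_Icc_self hx
    have hpos : 0 < x₁ - x := by linarith [hx.2]
    have hs : √(x₁ - x) ≠ 0 := (Real.sqrt_pos.2 hpos).ne'
    rw [eq_div_iff hs, fibreCircumference, hPf, mul_assoc,
      ← Real.sqrt_mul (div_nonneg (mul_nonneg (by positivity) (hden x hx').le) (hx2 x hx').le)]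
    congr 2
    ring
  have hk1 : 0 < k x₁ := Real.sqrt_pos.2 (div_pos (mul_pos (by positivity)
    (hx2 x₁ ⟨h0.le, le_rfl⟩)) (hden x₁ ⟨h0.le, le_rfl⟩))
  have hlim := hC.div hL (by positivity)
  have hx1 := hx2 x₁ ⟨h0.le, le_rfl⟩
  have hd1 := hden x₁ ⟨h0.le, le_rfl⟩
  have hval : 4 * π / m * √(4 * α ^ 2 * ((x₁ + x₁) * N x₁) / (1 - x₁ ^ 2)) / (2 * k x₁)
      = 4 * π / m * (2 * x₁ * (α ^ 2 * Λ * (2 - 2 * x₁ ^ 2 / 3) - 1) / (1 - x₁ ^ 2)) := by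
    rw [mul_div_assoc, ← hN1]
    congr 1
    -- The radicand of the circumference is the square of a rational multiple of `k x₁`, since the
    -- product of the dx² and dψ² coefficients is the constant 4α⁴. Hence no square root survives in
    -- the limit.
    have e : 4 * α ^ 2 * ((x₁ + x₁) * N x₁) / (1 - x₁ ^ 2)
        = (2 * (2 * x₁ * N x₁ / (1 - x₁ ^ 2)) * k x₁) ^ 2 := by
      rw [hk, mul_pow, Real.sq_sqrt (div_nonneg (mul_nonneg (sq_nonneg α) hx1.le) hd1.le)]
      field_simp
      ring
    rw [e, Real.sqrt_sq (mul_nonneg (mul_nonneg (by norm_num) (div_nonneg (by linarith) hx1.le))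
      hk1.le)]
    field_simp
  rw [hval] at hlim
  refine hlim.congr' ?_
  filter_upwards [self_mem_nhdsWithin] with x hx
  have hpos : 0 < x₁ - x := sub_pos.2 hx
  have hs : √(x₁ - x) ≠ 0 := (Real.sqrt_pos.2 hpos).ne'
  simp only [Pi.div_apply]
  rw [div_div_div_cancel_right₀ hs]

/-- At a double root of `P` the metric has an infinite throat. -/
theorem not_intervalIntegrable_of_double_root {α Λ c x₁ : ℝ} (h : IsAdmissible α Λ c x₁)
    (hN : α ^ 2 * Λ * (2 - 2 * x₁ ^ 2 / 3) - 1 = 0) {x : ℝ} (hx : x < x₁) :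
    ¬ IntervalIntegrable (fun x => √(α ^ 2 * (1 - x ^ 2) / pageP α Λ c x)) MeasureTheory.volume
      x x₁ := by
  have h0 := h.pos
  have h1 := h.lt_one
  have hα := h.scale_pos
  have hl : 0 < α ^ 2 * Λ := by
    have : 0 < 2 - 2 * x₁ ^ 2 / 3 := by nlinarith
    by_contra hn
    nlinarith
  refine not_intervalIntegrable_of_sub_inv_isBigO_punctured ?_ hx.ne right_mem_uIcc
  set k : ℝ → ℝ := fun y => √(α ^ 2 * (1 - y ^ 2) / (α ^ 2 * Λ / 3 * (x₁ + y) ^ 2)) with hk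
  have hkc : ContinuousAt k x₁ := by
    refine ContinuousAt.sqrt (ContinuousAt.div (by fun_prop) (by fun_prop) ?_)
    positivity
  have hk1 : 0 < k x₁ := by
    have : 0 < 1 - x₁ ^ 2 := by nlinarith
    rw [hk]
    positivity
  have hev : ∀ᶠ y in 𝓝[≠] x₁, k x₁ / 2 < k y :=
    nhdsWithin_le_nhds (hkc.eventually (lt_mem_nhds (by linarith)))
  refine Asymptotics.IsBigO.of_bound (2 / k x₁) ?_
  filter_upwards [hev, self_mem_nhdsWithin] with y hy hyne
  have hyne' : y - x₁ ≠ 0 := sub_ne_zero.2 hyne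
  -- When N(x₁) = 0 the quadratic factor itself is divisible by x₁² - y², so P has the square (y -
  -- x₁)² and the integrand has a non-integrable 1/|y - x₁| singularity.
  have e : √(α ^ 2 * (1 - y ^ 2) / pageP α Λ c y) = k y / |y - x₁| := by
    have : pageP α Λ c y = α ^ 2 * Λ / 3 * (x₁ + y) ^ 2 * (y - x₁) ^ 2 := by
      rw [pageP_factor h.root]
      linear_combination (x₁ ^ 2 - y ^ 2) * hN
    rw [this, ← div_div, Real.sqrt_div' _ (sq_nonneg _), Real.sqrt_sq_eq_abs]
  have hpos : 0 < |y - x₁| := abs_pos.2 hyne'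
  have hky : 0 < k y := by linarith
  rw [e, norm_inv, Real.norm_eq_abs, Real.norm_of_nonneg (by positivity), ← mul_div_assoc,
    inv_eq_one_div, div_le_div_iff_of_pos_right hpos, div_mul_eq_mul_div, le_div_iff₀ hk1]
  linarith

theorem hasNoConicalSingularity_iff_regularityValue (α Λ c x₁ : ℝ) (m : ℕ)
    (h : IsAdmissible α Λ c x₁) (hm : 1 ≤ m) :
    HasNoConicalSingularity α Λ c x₁ m ↔ (m : ℝ) = regularityValue c x₁ := by
  have hm' : (1 : ℝ) ≤ m := by exact_mod_cast hm
  have hx : 0 < 1 - x₁ ^ 2 := by nlinarith [h.pos, h.lt_one]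
  rw [hasNoConicalSingularity_iff, regularityValue_eq h.pos h.lt_one h.root]
  rcases h.factor_nonneg.eq_or_lt with hN | hN
  · constructor
    · intro ht
      exfalso
      -- The divergent length integral has the default value 0, and division by 0 gives 0, so the
      -- quotient is identically 0 and cannot tend to 2π. The integrality condition fails too, as it
      -- would give m = 0.
      have hz : ∀ᶠ x in 𝓝[<] x₁,
          fibreCircumference α Λ c m x / fibreLength α Λ c x x₁ = 0 := by
        filter_upwards [self_mem_nhdsWithin] with x hx
        rw [fibreLength, intervalIntegral.integral_undef
          (not_intervalIntegrable_of_double_root h hN.symm hx), div_zero]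
      have := tendsto_nhds_unique (ht.congr' hz) tendsto_const_nhds
      have := Real.pi_pos
      linarith
    · intro e
      rw [← hN] at e
      simp at e
      rw [e] at hm'
      norm_num at hm'
  · have ht := tendsto_circumference_div_length h (m := m) hN
    have hpi := Real.pi_pos
    constructor
    · intro h2
      have e := tendsto_nhds_unique h2 ht
      field_simp at e ⊢
      linarith
    · intro e
      convert ht using 2
      field_simp at e ⊢
      linarith


/-! ### The near-horizon limit of the extremal Kerr–Newman–`Λ` black hole -/

/-- With T = tan(t/2) the Poincaré coordinate R is a positive multiple of (e^ρ + T)(e^ρ - T). The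
two factors have the positive sum 2e^ρ, so R > 0 makes both positive; this is what makes the
logarithm in the near-horizon map differentiable. -/
theorem exp_sub_tan_pos {t ρ : ℝ} (ht : |t| < π) (hR : 0 < adsR t ρ) :
    0 < exp ρ + tan (t / 2) ∧ 0 < exp ρ - tan (t / 2) ∧
      adsR t ρ = (exp ρ + tan (t / 2)) * (exp ρ - tan (t / 2)) / (exp ρ * (1 + tan (t / 2) ^ 2)) ∧
      sin t = 2 * tan (t / 2) / (1 + tan (t / 2) ^ 2) := by
  have hc : cos (t / 2) ≠ 0 := by
    rw [abs_lt] at ht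
    exact (cos_pos_of_mem_Ioo ⟨by linarith [ht.1], by linarith [ht.2]⟩).ne'
  have hT : 0 < 1 + tan (t / 2) ^ 2 := by positivity
  have he := exp_pos ρ
  have e1 : cos t = (1 - tan (t / 2) ^ 2) / (1 + tan (t / 2) ^ 2) := by
    have : cos t = 2 * cos (t / 2) ^ 2 - 1 := by
      rw [← cos_two_mul, mul_div_cancel₀ t two_ne_zero]
    have h2 := sin_sq_add_cos_sq (t / 2)
    rw [this, eq_div_iff hT.ne', Real.tan_eq_sin_div_cos]
    field_simp
    linear_combination 2 * cos (t / 2) ^ 2 * h2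
  have e2 : sin t = 2 * tan (t / 2) / (1 + tan (t / 2) ^ 2) := by
    have : sin t = 2 * sin (t / 2) * cos (t / 2) := by
      rw [← sin_two_mul, mul_div_cancel₀ t two_ne_zero]
    have h2 := sin_sq_add_cos_sq (t / 2)
    rw [this, eq_div_iff hT.ne', Real.tan_eq_sin_div_cos]
    field_simp
    linear_combination sin (t / 2) * h2
  have e3 : adsR t ρ = (exp ρ + tan (t / 2)) * (exp ρ - tan (t / 2)) /
      (exp ρ * (1 + tan (t / 2) ^ 2)) := by
    rw [adsR, e1, cosh_eq, sinh_eq, exp_neg]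
    field_simp
    ring
  have h4 : 0 < (exp ρ + tan (t / 2)) * (exp ρ - tan (t / 2)) := by
    rw [e3] at hR
    exact (div_pos_iff_of_pos_right (by positivity)).1 hR
  refine ⟨?_, ?_, e3, e2⟩
  · by_contra h
    have : 0 < exp ρ - tan (t / 2) := by linarith
    nlinarith
  · by_contra h
    have : 0 < exp ρ + tan (t / 2) := by linarith
    nlinarith

section NearHorizon

variable {p : E4}

theorem hasGrad_adsR : HasGrad (fun q : E4 => adsR (q 0) (q 1))
    ![-(cosh (p 1) * sin (p 0)), sinh (p 1) * cos (p 0) + cosh (p 1), 0, 0] p := by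
  have h0 := hasGrad_coord (𝕜 := ℝ) (p := p) 0
  have h1 := hasGrad_coord (𝕜 := ℝ) (p := p) 1
  refine (((h1.comp (hasDerivAt_cosh (p 1))).mul (h0.comp (hasDerivAt_cos (p 0)))).add
    (h1.comp (hasDerivAt_sinh (p 1)))).congr ?_
  ext i
  fin_cases i <;> simp
  ring

theorem hasGrad_adsTime (hR : 0 < adsR (p 0) (p 1)) :
    HasGrad (fun q : E4 => cosh (q 1) * sin (q 0) / adsR (q 0) (q 1))
      ![cosh (p 1) * (cosh (p 1) + sinh (p 1) * cos (p 0)) / adsR (p 0) (p 1) ^ 2,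
        -sin (p 0) / adsR (p 0) (p 1) ^ 2, 0, 0] p := by
  have h0 := hasGrad_coord (𝕜 := ℝ) (p := p) 0
  have h1 := hasGrad_coord (𝕜 := ℝ) (p := p) 1
  refine (((h1.comp (hasDerivAt_cosh (p 1))).mul (h0.comp (hasDerivAt_sin (p 0)))).div
    hasGrad_adsR hR.ne').congr ?_
  have e1 := sin_sq_add_cos_sq (p 0)
  have e2 := cosh_sq (p 1)
  have hR' := hR.ne'
  ext i
  fin_cases i <;> simp <;> field_simp
  · unfold adsR
    linear_combination cosh (p 1) * e1
  · unfold adsR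
    linear_combination (-sin (p 0)) * e2

/-- Together with the gradient of τ this gives R dτ = sinh ρ dt + dγ: subtracting γ in the azimuth
replaces the Poincaré connection form R dτ by the global one. -/
theorem hasGrad_adsShift (ht : |p 0| < π) (hR : 0 < adsR (p 0) (p 1)) :
    HasGrad (fun q : E4 => log ((exp (q 1) + tan (q 0 / 2)) / (exp (q 1) - tan (q 0 / 2))))
      ![1 / adsR (p 0) (p 1), -sin (p 0) / adsR (p 0) (p 1), 0, 0] p := by
  obtain ⟨k1, k2, k3, k4⟩ := exp_sub_tan_pos ht hR
  have hc : cos (p 0 / 2) ≠ 0 := by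
    rw [abs_lt] at ht
    exact (cos_pos_of_mem_Ioo ⟨by linarith [ht.1], by linarith [ht.2]⟩).ne'
  have h1 := (hasGrad_coord (𝕜 := ℝ) (p := p) 1).comp (Real.hasDerivAt_exp (p 1))
  have h0 := ((hasGrad_coord (𝕜 := ℝ) (p := p) 0).div (hasGrad_const 2) two_ne_zero).comp
    (Real.hasDerivAt_tan hc)
  refine (((h1.add h0).div (h1.sub h0) k2.ne').comp
    (Real.hasDerivAt_log (div_pos k1 k2).ne')).congr ?_
  have e : 1 / cos (p 0 / 2) ^ 2 = 1 + tan (p 0 / 2) ^ 2 := by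
    rw [Real.tan_eq_sin_div_cos, div_pow, eq_comm]
    field_simp
    rw [add_comm, sin_sq_add_cos_sq]
  rw [e, k3, k4]
  have hT : 0 < 1 + tan (p 0 / 2) ^ 2 := by positivity
  have he := exp_pos (p 1)
  have k1' := k1.ne'
  have k2' := k2.ne'
  set T := tan (p 0 / 2)
  set e := exp (p 1)
  ext i
  fin_cases i <;> simp <;> field_simp <;> ring

/-- The light-cone identity for the global and Poincaré forms of the metric of `AdS₂`. -/
theorem adsMetric_eq (hR : 0 < adsR (p 0) (p 1)) (i j : Fin 4) :
    -(adsR (p 0) (p 1) ^ 2) * cosq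
        ![cosh (p 1) * (cosh (p 1) + sinh (p 1) * cos (p 0)) / adsR (p 0) (p 1) ^ 2,
          -sin (p 0) / adsR (p 0) (p 1) ^ 2, 0, 0] i j
      + (adsR (p 0) (p 1) ^ 2)⁻¹ * cosq
        ![-(cosh (p 1) * sin (p 0)), sinh (p 1) * cos (p 0) + cosh (p 1), 0, 0] i j
      = -cosh (p 1) ^ 2 * cosq ![1, 0, 0, 0] i j + cosq ![(0 : ℝ), 1, 0, 0] i j := by
  have e1 := sin_sq_add_cos_sq (p 0)
  have e2 := cosh_sq (p 1)
  have hR' := hR.ne'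
  have hRd : adsR (p 0) (p 1) = cosh (p 1) * cos (p 0) + sinh (p 1) := rfl
  set R := adsR (p 0) (p 1)
  simp only [cosq_apply]
  fin_cases i <;> fin_cases j <;> simp <;> field_simp <;> rw [hRd]
  · linear_combination (cos (p 0) ^ 2 - 1) * e2 + e1
  · ring
  · ring
  · linear_combination (1 - cos (p 0) ^ 2) * e2 - e1

/-- The first part is the Taylor expansion of a quartic whose two lowest coefficients vanish. The
second is Δ - r₀Δ' = 0, the combination which eliminates M. -/
theorem knDelta_double_root {Λ a M q r₀ : ℝ} (h0 : knDelta Λ a M q r₀ = 0)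
    (h1 : deriv (knDelta Λ a M q) r₀ = 0) :
    (∀ u, knDelta Λ a M q (r₀ + u) =
        u ^ 2 * (knC Λ a r₀ - 4 * Λ * r₀ / 3 * u - Λ / 3 * u ^ 2)) ∧
      a ^ 2 = r₀ ^ 2 * (1 - Λ * a ^ 2 / 3 - Λ * r₀ ^ 2) - q ^ 2 := by
  have hx := hasDerivAt_id' r₀
  have hd : HasDerivAt (knDelta Λ a M q)
      (2 * r₀ * (1 - Λ * r₀ ^ 2 / 3) - (r₀ ^ 2 + a ^ 2) * (2 * Λ * r₀ / 3) - 2 * M) r₀ := by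
    have := ((((hx.pow 2).add_const (a ^ 2)).mul
      ((((hx.pow 2).const_mul Λ).div_const 3).const_sub 1)).sub (hx.const_mul (2 * M))).add_const
        (q ^ 2)
    refine this.congr_deriv ?_
    simp
    ring
  rw [hd.deriv] at h1
  unfold knDelta at *
  refine ⟨fun u => ?_, ?_⟩
  · unfold knC
    linear_combination h0 + u * h1
  · linear_combination h0 - r₀ * h1

theorem jacobian_nearHorizonMap {Λ a r₀ s ε : ℝ} (ha : 0 < a) (hs : |s * p 2| < a)
    (ht : |p 0| < π) (hR : 0 < adsR (p 0) (p 1)) :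
    jacobian ℝ (nearHorizonMap Λ a r₀ s ε) p =
      let R := adsR (p 0) (p 1)
      let dτ : Fin 4 → ℝ := ![cosh (p 1) * (cosh (p 1) + sinh (p 1) * cos (p 0)) / R ^ 2,
        -sin (p 0) / R ^ 2, 0, 0]
      let dR : Fin 4 → ℝ := ![-(cosh (p 1) * sin (p 0)), sinh (p 1) * cos (p 0) + cosh (p 1), 0, 0]
      let dγ : Fin 4 → ℝ := ![1 / R, -sin (p 0) / R, 0, 0]
      Matrix.of ![((r₀ ^ 2 + a ^ 2) / (knC Λ a r₀ * ε)) • dτ, ε • dR,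
        ![0, 0, -(s / (a * √(1 - (s * p 2 / a) ^ 2))), 0],
        (a * knXi Λ a / (r₀ ^ 2 + a ^ 2)) • (![0, 0, 0, 1 / s] - (2 * r₀ / knC Λ a r₀) • dγ
          + ((r₀ ^ 2 + a ^ 2) / (knC Λ a r₀ * ε)) • dτ)] := by
  have hτ := hasGrad_adsTime hR
  have hRg := hasGrad_adsR (p := p)
  have hγ := hasGrad_adsShift ht hR
  have hy : |s * p 2 / a| < 1 := by rwa [abs_div, abs_of_pos ha, div_lt_one ha]
  rw [abs_lt] at hy
  have hT : HasGrad (fun q : E4 => (r₀ ^ 2 + a ^ 2) *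
      (cosh (q 1) * sin (q 0) / adsR (q 0) (q 1)) / (knC Λ a r₀ * ε)) _ p :=
    ((hτ.const_mul ((r₀ ^ 2 + a ^ 2) / (knC Λ a r₀ * ε))).congr_of_eventuallyEq
      (Eventually.of_forall fun q => by ring))
  refine jacobian_eq_of_hasGrad fun b => ?_
  fin_cases b
  · exact hT
  · exact ((hasGrad_const r₀).add (hRg.const_mul ε)).congr (zero_add _)
  · refine ((((hasGrad_coord (𝕜 := ℝ) (p := p) 2).const_mul (s / a)).congr_of_eventuallyEq
      (g := fun q : E4 => s * q 2 / a) (Eventually.of_forall fun q => by ring)).comp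
        (hasDerivAt_arccos hy.1.ne' hy.2.ne)).congr ?_
    ext i
    fin_cases i <;> simp
    field_simp
  · refine ((((((hasGrad_coord (𝕜 := ℝ) (p := p) 3).const_mul (1 / s)).congr_of_eventuallyEq
      (g := fun q : E4 => q 3 / s) (Eventually.of_forall fun q => by ring)).sub
        (hγ.const_mul (2 * r₀ / knC Λ a r₀))).add hT).const_mul
          (a * knXi Λ a / (r₀ ^ 2 + a ^ 2))).congr ?_
    have : (1 / s) • (Pi.single 3 1 : Fin 4 → ℝ) = ![0, 0, 0, 1 / s] := by
      ext i
      fin_cases i <;> simp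
    rw [this]
    rfl

end NearHorizon

theorem nhMetric_ofReal (Λ L k β Q : ℝ) (p : E4) (i j : Fin 4) :
    nhMetric Λ L k β Q (toComplexPoint p) i j =
      (((-(L * (k ^ 2 / β + β * p 2 ^ 2 / 4) * cosh (p 1) ^ 2)) * cosq ![1, 0, 0, 0] i j
        + (L * (k ^ 2 / β + β * p 2 ^ 2 / 4)) * cosq ![0, 1, 0, 0] i j
        + ((k ^ 2 / β + β * p 2 ^ 2 / 4) / (-(β * Λ * p 2 ^ 4 / 12)
          + (-1 / L - 2 * Λ * k ^ 2 / β) * p 2 ^ 2 - 4 * k ^ 2 / β ^ 2 * (-1 / L - Λ * k ^ 2 / β)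
            - Q)) * cosq ![0, 0, 1, 0] i j
        + ((-(β * Λ * p 2 ^ 4 / 12)
          + (-1 / L - 2 * Λ * k ^ 2 / β) * p 2 ^ 2 - 4 * k ^ 2 / β ^ 2 * (-1 / L - Λ * k ^ 2 / β)
            - Q) / (k ^ 2 / β + β * p 2 ^ 2 / 4)) * cosq ![L * k * sinh (p 1), 0, 0, 1] i j : ℝ) :
              ℂ) := by
  have h1 : toComplexPoint p 1 = (p 1 : ℂ) := rfl
  have h2 : toComplexPoint p 2 = (p 2 : ℂ) := rfl
  have hc : ∀ (x y z w : ℝ), ((cosq ![x, y, z, w] i j : ℝ) : ℂ)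
      = cosq ![(x : ℂ), (y : ℂ), (z : ℂ), (w : ℂ)] i j := fun x y z w => by
    simp only [cosq_apply]
    fin_cases i <;> fin_cases j <;> simp
  simp only [nhMetric, h1, h2, nhGamma, nhP, Matrix.add_apply, Matrix.smul_apply, smul_eq_mul]
  push_cast
  simp only [hc]
  push_cast
  rfl

/-- Only time and azimuth contain 1/ε. The covector dt - a sin²θ dφ/Ξ pulls back to `u ε`/ε, whose
square is compensated by the factor ε² of Δ_r. In a dt - (r² + a²) dφ/Ξ the 1/ε contributions cancel
at r = r₀, leaving `v ε`. What remains is continuous at ε = 0. -/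
theorem tendsto_coordPullback_nearHorizonMap (Λ a M q r₀ s μ : ℝ) (ha : 0 < a) (hr : 0 < r₀)
    (hΞ : 0 < knXi Λ a) (h0 : knDelta Λ a M q r₀ = 0) (h1 : deriv (knDelta Λ a M q) r₀ = 0)
    (hC : 0 < knC Λ a r₀) (hs : 0 < s) (hμ : 0 < μ) (p : E4) (ht : |p 0| < π)
    (hR : 0 < adsR (p 0) (p 1)) (hx : |s * p 2| < a) (i j : Fin 4) :
    Tendsto
      (fun ε : ℝ =>
        ((coordPullback ℝ (nearHorizonMap Λ a r₀ s ε) (knMetric Λ a M q) p i j : ℝ) : ℂ))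
      (𝓝[>] 0)
      (𝓝 (nhMetric Λ ((1 / (μ * knC Λ a r₀) : ℝ) : ℂ) ((2 * μ * r₀ * s : ℝ) : ℂ)
        ((4 * μ * s ^ 2 : ℝ) : ℂ) ((μ * q ^ 2 / s ^ 2 : ℝ) : ℂ) (toComplexPoint p) i j)) := by
  obtain ⟨hΔ, hq⟩ := knDelta_double_root h0 h1
  have hads := adsMetric_eq hR i j
  have hJ := fun ε => jacobian_nearHorizonMap (Λ := Λ) (r₀ := r₀) (ε := ε) ha hx ht hR
  have hy : |s * p 2 / a| < 1 := by rwa [abs_div, abs_of_pos ha, div_lt_one ha]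
  have hy2 : 0 < 1 - (s * p 2 / a) ^ 2 := abs_lt_one_sq hy
  rw [abs_lt] at hy
  rw [nhMetric_ofReal]
  refine (Complex.continuous_ofReal.tendsto _).comp ?_
  set R := adsR (p 0) (p 1) with hRdef
  set C := knC Λ a r₀ with hCdef
  set dτ : Fin 4 → ℝ := ![cosh (p 1) * (cosh (p 1) + sinh (p 1) * cos (p 0)) / R ^ 2,
        -sin (p 0) / R ^ 2, 0, 0] with hdτ
  set dR : Fin 4 → ℝ :=
    ![-(cosh (p 1) * sin (p 0)), sinh (p 1) * cos (p 0) + cosh (p 1), 0, 0] with hdR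
  set dγ : Fin 4 → ℝ := ![1 / R, -sin (p 0) / R, 0, 0] with hdγ
  simp only at hJ
  set S := 1 - (s * p 2 / a) ^ 2 with hS
  have hS0 : 0 < √S := Real.sqrt_pos.2 hy2
  have hSS : √S ^ 2 = S := Real.sq_sqrt hy2.le
  set X : ℝ := a ^ 2 * (s * p 2 / a) ^ 2 with hX
  set Dθ : ℝ := 1 + Λ * a ^ 2 * (s * p 2 / a) ^ 2 / 3 with hDθ
  have hDθ0 : 0 < Dθ := by
    have : knXi Λ a = 1 + Λ * a ^ 2 / 3 := rfl
    rw [this] at hΞ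
    -- The polar coefficient is the combination sin²θ · 1 + cos²θ · Ξ of two positive numbers, so no
    -- bound on Λ beyond Ξ > 0 is needed.
    have h2 : Dθ = S + (1 + Λ * a ^ 2 / 3) * (s * p 2 / a) ^ 2 := by
      rw [hDθ, hS]
      ring
    rw [h2]
    positivity
  set W : Fin 4 → ℝ := ![0, 0, 0, 1 / s] - (2 * r₀ / C) • dγ with hW
  set K : ℝ → ℝ := fun ε => C - 4 * Λ * r₀ / 3 * (ε * R) - Λ / 3 * (ε * R) ^ 2 with hK
  set Sg : ℝ → ℝ := fun ε => (r₀ + ε * R) ^ 2 + X with hSg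
  set u : ℝ → Fin 4 → ℝ := fun ε k =>
    (r₀ ^ 2 + X) / C * dτ k - ε * (a ^ 2 * S / (r₀ ^ 2 + a ^ 2)) * W k with hu
  set v : ℝ → Fin 4 → ℝ := fun ε k =>
    -(a / C) * (2 * r₀ * R + ε * R ^ 2) * dτ k
      - a * ((r₀ + ε * R) ^ 2 + a ^ 2) / (r₀ ^ 2 + a ^ 2) * W k with hv
  -- The pulled-back component with all powers of ε cancelled by hand. It agrees with the pull-back
  -- for ε > 0 and is continuous at 0, so the limit is `G 0`.
  set G : ℝ → ℝ := fun ε =>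
    -(R ^ 2 * K ε / Sg ε) * (u ε i * u ε j) + Sg ε / (R ^ 2 * K ε) * (dR i * dR j)
      + Sg ε / Dθ * (cosq ![0, 0, -(s / (a * √S)), 0] i j)
      + Dθ * S / Sg ε * (v ε i * v ε j) with hG
  have hX0 : 0 ≤ X := by positivity
  have hD : 0 < r₀ ^ 2 + a ^ 2 := by positivity
  have hXS : r₀ ^ 2 + a ^ 2 - a ^ 2 * S = r₀ ^ 2 + X := by
    rw [hX, hS]
    ring
  have hGc : ContinuousAt G 0 := by
    have hSg0 : Sg 0 ≠ 0 := by
      simp only [hSg]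
      positivity
    have hK0 : R ^ 2 * K 0 ≠ 0 := by
      simp only [hK]
      simp
      exact ⟨hR.ne', hC.ne'⟩
    have c1 : ContinuousAt K 0 := by fun_prop
    have c2 : ContinuousAt Sg 0 := by fun_prop
    have c3 : ∀ k, ContinuousAt (fun ε => u ε k) 0 := fun k => by
      simp only [hu]
      fun_prop
    have c4 : ∀ k, ContinuousAt (fun ε => v ε k) 0 := fun k => by
      simp only [hv]
      fun_prop
    exact (((((continuousAt_const.mul c1).div c2 hSg0).neg.mul ((c3 i).mul (c3 j))).add
      ((c2.div (continuousAt_const.mul c1) hK0).mul continuousAt_const)).add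
        ((c2.div_const _).mul continuousAt_const)).add
          ((continuousAt_const.div c2 hSg0).mul ((c4 i).mul (c4 j)))
  have hlim : Tendsto G (𝓝[>] 0) (𝓝 (G 0)) := hGc.tendsto.mono_left nhdsWithin_le_nhds
  have hG0 : G 0 = (-(1 / (μ * C) * ((2 * μ * r₀ * s) ^ 2 / (4 * μ * s ^ 2)
      + 4 * μ * s ^ 2 * p 2 ^ 2 / 4) * cosh (p 1) ^ 2)) * cosq ![1, 0, 0, 0] i j
        + (1 / (μ * C) * ((2 * μ * r₀ * s) ^ 2 / (4 * μ * s ^ 2) + 4 * μ * s ^ 2 * p 2 ^ 2 / 4))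
          * cosq ![0, 1, 0, 0] i j
        + (((2 * μ * r₀ * s) ^ 2 / (4 * μ * s ^ 2) + 4 * μ * s ^ 2 * p 2 ^ 2 / 4)
          / (-(4 * μ * s ^ 2 * Λ * p 2 ^ 4 / 12)
          + (-1 / (1 / (μ * C)) - 2 * Λ * (2 * μ * r₀ * s) ^ 2 / (4 * μ * s ^ 2)) * p 2 ^ 2
          - 4 * (2 * μ * r₀ * s) ^ 2 / (4 * μ * s ^ 2) ^ 2
            * (-1 / (1 / (μ * C)) - Λ * (2 * μ * r₀ * s) ^ 2 / (4 * μ * s ^ 2))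
            - μ * q ^ 2 / s ^ 2)) * cosq ![0, 0, 1, 0] i j
        + ((-(4 * μ * s ^ 2 * Λ * p 2 ^ 4 / 12)
          + (-1 / (1 / (μ * C)) - 2 * Λ * (2 * μ * r₀ * s) ^ 2 / (4 * μ * s ^ 2)) * p 2 ^ 2
          - 4 * (2 * μ * r₀ * s) ^ 2 / (4 * μ * s ^ 2) ^ 2
            * (-1 / (1 / (μ * C)) - Λ * (2 * μ * r₀ * s) ^ 2 / (4 * μ * s ^ 2))
            - μ * q ^ 2 / s ^ 2) / ((2 * μ * r₀ * s) ^ 2 / (4 * μ * s ^ 2)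
              + 4 * μ * s ^ 2 * p 2 ^ 2 / 4))
          * cosq ![1 / (μ * C) * (2 * μ * r₀ * s) * sinh (p 1), 0, 0, 1] i j := by
    have g1 : (2 * μ * r₀ * s) ^ 2 / (4 * μ * s ^ 2) + 4 * μ * s ^ 2 * p 2 ^ 2 / 4
        = μ * (r₀ ^ 2 + X) := by
      rw [hX]
      field_simp
      ring
    have g2 : -(4 * μ * s ^ 2 * Λ * p 2 ^ 4 / 12)
          + (-1 / (1 / (μ * C)) - 2 * Λ * (2 * μ * r₀ * s) ^ 2 / (4 * μ * s ^ 2)) * p 2 ^ 2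
          - 4 * (2 * μ * r₀ * s) ^ 2 / (4 * μ * s ^ 2) ^ 2
            * (-1 / (1 / (μ * C)) - Λ * (2 * μ * r₀ * s) ^ 2 / (4 * μ * s ^ 2))
            - μ * q ^ 2 / s ^ 2 = μ * (a ^ 2 / s ^ 2) * (Dθ * S) := by
      -- Extremality expresses q² through r₀, a and Λ. With it the near-horizon quartic factors into
      -- the polar coefficient times sin²θ, up to a constant.
      have e : q ^ 2 = r₀ ^ 2 * (1 - Λ * a ^ 2 / 3 - Λ * r₀ ^ 2) - a ^ 2 := by linarith
      rw [e, hDθ, hS, hCdef, knC]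
      field_simp
      ring
    have hSig : r₀ ^ 2 + X ≠ 0 := by positivity
    have hK0 : K 0 = C := by simp [hK]
    have hSg0 : Sg 0 = r₀ ^ 2 + X := by simp [hSg]
    have hu0 : ∀ k, u 0 k = (r₀ ^ 2 + X) / C * dτ k := fun k => by simp [hu]
    -- At ε = 0 the combination R dτ - dγ appears, which is sinh ρ dt; the second rotating covector
    -- becomes a multiple of dφ + ℓ²k sinh ρ dt.
    have hv0 : ∀ k, v 0 k = -(a / s) *
        (![1 / (μ * C) * (2 * μ * r₀ * s) * sinh (p 1), 0, 0, 1] : Fin 4 → ℝ) k := fun k => by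
      have hRe : R = cosh (p 1) * cos (p 0) + sinh (p 1) := rfl
      have hch := cosh_sq (p 1)
      have hR0 := hR.ne'
      simp only [hv, hW, hdτ, hdγ]
      fin_cases k <;> simp <;> field_simp
      · linear_combination -hch + sinh (p 1) * hRe
      · ring
    -- The first two terms are a multiple of -R² dτ² + dR²/R², the Poincaré form of AdS₂, so the
    -- light-cone identity applies.
    have t1 : -(R ^ 2 * K 0 / Sg 0) * (u 0 i * u 0 j) + Sg 0 / (R ^ 2 * K 0) * (dR i * dR j)
        = (r₀ ^ 2 + X) / C * (-cosh (p 1) ^ 2 * cosq ![1, 0, 0, 0] i j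
          + cosq ![(0 : ℝ), 1, 0, 0] i j) := by
      rw [← hads, hK0, hSg0, hu0, hu0, cosq_apply, cosq_apply]
      have hR0 := hR.ne'
      field_simp
    have t2 : cosq ![0, 0, -(s / (a * √S)), 0] i j
        = s ^ 2 / (a ^ 2 * S) * cosq ![(0 : ℝ), 0, 1, 0] i j := by
      simp only [cosq_apply]
      rw [← hSS]
      fin_cases i <;> fin_cases j <;> simp
      field_simp
    have hS' : S ≠ 0 := hy2.ne'
    have hD' := hDθ0.ne'
    simp only [hG]
    rw [g1, g2, t1, t2, hSg0, hv0, hv0]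
    simp only [cosq_apply ![1 / (μ * C) * (2 * μ * r₀ * s) * sinh (p 1), 0, 0, 1]]
    field_simp
  rw [hG0] at hlim
  refine hlim.congr' ?_
  filter_upwards [self_mem_nhdsWithin] with ε hε
  have hε0 : (ε : ℝ) ≠ 0 := (mem_Ioi.1 hε).ne'
  have e1 : nearHorizonMap Λ a r₀ s ε p 1 = r₀ + ε * R := rfl
  have e2 : nearHorizonMap Λ a r₀ s ε p 2 = arccos (s * p 2 / a) := rfl
  have e3 : sin (arccos (s * p 2 / a)) ^ 2 = S := by rw [sin_arccos, hSS]
  have e4 : cos (arccos (s * p 2 / a)) = s * p 2 / a := cos_arccos hy.1.le hy.2.le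
  have hΞ0 := hΞ.ne'
  have hC0 := hC.ne'
  have hD0 := hD.ne'
  rw [coordPullback_eq, hJ ε]
  set J : Matrix (Fin 4) (Fin 4) ℝ := Matrix.of ![((r₀ ^ 2 + a ^ 2) / (C * ε)) • dτ, ε • dR,
    ![0, 0, -(s / (a * √S)), 0],
    (a * knXi Λ a / (r₀ ^ 2 + a ^ 2)) • (![0, 0, 0, 1 / s] - (2 * r₀ / C) • dγ
      + ((r₀ ^ 2 + a ^ 2) / (C * ε)) • dτ)] with hJdef
  rw [knMetric, e1, e2, e3, e4, ← hX, ← hDθ, hΔ]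
  simp only [Matrix.mul_add, Matrix.add_mul, Matrix.mul_smul, Matrix.smul_mul, transpose_mul_cosq_mul]
  simp only [Matrix.add_apply, Matrix.smul_apply, smul_eq_mul]
  have j0 : ∀ k, J 0 k = (r₀ ^ 2 + a ^ 2) / (C * ε) * dτ k := fun k => rfl
  have j1 : ∀ k, J 1 k = ε * dR k := fun k => rfl
  have j2 : J 2 = ![0, 0, -(s / (a * √S)), 0] := rfl
  have j3 : ∀ k, J 3 k = a * knXi Λ a / (r₀ ^ 2 + a ^ 2) *
    (W k + (r₀ ^ 2 + a ^ 2) / (C * ε) * dτ k) := fun k => rfl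
  have w1 : ∀ k, (![1, 0, 0, -(a * S / knXi Λ a)] ᵥ* J) k = u ε k / ε := fun k => by
    rw [vecMul_four, j0, j3]
    simp only [hu]
    simp
    rw [← hXS]
    field_simp
    ring
  have w2 : ∀ k, (![0, 1, 0, 0] ᵥ* J) k = ε * dR k := fun k => by
    rw [vecMul_four, j1]
    simp
  have w3 : ![0, 0, 1, 0] ᵥ* J = ![0, 0, -(s / (a * √S)), 0] := by
    rw [← j2]
    ext k
    rw [vecMul_four]
    simp
  have w4 : ∀ k, (![a, 0, 0, -(((r₀ + ε * R) ^ 2 + a ^ 2) / knXi Λ a)] ᵥ* J) k = v ε k :=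
    fun k => by
      rw [vecMul_four, j0, j3]
      simp only [hv]
      simp
      field_simp
      ring
  simp only [cosq_apply, w1, w2, w3, w4, hG]
  have hSgε : (r₀ + ε * R) ^ 2 + X = Sg ε := rfl
  have hKε : C - 4 * Λ * r₀ / 3 * (ε * R) - Λ / 3 * (ε * R) ^ 2 = K ε := rfl
  rw [hSgε, hKε]
  have f1 : -(R ^ 2 * K ε / Sg ε) * (u ε i * u ε j)
      = -((ε * R) ^ 2 * K ε) / Sg ε * (u ε i / ε * (u ε j / ε)) := by
    field_simp
  have f2 : Sg ε / (R ^ 2 * K ε) * (dR i * dR j)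
      = Sg ε / ((ε * R) ^ 2 * K ε) * (ε * dR i * (ε * dR j)) := by
    rw [div_mul_eq_mul_div, div_mul_eq_mul_div, ← mul_div_mul_left _ _ (pow_ne_zero 2 hε0)]
    congr 1 <;> ring
  rw [f1, f2]



/-! ### Exterior derivatives of potentials -/

/-- The field strength `∂ᵢ Aⱼ - ∂ⱼ Aᵢ` of a potential. -/
def fieldStrength (A : Fin 4 → E4 → ℝ) (p : E4) : Matrix (Fin 4) (Fin 4) ℝ :=
  Matrix.of fun i j => pd i (A j) p - pd j (A i) p

theorem ContDiffAt.pd {f : E4 → ℝ} {p : E4} (h : ContDiffAt ℝ ∞ f p) (i : Fin 4) :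
    ContDiffAt ℝ ∞ (pd i f) p :=
  (h.fderiv_right (m := ∞) (by simp)).clm_apply contDiffAt_const

theorem pd_add {f g : E4 → ℝ} {p : E4} (hf : DifferentiableAt ℝ f p) (hg : DifferentiableAt ℝ g p)
    (i : Fin 4) : pd i (fun q => f q + g q) p = pd i f p + pd i g p := by
  simp [pd, fderiv_fun_add hf hg]

theorem pd_sub {f g : E4 → ℝ} {p : E4} (hf : DifferentiableAt ℝ f p) (hg : DifferentiableAt ℝ g p)
    (i : Fin 4) : pd i (fun q => f q - g q) p = pd i f p - pd i g p := by
  simp [pd, fderiv_fun_sub hf hg]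

theorem Filter.EventuallyEq.pd_eq {f g : E4 → ℝ} {p : E4} (h : f =ᶠ[𝓝 p] g) (i : Fin 4) :
    pd i f p = pd i g p := by
  unfold pd
  rw [Filter.EventuallyEq.fderiv_eq h]

theorem pd_pd_comm {f : E4 → ℝ} {p : E4} (h : ContDiffAt ℝ ∞ f p) (i j : Fin 4) :
    pd i (pd j f) p = pd j (pd i f) p := by
  have hd : DifferentiableAt ℝ (fderiv ℝ f) p :=
    (h.fderiv_right (m := 1) (by norm_cast)).differentiableAt (by norm_num)
  have key : ∀ i j, pd i (pd j f) p = fderiv ℝ (fderiv ℝ f) p (coordVec ℝ i) (coordVec ℝ j) :=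
    fun i j => by
      have := (hd.hasFDerivAt.clm_apply (hasFDerivAt_const (coordVec ℝ j) p)).fderiv
      unfold pd
      rw [this]
      simp
  rw [key, key]
  exact (h.isSymmSndFDerivAt (by simpa using ENat.LEInfty.out)).eq _ _

theorem contDiffAt_fieldStrength {A : Fin 4 → E4 → ℝ} {p : E4} (h : ∀ i, ContDiffAt ℝ ∞ (A i) p)
    (i j : Fin 4) : ContDiffAt ℝ ∞ (fun q => fieldStrength A q i j) p :=
  ((h j).pd i).sub ((h i).pd j)

theorem fieldStrength_antisymm (A : Fin 4 → E4 → ℝ) (p : E4) (i j : Fin 4) :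
    fieldStrength A p i j = -fieldStrength A p j i := by
  simp [fieldStrength]

theorem fieldStrength_bianchi {A : Fin 4 → E4 → ℝ} {p : E4} (h : ∀ i, ContDiffAt ℝ ∞ (A i) p)
    (i j k : Fin 4) :
    pd i (fun q => fieldStrength A q j k) p + pd j (fun q => fieldStrength A q k i) p
      + pd k (fun q => fieldStrength A q i j) p = 0 := by
  have hd : ∀ a b, DifferentiableAt ℝ (pd a (A b)) p := fun a b =>
    ((h b).pd a).differentiableAt (by simp)
  have key : ∀ a b d, pd a (fun q => fieldStrength A q b d) p
      = pd a (pd b (A d)) p - pd a (pd d (A b)) p := fun a b d => pd_sub (hd b d) (hd d b) a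
  rw [key, key, key, pd_pd_comm (h k) i j, pd_pd_comm (h i) j k, pd_pd_comm (h j) k i]
  ring

/-! ### The curvature of the continued metrics -/

/-- The first derivative of `pageP`. -/
def pageP₁ (α Λ x : ℝ) : ℝ := 2 * x - (4 * x - 4 * x ^ 3 / 3) * (α ^ 2 * Λ)

/-- The second derivative of `pageP`. -/
def pageP₂ (α Λ x : ℝ) : ℝ := 2 - (4 - 4 * x ^ 2) * (α ^ 2 * Λ)

theorem hasDerivAt_pageP (α Λ c x : ℝ) : HasDerivAt (pageP α Λ c) (pageP₁ α Λ x) x := by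
  have hx := hasDerivAt_id' x
  have := (((hx.pow 2).const_add 1).add_const c).sub
    (((((hx.pow 2).const_mul 2).const_add 1).sub ((hx.pow 4).div_const 3)).mul_const (α ^ 2 * Λ))
  refine this.congr_deriv ?_
  unfold pageP₁
  push_cast
  ring

theorem hasDerivAt_pageP₁ (α Λ x : ℝ) : HasDerivAt (pageP₁ α Λ) (pageP₂ α Λ x) x := by
  have hx := hasDerivAt_id' x
  have := (hx.const_mul 2).sub
    (((hx.const_mul 4).sub (((hx.pow 3).const_mul 4).div_const 3)).mul_const (α ^ 2 * Λ))
  refine this.congr_deriv ?_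
  unfold pageP₂
  push_cast
  ring

/-- Matrix form of a metric of the type of `pageMetric`. -/
def biaxialMatrix (A B C s c : ℝ) : Matrix (Fin 4) (Fin 4) ℝ :=
  !![A, 0, 0, 0; 0, B, 0, B * c; 0, 0, C, 0; 0, B * c, 0, B * c ^ 2 + C * s ^ 2]

/-- The inverse of `biaxialMatrix`. -/
def biaxialInv (A B C s c : ℝ) : Matrix (Fin 4) (Fin 4) ℝ :=
  !![A⁻¹, 0, 0, 0; 0, B⁻¹ + c ^ 2 / (C * s ^ 2), 0, -(c / (C * s ^ 2)); 0, 0, C⁻¹, 0;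
    0, -(c / (C * s ^ 2)), 0, (C * s ^ 2)⁻¹]

theorem biaxialMatrix_inv {A B C s : ℝ} (c : ℝ) (hA : A ≠ 0) (hB : B ≠ 0) (hC : C ≠ 0)
    (hs : s ≠ 0) : (biaxialMatrix A B C s c)⁻¹ = biaxialInv A B C s c := by
  refine Matrix.inv_eq_right_inv ?_
  ext i j
  fin_cases i <;> fin_cases j <;>
    simp [biaxialMatrix, biaxialInv, Matrix.mul_apply, Fin.sum_univ_four] <;> field_simp <;> ring

theorem biaxialMatrix_det (A B C s c : ℝ) :
    (biaxialMatrix A B C s c).det = A * B * C ^ 2 * s ^ 2 := by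
  simp [biaxialMatrix, Matrix.det_succ_row_zero, Fin.sum_univ_succ, Fin.succAbove]
  ring

/-- The Christoffel symbols of `pageMetric`, in terms of `b = B'/2B`, `e = C'/2C`, `u = B'/2A`,
`v = C'/2A`, `w = B/2C`. -/
def biaxialChr (b e u v w s c : ℝ) (k : Fin 4) : Matrix (Fin 4) (Fin 4) ℝ :=
  match k with
  | 0 => !![-b, 0, 0, 0; 0, -u, 0, -(u * c); 0, 0, -v, 0; 0, -(u * c), 0,
      -(u * c ^ 2 + v * s ^ 2)]
  | 1 => !![0, b, 0, (b - e) * c; b, 0, w * (c / s), 0;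
      0, w * (c / s), 0, w * (c ^ 2 / s) - (1 + c ^ 2) / (2 * s);
      (b - e) * c, 0, w * (c ^ 2 / s) - (1 + c ^ 2) / (2 * s), 0]
  | 2 => !![0, 0, e, 0; 0, 0, 0, w * s; e, 0, 0, 0; 0, w * s, 0, (2 * w - 1) * (c * s)]
  | 3 => !![0, 0, 0, e; 0, 0, -(w * s⁻¹), 0; 0, -(w * s⁻¹), 0, (1 - w) * (c / s);
      e, 0, (1 - w) * (c / s), 0]

/-- Partial derivatives of the metric components. -/
def biaxialDeriv (A' B' C' B C s c : ℝ) (i : Fin 4) : Matrix (Fin 4) (Fin 4) ℝ :=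
  match i with
  | 0 => !![A', 0, 0, 0; 0, B', 0, B' * c; 0, 0, C', 0; 0, B' * c, 0, B' * c ^ 2 + C' * s ^ 2]
  | 1 => 0
  | 2 => !![0, 0, 0, 0; 0, 0, 0, -(B * s); 0, 0, 0, 0; 0, -(B * s), 0, 2 * (C - B) * c * s]
  | 3 => 0

/-- The relation assumed for A' says that AB is constant, as it is for `pageMetric`, where AB = 4α⁴.
It turns A'/2A into -B'/2B, so that five coefficient functions of x suffice for all Christoffel
symbols. -/
theorem biaxial_christoffel {A B C s c A' B' C' : ℝ} (hA : A ≠ 0) (hB : B ≠ 0) (hC : C ≠ 0)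
    (hs : s ≠ 0) (hsc : s ^ 2 + c ^ 2 = 1) (hA' : A' = -B' * A / B) (k i j : Fin 4) :
    (1 / 2) * ∑ l, biaxialInv A B C s c k l * (biaxialDeriv A' B' C' B C s c i j l
      + biaxialDeriv A' B' C' B C s c j i l - biaxialDeriv A' B' C' B C s c l i j)
    = biaxialChr (B' / (2 * B)) (C' / (2 * C)) (B' / (2 * A)) (C' / (2 * A)) (B / (2 * C)) s c
        k i j := by
  subst hA'
  have hc : c ^ 2 = 1 - s ^ 2 := by linarith
  rw [Fin.sum_univ_four]
  fin_cases k <;> fin_cases i <;> fin_cases j <;>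
    simp [biaxialInv, biaxialDeriv, biaxialChr]
  all_goals field_simp
  all_goals try ring
  all_goals linear_combination (-C) * hsc

/-- Derivatives of `biaxialChr` with respect to the polar angle. -/
def biaxialChrAngle (b e u v w s c : ℝ) (k : Fin 4) : Matrix (Fin 4) (Fin 4) ℝ :=
  match k with
  | 0 => !![0, 0, 0, 0; 0, 0, 0, u * s; 0, 0, 0, 0; 0, u * s, 0, 2 * (u - v) * (c * s)]
  | 1 => !![0, 0, 0, (e - b) * s; 0, 0, -(w / s ^ 2), 0;
      0, -(w / s ^ 2), 0, -(w * (c * (1 + s ^ 2) / s ^ 2)) + c * (2 + s ^ 2) / (2 * s ^ 2);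
      (e - b) * s, 0, -(w * (c * (1 + s ^ 2) / s ^ 2)) + c * (2 + s ^ 2) / (2 * s ^ 2), 0]
  | 2 => !![0, 0, 0, 0; 0, 0, 0, w * c; 0, 0, 0, 0; 0, w * c, 0, (2 * w - 1) * (c ^ 2 - s ^ 2)]
  | 3 => !![0, 0, 0, 0; 0, 0, w * (c / s ^ 2), 0; 0, w * (c / s ^ 2), 0, (w - 1) / s ^ 2;
      0, 0, (w - 1) / s ^ 2, 0]

/-- Derivatives of `biaxialChr` with respect to all coordinates; primed arguments are derivatives
of the coefficients. -/
def biaxialChrDeriv (b e u v w b' e' u' v' w' s c : ℝ) (i k : Fin 4) :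
    Matrix (Fin 4) (Fin 4) ℝ :=
  match i with
  | 0 => biaxialChr b' e' u' v' w' s c k - biaxialChr 0 0 0 0 0 s c k
  | 1 => 0
  | 2 => biaxialChrAngle b e u v w s c k
  | 3 => 0

/-- A formal identity in the coefficients and their derivatives; no relation between them is used.
The Christoffel symbols are affine in the coefficients, which is why their x-derivative is
`biaxialChr` at the derivatives minus its value at zero. The result again has biaxial form. -/
theorem biaxial_ricci {b e u v w b' e' u' v' w' s c : ℝ} (hs : s ≠ 0) (hsc : s ^ 2 + c ^ 2 = 1)
    (i j : Fin 4) :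
    ∑ k, (biaxialChrDeriv b e u v w b' e' u' v' w' s c k k i j
      - biaxialChrDeriv b e u v w b' e' u' v' w' s c j k i k
      + ∑ l, (biaxialChr b e u v w s c k k l * biaxialChr b e u v w s c l i j
        - biaxialChr b e u v w s c k j l * biaxialChr b e u v w s c l i k))
    = biaxialMatrix (-b' - 2 * e' - 2 * e * b - 2 * b ^ 2 - 2 * e ^ 2)
        (-u' - 2 * e * u + 2 * u * b + 2 * w ^ 2) (-v' + 1 - w) s c i j := by
  simp only [Fin.sum_univ_four]
  fin_cases i <;> fin_cases j <;>
    simp [biaxialChrDeriv, biaxialChr, biaxialChrAngle, biaxialMatrix]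
  all_goals field_simp
  all_goals try ring_nf
  · linear_combination (-2 * (1 - w)) * hsc
  · linear_combination (-2 * w) * hsc


theorem hasGrad_biaxialChr {fb fe fu fv fw : ℝ → ℝ} {b' e' u' v' w' : ℝ} {p : E4}
    (hb : HasDerivAt fb b' (p 0)) (he : HasDerivAt fe e' (p 0)) (hu : HasDerivAt fu u' (p 0))
    (hv : HasDerivAt fv v' (p 0)) (hw : HasDerivAt fw w' (p 0)) (hs : sin (p 2) ≠ 0)
    (k i j : Fin 4) :
    HasGrad (fun q : E4 => biaxialChr (fb (q 0)) (fe (q 0)) (fu (q 0)) (fv (q 0)) (fw (q 0))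
        (sin (q 2)) (cos (q 2)) k i j)
      (fun l => biaxialChrDeriv (fb (p 0)) (fe (p 0)) (fu (p 0)) (fv (p 0)) (fw (p 0))
        b' e' u' v' w' (sin (p 2)) (cos (p 2)) l k i j) p := by
  have h0 := hasGrad_coord (𝕜 := ℝ) (p := p) 0
  have h2 := hasGrad_coord (𝕜 := ℝ) (p := p) 2
  have gb := h0.comp hb
  have ge := h0.comp he
  have gu := h0.comp hu
  have gv := h0.comp hv
  have gw := h0.comp hw
  have gs := h2.comp (Real.hasDerivAt_sin (p 2))
  have gc := h2.comp (Real.hasDerivAt_cos (p 2))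
  have gs2 := gs.comp (hasDerivAt_pow 2 (sin (p 2)))
  have gc2 := gc.comp (hasDerivAt_pow 2 (cos (p 2)))
  have gcs := gc.div gs hs
  have gi := gs.inv hs
  have hsc := sin_sq_add_cos_sq (p 2)
  have hd := (((hasGrad_const 1).add gc2).div (gs.const_mul 2) (mul_ne_zero two_ne_zero hs))
  have z := hasGrad_const (𝕜 := ℝ) (p := p) 0
  have k00 := gb.neg
  have k01 := gu.neg
  have k02 := (gu.mul gc).neg
  have k03 := gv.neg
  have k04 := ((gu.mul gc2).add (gv.mul gs2)).neg
  have k11 := (gb.sub ge).mul gc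
  have k12 := gw.mul gcs
  have k13 := (gw.mul (gc2.div gs hs)).sub hd
  have k21 := gw.mul gs
  have k22 := ((gw.const_mul 2).sub (hasGrad_const 1)).mul (gc.mul gs)
  have k31 := (gw.mul gi).neg
  have k32 := ((hasGrad_const 1).sub gw).mul gcs
  fin_cases k <;> fin_cases i <;> fin_cases j <;>
    first
    | exact z.congr (by ext l; fin_cases l <;> simp [biaxialChrDeriv, biaxialChr, biaxialChrAngle])
    | refine gb.congr ?_
    | refine ge.congr ?_
    | refine k00.congr ?_
    | refine k01.congr ?_
    | refine k02.congr ?_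
    | refine k03.congr ?_
    | refine k04.congr ?_
    | refine k11.congr ?_
    | refine k12.congr ?_
    | refine k13.congr ?_
    | refine k21.congr ?_
    | refine k22.congr ?_
    | refine k31.congr ?_
    | refine k32.congr ?_
  all_goals
    ext l
    fin_cases l <;> simp [biaxialChrDeriv, biaxialChr, biaxialChrAngle]
  all_goals field_simp
  all_goals try ring_nf
  · linear_combination (-fw (p 0)) * hsc
  · linear_combination (-fw (p 0)) * hsc
  · linear_combination (-2 * fw (p 0) * cos (p 2) + cos (p 2)) * hsc
  · linear_combination (-2 * fw (p 0) * cos (p 2) + cos (p 2)) * hsc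
  · simp
  · simp
  · linear_combination (fw (p 0) - 1) * hsc
  · linear_combination (fw (p 0) - 1) * hsc

section Page

variable {α Λ c : ℝ}

theorem isOpen_pageDomain (α Λ c : ℝ) : IsOpen (pageDomain α Λ c) := by
  have hc : Continuous (fun x : ℝ => pageP α Λ c x) :=
    continuous_iff_continuousAt.2 fun x => (hasDerivAt_pageP α Λ c x).continuousAt
  have e0 : Continuous fun p : E4 => p 0 := by fun_prop
  have e2 : Continuous fun p : E4 => p 2 := by fun_prop
  exact (isOpen_lt e0.abs continuous_const).inter ((isOpen_lt continuous_const (hc.comp e0)).inter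
    ((isOpen_lt continuous_const e2).inter (isOpen_lt e2 continuous_const)))

theorem pageMetric_eq (p : E4) : pageMetric α Λ c p =
    biaxialMatrix (α ^ 2 * (1 - p 0 ^ 2) / pageP α Λ c (p 0))
      (4 * α ^ 2 * pageP α Λ c (p 0) / (1 - p 0 ^ 2)) (α ^ 2 * (1 - p 0 ^ 2))
      (sin (p 2)) (cos (p 2)) := by
  ext i j
  simp only [pageMetric, Matrix.add_apply, Matrix.smul_apply, cosq_apply, smul_eq_mul]
  fin_cases i <;> fin_cases j <;> simp [biaxialMatrix]
  left
  ring

theorem hasGrad_biaxialMatrix {fA fB fC : ℝ → ℝ} {A' B' C' : ℝ} {p : E4}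
    (hA : HasDerivAt fA A' (p 0)) (hB : HasDerivAt fB B' (p 0)) (hC : HasDerivAt fC C' (p 0))
    (i j : Fin 4) :
    HasGrad (fun q : E4 => biaxialMatrix (fA (q 0)) (fB (q 0)) (fC (q 0)) (sin (q 2)) (cos (q 2)) i j)
      (fun l => biaxialDeriv A' B' C' (fB (p 0)) (fC (p 0)) (sin (p 2)) (cos (p 2)) l i j) p := by
  have h0 := hasGrad_coord (𝕜 := ℝ) (p := p) 0
  have h2 := hasGrad_coord (𝕜 := ℝ) (p := p) 2
  have gA := h0.comp hA
  have gB := h0.comp hB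
  have gC := h0.comp hC
  have gs := h2.comp (Real.hasDerivAt_sin (p 2))
  have gc := h2.comp (Real.hasDerivAt_cos (p 2))
  have gs2 := gs.comp (hasDerivAt_pow 2 (sin (p 2)))
  have gc2 := gc.comp (hasDerivAt_pow 2 (cos (p 2)))
  have z := hasGrad_const (𝕜 := ℝ) (p := p) 0
  have k1 := gB.mul gc
  have k2 := (gB.mul gc2).add (gC.mul gs2)
  fin_cases i <;> fin_cases j <;>
    first
    | exact z.congr (by ext l; fin_cases l <;> simp [biaxialDeriv])
    | refine gA.congr ?_
    | refine gB.congr ?_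
    | refine gC.congr ?_
    | refine k1.congr ?_
    | refine k2.congr ?_
  all_goals
    ext l
    fin_cases l <;> simp [biaxialDeriv]
  all_goals ring

theorem deriv_pageCoeff {x : ℝ} (hD : 1 - x ^ 2 ≠ 0) (hP : pageP α Λ c x ≠ 0) :
    HasDerivAt (fun x => α ^ 2 * (1 - x ^ 2) / pageP α Λ c x)
      (α ^ 2 * (-2 * x / pageP α Λ c x - (1 - x ^ 2) * pageP₁ α Λ x / pageP α Λ c x ^ 2)) x ∧
    HasDerivAt (fun x => 4 * α ^ 2 * pageP α Λ c x / (1 - x ^ 2))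
      (4 * α ^ 2 * (pageP₁ α Λ x / (1 - x ^ 2) + 2 * x * pageP α Λ c x / (1 - x ^ 2) ^ 2)) x ∧
    HasDerivAt (fun x => α ^ 2 * (1 - x ^ 2)) (-2 * x * α ^ 2) x := by
  have hx := hasDerivAt_id' x
  have h1 := (hx.pow 2).const_sub 1
  have h2 := hasDerivAt_pageP α Λ c x
  refine ⟨((h1.const_mul (α ^ 2)).div h2 hP).congr_deriv ?_,
    ((h2.const_mul (4 * α ^ 2)).div h1 hD).congr_deriv ?_,
    (h1.const_mul (α ^ 2)).congr_deriv ?_⟩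
  · simp
    field_simp
  · simp
    field_simp
  · simp
    ring

/-- The Christoffel symbols of `pageMetric`. -/
def pageChr (α Λ c : ℝ) (k i j : Fin 4) (q : E4) : ℝ :=
  biaxialChr (pageP₁ α Λ (q 0) / (2 * pageP α Λ c (q 0)) + q 0 / (1 - q 0 ^ 2))
    (-q 0 / (1 - q 0 ^ 2))
    (2 * pageP α Λ c (q 0) * (pageP₁ α Λ (q 0) * (1 - q 0 ^ 2) + 2 * q 0 * pageP α Λ c (q 0))
      / (1 - q 0 ^ 2) ^ 3)
    (-(q 0 * pageP α Λ c (q 0) / (1 - q 0 ^ 2))) (2 * pageP α Λ c (q 0) / (1 - q 0 ^ 2) ^ 2)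
    (sin (q 2)) (cos (q 2)) k i j

theorem christoffel_pageMetric (hα : α ≠ 0) {p : E4} (hp : p ∈ pageDomain α Λ c) (k i j : Fin 4) :
    christoffel (pageMetric α Λ c) k i j p = pageChr α Λ c k i j p := by
  obtain ⟨hx, hP, hθ, hθ'⟩ := hp
  have hD := (abs_lt_one_sq hx).ne'
  have hP := hP.ne'
  have hs := (sin_pos_of_pos_of_lt_pi hθ hθ').ne'
  have hsc := sin_sq_add_cos_sq (p 2)
  obtain ⟨dA, dB, dC⟩ := deriv_pageCoeff (α := α) (Λ := Λ) (c := c) hD hP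
  have hpd : ∀ l a b, pd l (fun q => pageMetric α Λ c q a b) p = _ := fun l a b => by
    simp only [pageMetric_eq]
    exact (hasGrad_biaxialMatrix dA dB dC a b).pd l
  unfold christoffel
  simp only [hpd]
  rw [pageMetric_eq, biaxialMatrix_inv _ (by positivity) (by positivity) (by positivity) hs,
    biaxial_christoffel (by positivity) (by positivity) (by positivity) hs hsc, pageChr]
  · congr 1 <;> field_simp <;> ring
  · field_simp
    ring

end Page


/-! ### The Ricci tensor of the continued metrics -/

section Page

variable {α Λ c : ℝ}

/-- The deviation from Λg has opposite signs on the (x, ψ) directions and on the sphere. It is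
therefore traceless and of the shape of a Maxwell stress tensor, with size governed by c. -/
theorem ricci_pageMetric (hα : α ≠ 0) {p : E4} (hp : p ∈ pageDomain α Λ c) (i j : Fin 4) :
    ricci (pageMetric α Λ c) i j p =
      biaxialMatrix
        ((Λ + c / (α ^ 2 * (1 - p 0 ^ 2) ^ 2)) * (α ^ 2 * (1 - p 0 ^ 2) / pageP α Λ c (p 0)))
        ((Λ + c / (α ^ 2 * (1 - p 0 ^ 2) ^ 2)) * (4 * α ^ 2 * pageP α Λ c (p 0) / (1 - p 0 ^ 2)))
        ((Λ - c / (α ^ 2 * (1 - p 0 ^ 2) ^ 2)) * (α ^ 2 * (1 - p 0 ^ 2)))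
        (sin (p 2)) (cos (p 2)) i j := by
  have hev : ∀ k i j, christoffel (pageMetric α Λ c) k i j =ᶠ[𝓝 p] pageChr α Λ c k i j :=
    fun k i j => by
      filter_upwards [(isOpen_pageDomain α Λ c).mem_nhds hp] with q hq
      exact christoffel_pageMetric hα hq k i j
  obtain ⟨hx, hP, hθ, hθ'⟩ := hp
  have hD := (abs_lt_one_sq hx).ne'
  have hP := hP.ne'
  have hs := (sin_pos_of_pos_of_lt_pi hθ hθ').ne'
  have hsc := sin_sq_add_cos_sq (p 2)
  have hy := hasDerivAt_id' (p 0)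
  have d0 := hasDerivAt_pageP α Λ c (p 0)
  have d1 := hasDerivAt_pageP₁ α Λ (p 0)
  have dD := (hy.pow 2).const_sub 1
  have hb := (d1.div (d0.const_mul 2) (mul_ne_zero two_ne_zero hP)).add (hy.div dD hD)
  have he := hy.neg.div dD hD
  have hu := ((d0.const_mul 2).mul ((d1.mul dD).add ((hy.const_mul 2).mul d0))).div (dD.pow 3)
    (pow_ne_zero 3 hD)
  have hv := ((hy.mul d0).div dD hD).neg
  have hw := (d0.const_mul 2).div (dD.pow 2) (pow_ne_zero 2 hD)
  have hpd : ∀ l k a b, pd l (christoffel (pageMetric α Λ c) k a b) p = _ := fun l k a b =>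
    ((hev k a b).pd_eq l).trans ((hasGrad_biaxialChr hb he hu hv hw hs k a b).pd l)
  unfold ricci
  simp only [hpd, (hev _ _ _).eq_of_nhds]
  unfold pageChr
  refine (biaxial_ricci hs hsc i j).trans ?_
  -- The constant c is expressed through the value P(x), so that P, x, α and Λ become independent
  -- and each component is an identity of rational functions.
  have hc : c = pageP α Λ c (p 0) - 1 - p 0 ^ 2
      + (1 + 2 * p 0 ^ 2 - p 0 ^ 4 / 3) * (α ^ 2 * Λ) := by
    rw [pageP]
    ring
  clear hpd hev hb he hu hv hw d0
  simp only [Pi.pow_apply, Pi.div_apply, Pi.add_apply, Pi.mul_apply, Pi.neg_apply, Pi.sub_apply]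
  generalize pageP α Λ c (p 0) = P at *
  subst hc
  simp only [pageP₁, pageP₂]
  congr 1
  · field_simp
    ring
  · field_simp
    ring
  · field_simp
    ring

end Page

/-! ### Einstein–Maxwell equations in matrix form -/

section MatrixForm

variable {G F J : Matrix (Fin 4) (Fin 4) ℝ}

/-- The two-form `F` with both indices raised by `G`. -/
def raisedMatrix (G F : Matrix (Fin 4) (Fin 4) ℝ) : Matrix (Fin 4) (Fin 4) ℝ :=
  G⁻¹ * F * G⁻¹ᵀ

/-- The Maxwell energy-momentum tensor in matrix form. -/
def stressMatrix (G F : Matrix (Fin 4) (Fin 4) ℝ) : Matrix (Fin 4) (Fin 4) ℝ :=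
  (2 : ℝ) • (F * G⁻¹ * Fᵀ - ((1 / 4) * (F * (raisedMatrix G F)ᵀ).trace) • G)

/-- The right-hand side of the Einstein equation in matrix form. -/
def einsteinSource (Λ : ℝ) (G F : Matrix (Fin 4) (Fin 4) ℝ) : Matrix (Fin 4) (Fin 4) ℝ :=
  Λ • G + stressMatrix G F - ((1 / 2) * (G⁻¹ * (stressMatrix G F)ᵀ).trace) • G

/-- The bivector density `½ εⁱʲᵏˡ Fₖₗ`. -/
def hodgeDual (F : Matrix (Fin 4) (Fin 4) ℝ) : Matrix (Fin 4) (Fin 4) ℝ :=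
  !![0, F 2 3, F 3 1, F 1 2; F 3 2, 0, F 0 3, F 2 0; F 1 3, F 3 0, 0, F 0 1;
    F 2 1, F 0 2, F 1 0, 0]

theorem inv_transpose_mul_mul (G J : Matrix (Fin 4) (Fin 4) ℝ) :
    (Jᵀ * G * J)⁻¹ = J⁻¹ * G⁻¹ * J⁻¹ᵀ := by
  rw [Matrix.mul_inv_rev, Matrix.mul_inv_rev, Matrix.transpose_nonsing_inv, Matrix.mul_assoc]

theorem raisedMatrix_congruence (hJ : IsUnit J.det) :
    raisedMatrix (Jᵀ * G * J) (Jᵀ * F * J) = J⁻¹ * raisedMatrix G F * J⁻¹ᵀ := by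
  have h1 : J * J⁻¹ = 1 := Matrix.mul_nonsing_inv J hJ
  have h2 : J⁻¹ᵀ * Jᵀ = 1 := by rw [← Matrix.transpose_mul, h1, Matrix.transpose_one]
  unfold raisedMatrix
  rw [inv_transpose_mul_mul]
  simp only [Matrix.transpose_mul, Matrix.transpose_transpose, Matrix.mul_assoc]
  rw [← Matrix.mul_assoc J⁻¹ᵀ Jᵀ, h2, Matrix.one_mul, ← Matrix.mul_assoc J J⁻¹, h1, Matrix.one_mul]

theorem stressMatrix_congruence (hJ : IsUnit J.det) :
    stressMatrix (Jᵀ * G * J) (Jᵀ * F * J) = Jᵀ * stressMatrix G F * J := by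
  have h1 : J * J⁻¹ = 1 := Matrix.mul_nonsing_inv J hJ
  have h2 : J⁻¹ᵀ * Jᵀ = 1 := by rw [← Matrix.transpose_mul, h1, Matrix.transpose_one]
  have h3 : Jᵀ * F * J * (Jᵀ * G * J)⁻¹ * (Jᵀ * F * J)ᵀ = Jᵀ * (F * G⁻¹ * Fᵀ) * J := by
    rw [inv_transpose_mul_mul]
    simp only [Matrix.transpose_mul, Matrix.transpose_transpose, Matrix.mul_assoc]
    rw [← Matrix.mul_assoc J⁻¹ᵀ Jᵀ, h2, Matrix.one_mul, ← Matrix.mul_assoc J J⁻¹, h1,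
      Matrix.one_mul]
  have h4 : (Jᵀ * F * J * (raisedMatrix (Jᵀ * G * J) (Jᵀ * F * J))ᵀ).trace
      = (F * (raisedMatrix G F)ᵀ).trace := by
    rw [raisedMatrix_congruence hJ]
    simp only [Matrix.transpose_mul, Matrix.transpose_transpose, Matrix.mul_assoc]
    rw [← Matrix.mul_assoc J J⁻¹, h1, Matrix.one_mul, Matrix.trace_mul_comm]
    simp only [Matrix.mul_assoc]
    rw [h2, Matrix.mul_one]
  unfold stressMatrix
  rw [h3, h4]
  simp only [Matrix.mul_smul, Matrix.smul_mul, Matrix.mul_sub, Matrix.sub_mul]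

theorem einsteinSource_congruence (Λ : ℝ) (hJ : IsUnit J.det) :
    einsteinSource Λ (Jᵀ * G * J) (Jᵀ * F * J) = Jᵀ * einsteinSource Λ G F * J := by
  have h1 : J * J⁻¹ = 1 := Matrix.mul_nonsing_inv J hJ
  have h2 : J⁻¹ᵀ * Jᵀ = 1 := by rw [← Matrix.transpose_mul, h1, Matrix.transpose_one]
  unfold einsteinSource
  rw [stressMatrix_congruence hJ]
  have h3 : ((Jᵀ * G * J)⁻¹ * (Jᵀ * stressMatrix G F * J)ᵀ).trace
      = (G⁻¹ * (stressMatrix G F)ᵀ).trace := by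
    rw [inv_transpose_mul_mul]
    simp only [Matrix.transpose_mul, Matrix.transpose_transpose, Matrix.mul_assoc]
    rw [← Matrix.mul_assoc J⁻¹ᵀ Jᵀ, h2, Matrix.one_mul, Matrix.trace_mul_comm]
    simp only [Matrix.mul_assoc]
    rw [h1, Matrix.mul_one]
  rw [h3]
  simp only [Matrix.mul_smul, Matrix.smul_mul, Matrix.mul_sub, Matrix.sub_mul, Matrix.mul_add,
    Matrix.add_mul]

/-- The dual is formed with the Levi-Civita symbol alone and no metric, so it is a bivector density:
contracting the symbol with four Jacobian columns produces the determinant. The proof checks this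
polynomial identity in the six entries of F. -/
theorem hodgeDual_congruence (hF : ∀ i j, F i j = -F j i) :
    J * hodgeDual (Jᵀ * F * J) * Jᵀ = J.det • hodgeDual F := by
  obtain ⟨a, b, c, d, e, f, rfl⟩ : ∃ a b c d e f,
      F = !![0, a, b, c; -a, 0, d, e; -b, -d, 0, f; -c, -e, -f, 0] := by
    refine ⟨F 0 1, F 0 2, F 0 3, F 1 2, F 1 3, F 2 3, ?_⟩
    have h0 : ∀ i, F i i = 0 := fun i => by linarith [hF i i]
    ext i j
    fin_cases i <;> fin_cases j <;> simp [h0] <;> exact hF _ _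
  ext i j
  have e1 : ∀ k l, (Jᵀ * !![0, a, b, c; -a, 0, d, e; -b, -d, 0, f; -c, -e, -f, 0] * J) k l
      = a * (J 0 k * J 1 l - J 1 k * J 0 l) + b * (J 0 k * J 2 l - J 2 k * J 0 l)
        + c * (J 0 k * J 3 l - J 3 k * J 0 l) + d * (J 1 k * J 2 l - J 2 k * J 1 l)
        + e * (J 1 k * J 3 l - J 3 k * J 1 l) + f * (J 2 k * J 3 l - J 3 k * J 2 l) := by
    intro k l
    simp [Matrix.mul_apply, Fin.sum_univ_four]
    ring
  have e2 : J.det = J 0 0 * (J 1 1 * (J 2 2 * J 3 3 - J 2 3 * J 3 2)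
        - J 1 2 * (J 2 1 * J 3 3 - J 2 3 * J 3 1) + J 1 3 * (J 2 1 * J 3 2 - J 2 2 * J 3 1))
      - J 0 1 * (J 1 0 * (J 2 2 * J 3 3 - J 2 3 * J 3 2)
        - J 1 2 * (J 2 0 * J 3 3 - J 2 3 * J 3 0) + J 1 3 * (J 2 0 * J 3 2 - J 2 2 * J 3 0))
      + J 0 2 * (J 1 0 * (J 2 1 * J 3 3 - J 2 3 * J 3 1)
        - J 1 1 * (J 2 0 * J 3 3 - J 2 3 * J 3 0) + J 1 3 * (J 2 0 * J 3 1 - J 2 1 * J 3 0))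
      - J 0 3 * (J 1 0 * (J 2 1 * J 3 2 - J 2 2 * J 3 1)
        - J 1 1 * (J 2 0 * J 3 2 - J 2 2 * J 3 0) + J 1 2 * (J 2 0 * J 3 1 - J 2 1 * J 3 0)) := by
    simp [Matrix.det_succ_row_zero, Fin.sum_univ_succ, Fin.succAbove]
    ring
  rw [Matrix.smul_apply, e2]
  simp only [Matrix.mul_apply, Fin.sum_univ_four, Matrix.transpose_apply, hodgeDual, e1]
  fin_cases i <;> fin_cases j <;> simp <;> ring

end MatrixForm

/-- The Einstein equation at `p` for the Maxwell field `dA`, together with `⋆dA = σ dB`. -/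
structure IsElectrovacAt (Λ σ : ℝ) (g : E4 → Matrix (Fin 4) (Fin 4) ℝ) (A B : Fin 4 → E4 → ℝ)
    (p : E4) : Prop where
  einstein : (Matrix.of fun i j => ricci g i j p) = einsteinSource Λ (g p) (fieldStrength A p)
  duality : √|(g p).det| • raisedMatrix (g p) (fieldStrength A p)
    = σ • hodgeDual (fieldStrength B p)

theorem raised_eq (g F : E4 → Matrix (Fin 4) (Fin 4) ℝ) (i j : Fin 4) (p : E4) :
    raised g F i j p = raisedMatrix (g p) (F p) i j := by
  simp only [raised, raisedMatrix, Matrix.mul_apply, Matrix.transpose_apply, Finset.sum_mul]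
  rw [Finset.sum_comm]
  exact Finset.sum_congr rfl fun a _ => Finset.sum_congr rfl fun b _ => by ring

theorem maxwellStress_eq (g F : E4 → Matrix (Fin 4) (Fin 4) ℝ) (i j : Fin 4) (p : E4) :
    maxwellStress g F i j p = stressMatrix (g p) (F p) i j := by
  have h1 : ∑ k, ∑ l, (g p)⁻¹ k l * F p i k * F p j l = (F p * (g p)⁻¹ * (F p)ᵀ) i j := by
    simp only [Matrix.mul_apply, Matrix.transpose_apply, Finset.sum_mul]
    rw [Finset.sum_comm]
    exact Finset.sum_congr rfl fun a _ => Finset.sum_congr rfl fun b _ => by ring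
  have h2 : ∑ k, ∑ l, F p k l * raised g F k l p
      = (F p * (raisedMatrix (g p) (F p))ᵀ).trace := by
    simp only [Matrix.trace, Matrix.diag, Matrix.mul_apply, Matrix.transpose_apply, raised_eq]
  rw [maxwellStress, h1, h2]
  simp only [stressMatrix, Matrix.smul_apply, Matrix.sub_apply, smul_eq_mul]

theorem einsteinSource_apply (Λ : ℝ) (g F : E4 → Matrix (Fin 4) (Fin 4) ℝ) (i j : Fin 4) (p : E4) :
    Λ * g p i j + maxwellStress g F i j p
      - (1 / 2) * (∑ k, ∑ l, (g p)⁻¹ k l * maxwellStress g F k l p) * g p i j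
      = einsteinSource Λ (g p) (F p) i j := by
  have h : ∑ k, ∑ l, (g p)⁻¹ k l * stressMatrix (g p) (F p) k l
      = ((g p)⁻¹ * (stressMatrix (g p) (F p))ᵀ).trace := by
    simp only [Matrix.trace, Matrix.diag, Matrix.mul_apply, Matrix.transpose_apply]
  simp only [maxwellStress_eq, h]
  simp only [einsteinSource, Matrix.sub_apply, Matrix.add_apply, Matrix.smul_apply, smul_eq_mul]

/-- The divergence of the dual density has the cyclic derivatives of dB as components, so it
vanishes by d² = 0. -/
theorem hodgeDual_divergence {B : Fin 4 → E4 → ℝ} {p : E4} (h : ∀ i, ContDiffAt ℝ ∞ (B i) p)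
    (j : Fin 4) : ∑ i, pd i (fun q => hodgeDual (fieldStrength B q) i j) p = 0 := by
  have hb := fieldStrength_bianchi h
  have h0 : ∀ k, pd k (fun _ : E4 => (0 : ℝ)) p = 0 := fun k => by simp [pd]
  have key : ∀ k a b, pd k (fun q => fieldStrength B q a b) p
      = -pd k (fun q => fieldStrength B q b a) p := fun k a b => by
    have : (fun q => fieldStrength B q a b) = fun q => -fieldStrength B q b a := by
      funext q
      exact fieldStrength_antisymm B q a b
    rw [this]
    simp [pd]
  rw [Fin.sum_univ_four]
  fin_cases j
  · have := hb 1 3 2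
    simp [hodgeDual, h0]
    linarith [key 1 3 2]
  · have := hb 0 2 3
    simp [hodgeDual, h0]
    linarith [key 0 2 3]
  · have := hb 0 3 1
    simp [hodgeDual, h0]
    linarith [key 0 3 1]
  · have := hb 0 1 2
    simp [hodgeDual, h0]
    linarith [key 0 1 2]

/-- With a dual potential B, the Maxwell equation is the Bianchi identity for dB. The electrovacuum
condition is then pointwise in the curvature and the field strengths, which makes it convenient for
changes of coordinates and for passage to limits. -/
theorem SolvesEinsteinMaxwell.of_isElectrovacAt {Λ σ : ℝ} {g : E4 → Matrix (Fin 4) (Fin 4) ℝ}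
    {A B : Fin 4 → E4 → ℝ} {U : Set E4} (hU : IsOpen U)
    (hg : ∀ i j, ContDiffOn ℝ ∞ (fun p => g p i j) U)
    (hs : ∀ p ∈ U, ∀ i j, g p i j = g p j i) (hdet : ∀ p ∈ U, (g p).det ≠ 0)
    (hA : ∀ i, ContDiffOn ℝ ∞ (A i) U) (hB : ∀ i, ContDiffOn ℝ ∞ (B i) U)
    (h : ∀ p ∈ U, IsElectrovacAt Λ σ g A B p) :
    SolvesEinsteinMaxwell Λ g (fieldStrength A) U where
  smooth_metric := hg
  smooth_field i j p hp := (contDiffAt_fieldStrength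
    (fun i => (hA i).contDiffAt (hU.mem_nhds hp)) i j).contDiffWithinAt
  symm := hs
  nondegenerate := hdet
  antisymm p _ := fieldStrength_antisymm A p
  einstein p hp i j := by
    rw [einsteinSource_apply, ← (h p hp).einstein]
    rfl
  bianchi p hp := fieldStrength_bianchi fun i => (hA i).contDiffAt (hU.mem_nhds hp)
  maxwell p hp j := by
    have hBp : ∀ i, ContDiffAt ℝ ∞ (B i) p := fun i => (hB i).contDiffAt (hU.mem_nhds hp)
    have key : ∀ i, pd i (fun q => √|(g q).det| * raised g (fieldStrength A) i j q) p
        = σ * pd i (fun q => hodgeDual (fieldStrength B q) i j) p := fun i => by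
      have : (fun q => √|(g q).det| * raised g (fieldStrength A) i j q)
          =ᶠ[𝓝 p] fun q => σ * hodgeDual (fieldStrength B q) i j := by
        filter_upwards [hU.mem_nhds hp] with q hq
        have := congrFun (congrFun (h q hq).duality i) j
        rwa [Matrix.smul_apply, Matrix.smul_apply, smul_eq_mul, smul_eq_mul, ← raised_eq] at this
      rw [this.pd_eq]
      have hd : DifferentiableAt ℝ (fun q => hodgeDual (fieldStrength B q) i j) p := by
        have hf := fun a b => (contDiffAt_fieldStrength hBp a b).differentiableAt (by simp)
        fin_cases i <;> fin_cases j <;>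
          first | exact differentiableAt_const _ | exact hf _ _
      simp [pd, fderiv_const_mul hd]
    simp only [key, ← Finset.mul_sum, hodgeDual_divergence hBp, mul_zero]

/-! ### Positivity of the continued metrics and their Maxwell fields -/

section PageSolution

variable {α Λ c : ℝ}

theorem posDef_biaxialMatrix {A B C s c : ℝ} (hA : 0 < A) (hB : 0 < B) (hC : 0 < C) (hs : s ≠ 0) :
    (biaxialMatrix A B C s c).PosDef := by
  refine Matrix.PosDef.of_dotProduct_mulVec_pos ?_ fun v hv => ?_
  · ext i j
    fin_cases i <;> fin_cases j <;> simp [biaxialMatrix]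
  · have e : star v ⬝ᵥ (biaxialMatrix A B C s c *ᵥ v)
        = A * v 0 ^ 2 + B * (v 1 + c * v 3) ^ 2 + C * v 2 ^ 2 + C * (s * v 3) ^ 2 := by
      simp [biaxialMatrix, Matrix.mulVec, dotProduct, Fin.sum_univ_four]
      ring
    rw [e]
    by_contra hn
    have h0 : 0 ≤ A * v 0 ^ 2 := by positivity
    have h1 : 0 ≤ B * (v 1 + c * v 3) ^ 2 := by positivity
    have h2 : 0 ≤ C * v 2 ^ 2 := by positivity
    have h3 : 0 ≤ C * (s * v 3) ^ 2 := by positivity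
    have z0 : A * v 0 ^ 2 = 0 := by linarith
    have z1 : B * (v 1 + c * v 3) ^ 2 = 0 := by linarith
    have z2 : C * v 2 ^ 2 = 0 := by linarith
    have z3 : C * (s * v 3) ^ 2 = 0 := by linarith
    have y0 : v 0 = 0 := by simpa [hA.ne'] using z0
    have y2 : v 2 = 0 := by simpa [hC.ne'] using z2
    have y3 : v 3 = 0 := by simpa [hC.ne', hs] using z3
    have y1 : v 1 = 0 := by simpa [hB.ne', y3] using z1
    refine hv (funext fun i => ?_)
    fin_cases i
    exacts [y0, y1, y2, y3]

theorem posDef_pageMetric (hα : α ≠ 0) {p : E4} (hp : p ∈ pageDomain α Λ c) :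
    (pageMetric α Λ c p).PosDef := by
  obtain ⟨hx, hP, hθ, hθ'⟩ := hp
  have hD := abs_lt_one_sq hx
  rw [pageMetric_eq]
  exact posDef_biaxialMatrix (by positivity) (by positivity) (by positivity)
    (sin_pos_of_pos_of_lt_pi hθ hθ').ne'

theorem contDiffAt_pageMetric {p : E4} (hp : p ∈ pageDomain α Λ c) (i j : Fin 4) :
    ContDiffAt ℝ ∞ (fun q => pageMetric α Λ c q i j) p := by
  obtain ⟨hx, hP, hθ, hθ'⟩ := hp
  have hD := (abs_lt_one_sq hx).ne'
  have h0 : ContDiffAt ℝ ∞ (fun q : E4 => q 0) p := by fun_prop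
  have h2 : ContDiffAt ℝ ∞ (fun q : E4 => q 2) p := by fun_prop
  have hD' : ContDiffAt ℝ ∞ (fun q : E4 => 1 - q 0 ^ 2) p := by fun_prop
  have hP' : ContDiffAt ℝ ∞ (fun q : E4 => pageP α Λ c (q 0)) p := by
    unfold pageP
    fun_prop
  have hs : ContDiffAt ℝ ∞ (fun q : E4 => sin (q 2)) p := by fun_prop
  have hc : ContDiffAt ℝ ∞ (fun q : E4 => cos (q 2)) p := by fun_prop
  have hA := (contDiffAt_const (c := α ^ 2).mul hD').div hP' hP.ne'
  have hB := (contDiffAt_const (c := 4 * α ^ 2).mul hP').div hD' hD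
  have hC := contDiffAt_const (c := α ^ 2).mul hD'
  simp only [pageMetric_eq]
  fin_cases i <;> fin_cases j <;>
    first
    | exact contDiffAt_const
    | exact hA
    | exact hB
    | exact hC
    | exact hB.mul hc
    | exact (hB.mul (hc.pow 2)).add (hC.mul (hs.pow 2))

/-- The profile of the potential of the Maxwell field. -/
def pageProfile (a b x : ℝ) : ℝ := a * ((1 + x) / (1 - x)) + b * ((1 - x) / (1 + x))

/-- The potential `h(x) (dψ + cos θ dφ)`. -/
def pagePotential (a b : ℝ) (i : Fin 4) (p : E4) : ℝ :=
  match i with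
  | 0 => 0
  | 1 => pageProfile a b (p 0)
  | 2 => 0
  | 3 => pageProfile a b (p 0) * cos (p 2)

/-- Matrix form of the field of a potential `h(x) (dψ + cos θ dφ)` with `d = h'(x)`. -/
def biaxialField (h d s c : ℝ) : Matrix (Fin 4) (Fin 4) ℝ :=
  !![0, d, 0, d * c; -d, 0, 0, 0; 0, 0, 0, -(h * s); -(d * c), 0, h * s, 0]

theorem hasDerivAt_pageProfile (a b : ℝ) {x : ℝ} (h1 : 1 - x ≠ 0) (h2 : 1 + x ≠ 0) :
    HasDerivAt (pageProfile a b) (2 * a / (1 - x) ^ 2 - 2 * b / (1 + x) ^ 2) x := by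
  have hx := hasDerivAt_id' x
  have := (((hx.const_add 1).div (hx.const_sub 1) h1).const_mul a).add
    (((hx.const_sub 1).div (hx.const_add 1) h2).const_mul b)
  refine this.congr_deriv ?_
  field_simp
  ring

theorem fieldStrength_pagePotential (a b : ℝ) {p : E4} (h1 : 1 - p 0 ≠ 0) (h2 : 1 + p 0 ≠ 0) :
    fieldStrength (pagePotential a b) p = biaxialField (pageProfile a b (p 0))
      (2 * a / (1 - p 0) ^ 2 - 2 * b / (1 + p 0) ^ 2) (sin (p 2)) (cos (p 2)) := by
  have g0 : ∀ i, pd i (pagePotential a b 0) p = 0 := fun i => by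
    change pd i (fun _ => (0 : ℝ)) p = 0
    simp [pd]
  have g2 : ∀ i, pd i (pagePotential a b 2) p = 0 := fun i => by
    change pd i (fun _ => (0 : ℝ)) p = 0
    simp [pd]
  have hh := (hasGrad_coord (p := p) 0).comp (hasDerivAt_pageProfile a b h1 h2)
  have hc := (hasGrad_coord (p := p) 2).comp (hasDerivAt_cos (p 2))
  have g1 : ∀ i, pd i (pagePotential a b 1) p = _ := hh.pd
  have g3 : ∀ i, pd i (pagePotential a b 3) p = _ := (hh.mul hc).pd
  ext i j
  simp only [fieldStrength, Matrix.of_apply]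
  fin_cases i <;> fin_cases j <;> simp [g0, g1, g2, g3, biaxialField] <;> ring

theorem contDiffAt_pagePotential (a b : ℝ) {p : E4} (h1 : 1 - p 0 ≠ 0) (h2 : 1 + p 0 ≠ 0)
    (i : Fin 4) : ContDiffAt ℝ ∞ (pagePotential a b i) p := by
  have hh : ContDiffAt ℝ ∞ (fun q : E4 => pageProfile a b (q 0)) p := by
    unfold pageProfile
    have hs : ContDiffAt ℝ ∞ (fun q : E4 => 1 + q 0) p := by fun_prop
    have hd : ContDiffAt ℝ ∞ (fun q : E4 => 1 - q 0) p := by fun_prop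
    exact (contDiffAt_const.mul (hs.div hd h1)).add (contDiffAt_const.mul (hd.div hs h2))
  fin_cases i
  · exact contDiffAt_const
  · exact hh
  · exact contDiffAt_const
  · exact hh.mul (by fun_prop)

theorem raisedMatrix_biaxial {A B C s c h d : ℝ} (hA : A ≠ 0) (hB : B ≠ 0) (hC : C ≠ 0)
    (hs : s ≠ 0) : raisedMatrix (biaxialMatrix A B C s c) (biaxialField h d s c) =
      !![0, d / (A * B), 0, 0; -(d / (A * B)), 0, -(h * c / (C ^ 2 * s)), 0;
        0, h * c / (C ^ 2 * s), 0, -(h / (C ^ 2 * s)); 0, 0, h / (C ^ 2 * s), 0] := by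
  rw [raisedMatrix, biaxialMatrix_inv c hA hB hC hs]
  ext i j
  fin_cases i <;> fin_cases j <;>
    simp [biaxialInv, biaxialField, Matrix.mul_apply, Fin.sum_univ_four]
  all_goals field_simp
  all_goals try simp
  all_goals try ring

/-- The field has one component along the (x, ψ) directions and one along the sphere. Its stress is
a multiple of the metric with the sphere block reversed, and in dimension 2 + 2 such a tensor is
traceless. -/
theorem stressMatrix_biaxial {A B C s c h d : ℝ} (hA : A ≠ 0) (hB : B ≠ 0) (hC : C ≠ 0)
    (hs : s ≠ 0) : stressMatrix (biaxialMatrix A B C s c) (biaxialField h d s c) =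
      (d ^ 2 / (A * B) - h ^ 2 / C ^ 2) • biaxialMatrix A B (-C) s c := by
  have ht : (biaxialField h d s c
      * (raisedMatrix (biaxialMatrix A B C s c) (biaxialField h d s c))ᵀ).trace
      = 2 * (d ^ 2 / (A * B) + h ^ 2 / C ^ 2) := by
    rw [raisedMatrix_biaxial hA hB hC hs]
    simp only [Matrix.trace, Matrix.diag, Matrix.mul_apply, Matrix.transpose_apply,
      Fin.sum_univ_four]
    simp [biaxialField]
    field_simp
    ring
  have hT : (biaxialField h d s c)ᵀ = biaxialField (-h) (-d) s c := by
    ext i j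
    fin_cases i <;> fin_cases j <;> simp [biaxialField]
  rw [stressMatrix, ht, hT, biaxialMatrix_inv c hA hB hC hs]
  ext i j
  fin_cases i <;> fin_cases j <;>
    simp [biaxialMatrix, biaxialInv, biaxialField, Matrix.mul_apply, Fin.sum_univ_four]
  all_goals field_simp
  all_goals try simp
  all_goals try ring

theorem einsteinSource_biaxial {A B C s c h d : ℝ} (hA : A ≠ 0) (hB : B ≠ 0) (hC : C ≠ 0)
    (hs : s ≠ 0) : einsteinSource Λ (biaxialMatrix A B C s c) (biaxialField h d s c) =
      Λ • biaxialMatrix A B C s c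
        + (d ^ 2 / (A * B) - h ^ 2 / C ^ 2) • biaxialMatrix A B (-C) s c := by
  have ht : ((biaxialMatrix A B C s c)⁻¹ * (biaxialMatrix A B (-C) s c)ᵀ).trace = 0 := by
    rw [biaxialMatrix_inv c hA hB hC hs]
    simp only [Matrix.trace, Matrix.diag, Matrix.mul_apply, Matrix.transpose_apply,
      Fin.sum_univ_four]
    simp [biaxialMatrix, biaxialInv]
    field_simp
    ring
  rw [einsteinSource, stressMatrix_biaxial hA hB hC hs, Matrix.transpose_smul, Matrix.mul_smul,
    Matrix.trace_smul, ht]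
  simp

/-- Up to the common factor α⁻⁴ the two squares in the stress are (a/(1-x)² - b/(1+x)²)² and
(a/(1-x)² + b/(1+x)²)². Their difference contains only ab and reproduces the traceless Ricci part.
Duality exchanges h' with a multiple of h, which amounts to the sign change of a. -/
theorem isElectrovacAt_pageMetric (hα : α ≠ 0) {a b : ℝ} (hab : a * b = -(c * α ^ 2 / 4)) {p : E4}
    (hp : p ∈ pageDomain α Λ c) :
    IsElectrovacAt Λ 1 (pageMetric α Λ c) (pagePotential a b) (pagePotential (-a) b) p := by
  have hric := ricci_pageMetric hα hp
  obtain ⟨hx, hP, hθ, hθ'⟩ := hp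
  have hD := abs_lt_one_sq hx
  have h1 : 1 - p 0 ≠ 0 := by linarith [(abs_lt.1 hx).2] |> fun h : 0 < 1 - p 0 => h.ne'
  have h2 : 1 + p 0 ≠ 0 := by linarith [(abs_lt.1 hx).1] |> fun h : 0 < 1 + p 0 => h.ne'
  have hs := sin_pos_of_pos_of_lt_pi hθ hθ'
  have hf : 1 - p 0 ^ 2 = (1 - p 0) * (1 + p 0) := by ring
  have hα2 : 0 < α ^ 2 := by positivity
  constructor
  · ext i j
    rw [Matrix.of_apply, hric, pageMetric_eq, fieldStrength_pagePotential a b h1 h2,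
      einsteinSource_biaxial (by positivity) (by positivity) (by positivity) hs.ne']
    have hc : c = -(4 * (a * b) / α ^ 2) := by
      rw [hab]
      field_simp
    have hτ : (2 * a / (1 - p 0) ^ 2 - 2 * b / (1 + p 0) ^ 2) ^ 2 /
        (α ^ 2 * (1 - p 0 ^ 2) / pageP α Λ c (p 0) *
          (4 * α ^ 2 * pageP α Λ c (p 0) / (1 - p 0 ^ 2)))
        - pageProfile a b (p 0) ^ 2 / (α ^ 2 * (1 - p 0 ^ 2)) ^ 2
        = c / (α ^ 2 * (1 - p 0 ^ 2) ^ 2) := by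
      have e : α ^ 2 * (1 - p 0 ^ 2) / pageP α Λ c (p 0) *
          (4 * α ^ 2 * pageP α Λ c (p 0) / (1 - p 0 ^ 2)) = 4 * α ^ 4 := by
        field_simp
      rw [e, pageProfile, hf]
      generalize pageP α Λ c (p 0) = P at *
      rw [hc]
      field_simp
      ring
    rw [hτ]
    generalize c / (α ^ 2 * (1 - p 0 ^ 2) ^ 2) = τ
    fin_cases i <;> fin_cases j <;> simp [biaxialMatrix] <;> ring
  · have hdet : √|(pageMetric α Λ c p).det| = 2 * α ^ 4 * (1 - p 0 ^ 2) * sin (p 2) := by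
      have : (pageMetric α Λ c p).det = (2 * α ^ 4 * (1 - p 0 ^ 2) * sin (p 2)) ^ 2 := by
        rw [pageMetric_eq, biaxialMatrix_det]
        field_simp
        ring
      rw [this, abs_of_nonneg (by positivity), Real.sqrt_sq (by positivity)]
    rw [hdet, pageMetric_eq, fieldStrength_pagePotential a b h1 h2,
      fieldStrength_pagePotential (-a) b h1 h2,
      raisedMatrix_biaxial (by positivity) (by positivity) (by positivity) hs.ne', one_smul]
    ext i j
    have h3 := hs.ne'
    fin_cases i <;> fin_cases j <;>
      simp [hodgeDual, biaxialField, pageProfile, hf] <;> field_simp <;> ring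

theorem solvesEinsteinMaxwell_pageMetric (hα : α ≠ 0) {a b : ℝ}
    (hab : a * b = -(c * α ^ 2 / 4)) :
    SolvesEinsteinMaxwell Λ (pageMetric α Λ c) (fieldStrength (pagePotential a b))
      (pageDomain α Λ c) := by
  have hx : ∀ p ∈ pageDomain α Λ c, 1 - p 0 ≠ 0 ∧ 1 + p 0 ≠ 0 := fun p hp =>
    ⟨by linarith [(abs_lt.1 hp.1).2] |> fun h : 0 < 1 - p 0 => h.ne',
      by linarith [(abs_lt.1 hp.1).1] |> fun h : 0 < 1 + p 0 => h.ne'⟩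
  refine .of_isElectrovacAt (σ := 1) (B := pagePotential (-a) b) (isOpen_pageDomain α Λ c)
    (fun i j p hp => (contDiffAt_pageMetric hp i j).contDiffWithinAt) (fun p _ i j => ?_)
    (fun p hp => (posDef_pageMetric hα hp).det_pos.ne')
    (fun i p hp => (contDiffAt_pagePotential a b (hx p hp).1 (hx p hp).2 i).contDiffWithinAt)
    (fun i p hp => (contDiffAt_pagePotential (-a) b (hx p hp).1 (hx p hp).2 i).contDiffWithinAt)
    (fun p hp => isElectrovacAt_pageMetric hα hab hp)
  rw [pageMetric_eq]
  fin_cases i <;> fin_cases j <;> rfl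

theorem scalarCurvature_pageMetric (hα : α ≠ 0) {p : E4} (hp : p ∈ pageDomain α Λ c) :
    scalarCurvature (pageMetric α Λ c) p = 4 * Λ := by
  have hric := ricci_pageMetric hα hp
  obtain ⟨hx, hP, hθ, hθ'⟩ := hp
  have hD := abs_lt_one_sq hx
  have hs := (sin_pos_of_pos_of_lt_pi hθ hθ').ne'
  unfold scalarCurvature
  simp only [hric]
  rw [pageMetric_eq, biaxialMatrix_inv _ (by positivity) (by positivity) (by positivity) hs]
  generalize c / (α ^ 2 * (1 - p 0 ^ 2) ^ 2) = τ
  have hA : α ^ 2 * (1 - p 0 ^ 2) / pageP α Λ c (p 0) ≠ 0 := by positivity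
  have hB : 4 * α ^ 2 * pageP α Λ c (p 0) / (1 - p 0 ^ 2) ≠ 0 := by positivity
  have hC : α ^ 2 * (1 - p 0 ^ 2) ≠ 0 := by positivity
  generalize α ^ 2 * (1 - p 0 ^ 2) / pageP α Λ c (p 0) = A at *
  generalize 4 * α ^ 2 * pageP α Λ c (p 0) / (1 - p 0 ^ 2) = B at *
  generalize α ^ 2 * (1 - p 0 ^ 2) = C at *
  simp [biaxialMatrix, biaxialInv, Fin.sum_univ_four]
  field_simp
  ring

end PageSolution

/-! ### Covariance of the Ricci tensor -/

section Covariance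

open Matrix (of)

/-- Entrywise partial derivative of a matrix-valued function. -/
def mpd (l : Fin 4) (f : E4 → Matrix (Fin 4) (Fin 4) ℝ) (p : E4) : Matrix (Fin 4) (Fin 4) ℝ :=
  of fun i j => pd l (fun q => f q i j) p

/-- Smoothness of the entries of a matrix-valued function. -/
def MSmoothAt (f : E4 → Matrix (Fin 4) (Fin 4) ℝ) (p : E4) : Prop :=
  ∀ i j, ContDiffAt ℝ ∞ (fun q => f q i j) p

variable {f g g' : E4 → Matrix (Fin 4) (Fin 4) ℝ} {Ψ : E4 → E4} {p : E4} {U : Set E4}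

theorem MSmoothAt.differentiableAt (h : MSmoothAt f p) (i j : Fin 4) :
    DifferentiableAt ℝ (fun q => f q i j) p :=
  (h i j).differentiableAt (by simp)

theorem MSmoothAt.mul (hf : MSmoothAt f p) (hg : MSmoothAt g p) :
    MSmoothAt (fun q => f q * g q) p := fun i j => by
  simp only [Matrix.mul_apply]
  exact ContDiffAt.sum fun k _ => (hf i k).mul (hg k j)

theorem MSmoothAt.transpose (hf : MSmoothAt f p) : MSmoothAt (fun q => (f q)ᵀ) p := fun i j =>
  hf j i

theorem MSmoothAt.det (hf : MSmoothAt f p) : ContDiffAt ℝ ∞ (fun q => (f q).det) p := by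
  simp only [Matrix.det_apply]
  refine ContDiffAt.sum fun σ _ => ?_
  simp only [Units.smul_def, ← Int.cast_smul_eq_zsmul ℝ]
  have := contDiffAt_prod (𝕜 := ℝ) (n := ∞) (x := p) (t := Finset.univ)
    (f := fun i q => f q (σ i) i) fun i _ => hf _ _
  exact (contDiffAt_const (c := ((Equiv.Perm.sign σ : ℤ) : ℝ))).mul this

theorem MSmoothAt.inv (hf : MSmoothAt f p) (h : (f p).det ≠ 0) :
    MSmoothAt (fun q => (f q)⁻¹) p := fun i j => by
  have : (fun q => (f q)⁻¹ i j) = fun q => (f q).det⁻¹ * ((f q).updateRow j (Pi.single i 1)).det := by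
    funext q
    rw [Matrix.inv_def, Matrix.smul_apply, Matrix.adjugate_apply, Ring.inverse_eq_inv', smul_eq_mul]
  rw [this]
  refine (hf.det.inv h).mul (MSmoothAt.det fun a b => ?_)
  simp only [Matrix.updateRow_apply]
  split_ifs
  · exact contDiffAt_const
  · exact hf a b

theorem mpd_mul (hf : MSmoothAt f p) (hg : MSmoothAt g p) (l : Fin 4) :
    mpd l (fun q => f q * g q) p = mpd l f p * g p + f p * mpd l g p := by
  ext i j
  simp only [mpd, Matrix.of_apply, Matrix.add_apply, Matrix.mul_apply]
  have := fun k => (hf.differentiableAt i k).hasFDerivAt.fun_mul (hg.differentiableAt k j).hasFDerivAt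
  rw [pd, (HasFDerivAt.fun_sum fun k (_ : k ∈ Finset.univ) => this k).fderiv]
  simp [Finset.sum_add_distrib, pd, mul_comm, add_comm]

theorem mpd_transpose (l : Fin 4) : mpd l (fun q => (f q)ᵀ) p = (mpd l f p)ᵀ := rfl

theorem mpd_add (hf : MSmoothAt f p) (hg : MSmoothAt g p) (l : Fin 4) :
    mpd l (fun q => f q + g q) p = mpd l f p + mpd l g p := by
  ext i j
  exact pd_add (hf.differentiableAt i j) (hg.differentiableAt i j) l

theorem MSmoothAt.mpd (hf : MSmoothAt f p) (l : Fin 4) : MSmoothAt (mpd l f) p := fun i j =>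
  (hf i j).pd l

theorem mpd_congr (h : f =ᶠ[𝓝 p] g) (l : Fin 4) : mpd l f p = mpd l g p := by
  ext i j
  exact Filter.EventuallyEq.pd_eq (h.mono fun q e => congrFun (congrFun e i) j) l

theorem MSmoothAt.congr (hf : MSmoothAt f p) (h : g =ᶠ[𝓝 p] f) : MSmoothAt g p := fun i j =>
  (hf i j).congr_of_eventuallyEq (h.mono fun _ e => congrFun (congrFun e i) j)

theorem mSmoothAt_jacobian (h : ContDiffAt ℝ ∞ Ψ p) : MSmoothAt (jacobian ℝ Ψ) p := fun i j => by
  have h1 := (h.fderiv_right (m := ∞) (by simp)).clm_apply (contDiffAt_const (c := coordVec ℝ j))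
  exact (contDiffAt_piLp 2).1 h1 i

theorem pd_comp {f : E4 → ℝ} (hf : DifferentiableAt ℝ f (Ψ p)) (h : DifferentiableAt ℝ Ψ p)
    (l : Fin 4) : pd l (fun q => f (Ψ q)) p = ∑ c, jacobian ℝ Ψ p c l * pd c f (Ψ p) := by
  have h1 := hf.hasFDerivAt.comp p h.hasFDerivAt
  have h2 : pd l (fun q => f (Ψ q)) p = fderiv ℝ f (Ψ p) (fderiv ℝ Ψ p (coordVec ℝ l)) := by
    rw [pd]
    exact congrArg (fun L : E4 →L[ℝ] ℝ => L (coordVec ℝ l)) h1.fderiv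
  rw [h2, eq_sum_coordVec (fderiv ℝ Ψ p (coordVec ℝ l)), map_sum]
  simp [jacobian, pd]

theorem MSmoothAt.comp (hf : MSmoothAt f (Ψ p)) (h : ContDiffAt ℝ ∞ Ψ p) :
    MSmoothAt (fun q => f (Ψ q)) p := fun i j => (hf i j).comp p h

theorem mpd_comp (hf : MSmoothAt f (Ψ p)) (h : ContDiffAt ℝ ∞ Ψ p) (l : Fin 4) :
    mpd l (fun q => f (Ψ q)) p = ∑ c, jacobian ℝ Ψ p c l • mpd c f (Ψ p) := by
  ext i j
  rw [Matrix.sum_apply]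
  exact pd_comp (hf.differentiableAt i j) (h.differentiableAt (by simp)) l

theorem mpd_jacobian_symm (h : ContDiffAt ℝ ∞ Ψ p) (a i j : Fin 4) :
    mpd i (jacobian ℝ Ψ) p a j = mpd j (jacobian ℝ Ψ) p a i := by
  have h1 : ∀ j, (fun q => jacobian ℝ Ψ q a j) =ᶠ[𝓝 p] pd j (fun q => Ψ q a) := fun j => by
    filter_upwards [(h.of_le (n := ∞) (m := 1) (by norm_cast)).eventually (by norm_num)] with q hq
    exact (fderiv_coord (hq.differentiableAt (by norm_num)) a _).symm
  simp only [mpd, Matrix.of_apply]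
  rw [(h1 j).pd_eq, (h1 i).pd_eq]
  exact pd_pd_comm ((contDiffAt_piLp 2).1 h a) i j

/-- The connection matrices `(Γₐ)ᵏᵦ`. -/
def connMatrix (g : E4 → Matrix (Fin 4) (Fin 4) ℝ) (a : Fin 4) (p : E4) :
    Matrix (Fin 4) (Fin 4) ℝ :=
  of fun k b => christoffel g k a b p

/-- Christoffel symbols of the first kind. -/
def connLower (g : E4 → Matrix (Fin 4) (Fin 4) ℝ) (a : Fin 4) (p : E4) :
    Matrix (Fin 4) (Fin 4) ℝ :=
  of fun l b => (1 / 2) * (mpd a g p b l + mpd b g p a l - mpd l g p a b)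

theorem connMatrix_eq (a : Fin 4) : connMatrix g a p = (g p)⁻¹ * connLower g a p := by
  ext k b
  simp only [connMatrix, connLower, christoffel, Matrix.of_apply, Matrix.mul_apply, Finset.mul_sum,
    mpd]
  exact Finset.sum_congr rfl fun l _ => by ring

/-- The curvature matrices. -/
def curvMatrix (g : E4 → Matrix (Fin 4) (Fin 4) ℝ) (a b : Fin 4) (p : E4) :
    Matrix (Fin 4) (Fin 4) ℝ :=
  mpd a (connMatrix g b) p - mpd b (connMatrix g a) p + connMatrix g a p * connMatrix g b p
    - connMatrix g b p * connMatrix g a p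

theorem christoffel_symm (hs : ∀ᶠ q in 𝓝 p, ∀ i j, g q i j = g q j i) (k i j : Fin 4) :
    christoffel g k i j p = christoffel g k j i p := by
  have : ∀ l, pd l (fun q => g q i j) p = pd l (fun q => g q j i) p := fun l =>
    Filter.EventuallyEq.pd_eq (hs.mono fun q h => h i j) l
  unfold christoffel
  simp only [this]
  congr 1
  exact Finset.sum_congr rfl fun l _ => by ring

/-- In this form the transformation law of curvature is a matrix computation, with the Ricci tensor
as a contraction at the end. Symmetry of the lower Christoffel indices near p is needed because they
are also differentiated. -/
theorem ricci_eq_curvMatrix (hs : ∀ᶠ q in 𝓝 p, ∀ i j, g q i j = g q j i) (i j : Fin 4) :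
    ricci g i j p = ∑ k, curvMatrix g k j p k i := by
  have h1 : ∀ k, christoffel g k i j =ᶠ[𝓝 p] christoffel g k j i := fun k =>
    hs.eventually_nhds.mono fun q h => christoffel_symm h k i j
  have h2 : ∀ k, christoffel g k i k =ᶠ[𝓝 p] christoffel g k k i := fun k =>
    hs.eventually_nhds.mono fun q h => christoffel_symm h k i k
  unfold ricci
  refine Finset.sum_congr rfl fun k _ => ?_
  rw [(h1 k).pd_eq, (h2 k).pd_eq]
  have h3 : ∀ l, christoffel g l i j p = christoffel g l j i p := fun l =>
    christoffel_symm hs l i j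
  have h4 : ∀ l, christoffel g l i k p = christoffel g l k i p := fun l =>
    christoffel_symm hs l i k
  simp only [h3, h4, curvMatrix, Matrix.sub_apply, Matrix.add_apply, Matrix.mul_apply, mpd,
    connMatrix, Matrix.of_apply, Finset.sum_sub_distrib]
  ring

theorem mSmoothAt_connMatrix (hg : MSmoothAt g p) (h : (g p).det ≠ 0) (a : Fin 4) :
    MSmoothAt (connMatrix g a) p := by
  have h1 : connMatrix g a = fun q => (g q)⁻¹ * connLower g a q := funext fun q => connMatrix_eq a
  rw [h1]
  refine (hg.inv h).mul fun l b => contDiffAt_const.mul ?_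
  exact ((hg.mpd a b l).add (hg.mpd b a l)).sub (hg.mpd l a b)

/-- Transformation law of the Christoffel symbols of the first kind. -/
theorem connLower_pullback (hΨ : ContDiffAt ℝ ∞ Ψ p) (hg : MSmoothAt g (Ψ p))
    (hs : ∀ i j, g (Ψ p) i j = g (Ψ p) j i)
    (h : g' =ᶠ[𝓝 p] fun q => (jacobian ℝ Ψ q)ᵀ * g (Ψ q) * jacobian ℝ Ψ q) (i : Fin 4) :
    connLower g' i p = (jacobian ℝ Ψ p)ᵀ *
        (∑ a, jacobian ℝ Ψ p a i • connLower g a (Ψ p)) * jacobian ℝ Ψ p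
      + (jacobian ℝ Ψ p)ᵀ * g (Ψ p) * mpd i (jacobian ℝ Ψ) p := by
  have hJ := mSmoothAt_jacobian hΨ
  have hd : ∀ l, mpd l g' p = _ := fun l => by
    rw [mpd_congr h, mpd_mul (hJ.transpose.mul (hg.comp hΨ)) hJ, mpd_mul hJ.transpose (hg.comp hΨ),
      mpd_comp hg hΨ, mpd_transpose]
  have hH := mpd_jacobian_symm hΨ
  have hT : (g (Ψ p))ᵀ = g (Ψ p) := by
    ext a b
    exact hs b a
  ext l j
  generalize jacobian ℝ Ψ p = J at *
  generalize hHd : (fun i => mpd i (jacobian ℝ Ψ) p) = H at *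
  have hHe : ∀ i, mpd i (jacobian ℝ Ψ) p = H i := fun i => congrFun hHd i
  simp only [hHe] at *
  have e1 : ∀ k i j, ((H k)ᵀ * g (Ψ p) * J) i j = (Jᵀ * g (Ψ p) * H k) j i := fun k i j => by
    have : ((H k)ᵀ * g (Ψ p) * J)ᵀ = Jᵀ * g (Ψ p) * H k := by
      simp [Matrix.transpose_mul, hT, Matrix.mul_assoc]
    rw [← this]
    rfl
  -- Second derivatives of Ψ commute. Of the six Hessian terms in the three metric derivatives, two
  -- pairs cancel and the remaining two are equal, so the factor 1/2 leaves one.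
  have e2 : ∀ k i j, (Jᵀ * g (Ψ p) * H k) i j = (Jᵀ * g (Ψ p) * H j) i k := fun k i j => by
    rw [Matrix.mul_apply, Matrix.mul_apply]
    exact Finset.sum_congr rfl fun x _ => by rw [hH]
  have e3 : ∀ k i j, (Jᵀ * (∑ c, J c k • mpd c g (Ψ p)) * J) i j
      = ∑ c, ∑ a, ∑ b, J c k * J a i * J b j * mpd c g (Ψ p) a b := fun k i j => by
    simp only [Matrix.mul_apply, Matrix.transpose_apply, Matrix.add_apply, Matrix.smul_apply,
      smul_eq_mul, Fin.sum_univ_four]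
    ring
  have e4 : (Jᵀ * (∑ a, J a i • connLower g a (Ψ p)) * J) l j
      = (1 / 2) * ((Jᵀ * (∑ c, J c i • mpd c g (Ψ p)) * J) j l
        + (Jᵀ * (∑ c, J c j • mpd c g (Ψ p)) * J) i l
        - (Jᵀ * (∑ c, J c l • mpd c g (Ψ p)) * J) i j) := by
    rw [e3, e3, e3]
    simp only [Matrix.mul_apply, Matrix.transpose_apply, Matrix.add_apply, Matrix.smul_apply,
      smul_eq_mul, Fin.sum_univ_four, connLower, Matrix.of_apply]
    ring
  rw [Matrix.add_apply, e4, connLower, Matrix.of_apply, hd, hd, hd]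
  simp only [Matrix.add_apply, Matrix.add_mul, e1]
  rw [e2 j l i, e2 j i l, e2 i l j, e2 i j l]
  have := e2 l j i
  have := e2 l i j
  linarith

/-- Transformation law of the connection. -/
theorem connMatrix_pullback (hΨ : ContDiffAt ℝ ∞ Ψ p) (hg : MSmoothAt g (Ψ p))
    (hs : ∀ i j, g (Ψ p) i j = g (Ψ p) j i) (hdet : (g (Ψ p)).det ≠ 0)
    (hJ : IsUnit (jacobian ℝ Ψ p).det)
    (h : g' =ᶠ[𝓝 p] fun q => (jacobian ℝ Ψ q)ᵀ * g (Ψ q) * jacobian ℝ Ψ q) (i : Fin 4) :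
    jacobian ℝ Ψ p * connMatrix g' i p
      = (∑ a, jacobian ℝ Ψ p a i • connMatrix g a (Ψ p)) * jacobian ℝ Ψ p
        + mpd i (jacobian ℝ Ψ) p := by
  have hG : (g (Ψ p))⁻¹ * g (Ψ p) = 1 := Matrix.nonsing_inv_mul _ hdet.isUnit
  simp only [connMatrix_eq]
  rw [connLower_pullback hΨ hg hs h, h.eq_of_nhds, inv_transpose_mul_mul]
  generalize jacobian ℝ Ψ p = J at *
  have h1 : J * J⁻¹ = 1 := Matrix.mul_nonsing_inv J hJ
  have h2 : J⁻¹ᵀ * Jᵀ = 1 := by rw [← Matrix.transpose_mul, h1, Matrix.transpose_one]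
  simp only [← Matrix.mul_smul, ← Matrix.mul_sum]
  simp only [Matrix.mul_add, ← Matrix.mul_assoc, h1, Matrix.one_mul]
  simp only [Matrix.mul_assoc]
  simp only [← Matrix.mul_assoc J⁻¹ᵀ, h2, Matrix.one_mul]
  simp only [← Matrix.mul_assoc _⁻¹ (g (Ψ p)), hG, Matrix.one_mul]

/-- The curvature transforms as a tensor. -/
theorem curvMatrix_pullback (hU : IsOpen U) (hΨ : ContDiffOn ℝ ∞ Ψ U) (hg : ∀ q, MSmoothAt g q)
    (hs : ∀ q i j, g q i j = g q j i) (hdet : ∀ q, (g q).det ≠ 0)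
    (hJ : ∀ q ∈ U, IsUnit (jacobian ℝ Ψ q).det)
    (h : ∀ q ∈ U, g' q = (jacobian ℝ Ψ q)ᵀ * g (Ψ q) * jacobian ℝ Ψ q) (hp : p ∈ U)
    (i j : Fin 4) :
    jacobian ℝ Ψ p * curvMatrix g' i j p
      = (∑ a, ∑ b, (jacobian ℝ Ψ p a i * jacobian ℝ Ψ p b j) • curvMatrix g a b (Ψ p))
        * jacobian ℝ Ψ p := by
  have hΨ' : ∀ q ∈ U, ContDiffAt ℝ ∞ Ψ q := fun q hq => hΨ.contDiffAt (hU.mem_nhds hq)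
  have hT : ∀ q ∈ U, ∀ i, _ := fun q hq i => connMatrix_pullback (hΨ' q hq) (hg (Ψ q))
    (hs (Ψ q)) (hdet (Ψ q)) (hJ q hq) ((hU.eventually_mem hq).mono h) i
  have hJs := mSmoothAt_jacobian (hΨ' p hp)
  have hgs : MSmoothAt g' p := ((hJs.transpose.mul ((hg _).comp (hΨ' p hp))).mul hJs).congr
    ((hU.eventually_mem hp).mono h)
  have hg'det : (g' p).det ≠ 0 := by
    rw [h p hp, Matrix.det_mul, Matrix.det_mul, Matrix.det_transpose]
    exact mul_ne_zero (mul_ne_zero (hJ p hp).ne_zero (hdet _)) (hJ p hp).ne_zero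
  have hC' := mSmoothAt_connMatrix hgs hg'det
  have hC := fun a => mSmoothAt_connMatrix (hg (Ψ p)) (hdet (Ψ p)) a
  have hA : ∀ i, MSmoothAt (fun q => ∑ a, jacobian ℝ Ψ q a i • connMatrix g a (Ψ q)) p :=
    fun i k l => by
      simp only [Matrix.sum_apply, Matrix.smul_apply, smul_eq_mul]
      exact ContDiffAt.sum fun a _ => (hJs a i).mul ((hC a).comp (hΨ' p hp) k l)
  have hdA : ∀ l i, mpd l (fun q => ∑ a, jacobian ℝ Ψ q a i • connMatrix g a (Ψ q)) p
      = ∑ a, (mpd l (jacobian ℝ Ψ) p a i • connMatrix g a (Ψ p)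
        + ∑ c, (jacobian ℝ Ψ p a i * jacobian ℝ Ψ p c l) • mpd c (connMatrix g a) (Ψ p)) := by
    intro l i
    ext k b
    simp only [mpd, Matrix.of_apply, Matrix.sum_apply, Matrix.add_apply, Matrix.smul_apply,
      smul_eq_mul]
    have h1 := fun a => (hJs.differentiableAt a i).hasFDerivAt.fun_mul
      (((hC a).comp (hΨ' p hp)).differentiableAt k b).hasFDerivAt
    rw [pd, (HasFDerivAt.fun_sum fun k (_ : k ∈ Finset.univ) => h1 k).fderiv]
    have h2 := fun a => pd_comp ((hC a).differentiableAt k b)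
      ((hΨ' p hp).differentiableAt (by simp)) l
    simp only [pd] at h2
    simp only [ContinuousLinearMap.sum_apply, ContinuousLinearMap.add_apply,
      ContinuousLinearMap.smul_apply, smul_eq_mul, h2, Finset.mul_sum, pd]
    refine Finset.sum_congr rfl fun a _ => ?_
    rw [add_comm, mul_comm]
    congr 1
    exact Finset.sum_congr rfl fun c _ => by ring
  -- differentiate the transformation law of the connection
  have hD : ∀ l i, mpd l (jacobian ℝ Ψ) p * connMatrix g' i p
      + jacobian ℝ Ψ p * mpd l (connMatrix g' i) p
      = mpd l (fun q => ∑ a, jacobian ℝ Ψ q a i • connMatrix g a (Ψ q)) p * jacobian ℝ Ψ p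
        + (∑ a, jacobian ℝ Ψ p a i • connMatrix g a (Ψ p)) * mpd l (jacobian ℝ Ψ) p
        + mpd l (mpd i (jacobian ℝ Ψ)) p := fun l i => by
    rw [← mpd_mul hJs (hC' i), ← mpd_mul (hA i) hJs, ← mpd_add ((hA i).mul hJs) (hJs.mpd i)]
    exact mpd_congr ((hU.eventually_mem hp).mono fun q hq => hT q hq i) l
  have hH : ∀ l i, mpd l (mpd i (jacobian ℝ Ψ)) p = mpd i (mpd l (jacobian ℝ Ψ)) p := fun l i => by
    ext a b
    exact pd_pd_comm (hJs a b) l i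
  have hHs := mpd_jacobian_symm (hΨ' p hp)
  have e1 := hT p hp i
  have e2 := hT p hp j
  have e3 := hD i j
  have e4 := hD j i
  rw [hH j i] at e4
  rw [hdA] at e3 e4
  have e5 : ∑ a, mpd i (jacobian ℝ Ψ) p a j • connMatrix g a (Ψ p)
      = ∑ a, mpd j (jacobian ℝ Ψ) p a i • connMatrix g a (Ψ p) :=
    Finset.sum_congr rfl fun a _ => by rw [hHs]
  rw [Finset.sum_add_distrib] at e3 e4
  rw [e5] at e3
  have e6 : ∑ a, ∑ b, (jacobian ℝ Ψ p a i * jacobian ℝ Ψ p b j) • curvMatrix g a b (Ψ p)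
      = ∑ a, ∑ c, (jacobian ℝ Ψ p a j * jacobian ℝ Ψ p c i) • mpd c (connMatrix g a) (Ψ p)
        - ∑ a, ∑ c, (jacobian ℝ Ψ p a i * jacobian ℝ Ψ p c j) • mpd c (connMatrix g a) (Ψ p)
        + (∑ a, jacobian ℝ Ψ p a i • connMatrix g a (Ψ p))
          * (∑ a, jacobian ℝ Ψ p a j • connMatrix g a (Ψ p))
        - (∑ a, jacobian ℝ Ψ p a j • connMatrix g a (Ψ p))
          * (∑ a, jacobian ℝ Ψ p a i • connMatrix g a (Ψ p)) := by
    simp only [curvMatrix, smul_sub, smul_add, Finset.sum_sub_distrib, Finset.sum_add_distrib]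
    congr 1
    · congr 1
      · congr 1
        rw [Finset.sum_comm]
        simp only [mul_comm]
      · simp only [Finset.sum_mul, Finset.mul_sum, Matrix.smul_mul, Matrix.mul_smul, smul_smul]
        rw [Finset.sum_comm]
        simp only [mul_comm]
    · simp only [Finset.sum_mul, Finset.mul_sum, Matrix.smul_mul, Matrix.mul_smul, smul_smul]
  rw [e6]
  unfold curvMatrix
  generalize jacobian ℝ Ψ p = J at *
  generalize ∑ a, J a i • connMatrix g a (Ψ p) = A at *
  generalize ∑ a, J a j • connMatrix g a (Ψ p) = B at *
  generalize (∑ a, mpd j (jacobian ℝ Ψ) p a i • connMatrix g a (Ψ p)) = S at *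
  generalize connMatrix g' i p = X at *
  generalize connMatrix g' j p = Y at *
  generalize mpd i (connMatrix g' j) p = dY at *
  generalize mpd j (connMatrix g' i) p = dX at *
  -- The Hessian of Ψ is eliminated through the transformation law of the connection. The third
  -- derivatives agree in `e3` and `e4`, so subtracting the two leaves only the curvature terms.
  have f1 : mpd i (jacobian ℝ Ψ) p = J * X - A * J := by rw [e1]; abel
  have f2 : mpd j (jacobian ℝ Ψ) p = J * Y - B * J := by rw [e2]; abel
  rw [f1] at e3
  rw [f2] at e4
  have e7 := congrArg₂ (· - ·) e3 e4
  simp only [Matrix.mul_sub, Matrix.sub_mul, Matrix.mul_add, Matrix.add_mul, ← Matrix.mul_assoc]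
    at e7 ⊢
  rw [← sub_eq_zero] at e7 ⊢
  rw [← e7]
  abel

/-- The Ricci tensor transforms as a tensor. -/
theorem ricci_pullback (hU : IsOpen U) (hΨ : ContDiffOn ℝ ∞ Ψ U) (hg : ∀ q, MSmoothAt g q)
    (hs : ∀ q i j, g q i j = g q j i) (hdet : ∀ q, (g q).det ≠ 0)
    (hJ : ∀ q ∈ U, IsUnit (jacobian ℝ Ψ q).det)
    (h : ∀ q ∈ U, g' q = (jacobian ℝ Ψ q)ᵀ * g (Ψ q) * jacobian ℝ Ψ q) (hp : p ∈ U) :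
    (of fun i j => ricci g' i j p)
      = (jacobian ℝ Ψ p)ᵀ * (of fun i j => ricci g i j (Ψ p)) * jacobian ℝ Ψ p := by
  have hs' : ∀ᶠ q in 𝓝 p, ∀ i j, g' q i j = g' q j i := by
    filter_upwards [hU.mem_nhds hp] with q hq i j
    have hgT : (g (Ψ q))ᵀ = g (Ψ q) := by
      ext a b
      exact hs _ b a
    have hT : (g' q)ᵀ = g' q := by
      rw [h q hq]
      simp [Matrix.transpose_mul, hgT, Matrix.mul_assoc]
    exact congrFun (congrFun hT j) i
  have hc := fun i j => curvMatrix_pullback hU hΨ hg hs hdet hJ h hp i j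
  have hJp := hJ p hp
  ext i j
  rw [Matrix.of_apply, ricci_eq_curvMatrix hs']
  generalize jacobian ℝ Ψ p = J at *
  have h1 : J⁻¹ * J = 1 := Matrix.nonsing_inv_mul J hJp
  have h2 : J * J⁻¹ = 1 := Matrix.mul_nonsing_inv J hJp
  have hc' : ∀ k, curvMatrix g' k j p k i
      = ∑ a, ∑ b, J b j * (J a k * (J⁻¹ * (curvMatrix g a b (Ψ p) * J)) k i) := fun k => by
    have : curvMatrix g' k j p = J⁻¹ * (J * curvMatrix g' k j p) := by
      rw [← Matrix.mul_assoc, h1, Matrix.one_mul]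
    rw [this, hc]
    simp only [Finset.sum_mul, Finset.mul_sum, Matrix.sum_apply, Matrix.smul_mul, Matrix.mul_smul,
      Matrix.smul_apply, smul_eq_mul]
    exact Finset.sum_congr rfl fun a _ => Finset.sum_congr rfl fun b _ => by ring
  -- The contracted index k meets both J and its inverse, so one Jacobian factor disappears and two
  -- remain, as for a covariant 2-tensor.
  have h3 : ∀ a b, ∑ k, J a k * (J⁻¹ * (curvMatrix g a b (Ψ p) * J)) k i
      = (curvMatrix g a b (Ψ p) * J) a i := fun a b => by
    rw [← Matrix.mul_apply, ← Matrix.mul_assoc, h2, Matrix.one_mul]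
  simp only [hc']
  rw [Finset.sum_comm]
  have h4 : ∀ a, ∑ k, ∑ b, J b j * (J a k * (J⁻¹ * (curvMatrix g a b (Ψ p) * J)) k i)
      = ∑ b, J b j * (curvMatrix g a b (Ψ p) * J) a i := fun a => by
    rw [Finset.sum_comm]
    exact Finset.sum_congr rfl fun b _ => by rw [← Finset.mul_sum, h3]
  simp only [h4]
  simp only [Matrix.mul_apply, Matrix.transpose_apply, Matrix.of_apply,
    ricci_eq_curvMatrix (.of_forall hs), Finset.mul_sum, Finset.sum_mul]
  rw [Finset.sum_comm]
  refine Finset.sum_congr rfl fun b _ => ?_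
  rw [Finset.sum_comm]
  exact Finset.sum_congr rfl fun a _ => Finset.sum_congr rfl fun c _ => by ring

/-- Exterior derivatives commute with pull-backs. -/
theorem fieldStrength_pullback {A A' : Fin 4 → E4 → ℝ} (hΨ : ContDiffAt ℝ ∞ Ψ p)
    (hA : ∀ a, ContDiffAt ℝ ∞ (A a) (Ψ p))
    (h : ∀ i, A' i =ᶠ[𝓝 p] fun q => ∑ a, jacobian ℝ Ψ q a i * A a (Ψ q)) :
    fieldStrength A' p
      = (jacobian ℝ Ψ p)ᵀ * fieldStrength A (Ψ p) * jacobian ℝ Ψ p := by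
  have hJ := mSmoothAt_jacobian hΨ
  have hd : ∀ a, DifferentiableAt ℝ (A a) (Ψ p) := fun a => (hA a).differentiableAt (by simp)
  have hΨd : DifferentiableAt ℝ Ψ p := hΨ.differentiableAt (by simp)
  have hpd : ∀ i j, pd i (A' j) p = ∑ a, (mpd i (jacobian ℝ Ψ) p a j * A a (Ψ p)
      + jacobian ℝ Ψ p a j * ∑ b, jacobian ℝ Ψ p b i * pd b (A a) (Ψ p)) := fun i j => by
    rw [(h j).pd_eq]
    have h1 := fun a => (hJ.differentiableAt a j).hasFDerivAt.fun_mul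
      ((hd a).comp p hΨd).hasFDerivAt
    have h0 := (HasFDerivAt.fun_sum fun a (_ : a ∈ Finset.univ) => h1 a).fderiv
    simp only [Function.comp_apply] at h0
    rw [pd, h0]
    have h2 := fun a => pd_comp (hd a) hΨd i
    simp only [pd] at h2
    simp only [ContinuousLinearMap.sum_apply, ContinuousLinearMap.add_apply,
      ContinuousLinearMap.smul_apply, smul_eq_mul, pd, ← h2, mpd, Matrix.of_apply]
    refine Finset.sum_congr rfl fun a _ => ?_
    rw [add_comm, mul_comm (A a (Ψ p))]
    rfl
  have hH := mpd_jacobian_symm hΨ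
  ext i j
  simp only [fieldStrength, Matrix.of_apply, hpd, Matrix.mul_apply, Matrix.transpose_apply]
  rw [← Finset.sum_sub_distrib]
  -- The Hessian terms are symmetric in i and j, so antisymmetrisation removes them.
  have e : ∀ a, mpd i (jacobian ℝ Ψ) p a j = mpd j (jacobian ℝ Ψ) p a i := fun a => hH a i j
  simp only [e, add_sub_add_left_eq_sub, Finset.sum_sub_distrib, Finset.mul_sum, Finset.sum_mul,
    mul_sub, sub_mul]
  congr 1
  · exact Finset.sum_congr rfl fun a _ => Finset.sum_congr rfl fun b _ => by ring
  · rw [Finset.sum_comm]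
    exact Finset.sum_congr rfl fun a _ => Finset.sum_congr rfl fun b _ => by ring

/-- Solutions can be pushed forward along local diffeomorphisms. -/
theorem IsElectrovacAt.of_pullback {Λ σ σ' : ℝ} {A A' B B' : Fin 4 → E4 → ℝ} (hU : IsOpen U)
    (hΨ : ContDiffOn ℝ ∞ Ψ U) (hg : ∀ q, MSmoothAt g q)
    (hs : ∀ q i j, g q i j = g q j i) (hdet : ∀ q, (g q).det ≠ 0)
    (hA : ∀ a, ContDiff ℝ ∞ (A a)) (hB : ∀ a, ContDiff ℝ ∞ (B a))
    (hJ : ∀ q ∈ U, IsUnit (jacobian ℝ Ψ q).det)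
    (h : ∀ q ∈ U, g' q = (jacobian ℝ Ψ q)ᵀ * g (Ψ q) * jacobian ℝ Ψ q)
    (hA' : ∀ q ∈ U, ∀ i, A' i q = ∑ a, jacobian ℝ Ψ q a i * A a (Ψ q))
    (hB' : ∀ q ∈ U, ∀ i, B' i q = ∑ a, jacobian ℝ Ψ q a i * B a (Ψ q)) (hp : p ∈ U)
    (hσ : σ * |(jacobian ℝ Ψ p).det| = σ' * (jacobian ℝ Ψ p).det)
    (hsol : IsElectrovacAt Λ σ' g' A' B' p) : IsElectrovacAt Λ σ g A B (Ψ p) := by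
  obtain ⟨he, hd⟩ := hsol
  have hΨp : ContDiffAt ℝ ∞ Ψ p := hΨ.contDiffAt (hU.mem_nhds hp)
  have hFA := fieldStrength_pullback (A' := A') hΨp (fun a => (hA a).contDiffAt)
    fun i => (hU.eventually_mem hp).mono fun q hq => hA' q hq i
  have hFB := fieldStrength_pullback (A' := B') hΨp (fun a => (hB a).contDiffAt)
    fun i => (hU.eventually_mem hp).mono fun q hq => hB' q hq i
  rw [ricci_pullback hU hΨ hg hs hdet hJ h hp, hFA, h p hp,
    einsteinSource_congruence _ (hJ p hp)] at he
  rw [hFA, hFB, h p hp, raisedMatrix_congruence (hJ p hp)] at hd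
  have hdual := hodgeDual_congruence (J := jacobian ℝ Ψ p) (fieldStrength_antisymm B (Ψ p))
  have hJp := hJ p hp
  generalize jacobian ℝ Ψ p = J at *
  have h1 : J * J⁻¹ = 1 := Matrix.mul_nonsing_inv J hJp
  have h2 : J⁻¹ᵀ * Jᵀ = 1 := by rw [← Matrix.transpose_mul, h1, Matrix.transpose_one]
  have h3 : ∀ X : Matrix (Fin 4) (Fin 4) ℝ, J⁻¹ᵀ * (Jᵀ * X * J) * J⁻¹ = X := fun X => by
    simp only [Matrix.mul_assoc]
    rw [h1, Matrix.mul_one, ← Matrix.mul_assoc, h2, Matrix.one_mul]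
  have h4 : ∀ X : Matrix (Fin 4) (Fin 4) ℝ, J * (J⁻¹ * X * J⁻¹ᵀ) * Jᵀ = X := fun X => by
    simp only [Matrix.mul_assoc]
    rw [h2, Matrix.mul_one, ← Matrix.mul_assoc, h1, Matrix.one_mul]
  constructor
  · rw [← h3 (of _), he, h3]
  · have h5 := congrArg (fun X => J * X * Jᵀ) hd
    simp only [Matrix.mul_smul, Matrix.smul_mul, h4, hdual] at h5
    -- The volume density scales by |det J| while the dual density scales by det J; the mismatch is
    -- the orientation sign by which σ and σ' may differ.
    have h6 : √|(Jᵀ * g (Ψ p) * J).det| = |J.det| * √|(g (Ψ p)).det| := by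
      rw [Matrix.det_mul, Matrix.det_mul, Matrix.det_transpose,
        show J.det * (g (Ψ p)).det * J.det = J.det ^ 2 * (g (Ψ p)).det by ring, abs_mul,
        Real.sqrt_mul (abs_nonneg _), abs_of_nonneg (sq_nonneg _), Real.sqrt_sq_eq_abs]
    have h7 : |J.det| ≠ 0 := abs_ne_zero.2 hJp.ne_zero
    rw [h6, smul_smul, ← hσ, mul_comm σ, mul_smul, mul_smul] at h5
    exact smul_right_injective _ h7 h5

theorem continuous_of_mSmoothAt (h : ∀ q, MSmoothAt f q) : Continuous f :=
  continuous_pi fun i => continuous_pi fun j => continuous_iff_continuousAt.2 fun q =>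
    (h q i j).continuousAt

/-- The equations extend by continuity. -/
theorem IsElectrovacAt.of_dense {Λ σ : ℝ} {A B : Fin 4 → E4 → ℝ} {S : Set E4} (hS : Dense S)
    (hg : ∀ q, MSmoothAt g q) (hs : ∀ q i j, g q i j = g q j i) (hdet : ∀ q, (g q).det ≠ 0)
    (hA : ∀ a, ContDiff ℝ ∞ (A a)) (hB : ∀ a, ContDiff ℝ ∞ (B a))
    (h : ∀ q ∈ S, IsElectrovacAt Λ σ g A B q) (p : E4) : IsElectrovacAt Λ σ g A B p := by
  have cg := continuous_of_mSmoothAt hg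
  have ci := continuous_of_mSmoothAt fun q => (hg q).inv (hdet q)
  have cA : Continuous (fieldStrength A) := continuous_of_mSmoothAt fun q i j =>
    contDiffAt_fieldStrength (fun a => (hA a).contDiffAt) i j
  have cB : Continuous (fieldStrength B) := continuous_of_mSmoothAt fun q i j =>
    contDiffAt_fieldStrength (fun a => (hB a).contDiffAt) i j
  have hC := fun a q => mSmoothAt_connMatrix (hg q) (hdet q) a
  have cC := fun a => continuous_of_mSmoothAt (hC a)
  have cdC := fun l a => continuous_of_mSmoothAt fun q => (hC a q).mpd l
  have cr : Continuous fun q => (of fun i j => ricci g i j q : Matrix (Fin 4) (Fin 4) ℝ) := by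
    refine continuous_pi fun i => continuous_pi fun j => ?_
    simp only [Matrix.of_apply, ricci_eq_curvMatrix (.of_forall hs)]
    refine continuous_finset_sum _ fun k _ => Continuous.matrix_elem ?_ k i
    exact (((cdC k j).sub (cdC j k)).add ((cC k).matrix_mul (cC j))).sub
      ((cC j).matrix_mul (cC k))
  have cR : Continuous fun q => raisedMatrix (g q) (fieldStrength A q) :=
    (ci.matrix_mul cA).matrix_mul ci.matrix_transpose
  have cS : Continuous fun q => stressMatrix (g q) (fieldStrength A q) := by
    have c1 : Continuous fun q => (1 / 4)
        * (fieldStrength A q * (raisedMatrix (g q) (fieldStrength A q))ᵀ).trace :=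
      continuous_const.mul (cA.matrix_mul cR.matrix_transpose).matrix_trace
    exact (((cA.matrix_mul ci).matrix_mul cA.matrix_transpose).sub (c1.smul cg)).const_smul (2 : ℝ)
  have cE : Continuous fun q => einsteinSource Λ (g q) (fieldStrength A q) := by
    have c1 : Continuous fun q => (1 / 2)
        * ((g q)⁻¹ * (stressMatrix (g q) (fieldStrength A q))ᵀ).trace :=
      continuous_const.mul (ci.matrix_mul cS.matrix_transpose).matrix_trace
    exact ((cg.const_smul Λ).add cS).sub (c1.smul cg)
  have cD : Continuous fun q => hodgeDual (fieldStrength B q) := by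
    refine continuous_pi fun i => continuous_pi fun j => ?_
    have := fun a b => Continuous.matrix_elem cB a b
    fin_cases i <;> fin_cases j <;> first | exact continuous_const | exact this _ _
  constructor
  · exact congrFun (Continuous.ext_on hS cr cE fun q hq => (h q hq).einstein) p
  · exact congrFun (Continuous.ext_on hS (cg.matrix_det.abs.sqrt.smul cR)
      (cD.const_smul σ) fun q hq => (h q hq).duality) p

end Covariance

/-! ### The sphere bundles over the sphere -/

open scoped ComplexConjugate

/-- The space which contains the sphere bundles. -/
abbrev BundleAmbient : Type := ℝ × ℂ × ℂ × ℂ × ℝ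

/-- Points of `ℂ² × (ℂ × ℝ)`. -/
abbrev FramePoint : Type := ℂ × ℂ × ℂ × ℝ

/-- The product of the unit spheres of `ℂ²` and `ℂ × ℝ`. -/
def frameSet : Set FramePoint :=
  {x | Complex.normSq x.1 + Complex.normSq x.2.1 = 1 ∧
    Complex.normSq x.2.2.1 + x.2.2.2 ^ 2 = 1}

/-- Invariants of `(z₀, z₁, ζ, t)` under the circle action `(λ z₀, λ z₁, λᵐ ζ, t)`. -/
def frameInvariants (m : ℕ) (x : FramePoint) : BundleAmbient :=
  (Complex.normSq x.1 - Complex.normSq x.2.1, x.2.1 * conj x.1, x.2.2.1 * conj x.1 ^ m,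
    x.2.2.1 * conj x.2.1 ^ m, x.2.2.2)

/-- The quotient of `frameSet` by the circle action `(λ z₀, λ z₁, λᵐ ζ, t)`. -/
def Hirz (m : ℕ) : Type := {v : BundleAmbient // v ∈ frameInvariants m '' frameSet}

namespace Hirz

variable {m : ℕ}

instance : TopologicalSpace (Hirz m) := instTopologicalSpaceSubtype

/-- The inclusion in the ambient space. -/
def val (p : Hirz m) : BundleAmbient := Subtype.val p

theorem val_injective : Function.Injective (val (m := m)) := Subtype.val_injective

theorem isInducing_val : IsInducing (val (m := m)) := IsInducing.subtypeVal

theorem continuous_val : Continuous (val (m := m)) := isInducing_val.continuous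

/-- The class of a point of `frameSet`. -/
def mk (x : FramePoint) (hx : x ∈ frameSet) : Hirz m := ⟨frameInvariants m x, x, hx, rfl⟩

theorem val_mk (x : FramePoint) (hx : x ∈ frameSet) :
    (mk x hx : Hirz m).val = frameInvariants m x := rfl

theorem exists_mk (p : Hirz m) : ∃ x, ∃ hx : x ∈ frameSet, mk x hx = p := by
  obtain ⟨v, x, hx, rfl⟩ := p
  exact ⟨x, hx, rfl⟩

instance : T2Space (Hirz m) := T2Space.of_injective_continuous val_injective continuous_val

instance : SecondCountableTopology (Hirz m) :=
  isInducing_val.secondCountableTopology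

theorem contDiff_conj : ContDiff ℝ ∞ (fun z : ℂ => conj z) := Complex.conjCLE.contDiff

theorem contDiff_normSq : ContDiff ℝ ∞ Complex.normSq := by
  have : Complex.normSq = fun z : ℂ => Complex.reCLM z ^ 2 + Complex.imCLM z ^ 2 := by
    funext z
    simp [Complex.normSq_apply, sq]
  rw [this]
  fun_prop

theorem contDiff_frameInvariants (m : ℕ) : ContDiff ℝ ∞ (frameInvariants m) := by
  have h1 : ContDiff ℝ ∞ fun x : FramePoint => x.1 := contDiff_fst
  have h2 : ContDiff ℝ ∞ fun x : FramePoint => x.2.1 := contDiff_fst.comp contDiff_snd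
  have h3 : ContDiff ℝ ∞ fun x : FramePoint => x.2.2.1 :=
    contDiff_fst.comp (contDiff_snd.comp contDiff_snd)
  have h4 : ContDiff ℝ ∞ fun x : FramePoint => x.2.2.2 :=
    contDiff_snd.comp (contDiff_snd.comp contDiff_snd)
  have c1 := contDiff_conj.comp h1
  have c2 := contDiff_conj.comp h2
  exact ((contDiff_normSq.comp h1).sub (contDiff_normSq.comp h2)).prodMk
    ((h2.mul c1).prodMk ((h3.mul (c1.pow m)).prodMk ((h3.mul (c2.pow m)).prodMk h4)))

theorem isCompact_frameSet : IsCompact frameSet := by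
  refine Metric.isCompact_of_isClosed_isBounded ?_ ?_
  · have c := Complex.continuous_normSq
    exact (isClosed_eq (by fun_prop) continuous_const).inter
      (isClosed_eq (by fun_prop) continuous_const)
  · refine (Metric.isBounded_closedBall (x := (0 : FramePoint)) (r := 1)).subset ?_
    rintro ⟨a, b, c, t⟩ ⟨h1, h2⟩
    simp only [Complex.normSq_eq_norm_sq] at h1 h2
    rw [mem_closedBall_zero_iff]
    have ht : ‖t‖ ^ 2 = t ^ 2 := by simp
    have e : ∀ x y : ℝ, 0 ≤ x → x ^ 2 + y ^ 2 = 1 → x ≤ 1 := fun x y hx h => by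
      nlinarith [sq_nonneg y]
    refine max_le (e _ _ (norm_nonneg _) h1) (max_le (e _ ‖a‖ (norm_nonneg _) (by linarith))
      (max_le (e _ _ (norm_nonneg _) h2) (e _ ‖c‖ (norm_nonneg _) (by linarith))))

instance : CompactSpace (Hirz m) :=
  isCompact_iff_compactSpace.1 (isCompact_frameSet.image (contDiff_frameInvariants m).continuous)

theorem conj_scale {a b : ℂ} (ha : a ≠ 0) (h : Complex.normSq a = Complex.normSq b) :
    b / a * conj b = conj a := by
  rw [div_mul_eq_mul_div, Complex.mul_conj, ← h, ← Complex.mul_conj]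
  field_simp

/-- The invariants separate the orbits of the circle. They fix the moduli of both entries of the
base frame, so a unit scalar is the quotient of two non-zero corresponding entries; the remaining
entries follow on cancelling a conjugate. -/
theorem frameInvariants_eq_iff {x y : FramePoint} (hx : x ∈ frameSet) (hy : y ∈ frameSet) :
    frameInvariants m x = frameInvariants m y ↔
      ∃ l : ℂ, Complex.normSq l = 1 ∧ y = (l * x.1, l * x.2.1, l ^ m * x.2.2.1, x.2.2.2) := by
  obtain ⟨a, b, c, t⟩ := x
  obtain ⟨a', b', c', t'⟩ := y
  obtain ⟨h1, -⟩ := hx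
  obtain ⟨h2, -⟩ := hy
  simp only at h1 h2
  simp only [frameInvariants, Prod.mk.injEq]
  constructor
  · rintro ⟨e1, e2, e3, e4, rfl⟩
    have na : Complex.normSq a = Complex.normSq a' := by linarith
    have nb : Complex.normSq b = Complex.normSq b' := by linarith
    -- Over the pole a = 0 the scalar must be read off from b, which is then non-zero, and the fibre
    -- entry from the invariant containing conj b.
    by_cases ha : a = 0
    · have ha' : a' = 0 := by
        rw [ha, map_zero] at na
        exact Complex.normSq_eq_zero.1 na.symm
      have hb : b ≠ 0 := by
        rintro rfl
        simp [ha] at h1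
      have hnb : Complex.normSq b ≠ 0 := by simpa using hb
      refine ⟨b' / b, ?_, ?_, ?_, ?_, rfl⟩
      · rw [map_div₀, nb, div_self (nb ▸ hnb)]
      · rw [ha, ha', mul_zero]
      · field_simp
      · have hcb : conj b' ≠ 0 := by
          rw [Ne, map_eq_zero]
          rintro rfl
          simp at nb
          exact hb nb
        refine mul_right_cancel₀ (pow_ne_zero m hcb) ?_
        rw [← e4, mul_right_comm, ← mul_pow, conj_scale hb nb, mul_comm]
    · have hna : Complex.normSq a ≠ 0 := by simpa using ha
      have hca : conj a ≠ 0 := by simpa using ha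
      have ha' : a' ≠ 0 := by
        rintro rfl
        simp at na
        exact ha na
      have hca' : conj a' ≠ 0 := by simpa using ha'
      refine ⟨a' / a, ?_, ?_, ?_, ?_, rfl⟩
      · rw [map_div₀, na, div_self (na ▸ hna)]
      · field_simp
      · refine mul_right_cancel₀ hca' ?_
        rw [← e2, mul_right_comm, conj_scale ha na, mul_comm]
      · refine mul_right_cancel₀ (pow_ne_zero m hca') ?_
        rw [← e3, mul_right_comm, ← mul_pow, conj_scale ha na, mul_comm]
  · rintro ⟨l, hl, rfl, rfl, rfl, rfl⟩
    have hl' : l * conj l = 1 := by rw [Complex.mul_conj, hl, Complex.ofReal_one]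
    refine ⟨by simp [hl], ?_, ?_, ?_, rfl⟩
    · rw [map_mul]
      linear_combination -b * conj a * hl'
    · rw [map_mul]
      have : (l * conj l) ^ m = 1 := by rw [hl', one_pow]
      rw [mul_pow] at this ⊢
      linear_combination -c * conj a ^ m * this
    · rw [map_mul]
      have : (l * conj l) ^ m = 1 := by rw [hl', one_pow]
      rw [mul_pow] at this ⊢
      linear_combination -c * conj b ^ m * this

/-! #### Symmetries -/

/-- The symmetries of the ambient space which exchange the poles of the base and of the fibre. -/
def flipAmbient (s : Bool × Bool) (v : BundleAmbient) : BundleAmbient :=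
  let w := if s.1 then (-v.1, conj v.2.1, v.2.2.2.1, v.2.2.1, v.2.2.2.2) else v
  if s.2 then (w.1, w.2.1, w.2.2.1, w.2.2.2.1, -w.2.2.2.2) else w

/-- The action of the symmetries on `FramePoint`. -/
def flipFrame (s : Bool × Bool) (x : FramePoint) : FramePoint :=
  let y := if s.1 then (x.2.1, x.1, x.2.2) else x
  if s.2 then (y.1, y.2.1, y.2.2.1, -y.2.2.2) else y

theorem frameInvariants_flipFrame (s : Bool × Bool) (x : FramePoint) :
    frameInvariants m (flipFrame s x) = flipAmbient s (frameInvariants m x) := by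
  obtain ⟨a, b, c, t⟩ := x
  rcases s with ⟨_ | _, _ | _⟩ <;> simp [flipFrame, flipAmbient, frameInvariants, mul_comm]

theorem flipFrame_mem (s : Bool × Bool) {x : FramePoint} (hx : x ∈ frameSet) :
    flipFrame s x ∈ frameSet := by
  obtain ⟨a, b, c, t⟩ := x
  obtain ⟨h1, h2⟩ := hx
  simp only at h1 h2
  rcases s with ⟨_ | _, _ | _⟩ <;> simp [flipFrame, frameSet, h2] <;> linarith

theorem flipAmbient_flipAmbient (s s' : Bool × Bool) (v : BundleAmbient) :
    flipAmbient s (flipAmbient s' v) = flipAmbient (xor s.1 s'.1, xor s.2 s'.2) v := by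
  rcases s with ⟨_ | _, _ | _⟩ <;> rcases s' with ⟨_ | _, _ | _⟩ <;> simp [flipAmbient]

theorem flipAmbient_self (s : Bool × Bool) (v : BundleAmbient) :
    flipAmbient s (flipAmbient s v) = v := by
  rw [flipAmbient_flipAmbient]
  simp [flipAmbient]

theorem contDiff_flipAmbient (s : Bool × Bool) : ContDiff ℝ ∞ (flipAmbient s) := by
  have c : ContDiff ℝ ∞ fun v : BundleAmbient => conj v.2.1 :=
    contDiff_conj.comp (by fun_prop)
  have h1 : ContDiff ℝ ∞ fun v : BundleAmbient => (-v.1, conj v.2.1, v.2.2.2.1, v.2.2.1, v.2.2.2.2) :=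
    ContDiff.prodMk (by fun_prop) (c.prodMk (by fun_prop))
  have h2 : ContDiff ℝ ∞ fun v : BundleAmbient => (v.1, v.2.1, v.2.2.1, v.2.2.2.1, -v.2.2.2.2) := by
    fun_prop
  rcases s with ⟨_ | _, _ | _⟩
  exacts [contDiff_id, h2, h1, h2.comp h1]

theorem contDiff_flipFrame (s : Bool × Bool) : ContDiff ℝ ∞ (flipFrame s) := by
  have h1 : ContDiff ℝ ∞ fun x : FramePoint => (x.2.1, x.1, x.2.2) := by fun_prop
  have h2 : ContDiff ℝ ∞ fun x : FramePoint => (x.1, x.2.1, x.2.2.1, -x.2.2.2) := by fun_prop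
  rcases s with ⟨_ | _, _ | _⟩
  exacts [contDiff_id, h2, h1, h2.comp h1]

/-- The symmetries of the bundle. -/
def flip (s : Bool × Bool) (p : Hirz m) : Hirz m :=
  ⟨flipAmbient s p.val, by
    obtain ⟨x, hx, rfl⟩ := p.exists_mk
    exact ⟨flipFrame s x, flipFrame_mem s hx, frameInvariants_flipFrame s x⟩⟩

theorem val_flip (s : Bool × Bool) (p : Hirz m) : (flip s p).val = flipAmbient s p.val := rfl

/-- `flip` as a homeomorphism. -/
def flipHomeo (s : Bool × Bool) : Hirz m ≃ₜ Hirz m where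
  toFun := flip s
  invFun := flip s
  left_inv p := val_injective (flipAmbient_self s p.val)
  right_inv p := val_injective (flipAmbient_self s p.val)
  continuous_toFun := isInducing_val.continuous_iff.2
    ((contDiff_flipAmbient s).continuous.comp continuous_val)
  continuous_invFun := isInducing_val.continuous_iff.2
    ((contDiff_flipAmbient s).continuous.comp continuous_val)

/-! #### Charts -/

/-- The first complex coordinate on `ℝ⁴ = ℂ²`. -/
def baseCoord (y : E4) : ℂ := (y 0 : ℂ) + y 1 * Complex.I

/-- The second complex coordinate on `ℝ⁴ = ℂ²`. -/
def fibreCoord (y : E4) : ℂ := (y 2 : ℂ) + y 3 * Complex.I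

/-- The point of `ℝ⁴` with given complex coordinates. -/
def ofCoords (w z : ℂ) : E4 := !₂[w.re, w.im, z.re, z.im]

theorem ofCoords_coords (y : E4) : ofCoords (baseCoord y) (fibreCoord y) = y := by
  ext i
  fin_cases i <;> simp [ofCoords, baseCoord, fibreCoord]

theorem baseCoord_ofCoords (w z : ℂ) : baseCoord (ofCoords w z) = w := by
  simp [ofCoords, baseCoord]

theorem fibreCoord_ofCoords (w z : ℂ) : fibreCoord (ofCoords w z) = z := by
  simp [ofCoords, fibreCoord]

theorem contDiff_ofRealCoord (i : Fin 4) : ContDiff ℝ ∞ fun y : E4 => ((y i : ℝ) : ℂ) :=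
  Complex.ofRealCLM.contDiff.comp (by fun_prop)

theorem contDiff_baseCoord : ContDiff ℝ ∞ baseCoord :=
  (contDiff_ofRealCoord 0).add ((contDiff_ofRealCoord 1).mul contDiff_const)

theorem contDiff_fibreCoord : ContDiff ℝ ∞ fibreCoord :=
  (contDiff_ofRealCoord 2).add ((contDiff_ofRealCoord 3).mul contDiff_const)

/-- The normalization factor `(1 + |w|²)^(-1/2)`. -/
def cosHalf (w : ℂ) : ℝ := (√(1 + Complex.normSq w))⁻¹

theorem one_add_normSq_pos (w : ℂ) : 0 < 1 + Complex.normSq w := by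
  linarith [Complex.normSq_nonneg w]

theorem cosHalf_pos (w : ℂ) : 0 < cosHalf w :=
  inv_pos.2 (Real.sqrt_pos.2 (one_add_normSq_pos w))

theorem cosHalf_sq (w : ℂ) : cosHalf w ^ 2 = (1 + Complex.normSq w)⁻¹ := by
  rw [cosHalf, inv_pow, Real.sq_sqrt (one_add_normSq_pos w).le]

theorem contDiff_cosHalf : ContDiff ℝ ∞ cosHalf :=
  ((contDiff_const.add contDiff_normSq).sqrt fun w => (one_add_normSq_pos w).ne').inv fun w =>
    (Real.sqrt_pos.2 (one_add_normSq_pos w)).ne'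

/-- A normalized frame with given complex coordinates. -/
def frameOf (y : E4) : FramePoint :=
  (cosHalf (baseCoord y), cosHalf (baseCoord y) * baseCoord y,
    ((2 / (1 + Complex.normSq (fibreCoord y)) : ℝ) : ℂ) * fibreCoord y,
    (1 - Complex.normSq (fibreCoord y)) / (1 + Complex.normSq (fibreCoord y)))

theorem frameOf_mem (y : E4) : frameOf y ∈ frameSet := by
  have h1 := one_add_normSq_pos (baseCoord y)
  have h2 := one_add_normSq_pos (fibreCoord y)
  constructor
  · simp only [frameOf, map_mul, Complex.normSq_ofReal, ← sq, cosHalf_sq]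
    field_simp
  · simp only [frameOf, map_mul, Complex.normSq_ofReal]
    field_simp
    ring

theorem contDiff_frameOf : ContDiff ℝ ∞ frameOf := by
  have hc : ContDiff ℝ ∞ fun y => ((cosHalf (baseCoord y) : ℝ) : ℂ) :=
    Complex.ofRealCLM.contDiff.comp (contDiff_cosHalf.comp contDiff_baseCoord)
  have hn := contDiff_normSq.comp contDiff_fibreCoord
  have hd : ContDiff ℝ ∞ fun y => 1 + Complex.normSq (fibreCoord y) := contDiff_const.add hn
  have h0 : ∀ y, 1 + Complex.normSq (fibreCoord y) ≠ 0 := fun y => (one_add_normSq_pos _).ne'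
  exact hc.prodMk ((hc.mul contDiff_baseCoord).prodMk
    (((Complex.ofRealCLM.contDiff.comp (contDiff_const.div hd h0)).mul contDiff_fibreCoord).prodMk
      ((contDiff_const.sub hn).div hd h0)))

/-- Complex coordinates in terms of the invariants. -/
def coordsOf (m : ℕ) (v : BundleAmbient) : E4 :=
  ofCoords (((2 / (1 + v.1) : ℝ) : ℂ) * v.2.1)
    ((((√((1 + v.1) / 2) ^ m * (1 + v.2.2.2.2))⁻¹ : ℝ) : ℂ) * v.2.2.1)

/-- The part of the ambient space where `coordsOf` is regular. -/
def coordsDomain : Set BundleAmbient := {v | -1 < v.1 ∧ -1 < v.2.2.2.2}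

theorem isOpen_coordsDomain : IsOpen coordsDomain := by
  have h1 : IsOpen {v : BundleAmbient | -1 < v.1} := isOpen_lt continuous_const (by fun_prop)
  have h2 : IsOpen {v : BundleAmbient | -1 < v.2.2.2.2} := isOpen_lt continuous_const (by fun_prop)
  exact h1.inter h2

theorem contDiffOn_coordsOf (m : ℕ) : ContDiffOn ℝ ∞ (coordsOf m) coordsDomain := by
  have h0 : ContDiffOn ℝ ∞ (fun v : BundleAmbient => 1 + v.1) coordsDomain := by fun_prop
  have h1 : ContDiffOn ℝ ∞ (fun v : BundleAmbient => 1 + v.2.2.2.2) coordsDomain := by fun_prop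
  have n0 : ∀ v ∈ coordsDomain, 1 + v.1 ≠ 0 := fun v hv => by linarith [hv.1] |> fun h : 0 < 1 + v.1 => h.ne'
  have hs : ContDiffOn ℝ ∞ (fun v : BundleAmbient => √((1 + v.1) / 2)) coordsDomain :=
    (h0.div_const 2).sqrt fun v hv => div_ne_zero (n0 v hv) two_ne_zero
  have hi : ContDiffOn ℝ ∞ (fun v : BundleAmbient => (√((1 + v.1) / 2) ^ m * (1 + v.2.2.2.2))⁻¹)
      coordsDomain := ((hs.pow m).mul h1).inv fun v hv => by
    have e1 : 0 < 1 + v.1 := by linarith [hv.1]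
    have e2 : 0 < 1 + v.2.2.2.2 := by linarith [hv.2]
    positivity
  have hw : ContDiffOn ℝ ∞ (fun v : BundleAmbient => ((2 / (1 + v.1) : ℝ) : ℂ) * v.2.1)
      coordsDomain := (Complex.ofRealCLM.contDiff.comp_contDiffOn (contDiffOn_const.div h0 n0)).mul
    (by fun_prop)
  have hz : ContDiffOn ℝ ∞ (fun v : BundleAmbient =>
      (((√((1 + v.1) / 2) ^ m * (1 + v.2.2.2.2))⁻¹ : ℝ) : ℂ) * v.2.2.1)
      coordsDomain := (Complex.ofRealCLM.contDiff.comp_contDiffOn hi).mul (by fun_prop)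
  refine contDiffOn_piLp 2 |>.2 fun i => ?_
  fin_cases i
  · exact Complex.reCLM.contDiff.comp_contDiffOn hw
  · exact Complex.imCLM.contDiff.comp_contDiffOn hw
  · exact Complex.reCLM.contDiff.comp_contDiffOn hz
  · exact Complex.imCLM.contDiff.comp_contDiffOn hz

/-- The parametrization of an open subset by complex coordinates. -/
def param (y : E4) : Hirz m := mk (frameOf y) (frameOf_mem y)

theorem frameOf_fst_sq (y : E4) :
    1 + (frameInvariants m (frameOf y)).1 = 2 * cosHalf (baseCoord y) ^ 2 := by
  have h1 := one_add_normSq_pos (baseCoord y)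
  simp only [frameInvariants, frameOf, map_mul, Complex.normSq_ofReal, ← sq, cosHalf_sq]
  field_simp
  ring

theorem one_add_frameOf_last (y : E4) :
    1 + (frameInvariants m (frameOf y)).2.2.2.2 = 2 / (1 + Complex.normSq (fibreCoord y)) := by
  have h1 := one_add_normSq_pos (fibreCoord y)
  simp only [frameInvariants, frameOf]
  field_simp
  ring

theorem param_mem_coordsDomain (y : E4) : (param y : Hirz m).val ∈ coordsDomain := by
  have h1 := frameOf_fst_sq (m := m) y
  have h2 := one_add_frameOf_last (m := m) y
  have h3 := one_add_normSq_pos (fibreCoord y)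
  have h4 := cosHalf_pos (baseCoord y)
  constructor
  · have : 0 < 2 * cosHalf (baseCoord y) ^ 2 := by positivity
    change -1 < (frameInvariants m (frameOf y)).1
    linarith
  · have : 0 < 2 / (1 + Complex.normSq (fibreCoord y)) := by positivity
    change -1 < (frameInvariants m (frameOf y)).2.2.2.2
    linarith

theorem coordsOf_param (y : E4) : coordsOf m (param y : Hirz m).val = y := by
  have h3 := one_add_normSq_pos (fibreCoord y)
  have h4 := cosHalf_pos (baseCoord y)
  change coordsOf m (frameInvariants m (frameOf y)) = y
  rw [coordsOf, frameOf_fst_sq, one_add_frameOf_last]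
  have e1 : √(2 * cosHalf (baseCoord y) ^ 2 / 2) = cosHalf (baseCoord y) := by
    rw [mul_div_cancel_left₀ _ two_ne_zero, Real.sqrt_sq h4.le]
  rw [e1]
  conv_rhs => rw [← ofCoords_coords y]
  have h5 : ((cosHalf (baseCoord y) : ℝ) : ℂ) ≠ 0 := by exact_mod_cast h4.ne'
  have h6 : (1 + (Complex.normSq (fibreCoord y) : ℂ)) ≠ 0 := by exact_mod_cast h3.ne'
  congr 1
  · simp only [frameInvariants, frameOf, Complex.conj_ofReal]
    push_cast
    field_simp
  · simp only [frameInvariants, frameOf, Complex.conj_ofReal]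
    push_cast
    field_simp

/-- On the domain both |a|² and 1 + t are positive. The normalised frame built from the coordinates
is the representative of the orbit whose first entry is positive, reached by the unit scalar conj
a/|a|. -/
theorem param_coordsOf (p : Hirz m) (hp : p.val ∈ coordsDomain) : param (coordsOf m p.val) = p := by
  obtain ⟨⟨a, b, c, t⟩, ⟨h1, h2⟩, rfl⟩ := p.exists_mk
  simp only at h1 h2
  obtain ⟨hn, ht⟩ := hp
  change -1 < Complex.normSq a - Complex.normSq b at hn
  change -1 < t at ht
  refine val_injective ?_
  have e0 : 1 + (Complex.normSq a - Complex.normSq b) = 2 * Complex.normSq a := by linarith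
  have ha0 : 0 < Complex.normSq a := by linarith
  have ha : a ≠ 0 := by simpa using ha0.ne'
  have hca : conj a ≠ 0 := by simpa using ha
  have hn0 : (0 : ℝ) < ‖a‖ := norm_pos_iff.2 ha
  have hnc : ((‖a‖ : ℝ) : ℂ) ≠ 0 := by exact_mod_cast hn0.ne'
  have hs : √(2 * Complex.normSq a / 2) = ‖a‖ := by
    rw [mul_div_cancel_left₀ _ two_ne_zero, Complex.normSq_eq_norm_sq, Real.sqrt_sq hn0.le]
  have ht' : 0 < 1 + t := by linarith
  have htc : ((1 + t : ℝ) : ℂ) ≠ 0 := by exact_mod_cast ht'.ne'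
  have hac : a * conj a = ((‖a‖ : ℝ) : ℂ) ^ 2 := by
    rw [Complex.mul_conj, Complex.normSq_eq_norm_sq]
    push_cast
    ring
  obtain ⟨y, hy⟩ : ∃ y, y = coordsOf m (frameInvariants m (a, b, c, t)) := ⟨_, rfl⟩
  have hw : baseCoord y = b / a := by
    rw [hy, coordsOf, baseCoord_ofCoords]
    simp only [frameInvariants, e0]
    have hnn : ((Complex.normSq a : ℝ) : ℂ) = a * conj a := (Complex.mul_conj a).symm
    push_cast
    rw [hnn]
    field_simp
  have hz : fibreCoord y = c * conj a ^ m / (‖a‖ ^ m * (1 + t : ℝ)) := by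
    rw [hy, coordsOf, fibreCoord_ofCoords]
    simp only [frameInvariants, e0, hs]
    push_cast
    rw [div_eq_inv_mul]
  have hzn : 1 + Complex.normSq (fibreCoord y) = 2 / (1 + t) := by
    rw [hz]
    simp only [map_div₀, map_mul, map_pow, Complex.normSq_conj, Complex.normSq_ofReal,
      Complex.normSq_eq_norm_sq a, Complex.norm_real, ← sq]
    have e : Complex.normSq c = (1 - t) * (1 + t) := by linarith
    rw [e]
    field_simp
    ring
  have hcos : cosHalf (baseCoord y) = ‖a‖ := by
    have : 1 + Complex.normSq (baseCoord y) = (‖a‖ ^ 2)⁻¹ := by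
      rw [hw, map_div₀, ← Complex.normSq_eq_norm_sq]
      field_simp
      linarith
    rw [cosHalf, this, Real.sqrt_inv, inv_inv, Real.sqrt_sq hn0.le]
  change frameInvariants m (frameOf (coordsOf m (frameInvariants m (a, b, c, t))))
    = frameInvariants m (a, b, c, t)
  rw [← hy]
  have l1 : 2 / (1 + Complex.normSq (fibreCoord y)) = 1 + t := by
    rw [hzn]
    field_simp
  have l2 : (1 - Complex.normSq (fibreCoord y)) / (1 + Complex.normSq (fibreCoord y)) = t := by
    have : Complex.normSq (fibreCoord y) = 2 / (1 + t) - 1 := by linarith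
    rw [hzn, this]
    field_simp
    ring
  rw [eq_comm, frameInvariants_eq_iff ⟨h1, h2⟩ (frameOf_mem y)]
  refine ⟨conj a / ‖a‖, ?_, ?_⟩
  · rw [map_div₀, Complex.normSq_conj, Complex.normSq_ofReal, Complex.normSq_eq_norm_sq]
    field_simp
  · simp only [frameOf, hcos, l1, l2, Prod.mk.injEq]
    rw [hw, hz]
    refine ⟨?_, ?_, ?_, trivial⟩
    · rw [div_mul_eq_mul_div, mul_comm (conj a), hac]
      field_simp
    · have : conj a = (‖a‖ : ℂ) ^ 2 / a := by
        rw [← hac]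
        field_simp
      rw [this]
      field_simp
    · rw [div_pow]
      field_simp

/-- The standard chart. -/
def stdChart (m : ℕ) : OpenPartialHomeomorph (Hirz m) E4 where
  toFun p := coordsOf m p.val
  invFun := param
  source := val ⁻¹' coordsDomain
  target := univ
  map_source' _ _ := mem_univ _
  map_target' y _ := param_mem_coordsDomain y
  left_inv' p hp := param_coordsOf p hp
  right_inv' y _ := coordsOf_param y
  open_source := isOpen_coordsDomain.preimage continuous_val
  open_target := isOpen_univ
  continuousOn_toFun := (contDiffOn_coordsOf m).continuousOn.comp continuous_val.continuousOn
    fun _ h => h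
  continuousOn_invFun := (isInducing_val.continuous_iff.2 (show Continuous (val ∘ param) from
    (contDiff_frameInvariants m).continuous.comp contDiff_frameOf.continuous)).continuousOn

/-- The four charts. -/
def chart (m : ℕ) (s : Bool × Bool) : OpenPartialHomeomorph (Hirz m) E4 :=
  (flipHomeo s).transOpenPartialHomeomorph (stdChart m)

theorem chart_apply (s : Bool × Bool) (p : Hirz m) :
    chart m s p = coordsOf m (flipAmbient s p.val) := rfl

theorem mem_chart_source (s : Bool × Bool) (p : Hirz m) :
    p ∈ (chart m s).source ↔ flipAmbient s p.val ∈ coordsDomain := Iff.rfl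

theorem chart_target (s : Bool × Bool) : (chart m s).target = univ := rfl

open Classical in
/-- The index of the preferred chart at a point. -/
def index (p : Hirz m) : Bool × Bool := (decide (p.val.1 < 0), decide (p.val.2.2.2.2 < 0))

theorem mem_chart_index (p : Hirz m) : p ∈ (chart m (index p)).source := by
  rw [mem_chart_source]
  by_cases h1 : p.val.1 < 0 <;> by_cases h2 : p.val.2.2.2.2 < 0 <;>
    simp [index, flipAmbient, coordsDomain, h1, h2] <;> constructor <;> linarith

instance : ChartedSpace E4 (Hirz m) where
  atlas := range (chart m)
  chartAt p := chart m (index p)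
  mem_chart_source := mem_chart_index
  chart_mem_atlas p := mem_range_self _

theorem chartAt_eq (p : Hirz m) : chartAt E4 p = chart m (index p) := rfl

/-- The frame parametrizing a chart. -/
theorem val_chart_symm (s : Bool × Bool) (y : E4) :
    ((chart m s).symm y).val = frameInvariants m (flipFrame s (frameOf y)) :=
  (frameInvariants_flipFrame s _).symm

theorem contDiff_val_chart_symm (s : Bool × Bool) :
    ContDiff ℝ ∞ fun y => ((chart m s).symm y).val := by
  simp only [val_chart_symm]
  exact (contDiff_frameInvariants m).comp ((contDiff_flipFrame s).comp contDiff_frameOf)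

/-- Every transition map passes through the ambient vector space: a globally smooth parametrization,
an ambient flip, and then coordinate functions smooth on an open set of the ambient space. -/
instance : IsManifold (𝓡 4) ∞ (Hirz m) := by
  refine isManifold_of_contDiffOn _ _ _ ?_
  rintro _ _ ⟨s, rfl⟩ ⟨s', rfl⟩
  simp only [modelWithCornersSelf_coe, modelWithCornersSelf_coe_symm, Function.comp_id,
    Function.id_comp, range_id, inter_univ, preimage_id_eq, id_eq]
  exact (contDiffOn_coordsOf m).comp
    ((contDiff_flipAmbient s').comp (contDiff_val_chart_symm s)).contDiffOn fun y hy => hy.2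

theorem chart_mem_maximalAtlas (s : Bool × Bool) :
    chart m s ∈ IsManifold.maximalAtlas (𝓡 4) ∞ (Hirz m) :=
  IsManifold.subset_maximalAtlas (mem_range_self s)

theorem contMDiff_chart_symm (s : Bool × Bool) :
    ContMDiff (𝓡 4) (𝓡 4) ∞ (chart m s).symm :=
  contMDiffOn_univ.1 (contMDiffOn_symm_of_mem_maximalAtlas (chart_mem_maximalAtlas s))

theorem contMDiffOn_chart (s : Bool × Bool) :
    ContMDiffOn (𝓡 4) (𝓡 4) ∞ (chart m s) (chart m s).source :=
  contMDiffOn_of_mem_maximalAtlas (chart_mem_maximalAtlas s)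

section Smoothness

variable {E H N : Type*} [NormedAddCommGroup E] [NormedSpace ℝ E] [TopologicalSpace H]
  {I : ModelWithCorners ℝ E H} [TopologicalSpace N] [ChartedSpace H N]

/-- Smoothness of a map out of the bundle can be checked in the four parametrizations. -/
theorem contMDiffAt_of_chart_symm {f : Hirz m → N} {p : Hirz m} {s : Bool × Bool}
    (hp : p ∈ (chart m s).source)
    (h : ContMDiffAt (𝓡 4) I ∞ (fun y => f ((chart m s).symm y)) (chart m s p)) :
    ContMDiffAt (𝓡 4) I ∞ f p := by
  have h1 := h.comp p ((contMDiffOn_chart s).contMDiffAt ((chart m s).open_source.mem_nhds hp))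
  refine h1.congr_of_eventuallyEq ?_
  filter_upwards [(chart m s).open_source.mem_nhds hp] with q hq
  simp [(chart m s).left_inv hq]

theorem contMDiff_of_chart_symm {f : Hirz m → N}
    (h : ∀ s, ContMDiff (𝓡 4) I ∞ fun y => f ((chart m s).symm y)) :
    ContMDiff (𝓡 4) I ∞ f := fun p =>
  contMDiffAt_of_chart_symm (mem_chart_index p) (h _ _)

theorem contMDiff_val : ContMDiff (𝓡 4) 𝓘(ℝ, BundleAmbient) ∞ (val (m := m)) :=
  contMDiff_of_chart_symm fun s => (contDiff_val_chart_symm s).contMDiff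

/-- Smoothness of a map into the bundle can be checked in the ambient space. -/
theorem contMDiffOn_of_val {f : N → Hirz m} {U : Set N}
    (h : ContMDiffOn I 𝓘(ℝ, BundleAmbient) ∞ (fun q => (f q).val) U) :
    ContMDiffOn I (𝓡 4) ∞ f U := by
  intro q hq
  have hf : ContinuousWithinAt f U q := isInducing_val.continuousWithinAt_iff.2
    (h.continuousOn q hq)
  set s := index (f q)
  have hs : f q ∈ (chart m s).source := mem_chart_index (f q)
  have h1 : ContMDiffAt 𝓘(ℝ, BundleAmbient) (𝓡 4) ∞ (fun v => coordsOf m (flipAmbient s v))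
      (f q).val := by
    refine ContDiffAt.contMDiffAt ?_
    exact ContDiffAt.comp (f := flipAmbient s) (f q).val
      ((contDiffOn_coordsOf m).contDiffAt (isOpen_coordsDomain.mem_nhds hs))
      (contDiff_flipAmbient s).contDiffAt
  have h2 := ((contMDiff_chart_symm (m := m) s).contMDiffAt (x := chart m s (f q))).comp_contMDiffWithinAt
    q (h1.comp_contMDiffWithinAt q (h q hq))
  refine h2.congr_of_eventuallyEq ?_ ?_
  · filter_upwards [hf ((chart m s).open_source.mem_nhds hs)] with x hx
    exact ((chart m s).left_inv hx).symm
  · exact ((chart m s).left_inv hs).symm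

theorem contMDiff_of_val {f : N → Hirz m}
    (h : ContMDiff I 𝓘(ℝ, BundleAmbient) ∞ (fun q => (f q).val)) : ContMDiff I (𝓡 4) ∞ f :=
  contMDiffOn_univ.1 (contMDiffOn_of_val h.contMDiffOn)

end Smoothness

end Hirz

/-! ### The metrics in complex coordinates -/

section ChartMetric

/-- Square of the modulus of the first complex coordinate. -/
def baseSq (y : E4) : ℝ := y 0 ^ 2 + y 1 ^ 2

/-- Square of the modulus of the second complex coordinate. -/
def fibreSq (y : E4) : ℝ := y 2 ^ 2 + y 3 ^ 2

/-- The coordinate `x` on a chart. -/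
def chartHeight (x₁ : ℝ) (y : E4) : ℝ := x₁ * (1 - fibreSq y) / (1 + fibreSq y)

/-- The quadratic factor of `P`. -/
def pageFactor (α Λ x₁ x : ℝ) : ℝ :=
  2 * (α ^ 2 * Λ) - 1 - α ^ 2 * Λ * (x₁ ^ 2 + x ^ 2) / 3

/-- The conformal part of the fibre metric. -/
def fibreCoeff (α Λ x₁ : ℝ) (m : ℕ) (y : E4) : ℝ :=
  64 * α ^ 2 * x₁ ^ 2 * pageFactor α Λ x₁ (chartHeight x₁ y)
    / (m ^ 2 * (1 + fibreSq y) ^ 2 * (1 - chartHeight x₁ y ^ 2))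

/-- The remaining radial part of the fibre metric. -/
def radialCoeff (α Λ x₁ : ℝ) (m : ℕ) (y : E4) : ℝ :=
  16 * α ^ 2 * x₁ ^ 2 * (m - 4 * x₁ * (α ^ 2 * Λ) / 3)
      * (m * (1 - chartHeight x₁ y ^ 2) + 4 * x₁ * pageFactor α Λ x₁ (chartHeight x₁ y))
    / ((1 + fibreSq y) ^ 4 * m ^ 2 * pageFactor α Λ x₁ (chartHeight x₁ y)
      * (1 - chartHeight x₁ y ^ 2))

/-- The conformal factor of the base metric. -/
def baseCoeff (α x₁ : ℝ) (y : E4) : ℝ :=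
  4 * α ^ 2 * (1 - chartHeight x₁ y ^ 2) / (1 + baseSq y) ^ 2

/-- The real part of the covariant differential of the fibre coordinate. -/
def fibreRe (m : ℕ) (y : E4) : Fin 4 → ℝ :=
  ![-(m * y 3 * y 1 / (1 + baseSq y)), m * y 3 * y 0 / (1 + baseSq y), 1, 0]

/-- The imaginary part of the covariant differential of the fibre coordinate. -/
def fibreIm (m : ℕ) (y : E4) : Fin 4 → ℝ :=
  ![m * y 2 * y 1 / (1 + baseSq y), -(m * y 2 * y 0 / (1 + baseSq y)), 0, 1]

/-- The metric in complex coordinates. -/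
def chartMetric (α Λ x₁ : ℝ) (m : ℕ) (y : E4) : Matrix (Fin 4) (Fin 4) ℝ :=
  fibreCoeff α Λ x₁ m y • cosq (fibreRe m y) + fibreCoeff α Λ x₁ m y • cosq (fibreIm m y)
    + radialCoeff α Λ x₁ m y • cosq ![0, 0, y 2, y 3]
    + baseCoeff α x₁ y • cosq ![1, 0, 0, 0] + baseCoeff α x₁ y • cosq ![0, 1, 0, 0]

/-- A potential of the Maxwell field in complex coordinates. -/
def chartPotential (x₁ : ℝ) (m : ℕ) (a b : ℝ) (i : Fin 4) (y : E4) : ℝ :=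
  let H := -(4 * x₁ * a / ((1 + fibreSq y) * (1 - chartHeight x₁ y) * (1 - x₁)))
    + 4 * x₁ * b / ((1 + fibreSq y) * (1 + chartHeight x₁ y) * (1 + x₁))
  let h := pageProfile a b (chartHeight x₁ y)
  match i with
  | 0 => 2 * h * y 1 / (1 + baseSq y)
  | 1 => -(2 * h * y 0 / (1 + baseSq y))
  | 2 => -(2 / m * H * y 3)
  | 3 => 2 / m * H * y 2

theorem one_add_baseSq_pos (y : E4) : 0 < 1 + baseSq y := by
  unfold baseSq
  positivity

theorem one_add_fibreSq_pos (y : E4) : 0 < 1 + fibreSq y := by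
  unfold fibreSq
  positivity

theorem contDiff_baseSq : ContDiff ℝ ∞ baseSq := by
  unfold baseSq
  fun_prop

theorem contDiff_fibreSq : ContDiff ℝ ∞ fibreSq := by
  unfold fibreSq
  fun_prop

theorem contDiff_chartHeight (x₁ : ℝ) : ContDiff ℝ ∞ (chartHeight x₁) :=
  (contDiff_const.mul (contDiff_const.sub contDiff_fibreSq)).div
    (contDiff_const.add contDiff_fibreSq) fun y => (one_add_fibreSq_pos y).ne'

variable {α Λ c x₁ : ℝ} {m : ℕ}

theorem abs_chartHeight_le (hx : 0 < x₁) (y : E4) : |chartHeight x₁ y| ≤ x₁ := by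
  have h := one_add_fibreSq_pos y
  have h0 : 0 ≤ fibreSq y := by
    unfold fibreSq
    positivity
  rw [abs_le, chartHeight]
  constructor
  · rw [le_div_iff₀ h]
    nlinarith
  · rw [div_le_iff₀ h]
    nlinarith

theorem IsAdmissible.one_sub_chartHeight_sq_pos (h : IsAdmissible α Λ c x₁) (y : E4) :
    0 < 1 - chartHeight x₁ y ^ 2 :=
  abs_lt_one_sq ((abs_chartHeight_le h.pos y).trans_lt h.lt_one)

theorem IsRegularSolution.pageFactor_pos (h : IsRegularSolution α Λ c x₁ m) {x : ℝ}
    (hx : |x| ≤ x₁) : 0 < pageFactor α Λ x₁ x := by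
  have h1 := h.factor_pos
  have h2 := h.scaled_lambda_pos
  have h3 : x ^ 2 ≤ x₁ ^ 2 := sq_le_sq' (by linarith [(abs_le.1 hx).1]) (abs_le.1 hx).2
  unfold pageFactor
  nlinarith

theorem IsRegularSolution.cast_pos (h : IsRegularSolution α Λ c x₁ m) : (0 : ℝ) < m := by
  exact_mod_cast h.one_le

/-- The form of the integrality condition which removes the singularity at the poles of the fibre.
-/
theorem IsRegularSolution.mul_one_sub_sq (h : IsRegularSolution α Λ c x₁ m) :
    m * (1 - x₁ ^ 2) = 4 * x₁ * pageFactor α Λ x₁ x₁ := by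
  have hx : 1 - x₁ ^ 2 ≠ 0 := by nlinarith [h.pos, h.lt_one]
  rw [h.integrality, regularityValue_eq h.pos h.lt_one h.root, div_mul_cancel₀ _ hx, pageFactor]
  ring

theorem contDiff_pageFactor (α Λ x₁ : ℝ) : ContDiff ℝ ∞ (pageFactor α Λ x₁) := by
  unfold pageFactor
  fun_prop

theorem IsRegularSolution.mSmoothAt_chartMetric (h : IsRegularSolution α Λ c x₁ m) (y : E4) :
    MSmoothAt (chartMetric α Λ x₁ m) y := by
  have hS : ContDiff ℝ ∞ fun y => 1 + baseSq y := contDiff_const.add contDiff_baseSq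
  have hR : ContDiff ℝ ∞ fun y => 1 + fibreSq y := contDiff_const.add contDiff_fibreSq
  have hD : ContDiff ℝ ∞ fun y => 1 - chartHeight x₁ y ^ 2 :=
    contDiff_const.sub ((contDiff_chartHeight x₁).pow 2)
  have hN : ContDiff ℝ ∞ fun y => pageFactor α Λ x₁ (chartHeight x₁ y) :=
    (contDiff_pageFactor α Λ x₁).comp (contDiff_chartHeight x₁)
  have pS := one_add_baseSq_pos
  have pR := one_add_fibreSq_pos
  have pD := h.one_sub_chartHeight_sq_pos
  have pN := fun y => h.pageFactor_pos (abs_chartHeight_le h.pos y)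
  have pm := h.cast_pos
  have hb : ContDiff ℝ ∞ (fibreCoeff α Λ x₁ m) := by
    refine (contDiff_const.mul hN).div ((contDiff_const.mul (hR.pow 2)).mul hD) fun y => ?_
    have := pR y
    have := pD y
    positivity
  have hc : ContDiff ℝ ∞ (radialCoeff α Λ x₁ m) := by
    refine (contDiff_const.mul ((contDiff_const.mul hD).add (contDiff_const.mul hN))).div
      ((((hR.pow 4).mul contDiff_const).mul hN).mul hD) fun y => ?_
    have := pR y
    have := pD y
    have := pN y
    positivity
  have hf : ContDiff ℝ ∞ (baseCoeff α x₁) :=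
    (contDiff_const.mul hD).div (hS.pow 2) fun y => (pow_pos (pS y) 2).ne'
  have hq : ∀ {f : E4 → ℝ} {w : E4 → Fin 4 → ℝ}, ContDiff ℝ ∞ f →
      (∀ i, ContDiff ℝ ∞ fun y => w y i) → ∀ i j,
      ContDiff ℝ ∞ fun y => (f y • cosq (w y)) i j := fun hf hw i j =>
    hf.mul ((hw i).mul (hw j))
  have hd : ∀ i j : Fin 4, ContDiff ℝ ∞ fun y : E4 => m * y i * y j / (1 + baseSq y) := fun i j =>
    ContDiff.div (by fun_prop) hS fun y => (pS y).ne'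
  have h1 : ∀ i, ContDiff ℝ ∞ fun y => fibreRe m y i := fun i => by
    fin_cases i
    exacts [(hd 3 1).neg, hd 3 0, contDiff_const, contDiff_const]
  have h2 : ∀ i, ContDiff ℝ ∞ fun y => fibreIm m y i := fun i => by
    fin_cases i
    exacts [hd 2 1, (hd 2 0).neg, contDiff_const, contDiff_const]
  have h3 : ∀ i, ContDiff ℝ ∞ fun y : E4 => (![0, 0, y 2, y 3] : Fin 4 → ℝ) i := fun i => by
    fin_cases i
    · exact contDiff_const
    · exact contDiff_const
    · exact (by fun_prop : ContDiff ℝ ∞ fun y : E4 => y 2)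
    · exact (by fun_prop : ContDiff ℝ ∞ fun y : E4 => y 3)
  exact fun i j => (((((hq hb h1 i j).add (hq hb h2 i j)).add (hq hc h3 i j)).add
    (hq hf (w := fun _ => ![1, 0, 0, 0]) (fun _ => contDiff_const) i j)).add
    (hq hf (w := fun _ => ![0, 1, 0, 0]) (fun _ => contDiff_const) i j)).contDiffAt

theorem chartMetric_symm (α Λ x₁ : ℝ) (m : ℕ) (y : E4) (i j : Fin 4) :
    chartMetric α Λ x₁ m y i j = chartMetric α Λ x₁ m y j i := by
  simp only [chartMetric, Matrix.add_apply, Matrix.smul_apply, cosq_apply, smul_eq_mul]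
  ring

theorem dotProduct_cosq_mulVec (w v : Fin 4 → ℝ) : v ⬝ᵥ (cosq w *ᵥ v) = (w ⬝ᵥ v) ^ 2 := by
  simp only [cosq, dotProduct, Matrix.mulVec, Matrix.vecMulVec_apply, Fin.sum_univ_four]
  ring

/-- The radial coefficient is the difference of the two eigenvalues of the fibre metric. -/
theorem IsRegularSolution.fibreCoeff_add (h : IsRegularSolution α Λ c x₁ m) (y : E4) :
    fibreCoeff α Λ x₁ m y + radialCoeff α Λ x₁ m y * fibreSq y
      = 4 * α ^ 2 * (1 - chartHeight x₁ y ^ 2)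
        / (pageFactor α Λ x₁ (chartHeight x₁ y) * (1 + fibreSq y) ^ 2) := by
  have pR := one_add_fibreSq_pos y
  have pD := h.one_sub_chartHeight_sq_pos y
  have pN := h.pageFactor_pos (abs_chartHeight_le h.pos y)
  have pm := h.cast_pos
  have e0 := h.mul_one_sub_sq
  have e1 : x₁ ^ 2 - chartHeight x₁ y ^ 2 = 4 * x₁ ^ 2 * fibreSq y / (1 + fibreSq y) ^ 2 := by
    rw [chartHeight]
    field_simp
    ring
  -- The heart of the smooth extension: the left side is affine in x² and vanishes at x = x₁ by
  -- integrality, hence is a multiple of x₁² - x², that is, of |z|². Without this divisibility the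
  -- radial and angular eigenvalues would disagree at z = 0.
  have e2 : m * (1 - chartHeight x₁ y ^ 2) - 4 * x₁ * pageFactor α Λ x₁ (chartHeight x₁ y)
      = (m - 4 * x₁ * (α ^ 2 * Λ) / 3) * (4 * x₁ ^ 2 * fibreSq y / (1 + fibreSq y) ^ 2) := by
    rw [← e1]
    unfold pageFactor at *
    linear_combination e0
  have e3 : (m : ℝ) ^ 2 * (1 - chartHeight x₁ y ^ 2) ^ 2
      - 16 * x₁ ^ 2 * pageFactor α Λ x₁ (chartHeight x₁ y) ^ 2
      = (m - 4 * x₁ * (α ^ 2 * Λ) / 3) * (4 * x₁ ^ 2 * fibreSq y / (1 + fibreSq y) ^ 2)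
        * (m * (1 - chartHeight x₁ y ^ 2) + 4 * x₁ * pageFactor α Λ x₁ (chartHeight x₁ y)) := by
    rw [← e2]
    ring
  have e4 : radialCoeff α Λ x₁ m y * fibreSq y = 4 * α ^ 2
      * ((m : ℝ) ^ 2 * (1 - chartHeight x₁ y ^ 2) ^ 2
        - 16 * x₁ ^ 2 * pageFactor α Λ x₁ (chartHeight x₁ y) ^ 2)
      / ((1 + fibreSq y) ^ 2 * m ^ 2 * pageFactor α Λ x₁ (chartHeight x₁ y)
        * (1 - chartHeight x₁ y ^ 2)) := by
    rw [e3, radialCoeff]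
    generalize pageFactor α Λ x₁ (chartHeight x₁ y) = N at *
    generalize 1 - chartHeight x₁ y ^ 2 = D at *
    field_simp
    ring
  rw [e4, fibreCoeff]
  generalize pageFactor α Λ x₁ (chartHeight x₁ y) = N at *
  generalize 1 - chartHeight x₁ y ^ 2 = D at *
  field_simp
  ring

theorem eq_zero_of_sq_add_sq {a b : ℝ} (h : a ^ 2 + b ^ 2 = 0) : a = 0 ∧ b = 0 := by
  constructor
  · exact pow_eq_zero_iff two_ne_zero |>.1 (by linarith [sq_nonneg a, sq_nonneg b])
  · exact pow_eq_zero_iff two_ne_zero |>.1 (by linarith [sq_nonneg a, sq_nonneg b])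

/-- On the fibre directions the eigenvalues are `fibreCoeff` and `fibreCoeff + radialCoeff *
fibreSq`, both positive even where `radialCoeff` is negative. The Cauchy–Schwarz inequality bounds
the form below by the smaller one. -/
theorem IsRegularSolution.posDef_chartMetric (h : IsRegularSolution α Λ c x₁ m) (y : E4) :
    (chartMetric α Λ x₁ m y).PosDef := by
  have pS := one_add_baseSq_pos y
  have pR := one_add_fibreSq_pos y
  have pD := h.one_sub_chartHeight_sq_pos y
  have pN := h.pageFactor_pos (abs_chartHeight_le h.pos y)
  have pm := h.cast_pos
  have hx := h.pos
  have hα := h.scale_pos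
  have hb : 0 < fibreCoeff α Λ x₁ m y := by
    unfold fibreCoeff
    positivity
  have hf : 0 < baseCoeff α x₁ y := by
    unfold baseCoeff
    positivity
  have ha : 0 < fibreCoeff α Λ x₁ m y + radialCoeff α Λ x₁ m y * fibreSq y := by
    rw [h.fibreCoeff_add]
    positivity
  refine Matrix.PosDef.of_dotProduct_mulVec_pos ?_ fun v hv => ?_
  · ext i j
    simpa using chartMetric_symm α Λ x₁ m y j i
  · set p := fibreRe m y ⬝ᵥ v with hp
    set q := fibreIm m y ⬝ᵥ v with hq
    have e : star v ⬝ᵥ (chartMetric α Λ x₁ m y *ᵥ v) = fibreCoeff α Λ x₁ m y * (p ^ 2 + q ^ 2)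
        + radialCoeff α Λ x₁ m y * (y 2 * p + y 3 * q) ^ 2
        + baseCoeff α x₁ y * (v 0 ^ 2 + v 1 ^ 2) := by
      have e1 : (![0, 0, y 2, y 3] : Fin 4 → ℝ) ⬝ᵥ v = y 2 * p + y 3 * q := by
        simp [hp, hq, fibreRe, fibreIm, dotProduct, Fin.sum_univ_four]
        ring
      have e2 : (![1, 0, 0, 0] : Fin 4 → ℝ) ⬝ᵥ v = v 0 := by
        simp [dotProduct, Fin.sum_univ_four]
      have e3 : (![0, 1, 0, 0] : Fin 4 → ℝ) ⬝ᵥ v = v 1 := by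
        simp [dotProduct, Fin.sum_univ_four]
      simp only [chartMetric, Matrix.add_mulVec, Matrix.smul_mulVec, dotProduct_add,
        dotProduct_smul, star_trivial, dotProduct_cosq_mulVec, e1, e2, e3, smul_eq_mul]
      ring
    rw [e]
    have hCS : (y 2 * p + y 3 * q) ^ 2 ≤ fibreSq y * (p ^ 2 + q ^ 2) := by
      unfold fibreSq
      nlinarith [sq_nonneg (y 2 * q - y 3 * p)]
    obtain ⟨k, hk, hle⟩ : ∃ k, 0 < k ∧ k * (p ^ 2 + q ^ 2) ≤ fibreCoeff α Λ x₁ m y * (p ^ 2 + q ^ 2)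
        + radialCoeff α Λ x₁ m y * (y 2 * p + y 3 * q) ^ 2 := by
      rcases le_or_gt 0 (radialCoeff α Λ x₁ m y) with hc | hc
      · exact ⟨_, hb, by nlinarith [mul_nonneg hc (sq_nonneg (y 2 * p + y 3 * q))]⟩
      · exact ⟨_, ha, by nlinarith⟩
    by_contra hn
    have h1 : 0 ≤ k * (p ^ 2 + q ^ 2) := by positivity
    have h2 : 0 ≤ baseCoeff α x₁ y * (v 0 ^ 2 + v 1 ^ 2) := by positivity
    have z1 : k * (p ^ 2 + q ^ 2) = 0 := by linarith
    have z2 : baseCoeff α x₁ y * (v 0 ^ 2 + v 1 ^ 2) = 0 := by linarith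
    have z3 := (mul_eq_zero.1 z1).resolve_left hk.ne'
    have z4 := (mul_eq_zero.1 z2).resolve_left hf.ne'
    obtain ⟨v0, v1⟩ := eq_zero_of_sq_add_sq z4
    obtain ⟨p0, q0⟩ := eq_zero_of_sq_add_sq z3
    refine hv (funext fun i => ?_)
    rw [hp] at p0
    rw [hq] at q0
    simp [fibreRe, fibreIm, dotProduct, Fin.sum_univ_four, v0, v1] at p0 q0
    fin_cases i
    exacts [v0, v1, p0, q0]

theorem contDiff_chartPotential (h : IsAdmissible α Λ c x₁) (m : ℕ) (a b : ℝ) (i : Fin 4) :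
    ContDiff ℝ ∞ (chartPotential x₁ m a b i) := by
  have hS : ContDiff ℝ ∞ fun y => 1 + baseSq y := contDiff_const.add contDiff_baseSq
  have hR : ContDiff ℝ ∞ fun y => 1 + fibreSq y := contDiff_const.add contDiff_fibreSq
  have hX := contDiff_chartHeight x₁
  have h1 : ContDiff ℝ ∞ fun y => 1 - chartHeight x₁ y := contDiff_const.sub hX
  have h2 : ContDiff ℝ ∞ fun y => 1 + chartHeight x₁ y := contDiff_const.add hX
  have hx0 := h.pos
  have hx1 := h.lt_one
  have pX : ∀ y, |chartHeight x₁ y| < 1 := fun y => (abs_chartHeight_le h.pos y).trans_lt h.lt_one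
  have p1 : ∀ y, 1 - chartHeight x₁ y ≠ 0 := fun y => (sub_pos.2 (abs_lt.1 (pX y)).2).ne'
  have p2 : ∀ y, 1 + chartHeight x₁ y ≠ 0 := fun y => by linarith [(abs_lt.1 (pX y)).1]
    |> fun h : 0 < 1 + chartHeight x₁ y => h.ne'
  have pR : ∀ y, 1 + fibreSq y ≠ 0 := fun y => (one_add_fibreSq_pos y).ne'
  have hH : ContDiff ℝ ∞ fun y =>
      -(4 * x₁ * a / ((1 + fibreSq y) * (1 - chartHeight x₁ y) * (1 - x₁)))
        + 4 * x₁ * b / ((1 + fibreSq y) * (1 + chartHeight x₁ y) * (1 + x₁)) := by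
    refine (contDiff_const.div ((hR.mul h1).mul contDiff_const) fun y => ?_).neg.add
      (contDiff_const.div ((hR.mul h2).mul contDiff_const) fun y => ?_)
    · exact mul_ne_zero (mul_ne_zero (pR y) (p1 y)) (by linarith)
    · exact mul_ne_zero (mul_ne_zero (pR y) (p2 y)) (by linarith)
  have hh : ContDiff ℝ ∞ fun y => pageProfile a b (chartHeight x₁ y) :=
    (contDiff_const.mul (h2.div h1 p1)).add (contDiff_const.mul (h1.div h2 p2))
  have hc : ∀ i : Fin 4, ContDiff ℝ ∞ fun y : E4 => y i := fun i => by fun_prop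
  have pS : ∀ y, 1 + baseSq y ≠ 0 := fun y => (one_add_baseSq_pos y).ne'
  fin_cases i
  · exact ((contDiff_const.mul hh).mul (hc 1)).div hS pS
  · exact (((contDiff_const.mul hh).mul (hc 0)).div hS pS).neg
  · exact ((contDiff_const.mul hH).mul (hc 3)).neg
  · exact (contDiff_const.mul hH).mul (hc 2)

end ChartMetric

/-! ### Passage from (x, ψ, θ, φ) to complex coordinates -/

section PageChart

/-- The modulus of the fibre coordinate in terms of `x`. -/
def fibreRadius (x₁ x : ℝ) : ℝ := √((x₁ - x) / (x₁ + x))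

/-- The transition from the coordinates `(x, ψ, θ, φ)` to complex coordinates. -/
def pageChart (x₁ : ℝ) (m : ℕ) (p : E4) : E4 :=
  !₂[tan (p 2 / 2) * cos (p 3), tan (p 2 / 2) * sin (p 3),
    fibreRadius x₁ (p 0) * cos (m / 2 * (p 1 + p 3)),
    fibreRadius x₁ (p 0) * sin (m / 2 * (p 1 + p 3))]

/-- The Jacobian of `pageChart`, with `T = tan (θ / 2)`, `k = m / 2`. -/
def pageChartJac (T s c r d k s' c' : ℝ) : Matrix (Fin 4) (Fin 4) ℝ :=
  !![0, 0, (1 + T ^ 2) / 2 * c, -(T * s); 0, 0, (1 + T ^ 2) / 2 * s, T * c;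
    d * c', -(k * r * s'), 0, -(k * r * s'); d * s', k * r * c', 0, k * r * c']

variable {α Λ c x₁ : ℝ} {m : ℕ} {p : E4}

theorem fibreRadius_pos {x : ℝ} (h1 : -x₁ < x) (h2 : x < x₁) : 0 < fibreRadius x₁ x :=
  Real.sqrt_pos.2 (div_pos (by linarith) (by linarith))

theorem fibreRadius_sq {x : ℝ} (h1 : -x₁ < x) (h2 : x < x₁) :
    fibreRadius x₁ x ^ 2 = (x₁ - x) / (x₁ + x) :=
  Real.sq_sqrt (div_pos (by linarith) (by linarith)).le

theorem hasDerivAt_fibreRadius {x : ℝ} (h1 : -x₁ < x) (h2 : x < x₁) :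
    HasDerivAt (fibreRadius x₁)
      (-((1 + fibreRadius x₁ x ^ 2) ^ 2 / (4 * x₁ * fibreRadius x₁ x))) x := by
  have e1 : x₁ + x ≠ 0 := by linarith
  have e2 : (x₁ - x) / (x₁ + x) ≠ 0 := (div_pos (by linarith) (by linarith)).ne'
  have hx := hasDerivAt_id' x
  have := ((hx.const_sub x₁).div (hx.const_add x₁) e1).sqrt e2
  refine this.congr_deriv ?_
  have hr := fibreRadius_pos h1 h2
  have hx1 : x₁ ≠ 0 := by linarith
  rw [fibreRadius_sq h1 h2]
  change _ / (2 * fibreRadius x₁ x) = _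
  field_simp
  ring

theorem hasDerivAt_tan_half {θ : ℝ} (h0 : 0 < θ) (h1 : θ < π) :
    HasDerivAt (fun θ => tan (θ / 2)) ((1 + tan (θ / 2) ^ 2) / 2) θ := by
  have hc : 0 < cos (θ / 2) := cos_pos_of_mem_Ioo ⟨by linarith, by linarith⟩
  have := (Real.hasDerivAt_tan hc.ne').comp θ ((hasDerivAt_id' θ).div_const 2)
  refine this.congr_deriv ?_
  rw [Real.tan_eq_sin_div_cos]
  field_simp
  nlinarith [sin_sq_add_cos_sq (θ / 2)]

theorem jacobian_pageChart (hp : p ∈ coordBox x₁) :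
    (∀ a, HasGrad (fun q => pageChart x₁ m q a) (pageChartJac (tan (p 2 / 2)) (sin (p 3))
      (cos (p 3)) (fibreRadius x₁ (p 0))
      (-((1 + fibreRadius x₁ (p 0) ^ 2) ^ 2 / (4 * x₁ * fibreRadius x₁ (p 0)))) (m / 2)
      (sin (m / 2 * (p 1 + p 3))) (cos (m / 2 * (p 1 + p 3))) a) p) := by
  obtain ⟨h1, h2, h3, h4⟩ := hp
  have hT := (hasGrad_coord (p := p) 2).comp (hasDerivAt_tan_half h3 h4)
  have hr := (hasGrad_coord (p := p) 0).comp (hasDerivAt_fibreRadius h1 h2)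
  have hc := (hasGrad_coord (p := p) 3).comp (hasDerivAt_cos _)
  have hs := (hasGrad_coord (p := p) 3).comp (hasDerivAt_sin _)
  have hχ := ((hasGrad_coord (p := p) 1).add (hasGrad_coord 3)).const_mul ((m : ℝ) / 2)
  have hc' := hχ.comp (hasDerivAt_cos _)
  have hs' := hχ.comp (hasDerivAt_sin _)
  intro a
  fin_cases a
  · refine (hT.mul hc).congr ?_
    ext i
    fin_cases i <;> simp [pageChartJac] <;> ring
  · refine (hT.mul hs).congr ?_
    ext i
    fin_cases i <;> simp [pageChartJac] <;> ring
  · refine (hr.mul hc').congr ?_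
    ext i
    fin_cases i <;> simp [pageChartJac] <;> ring
  · refine (hr.mul hs').congr ?_
    ext i
    fin_cases i <;> simp [pageChartJac] <;> ring

theorem baseSq_pageChart : baseSq (pageChart x₁ m p) = tan (p 2 / 2) ^ 2 := by
  simp only [baseSq, pageChart]
  change (_ * cos (p 3)) ^ 2 + (_ * sin (p 3)) ^ 2 = _
  linear_combination tan (p 2 / 2) ^ 2 * sin_sq_add_cos_sq (p 3)

theorem fibreSq_pageChart : fibreSq (pageChart x₁ m p) = fibreRadius x₁ (p 0) ^ 2 := by
  simp only [fibreSq, pageChart]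
  change (_ * cos _) ^ 2 + (_ * sin _) ^ 2 = _
  linear_combination fibreRadius x₁ (p 0) ^ 2 * sin_sq_add_cos_sq (m / 2 * (p 1 + p 3))

theorem chartHeight_pageChart (hp : p ∈ coordBox x₁) :
    chartHeight x₁ (pageChart x₁ m p) = p 0 := by
  obtain ⟨h1, h2, -, -⟩ := hp
  have e : x₁ + p 0 ≠ 0 := by linarith
  have e1 : x₁ ≠ 0 := by linarith
  have e3 : 1 + (x₁ - p 0) / (x₁ + p 0) = 2 * x₁ / (x₁ + p 0) := by
    field_simp
    ring
  rw [chartHeight, fibreSq_pageChart, fibreRadius_sq h1 h2, e3]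
  field_simp
  ring

theorem sin_eq_tan_half {θ : ℝ} (h0 : 0 < θ) (h1 : θ < π) :
    sin θ = 2 * tan (θ / 2) / (1 + tan (θ / 2) ^ 2) := by
  have hc : 0 < cos (θ / 2) := cos_pos_of_mem_Ioo ⟨by linarith, by linarith⟩
  have h := sin_sq_add_cos_sq (θ / 2)
  conv_lhs => rw [← mul_div_cancel₀ θ (two_ne_zero (α := ℝ)), sin_two_mul]
  rw [eq_div_iff (by positivity), Real.tan_eq_sin_div_cos]
  field_simp
  linear_combination sin (θ / 2) * h

theorem cos_eq_tan_half {θ : ℝ} (h0 : 0 < θ) (h1 : θ < π) :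
    cos θ = (1 - tan (θ / 2) ^ 2) / (1 + tan (θ / 2) ^ 2) := by
  have hc : 0 < cos (θ / 2) := cos_pos_of_mem_Ioo ⟨by linarith, by linarith⟩
  have h := sin_sq_add_cos_sq (θ / 2)
  conv_lhs => rw [← mul_div_cancel₀ θ (two_ne_zero (α := ℝ)), cos_two_mul]
  rw [eq_div_iff (by positivity), Real.tan_eq_sin_div_cos]
  field_simp
  linear_combination (2 * cos (θ / 2) ^ 2) * h

theorem det_pageChartJac {T s c r d k s' c' : ℝ} (h : s ^ 2 + c ^ 2 = 1)
    (h' : s' ^ 2 + c' ^ 2 = 1) :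
    (pageChartJac T s c r d k s' c').det = (1 + T ^ 2) / 2 * T * (k * r * d) := by
  have : (pageChartJac T s c r d k s' c').det
      = (1 + T ^ 2) / 2 * T * (k * r * d) * (s ^ 2 + c ^ 2) * (s' ^ 2 + c' ^ 2) := by
    simp [pageChartJac, Matrix.det_succ_row_zero, Fin.sum_univ_succ, Fin.succAbove]
    ring
  rw [this, h, h', mul_one, mul_one]

/-- The fibre radius decreases as x increases, so the complex coordinates carry the opposite
orientation. This is the origin of σ = -1 in the charts, against σ = 1 for the original metric. -/
theorem det_jacobian_pageChart (hm : (0 : ℝ) < m) (hp : p ∈ coordBox x₁) :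
    (jacobian ℝ (pageChart x₁ m) p).det < 0 := by
  rw [jacobian_eq_of_hasGrad (jacobian_pageChart hp),
    det_pageChartJac (sin_sq_add_cos_sq _) (sin_sq_add_cos_sq _)]
  obtain ⟨h1, h2, h3, h4⟩ := hp
  have hr := fibreRadius_pos h1 h2
  have hT : 0 < tan (p 2 / 2) := tan_pos_of_pos_of_lt_pi_div_two (by linarith) (by linarith)
  have hx : 0 < x₁ := by linarith
  have : 0 < (1 + tan (p 2 / 2) ^ 2) / 2 * tan (p 2 / 2) * (m / 2 * fibreRadius x₁ (p 0)
      * ((1 + fibreRadius x₁ (p 0) ^ 2) ^ 2 / (4 * x₁ * fibreRadius x₁ (p 0)))) := by positivity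
  linarith

theorem isOpen_coordBox (x₁ : ℝ) : IsOpen (coordBox x₁) := by
  have c0 : Continuous fun p : E4 => p 0 := by fun_prop
  have c2 : Continuous fun p : E4 => p 2 := by fun_prop
  exact (isOpen_lt continuous_const c0).inter ((isOpen_lt c0 continuous_const).inter
    ((isOpen_lt continuous_const c2).inter (isOpen_lt c2 continuous_const)))

theorem contDiffOn_fibreRadius (x₁ : ℝ) :
    ContDiffOn ℝ ∞ (fun p : E4 => fibreRadius x₁ (p 0)) (coordBox x₁) := by
  have h1 : ContDiffOn ℝ ∞ (fun p : E4 => x₁ - p 0) (coordBox x₁) := by fun_prop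
  have h2 : ContDiffOn ℝ ∞ (fun p : E4 => x₁ + p 0) (coordBox x₁) := by fun_prop
  have h3 : ∀ p ∈ coordBox x₁, 0 < x₁ + p 0 := fun p hp => by linarith [hp.1]
  refine (h1.div h2 fun p hp => (h3 p hp).ne').sqrt fun p hp => ?_
  · exact (div_pos (by linarith [hp.2.1]) (by linarith [hp.1])).ne'

theorem contDiffOn_pageChart (x₁ : ℝ) (m : ℕ) :
    ContDiffOn ℝ ∞ (pageChart x₁ m) (coordBox x₁) := by
  have hr := contDiffOn_fibreRadius x₁
  have hs : ContDiff ℝ ∞ fun p : E4 => sin (p 2 / 2) := by fun_prop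
  have hc : ContDiff ℝ ∞ fun p : E4 => cos (p 2 / 2) := by fun_prop
  have hT : ContDiffOn ℝ ∞ (fun p : E4 => tan (p 2 / 2)) (coordBox x₁) := by
    simp only [Real.tan_eq_sin_div_cos]
    exact hs.contDiffOn.div hc.contDiffOn fun p hp =>
      (cos_pos_of_mem_Ioo ⟨by linarith [hp.2.2.1, pi_pos], by linarith [hp.2.2.2]⟩).ne'
  have c1 : ContDiff ℝ ∞ fun p : E4 => cos (p 3) := by fun_prop
  have s1 : ContDiff ℝ ∞ fun p : E4 => sin (p 3) := by fun_prop
  have c2 : ContDiff ℝ ∞ fun p : E4 => cos (m / 2 * (p 1 + p 3)) := by fun_prop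
  have s2 : ContDiff ℝ ∞ fun p : E4 => sin (m / 2 * (p 1 + p 3)) := by fun_prop
  refine contDiffOn_piLp 2 |>.2 fun i => ?_
  fin_cases i
  exacts [hT.mul c1.contDiffOn, hT.mul s1.contDiffOn, hr.mul c2.contDiffOn, hr.mul s2.contDiffOn]

theorem IsAdmissible.coordBox_subset (h : IsAdmissible α Λ c x₁) :
    coordBox x₁ ⊆ pageDomain α Λ c := fun p ⟨h1, h2, h3, h4⟩ =>
  ⟨abs_lt.2 ⟨by linarith [h.lt_one], by linarith [h.lt_one]⟩, h.positive _ h1 h2, h3, h4⟩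

/-- With χ = m(ψ + φ)/2, the covariant differential of z pulls back to e^{iχ}(dr + i(m/2) r (dψ +
cos θ dφ)). The angular square then carries `fibreCoeff` and dr² carries `fibreCoeff + radialCoeff
r²`, which match the two fibre coefficients of the original metric. -/
theorem IsRegularSolution.pullback_chartMetric (h : IsRegularSolution α Λ c x₁ m)
    (hp : p ∈ coordBox x₁) :
    pageMetric α Λ c p = (jacobian ℝ (pageChart x₁ m) p)ᵀ
      * chartMetric α Λ x₁ m (pageChart x₁ m p) * jacobian ℝ (pageChart x₁ m) p := by
  have hX := chartHeight_pageChart (m := m) hp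
  have hab := h.fibreCoeff_add (pageChart x₁ m p)
  have hP := pageP_factor h.root (p 0)
  change _ = _ * pageFactor α Λ x₁ (p 0) at hP
  have pN : 0 < pageFactor α Λ x₁ (p 0) := by
    have := h.pageFactor_pos (abs_chartHeight_le h.pos (pageChart x₁ m p))
    rwa [hX] at this
  have pD : 0 < 1 - p 0 ^ 2 := by
    have := h.one_sub_chartHeight_sq_pos (pageChart x₁ m p)
    rwa [hX] at this
  have pm := h.cast_pos
  have hx := h.pos
  rw [jacobian_eq_of_hasGrad (jacobian_pageChart hp)]
  simp only [chartMetric, Matrix.mul_add, Matrix.add_mul, Matrix.mul_smul, Matrix.smul_mul,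
    transpose_mul_cosq_mul]
  rw [pageMetric_eq]
  have hb : fibreCoeff α Λ x₁ m (pageChart x₁ m p) = 64 * α ^ 2 * x₁ ^ 2 * pageFactor α Λ x₁ (p 0)
      / (m ^ 2 * (1 + fibreRadius x₁ (p 0) ^ 2) ^ 2 * (1 - p 0 ^ 2)) := by
    rw [fibreCoeff, hX, fibreSq_pageChart]
  have hf : baseCoeff α x₁ (pageChart x₁ m p)
      = 4 * α ^ 2 * (1 - p 0 ^ 2) / (1 + tan (p 2 / 2) ^ 2) ^ 2 := by
    rw [baseCoeff, hX, baseSq_pageChart]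
  rw [hX, fibreSq_pageChart] at hab
  obtain ⟨h1, h2, h3, h4⟩ := hp
  have hr := fibreRadius_pos h1 h2
  have hd : x₁ ^ 2 - p 0 ^ 2 = 4 * x₁ ^ 2 * fibreRadius x₁ (p 0) ^ 2
      / (1 + fibreRadius x₁ (p 0) ^ 2) ^ 2 := by
    have e : x₁ + p 0 ≠ 0 := by linarith
    have e1 : x₁ ≠ 0 := by linarith
    have e3 : 1 + (x₁ - p 0) / (x₁ + p 0) = 2 * x₁ / (x₁ + p 0) := by
      field_simp
      ring
    rw [fibreRadius_sq h1 h2, e3]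
    field_simp
    ring
  rw [hP, hd, sin_eq_tan_half h3 h4, cos_eq_tan_half h3 h4]
  have hS := baseSq_pageChart (x₁ := x₁) (m := m) (p := p)
  have t1 := sin_sq_add_cos_sq (p 3)
  have t2 := sin_sq_add_cos_sq (m / 2 * (p 1 + p 3))
  have y0 : pageChart x₁ m p 0 = tan (p 2 / 2) * cos (p 3) := rfl
  have y1 : pageChart x₁ m p 1 = tan (p 2 / 2) * sin (p 3) := rfl
  have y2 : pageChart x₁ m p 2 = fibreRadius x₁ (p 0) * cos (m / 2 * (p 1 + p 3)) := rfl
  have y3 : pageChart x₁ m p 3 = fibreRadius x₁ (p 0) * sin (m / 2 * (p 1 + p 3)) := rfl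
  have hw1 : fibreRe m (pageChart x₁ m p) = _ := rfl
  have hw2 : fibreIm m (pageChart x₁ m p) = _ := rfl
  simp only [fibreRe, fibreIm, hS, y0, y1, y2, y3] at *
  have hT : 0 < tan (p 2 / 2) := tan_pos_of_pos_of_lt_pi_div_two (by linarith) (by linarith)
  generalize radialCoeff α Λ x₁ m (pageChart x₁ m p) = rc at *
  generalize fibreCoeff α Λ x₁ m (pageChart x₁ m p) = fc at *
  generalize baseCoeff α x₁ (pageChart x₁ m p) = bc at *
  generalize fibreRadius x₁ (p 0) = r at *
  generalize tan (p 2 / 2) = T at *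
  generalize sin (p 3) = s at *
  generalize cos (p 3) = k at *
  generalize sin (m / 2 * (p 1 + p 3)) = s' at *
  generalize cos (m / 2 * (p 1 + p 3)) = k' at *
  generalize pageFactor α Λ x₁ (p 0) = N at *
  generalize p 0 = x at *
  -- The base term in `fibreRe` converts dψ + dφ into dψ + cos θ dφ, since 1 - 2T²/(1 + T²) = cos θ
  -- for T = tan(θ/2).
  have g1 : ∀ d : ℝ, (![-(m * (r * s') * (T * s) / (1 + T ^ 2)), m * (r * s') * (T * k) / (1 + T ^ 2), 1, 0]
      ᵥ* pageChartJac T s k r d (m / 2) s' k')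
      = ![d * k', -(m / 2 * r * s'), 0, -(m / 2 * r * s' * ((1 - T ^ 2) / (1 + T ^ 2)))] := fun d => by
    ext i
    rw [vecMul_four]
    fin_cases i <;> simp [pageChartJac]
    · ring
    · field_simp
      linear_combination (2 * s' * T ^ 2) * t1
  have g2 : ∀ d : ℝ, (![m * (r * k') * (T * s) / (1 + T ^ 2), -(m * (r * k') * (T * k) / (1 + T ^ 2)), 0, 1]
      ᵥ* pageChartJac T s k r d (m / 2) s' k')
      = ![d * s', m / 2 * r * k', 0, m / 2 * r * k' * ((1 - T ^ 2) / (1 + T ^ 2))] := fun d => by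
    ext i
    rw [vecMul_four]
    fin_cases i <;> simp [pageChartJac]
    · ring
    · field_simp
      linear_combination (-(2 * k' * T ^ 2)) * t1
  have g3 : ∀ d : ℝ, (![0, 0, r * k', r * s'] ᵥ* pageChartJac T s k r d (m / 2) s' k')
      = ![r * d, 0, 0, 0] := fun d => by
    ext i
    rw [vecMul_four]
    fin_cases i <;> simp [pageChartJac]
    · linear_combination (r * d) * t2
    · ring
    · ring
  have g4 : ∀ d : ℝ, (![1, 0, 0, 0] ᵥ* pageChartJac T s k r d (m / 2) s' k')
      = ![0, 0, (1 + T ^ 2) / 2 * k, -(T * s)] := fun d => by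
    ext i
    rw [vecMul_four]
    fin_cases i <;> simp [pageChartJac]
  have g5 : ∀ d : ℝ, (![0, 1, 0, 0] ᵥ* pageChartJac T s k r d (m / 2) s' k')
      = ![0, 0, (1 + T ^ 2) / 2 * s, T * k] := fun d => by
    ext i
    rw [vecMul_four]
    fin_cases i <;> simp [pageChartJac]
  rw [g1, g2, g3, g4, g5]
  have eA : α ^ 2 * (1 - x ^ 2) / (4 * x₁ ^ 2 * r ^ 2 / (1 + r ^ 2) ^ 2 * N)
      = (fc + rc * r ^ 2) * ((1 + r ^ 2) ^ 2 / (4 * x₁ * r)) ^ 2 := by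
    rw [hab]
    field_simp
  have eB : 4 * α ^ 2 * (4 * x₁ ^ 2 * r ^ 2 / (1 + r ^ 2) ^ 2 * N) / (1 - x ^ 2)
      = fc * (m / 2 * r) ^ 2 := by
    rw [hb]
    field_simp
    ring
  have eC : α ^ 2 * (1 - x ^ 2) = bc * ((1 + T ^ 2) / 2) ^ 2 := by
    rw [hf]
    field_simp
    ring
  have eC' : bc * ((1 + T ^ 2) / 2) ^ 2 * (2 * T / (1 + T ^ 2)) ^ 2 = bc * T ^ 2 := by
    field_simp
  ext i j
  simp only [Matrix.add_apply, Matrix.smul_apply, cosq_apply, smul_eq_mul]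
  rw [eA, eB, eC]
  generalize (1 + r ^ 2) ^ 2 / (4 * x₁ * r) = D at *
  generalize (1 - T ^ 2) / (1 + T ^ 2) = e at *
  fin_cases i <;> fin_cases j <;> simp [biaxialMatrix]
  · linear_combination -(fc * D ^ 2) * t2
  · ring
  · ring
  · ring
  · linear_combination -(fc * (m / 2 * r) ^ 2) * t2
  · linear_combination -(fc * (m / 2 * r) ^ 2 * e) * t2
  · linear_combination -(bc * ((1 + T ^ 2) / 2) ^ 2) * t1
  · ring
  · ring
  · linear_combination -(fc * (m / 2 * r) ^ 2 * e) * t2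
  · ring
  · linear_combination -(fc * (m / 2 * r) ^ 2 * e ^ 2) * t2 + eC' - bc * T ^ 2 * t1

/-- The chart potential differs from the original one by a gauge transformation. -/
theorem IsAdmissible.pullback_chartPotential (h : IsAdmissible α Λ c x₁) (hm : (0 : ℝ) < m)
    (a b : ℝ) (hp : p ∈ coordBox x₁) (i : Fin 4) :
    ∑ k, jacobian ℝ (pageChart x₁ m) p k i * chartPotential x₁ m a b k (pageChart x₁ m p)
      = pagePotential a b i p - (![0, pageProfile a b x₁, 0, pageProfile a b x₁] : Fin 4 → ℝ) i := by
  have hX := chartHeight_pageChart (m := m) hp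
  rw [jacobian_eq_of_hasGrad (jacobian_pageChart hp), Fin.sum_univ_four]
  have hS := baseSq_pageChart (x₁ := x₁) (m := m) (p := p)
  have hR := fibreSq_pageChart (x₁ := x₁) (m := m) (p := p)
  have t1 := sin_sq_add_cos_sq (p 3)
  have t2 := sin_sq_add_cos_sq (m / 2 * (p 1 + p 3))
  have y0 : pageChart x₁ m p 0 = tan (p 2 / 2) * cos (p 3) := rfl
  have y1 : pageChart x₁ m p 1 = tan (p 2 / 2) * sin (p 3) := rfl
  have y2 : pageChart x₁ m p 2 = fibreRadius x₁ (p 0) * cos (m / 2 * (p 1 + p 3)) := rfl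
  have y3 : pageChart x₁ m p 3 = fibreRadius x₁ (p 0) * sin (m / 2 * (p 1 + p 3)) := rfl
  obtain ⟨h1, h2, h3, h4⟩ := hp
  have hx := h.pos
  have hx1 := h.lt_one
  -- The function H is the quotient of h(x) - h(x₁) by |z|². Subtracting the closed form h(x₁)(dψ +
  -- dφ) makes the potential vanish along dχ at z = 0, hence smooth there.
  have hH : (-(4 * x₁ * a / ((1 + fibreRadius x₁ (p 0) ^ 2) * (1 - p 0) * (1 - x₁)))
      + 4 * x₁ * b / ((1 + fibreRadius x₁ (p 0) ^ 2) * (1 + p 0) * (1 + x₁)))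
      * fibreRadius x₁ (p 0) ^ 2 = pageProfile a b (p 0) - pageProfile a b x₁ := by
    have n1 : x₁ + p 0 ≠ 0 := by linarith
    have n2 : 1 - p 0 ≠ 0 := by linarith
    have n3 : 1 + p 0 ≠ 0 := by linarith
    have n4 : 1 - x₁ ≠ 0 := by linarith
    have n5 : 1 + x₁ ≠ 0 := by linarith
    have e3 : 1 + (x₁ - p 0) / (x₁ + p 0) = 2 * x₁ / (x₁ + p 0) := by
      field_simp
      ring
    rw [fibreRadius_sq h1 h2, e3, pageProfile, pageProfile]
    field_simp
    ring
  have hcos := cos_eq_tan_half h3 h4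
  simp only [chartPotential, hX, hS, hR, y0, y1, y2, y3]
  generalize sin (m / 2 * (p 1 + p 3)) = s' at *
  generalize cos (m / 2 * (p 1 + p 3)) = k' at *
  generalize hHd : -(4 * x₁ * a / ((1 + fibreRadius x₁ (p 0) ^ 2) * (1 - p 0) * (1 - x₁)))
      + 4 * x₁ * b / ((1 + fibreRadius x₁ (p 0) ^ 2) * (1 + p 0) * (1 + x₁)) = H at *
  fin_cases i
  · simp [pageChartJac, pagePotential]
    ring
  · simp [pageChartJac, pagePotential]
    rw [← hH]
    field_simp
    linear_combination (H * fibreRadius x₁ (p 0) ^ 2) * t2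
  · simp [pageChartJac, pagePotential]
    ring
  · simp [pageChartJac, pagePotential]
    rw [hcos]
    have hH' : pageProfile a b x₁ = pageProfile a b (p 0) - H * fibreRadius x₁ (p 0) ^ 2 := by
      linarith
    rw [hH']
    generalize pageProfile a b (p 0) = h at *
    generalize tan (p 2 / 2) = T at *
    field_simp
    linear_combination (H * fibreRadius x₁ (p 0) ^ 2 * (1 + T ^ 2)) * t2 - 2 * h * T ^ 2 * t1

theorem dense_regular_coords : Dense {y : E4 | baseSq y ≠ 0 ∧ fibreSq y ≠ 0} := by
  have ho : ∀ i : Fin 4, IsOpenMap fun y : E4 => y i := fun i =>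
    (EuclideanSpace.proj i : E4 →L[ℝ] ℝ).isOpenMap fun t =>
      ⟨EuclideanSpace.single i t, by simp⟩
  have hd : ∀ i : Fin 4, Dense {y : E4 | y i ≠ 0} := fun i =>
    (dense_compl_singleton (0 : ℝ)).preimage (ho i)
  have hop : IsOpen {y : E4 | y 0 ≠ 0} := isOpen_ne.preimage (by fun_prop)
  refine ((hd 0).inter_of_isOpen_left (hd 2) hop).mono fun y hy => ⟨?_, ?_⟩
  · have := hy.1
    simp only [mem_ofPred_eq] at this
    unfold baseSq
    positivity
  · have := hy.2
    simp only [mem_ofPred_eq] at this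
    unfold fibreSq
    positivity

theorem exists_polar {a b : ℝ} (h : a ^ 2 + b ^ 2 ≠ 0) :
    ∃ r φ : ℝ, 0 < r ∧ a = r * cos φ ∧ b = r * sin φ := by
  have hz : (⟨a, b⟩ : ℂ) ≠ 0 := fun e => by
    obtain ⟨rfl, rfl⟩ := Complex.ext_iff.1 e
    simp at h
  refine ⟨‖(⟨a, b⟩ : ℂ)‖, Complex.arg ⟨a, b⟩, norm_pos_iff.2 hz, ?_, ?_⟩
  · exact (Complex.norm_mul_cos_arg ⟨a, b⟩).symm
  · exact (Complex.norm_mul_sin_arg ⟨a, b⟩).symm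

theorem mem_image_pageChart (hx : 0 < x₁) (hm : (0 : ℝ) < m) {y : E4} (h0 : baseSq y ≠ 0)
    (h1 : fibreSq y ≠ 0) : ∃ p ∈ coordBox x₁, pageChart x₁ m p = y := by
  obtain ⟨T, φ, hT, e0, e1⟩ := exists_polar h0
  obtain ⟨r, χ, hr, e2, e3⟩ := exists_polar h1
  refine ⟨!₂[x₁ * (1 - r ^ 2) / (1 + r ^ 2), 2 * χ / m - φ, 2 * arctan T, φ], ⟨?_, ?_, ?_, ?_⟩, ?_⟩
  · change -x₁ < x₁ * (1 - r ^ 2) / (1 + r ^ 2)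
    rw [lt_div_iff₀ (by positivity)]
    nlinarith
  · change x₁ * (1 - r ^ 2) / (1 + r ^ 2) < x₁
    rw [div_lt_iff₀ (by positivity)]
    nlinarith [mul_pos hx (pow_pos hr 2)]
  · change 0 < 2 * arctan T
    have := arctan_pos.2 hT
    linarith
  · change 2 * arctan T < π
    linarith [arctan_lt_pi_div_two T]
  · have hR : fibreRadius x₁ (x₁ * (1 - r ^ 2) / (1 + r ^ 2)) = r := by
      have : (x₁ - x₁ * (1 - r ^ 2) / (1 + r ^ 2)) / (x₁ + x₁ * (1 - r ^ 2) / (1 + r ^ 2))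
          = r ^ 2 := by
        have e : x₁ + x₁ * (1 - r ^ 2) / (1 + r ^ 2) = 2 * x₁ / (1 + r ^ 2) := by
          field_simp
          ring
        rw [e]
        field_simp
        ring
      rw [fibreRadius, this, Real.sqrt_sq hr.le]
    have hθ : tan (2 * arctan T / 2) = T := by
      rw [mul_div_cancel_left₀ _ two_ne_zero, tan_arctan]
    have hχ : (m : ℝ) / 2 * (2 * χ / m - φ + φ) = χ := by
      field_simp
      ring
    ext i
    fin_cases i
    · change tan (2 * arctan T / 2) * cos φ = y 0
      rw [hθ, e0]
    · change tan (2 * arctan T / 2) * sin φ = y 1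
      rw [hθ, e1]
    · change fibreRadius x₁ (x₁ * (1 - r ^ 2) / (1 + r ^ 2)) * cos (m / 2 * (2 * χ / m - φ + φ)) = y 2
      rw [hR, hχ, e2]
    · change fibreRadius x₁ (x₁ * (1 - r ^ 2) / (1 + r ^ 2)) * sin (m / 2 * (2 * χ / m - φ + φ)) = y 3
      rw [hR, hχ, e3]

theorem dense_image_pageChart (hx : 0 < x₁) (hm : (0 : ℝ) < m) :
    Dense (pageChart x₁ m '' coordBox x₁) :=
  dense_regular_coords.mono fun _ hy => mem_image_pageChart hx hm hy.1 hy.2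

theorem fieldStrength_sub_const (A : Fin 4 → E4 → ℝ) (k : Fin 4 → ℝ) (p : E4) :
    fieldStrength (fun i q => A i q - k i) p = fieldStrength A p := by
  ext i j
  simp [fieldStrength, pd, fderiv_sub_const]

/-- The equations hold on the image of `pageChart` because the metric and, up to constants, both
potentials are pulled back from there. That image is dense and all fields are smooth, so the
equations hold everywhere. -/
theorem IsRegularSolution.isElectrovacAt_chartMetric (h : IsRegularSolution α Λ c x₁ m) {a b : ℝ}
    (hab : a * b = -(c * α ^ 2 / 4)) (y : E4) :
    IsElectrovacAt Λ (-1) (chartMetric α Λ x₁ m) (chartPotential x₁ m a b)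
      (chartPotential x₁ m (-a) b) y := by
  have hdet : ∀ q, (chartMetric α Λ x₁ m q).det ≠ 0 := fun q => (h.posDef_chartMetric q).det_pos.ne'
  refine IsElectrovacAt.of_dense (dense_image_pageChart h.pos h.cast_pos) h.mSmoothAt_chartMetric
    (chartMetric_symm α Λ x₁ m) hdet
    (contDiff_chartPotential h.toIsAdmissible m a b)
    (contDiff_chartPotential h.toIsAdmissible m (-a) b) ?_ y
  rintro _ ⟨p, hp, rfl⟩
  have hneg := fun q hq => det_jacobian_pageChart (x₁ := x₁) (m := m) (p := q) h.cast_pos hq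
  have hpage := isElectrovacAt_pageMetric h.scale_pos.ne' hab (h.coordBox_subset hp)
  refine IsElectrovacAt.of_pullback (σ' := 1) (g' := pageMetric α Λ c)
    (A' := fun i q => pagePotential a b i q
      - (![0, pageProfile a b x₁, 0, pageProfile a b x₁] : Fin 4 → ℝ) i)
    (B' := fun i q => pagePotential (-a) b i q
      - (![0, pageProfile (-a) b x₁, 0, pageProfile (-a) b x₁] : Fin 4 → ℝ) i)
    (isOpen_coordBox x₁) (contDiffOn_pageChart x₁ m) h.mSmoothAt_chartMetric
    (chartMetric_symm α Λ x₁ m) hdet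
    (contDiff_chartPotential h.toIsAdmissible m a b)
    (contDiff_chartPotential h.toIsAdmissible m (-a) b)
    (fun q hq => (hneg q hq).ne.isUnit) (fun q hq => h.pullback_chartMetric hq)
    (fun q hq i => (h.toIsAdmissible.pullback_chartPotential h.cast_pos a b hq i).symm)
    (fun q hq i => (h.toIsAdmissible.pullback_chartPotential h.cast_pos (-a) b hq i).symm)
    hp ?_ ⟨?_, ?_⟩
  · rw [abs_of_neg (hneg p hp)]
    ring
  · rw [fieldStrength_sub_const]
    exact hpage.einstein
  · rw [fieldStrength_sub_const, fieldStrength_sub_const]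
    exact hpage.duality

theorem IsRegularSolution.solves_chartMetric (h : IsRegularSolution α Λ c x₁ m) {a b : ℝ}
    (hab : a * b = -(c * α ^ 2 / 4)) :
    SolvesEinsteinMaxwell Λ (chartMetric α Λ x₁ m) (fieldStrength (chartPotential x₁ m a b)) univ :=
  .of_isElectrovacAt isOpen_univ
    (fun i j y _ => (h.mSmoothAt_chartMetric y i j).contDiffWithinAt)
    (fun y _ => chartMetric_symm α Λ x₁ m y) (fun y _ => (h.posDef_chartMetric y).det_pos.ne')
    (fun i => (contDiff_chartPotential h.toIsAdmissible m a b i).contDiffOn)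
    (fun i => (contDiff_chartPotential h.toIsAdmissible m (-a) b i).contDiffOn)
    fun y _ => h.isElectrovacAt_chartMetric hab y

/-- The field in complex coordinates restricts to the field in the coordinates `(x, ψ, θ, φ)`. -/
theorem IsRegularSolution.pullback_field (h : IsRegularSolution α Λ c x₁ m) (a b : ℝ)
    (hp : p ∈ coordBox x₁) :
    fieldStrength (pagePotential a b) p = (jacobian ℝ (pageChart x₁ m) p)ᵀ
      * fieldStrength (chartPotential x₁ m a b) (pageChart x₁ m p)
      * jacobian ℝ (pageChart x₁ m) p := by
  rw [← fieldStrength_sub_const _ ![0, pageProfile a b x₁, 0, pageProfile a b x₁]]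
  refine fieldStrength_pullback
    ((contDiffOn_pageChart x₁ m).contDiffAt ((isOpen_coordBox x₁).mem_nhds hp))
    (fun k => (contDiff_chartPotential h.toIsAdmissible m a b k).contDiffAt) fun i => ?_
  filter_upwards [(isOpen_coordBox x₁).mem_nhds hp] with q hq
  exact (h.toIsAdmissible.pullback_chartPotential h.cast_pos a b hq i).symm

end PageChart

/-! ### The coordinates `(x, ψ, θ, φ)` on the sphere bundles -/

namespace Hirz

open scoped ComplexConjugate

variable {m : ℕ} {x₁ : ℝ} {p : E4}

/-- The complex exponential `exp (i t)`. -/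
def cexpI (t : ℝ) : ℂ := ⟨cos t, sin t⟩

theorem cexpI_eq (t : ℝ) : cexpI t = Complex.exp (t * Complex.I) := by
  rw [Complex.exp_mul_I, ← Complex.ofReal_cos, ← Complex.ofReal_sin]
  apply Complex.ext <;> simp [cexpI, -Complex.ofReal_cos, -Complex.ofReal_sin]

theorem cexpI_add (s t : ℝ) : cexpI (s + t) = cexpI s * cexpI t := by
  simp only [cexpI_eq, Complex.ofReal_add, add_mul, Complex.exp_add]

theorem cexpI_zero : cexpI 0 = 1 := by simp [cexpI_eq]

theorem cexpI_nat_mul (n : ℕ) (t : ℝ) : cexpI (n * t) = cexpI t ^ n := by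
  simp only [cexpI_eq, Complex.ofReal_mul, Complex.ofReal_natCast, mul_assoc, Complex.exp_nat_mul]

theorem normSq_cexpI (t : ℝ) : Complex.normSq (cexpI t) = 1 := by
  rw [cexpI, Complex.normSq_mk]
  linarith [sin_sq_add_cos_sq t]

theorem conj_cexpI (t : ℝ) : conj (cexpI t) = cexpI (-t) := by
  apply Complex.ext <;> simp [cexpI]

theorem cexpI_eq_iff (s t : ℝ) : cexpI s = cexpI t ↔ ∃ n : ℤ, s = t + 2 * π * n := by
  rw [cexpI_eq, cexpI_eq, Complex.exp_eq_exp_iff_exists_int]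
  refine exists_congr fun n => ?_
  constructor
  · intro h
    have h1 : ((s : ℂ)) = ((t + 2 * π * n : ℝ) : ℂ) := by
      refine mul_right_cancel₀ Complex.I_ne_zero ?_
      rw [h]
      push_cast
      ring
    exact_mod_cast h1
  · rintro rfl
    push_cast
    ring

/-- A frame for given values of the coordinates `(x, ψ, θ, φ)`. -/
def pageFrame (x₁ : ℝ) (m : ℕ) (p : E4) : FramePoint :=
  (cos (p 2 / 2) * cexpI (-(p 3 / 2)), sin (p 2 / 2) * cexpI (p 3 / 2),
    (√(1 - (p 0 / x₁) ^ 2) : ℝ) * cexpI (m / 2 * p 1), p 0 / x₁)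

theorem one_sub_div_sq_pos (hp : p ∈ coordBox x₁) : 0 < 1 - (p 0 / x₁) ^ 2 := by
  obtain ⟨h1, h2, -, -⟩ := hp
  have hx : 0 < x₁ := by linarith
  have : |p 0 / x₁| < 1 := by
    rw [abs_div, abs_of_pos hx, div_lt_one hx]
    exact abs_lt.2 ⟨h1, h2⟩
  exact abs_lt_one_sq this

theorem pageFrame_mem (hp : p ∈ coordBox x₁) : pageFrame x₁ m p ∈ frameSet := by
  have h := one_sub_div_sq_pos hp
  constructor
  · simp only [pageFrame, map_mul, normSq_cexpI, mul_one]
    have : ∀ t : ℝ, Complex.normSq (Complex.cos (t : ℂ)) = cos t ^ 2 := fun t => by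
      rw [← Complex.ofReal_cos, Complex.normSq_ofReal, sq]
    have h' : ∀ t : ℝ, Complex.normSq (Complex.sin (t : ℂ)) = sin t ^ 2 := fun t => by
      rw [← Complex.ofReal_sin, Complex.normSq_ofReal, sq]
    simp only [Complex.normSq_ofReal, ← sq]
    linarith [sin_sq_add_cos_sq (p 2 / 2)]
  · simp only [pageFrame, map_mul, normSq_cexpI, mul_one, Complex.normSq_ofReal]
    rw [Real.mul_self_sqrt h.le]
    ring

/-- The point with given coordinates `(x, ψ, θ, φ)`. -/
def pagePoint (x₁ : ℝ) (m : ℕ) (p : E4) : Hirz m :=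
  (chart m (false, false)).symm (pageChart x₁ m p)

theorem pagePoint_eq_param (x₁ : ℝ) (p : E4) : pagePoint x₁ m p = param (pageChart x₁ m p) := rfl

theorem baseCoord_pageChart : baseCoord (pageChart x₁ m p) = tan (p 2 / 2) * cexpI (p 3) := by
  apply Complex.ext <;> simp [baseCoord, pageChart, cexpI, -Complex.ofReal_cos, -Complex.ofReal_sin,
    -Complex.ofReal_tan]

theorem fibreCoord_pageChart : fibreCoord (pageChart x₁ m p)
    = fibreRadius x₁ (p 0) * cexpI (m / 2 * (p 1 + p 3)) := by
  apply Complex.ext <;> simp [fibreCoord, pageChart, cexpI, -Complex.ofReal_cos,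
    -Complex.ofReal_sin, -Complex.ofReal_mul]

/-- The half-angle frame is not periodic in φ, but its class is: it differs from the normalised
frame of the chart by the phase e^{iφ/2}. This form makes both the identifications and the
symmetries visible. -/
theorem pagePoint_eq (hp : p ∈ coordBox x₁) : pagePoint x₁ m p = mk (pageFrame x₁ m p) (pageFrame_mem hp) := by
  rw [pagePoint_eq_param, param]
  refine val_injective ?_
  rw [val_mk, val_mk, eq_comm, frameInvariants_eq_iff (pageFrame_mem hp) (frameOf_mem _)]
  refine ⟨cexpI (p 3 / 2), normSq_cexpI _, ?_⟩
  have hc : 0 < cos (p 2 / 2) :=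
    cos_pos_of_mem_Ioo ⟨by linarith [hp.2.2.1, pi_pos], by linarith [hp.2.2.2]⟩
  have hcos : cosHalf (baseCoord (pageChart x₁ m p)) = cos (p 2 / 2) := by
    rw [cosHalf, baseCoord_pageChart, map_mul, normSq_cexpI, mul_one, Complex.normSq_ofReal,
      ← sq, ← Real.inv_sqrt_one_add_tan_sq hc]
  obtain ⟨h1, h2, -, -⟩ := id hp
  have hx : 0 < x₁ := by linarith
  have e1 : 0 < x₁ + p 0 := by linarith
  have e2 : 0 < x₁ - p 0 := by linarith
  have hr : Complex.normSq (fibreCoord (pageChart x₁ m p)) = (x₁ - p 0) / (x₁ + p 0) := by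
    rw [fibreCoord_pageChart, map_mul, normSq_cexpI, mul_one, Complex.normSq_ofReal, ← sq,
      fibreRadius_sq h1 h2]
  have hden : 1 + (x₁ - p 0) / (x₁ + p 0) = 2 * x₁ / (x₁ + p 0) := by
    field_simp
    ring
  simp only [frameOf, pageFrame, hcos, hr, Prod.mk.injEq, hden]
  refine ⟨?_, ?_, ?_, ?_⟩
  · rw [mul_left_comm, ← cexpI_add, add_neg_cancel, cexpI_zero, mul_one]
  · rw [mul_left_comm, ← cexpI_add, add_halves, baseCoord_pageChart, ← mul_assoc,
      ← Complex.ofReal_mul, mul_comm (cos _), Real.tan_mul_cos hc.ne']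
  · rw [fibreCoord_pageChart, ← cexpI_nat_mul, mul_left_comm (cexpI _), ← cexpI_add, ← mul_assoc,
      ← Complex.ofReal_mul]
    have e3 : 2 / (2 * x₁ / (x₁ + p 0)) * fibreRadius x₁ (p 0) = √(1 - (p 0 / x₁) ^ 2) := by
      have hr0 := (fibreRadius_pos h1 h2).le
      rw [← Real.sqrt_sq (show 0 ≤ 2 / (2 * x₁ / (x₁ + p 0)) * fibreRadius x₁ (p 0) by positivity),
        mul_pow, fibreRadius_sq h1 h2]
      congr 1
      field_simp
      ring
    rw [e3]
    congr 2
    ring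
  · field_simp
    ring

/-- The symmetries in the coordinates `(x, ψ, θ, φ)`. -/
def flipCoords (s : Bool × Bool) (p : E4) : E4 :=
  !₂[if s.2 then -p 0 else p 0, p 1, if s.1 then π - p 2 else p 2, if s.1 then -p 3 else p 3]

/-- The Jacobian matrix of `flipCoords`. -/
def flipMatrix (s : Bool × Bool) : Matrix (Fin 4) (Fin 4) ℝ :=
  Matrix.diagonal ![if s.2 then -1 else 1, 1, if s.1 then -1 else 1, if s.1 then -1 else 1]

theorem flipCoords_mem (s : Bool × Bool) (hp : p ∈ coordBox x₁) : flipCoords s p ∈ coordBox x₁ := by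
  obtain ⟨h1, h2, h3, h4⟩ := hp
  rcases s with ⟨_ | _, _ | _⟩ <;> refine ⟨?_, ?_, ?_, ?_⟩ <;> simp [flipCoords] <;> linarith

/-- Exchanging the entries of the base frame is (θ, φ) → (π - θ, -φ), and reversing t is x → -x.
Symmetries of the metric in these coordinates thereby relate the four charts. -/
theorem flip_pagePoint (s : Bool × Bool) (hp : p ∈ coordBox x₁) :
    flip s (pagePoint x₁ m p) = pagePoint x₁ m (flipCoords s p) := by
  rw [pagePoint_eq hp, pagePoint_eq (flipCoords_mem s hp)]
  refine val_injective ?_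
  rw [val_flip, val_mk, val_mk, ← frameInvariants_flipFrame]
  congr 1
  have e1 : cos ((π - p 2) / 2) = sin (p 2 / 2) := by
    rw [sub_div, cos_pi_div_two_sub]
  have e2 : sin ((π - p 2) / 2) = cos (p 2 / 2) := by
    rw [sub_div, sin_pi_div_two_sub]
  have e3 : -(-p 3 / 2) = p 3 / 2 := by ring
  have e4 : -p 3 / 2 = -(p 3 / 2) := by ring
  have e5 : -p 0 / x₁ = -(p 0 / x₁) := neg_div _ _
  rcases s with ⟨_ | _, _ | _⟩ <;> simp [flipFrame, pageFrame, flipCoords, -Complex.ofReal_cos, -Complex.ofReal_sin, e1, e2, e4, e5]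

theorem jacobian_flipCoords (s : Bool × Bool) (p : E4) :
    jacobian ℝ (flipCoords s) p = flipMatrix s := by
  refine jacobian_eq_of_hasGrad fun a => ?_
  rcases s with ⟨_ | _, _ | _⟩ <;> fin_cases a
  all_goals first
    | exact (hasGrad_coord (p := p) 0).congr (by ext i; fin_cases i <;> simp [flipMatrix])
    | exact (hasGrad_coord (p := p) 1).congr (by ext i; fin_cases i <;> simp [flipMatrix])
    | exact (hasGrad_coord (p := p) 2).congr (by ext i; fin_cases i <;> simp [flipMatrix])
    | exact (hasGrad_coord (p := p) 3).congr (by ext i; fin_cases i <;> simp [flipMatrix])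
    | exact (hasGrad_coord (p := p) 0).neg.congr (by ext i; fin_cases i <;> simp [flipMatrix])
    | exact ((hasGrad_const (p := p) π).add (hasGrad_coord (p := p) 2).neg).congr
        (by ext i; fin_cases i <;> simp [flipMatrix])
    | exact (hasGrad_coord (p := p) 3).neg.congr (by ext i; fin_cases i <;> simp [flipMatrix])

theorem flipMatrix_transpose (s : Bool × Bool) : (flipMatrix s)ᵀ = flipMatrix s :=
  Matrix.diagonal_transpose _

theorem flipMatrix_mul_self (s : Bool × Bool) : flipMatrix s * flipMatrix s = 1 := by
  rw [flipMatrix, Matrix.diagonal_mul_diagonal, ← Matrix.diagonal_one]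
  congr 1
  ext i
  rcases s with ⟨_ | _, _ | _⟩ <;> fin_cases i <;> simp

theorem contDiff_flipCoords (s : Bool × Bool) : ContDiff ℝ ∞ (flipCoords s) := by
  refine contDiff_piLp 2 |>.2 fun i => ?_
  rcases s with ⟨_ | _, _ | _⟩ <;> fin_cases i <;> simp [flipCoords] <;> fun_prop

theorem flipCoords_flipCoords (s : Bool × Bool) (p : E4) : flipCoords s (flipCoords s p) = p := by
  ext i
  rcases s with ⟨_ | _, _ | _⟩ <;> fin_cases i <;> simp [flipCoords]

theorem chart_flip_pagePoint (s s' : Bool × Bool) (hp : p ∈ coordBox x₁) :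
    chart m s' (flip s (pagePoint x₁ m p)) = pageChart x₁ m (flipCoords s' (flipCoords s p)) := by
  rw [chart_apply, ← val_flip, flip_pagePoint s hp, flip_pagePoint s' (flipCoords_mem s hp),
    pagePoint_eq_param, coordsOf_param]

/-- The change of coordinates between two charts. -/
def transition (m : ℕ) (s s' : Bool × Bool) (y : E4) : E4 := chart m s' ((chart m s).symm y)

theorem transition_pageChart (s s' : Bool × Bool) (hp : p ∈ coordBox x₁) :
    transition m s s' (pageChart x₁ m p) = pageChart x₁ m (flipCoords s' (flipCoords s p)) :=
  chart_flip_pagePoint s s' hp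

/-- The domain of `transition`. -/
def transitionDomain (m : ℕ) (s s' : Bool × Bool) : Set E4 :=
  {y | (chart m s).symm y ∈ (chart m s').source}

theorem isOpen_transitionDomain (s s' : Bool × Bool) : IsOpen (transitionDomain m s s') :=
  (chart m s').open_source.preimage (contMDiff_chart_symm s).continuous

theorem contDiffOn_transition (s s' : Bool × Bool) :
    ContDiffOn ℝ ∞ (transition m s s') (transitionDomain m s s') :=
  (contDiffOn_coordsOf m).comp
    ((contDiff_flipAmbient s').comp (contDiff_val_chart_symm s)).contDiffOn fun _ hy => hy

/-- Bilinear forms in the four charts which agree on the dense set of points with coordinates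
`(x, ψ, θ, φ)`. -/
structure IsCompatible (x₁ : ℝ) (m : ℕ) (B : Bool × Bool → E4 → Matrix (Fin 4) (Fin 4) ℝ)
    (β : E4 → Matrix (Fin 4) (Fin 4) ℝ) : Prop where
  smooth : ∀ s y, MSmoothAt (B s) y
  pullback : ∀ s, ∀ p ∈ coordBox x₁, (jacobian ℝ (pageChart x₁ m) p)ᵀ * B s (pageChart x₁ m p)
    * jacobian ℝ (pageChart x₁ m) p = flipMatrix s * β (flipCoords s p) * flipMatrix s

variable {B : Bool × Bool → E4 → Matrix (Fin 4) (Fin 4) ℝ} {β : E4 → Matrix (Fin 4) (Fin 4) ℝ}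

/-- In the coordinates (x, ψ, θ, φ) a transition map is a composite of two flips. Pulling both sides
back by the invertible Jacobian of `pageChart` gives the same form β, because each flip matrix is
its own inverse. -/
theorem IsCompatible.transition_pageChart (h : IsCompatible x₁ m B β) (hm : (0 : ℝ) < m)
    (s s' : Bool × Bool) (hp : p ∈ coordBox x₁)
    (hy : pageChart x₁ m p ∈ transitionDomain m s s') :
    (jacobian ℝ (transition m s s') (pageChart x₁ m p))ᵀ
      * B s' (transition m s s' (pageChart x₁ m p))
      * jacobian ℝ (transition m s s') (pageChart x₁ m p) = B s (pageChart x₁ m p) := by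
  have hq := flipCoords_mem s' (flipCoords_mem s hp)
  have dT : DifferentiableAt ℝ (transition m s s') (pageChart x₁ m p) :=
    ((contDiffOn_transition s s').contDiffAt ((isOpen_transitionDomain s s').mem_nhds hy)).differentiableAt
      (by simp)
  have dP : ∀ {q : E4}, q ∈ coordBox x₁ → DifferentiableAt ℝ (pageChart x₁ m) q := fun hq =>
    ((contDiffOn_pageChart x₁ m).contDiffAt ((isOpen_coordBox x₁).mem_nhds hq)).differentiableAt
      (by simp)
  have dF : ∀ s q, DifferentiableAt ℝ (flipCoords s) q := fun s q =>
    (contDiff_flipCoords s).differentiable (by simp) q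
  have e1 := jacobian_comp dT (dP hp)
  have e2 : jacobian ℝ (fun q => transition m s s' (pageChart x₁ m q)) p
      = jacobian ℝ (fun q => pageChart x₁ m (flipCoords s' (flipCoords s q))) p := by
    have : (fun q => transition m s s' (pageChart x₁ m q))
        =ᶠ[𝓝 p] fun q => pageChart x₁ m (flipCoords s' (flipCoords s q)) := by
      filter_upwards [(isOpen_coordBox x₁).mem_nhds hp] with q hq
      exact Hirz.transition_pageChart s s' hq
    unfold jacobian
    rw [this.fderiv_eq]
  have e3 : jacobian ℝ (fun q => pageChart x₁ m (flipCoords s' (flipCoords s q))) p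
      = jacobian ℝ (pageChart x₁ m) (flipCoords s' (flipCoords s p)) * (flipMatrix s' * flipMatrix s) := by
    rw [← jacobian_flipCoords s p, ← jacobian_flipCoords s' (flipCoords s p),
      ← jacobian_comp (dF s' _) (dF s p)]
    exact jacobian_comp (Ψ := fun q => flipCoords s' (flipCoords s q)) (dP hq)
      ((dF s' _).comp p (dF s p))
  rw [e2, e3] at e1
  have hJ := (det_jacobian_pageChart hm hp).ne
  have p1 := h.pullback s p hp
  have p2 := h.pullback s' _ hq
  rw [flipCoords_flipCoords] at p2
  rw [Hirz.transition_pageChart s s' hp]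
  obtain ⟨J, hJe⟩ : ∃ J, J = jacobian ℝ (pageChart x₁ m) p := ⟨_, rfl⟩
  obtain ⟨K, hK⟩ : ∃ K, K = jacobian ℝ (transition m s s') (pageChart x₁ m p) := ⟨_, rfl⟩
  obtain ⟨L, hL⟩ : ∃ L, L = jacobian ℝ (pageChart x₁ m) (flipCoords s' (flipCoords s p)) := ⟨_, rfl⟩
  rw [← hJe, ← hK, ← hL] at e1
  rw [← hJe] at hJ p1
  rw [← hL] at p2
  rw [← hK]
  have hu : IsUnit J.det := isUnit_iff_ne_zero.2 hJ
  have hut : IsUnit Jᵀ.det := by rwa [Matrix.det_transpose]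
  have key : Jᵀ * (Kᵀ * B s' (pageChart x₁ m (flipCoords s' (flipCoords s p))) * K) * J
      = Jᵀ * B s (pageChart x₁ m p) * J := by
    calc _ = (K * J)ᵀ * B s' (pageChart x₁ m (flipCoords s' (flipCoords s p))) * (K * J) := by
          simp only [Matrix.transpose_mul, Matrix.mul_assoc]
      _ = flipMatrix s * (flipMatrix s' * (Lᵀ * B s' (pageChart x₁ m (flipCoords s' (flipCoords s p))) * L)
          * flipMatrix s') * flipMatrix s := by
          rw [← e1]
          simp only [Matrix.transpose_mul, flipMatrix_transpose, Matrix.mul_assoc]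
      _ = flipMatrix s * ((flipMatrix s' * flipMatrix s') * β (flipCoords s p)
          * (flipMatrix s' * flipMatrix s')) * flipMatrix s := by
          rw [p2]
          simp only [Matrix.mul_assoc]
      _ = _ := by rw [p1, flipMatrix_mul_self, Matrix.one_mul, Matrix.mul_one]
  have key2 := congrArg (fun M => Jᵀ⁻¹ * M * J⁻¹) key
  simpa only [Matrix.mul_assoc, Matrix.mul_nonsing_inv _ hu, Matrix.mul_one,
    Matrix.nonsing_inv_mul_cancel_left _ _ hut] using key2

/-- Both sides are continuous on the open transition domain and agree on its intersection with the
dense image of `pageChart`. No formula for the transition maps at the poles is needed. -/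
theorem IsCompatible.transition (h : IsCompatible x₁ m B β) (hx : 0 < x₁) (hm : (0 : ℝ) < m)
    (s s' : Bool × Bool) {y : E4} (hy : y ∈ transitionDomain m s s') :
    (jacobian ℝ (transition m s s') y)ᵀ * B s' (Hirz.transition m s s' y)
      * jacobian ℝ (Hirz.transition m s s') y = B s y := by
  have ho := isOpen_transitionDomain (m := m) s s'
  have cB : ∀ s, Continuous (B s) := fun s => continuous_of_mSmoothAt (h.smooth s)
  have cT := (contDiffOn_transition (m := m) s s').continuousOn
  have cJ : ContinuousOn (jacobian ℝ (Hirz.transition m s s')) (transitionDomain m s s') :=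
    continuousOn_pi.2 fun i => continuousOn_pi.2 fun j => fun y hy =>
      (mSmoothAt_jacobian ((contDiffOn_transition s s').contDiffAt (ho.mem_nhds hy)) i
        j).continuousAt.continuousWithinAt
  refine Set.EqOn.of_subset_closure (s := transitionDomain m s s' ∩ pageChart x₁ m '' coordBox x₁)
    (t := transitionDomain m s s')
    (f := fun y => (jacobian ℝ (Hirz.transition m s s') y)ᵀ * B s' (Hirz.transition m s s' y)
      * jacobian ℝ (Hirz.transition m s s') y) (g := B s) ?_ ?_ (cB s).continuousOn
    inter_subset_left ((dense_image_pageChart hx hm).open_subset_closure_inter ho) hy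
  · rintro _ ⟨hy, p, hp, rfl⟩
    exact h.transition_pageChart hm s s' hp hy
  · have c1 : ContinuousOn (fun y => (jacobian ℝ (Hirz.transition m s s') y)ᵀ)
        (transitionDomain m s s') := (continuous_id.matrix_transpose).comp_continuousOn cJ
    have c2 := (cB s').comp_continuousOn cT
    have cm : Continuous fun q : Matrix (Fin 4) (Fin 4) ℝ × Matrix (Fin 4) (Fin 4) ℝ => q.1 * q.2 :=
      continuous_fst.matrix_mul continuous_snd
    exact cm.comp_continuousOn ((cm.comp_continuousOn (c1.prodMk c2)).prodMk cJ)

end Hirz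

/-! ### Tensor fields on the sphere bundles -/

/-- The bilinear form with a given matrix. -/
def toBilin (M : Matrix (Fin 4) (Fin 4) ℝ) : E4 →L[ℝ] E4 →L[ℝ] ℝ :=
  ∑ i, ∑ j, M i j • (EuclideanSpace.proj i : E4 →L[ℝ] ℝ).smulRight
    (EuclideanSpace.proj j : E4 →L[ℝ] ℝ)

theorem toBilin_apply (M : Matrix (Fin 4) (Fin 4) ℝ) (v w : E4) :
    toBilin M v w = ∑ i, ∑ j, M i j * v i * w j := by
  simp [toBilin, mul_assoc]

theorem toBilin_eq_dotProduct (M : Matrix (Fin 4) (Fin 4) ℝ) (v w : E4) :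
    toBilin M v w = WithLp.ofLp v ⬝ᵥ (M *ᵥ WithLp.ofLp w) := by
  simp only [toBilin_apply, dotProduct, Matrix.mulVec, Finset.mul_sum]
  exact Finset.sum_congr rfl fun i _ => Finset.sum_congr rfl fun j _ => by ring

theorem toBilin_coordVec (M : Matrix (Fin 4) (Fin 4) ℝ) (i j : Fin 4) :
    toBilin M (coordVec ℝ i) (coordVec ℝ j) = M i j := by
  simp [toBilin_apply, coordVec]

theorem toBilin_ext {M : Matrix (Fin 4) (Fin 4) ℝ} {b : E4 →L[ℝ] E4 →L[ℝ] ℝ}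
    (h : ∀ i j, b (coordVec ℝ i) (coordVec ℝ j) = M i j) (v w : E4) : b v w = toBilin M v w := by
  conv_lhs => rw [eq_sum_coordVec v, eq_sum_coordVec w]
  simp only [map_sum, map_smul, sum_apply, smul_apply, h,
    smul_eq_mul, toBilin_apply, Finset.mul_sum]
  rw [Finset.sum_comm]
  exact Finset.sum_congr rfl fun i _ => Finset.sum_congr rfl fun j _ => by ring

theorem toBilin_fderiv (M : Matrix (Fin 4) (Fin 4) ℝ) (f : E4 → E4) (y v w : E4) :
    toBilin M (fderiv ℝ f y v) (fderiv ℝ f y w)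
      = toBilin ((jacobian ℝ f y)ᵀ * M * jacobian ℝ f y) v w := by
  refine toBilin_ext (b := ((toBilin M).bilinearComp (fderiv ℝ f y) (fderiv ℝ f y)))
    (fun i j => ?_) v w
  rw [ContinuousLinearMap.bilinearComp_apply, toBilin_eq_dotProduct]
  simp only [Matrix.mul_assoc]
  rw [Matrix.mul_apply]
  simp only [dotProduct, Matrix.mulVec, Matrix.transpose_apply, Matrix.mul_apply, jacobian,
    Matrix.of_apply]

/-- The form attains a positive minimum ε on the compact unit sphere, so by homogeneity its unit
ball lies in the ball of radius √(1/ε). -/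
theorem isVonNBounded_toBilin {M : Matrix (Fin 4) (Fin 4) ℝ} (hM : M.PosDef) :
    Bornology.IsVonNBounded ℝ {v : E4 | toBilin M v v < 1} := by
  have hc : Continuous fun v : E4 => toBilin M v v := by
    simp only [toBilin_apply]
    fun_prop
  have hpos : ∀ v : E4, v ≠ 0 → 0 < toBilin M v v := fun v hv => by
    rw [toBilin_eq_dotProduct]
    have := hM.dotProduct_mulVec_pos (x := WithLp.ofLp v) (by simpa using hv)
    simpa using this
  have hcomp : IsCompact (Metric.sphere (0 : E4) 1) := isCompact_sphere 0 1
  have hne : (Metric.sphere (0 : E4) 1).Nonempty := ⟨coordVec ℝ 0, by simp [coordVec]⟩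
  obtain ⟨u, hu, hmin⟩ := hcomp.exists_isMinOn hne hc.continuousOn
  have hu0 : u ≠ 0 := by
    rintro rfl
    simp at hu
  obtain ⟨ε, hε⟩ : ∃ ε, ε = toBilin M u u := ⟨_, rfl⟩
  have hε0 : 0 < ε := hε ▸ hpos u hu0
  rw [NormedSpace.isVonNBounded_iff]
  refine (Metric.isBounded_closedBall (x := (0 : E4)) (r := √(1 / ε))).subset fun v hv => ?_
  rw [mem_closedBall_zero_iff]
  refine Real.le_sqrt_of_sq_le ?_
  rw [le_div_iff₀ hε0]
  by_cases h0 : v = 0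
  · simp [h0]
  have hn : 0 < ‖v‖ := norm_pos_iff.2 h0
  have h1 : ‖v‖⁻¹ • v ∈ Metric.sphere (0 : E4) 1 := by
    rw [mem_sphere_zero_iff_norm, norm_smul, norm_inv, norm_norm, inv_mul_cancel₀ hn.ne']
  have h2 : toBilin M u u ≤ toBilin M (‖v‖⁻¹ • v) (‖v‖⁻¹ • v) := hmin h1
  rw [← hε] at h2
  simp only [map_smul, smul_apply, smul_eq_mul] at h2
  have h3 : toBilin M v v < 1 := hv
  have h4 : ‖v‖ ^ 2 * ε ≤ ‖v‖ ^ 2 * (‖v‖⁻¹ * (‖v‖⁻¹ * toBilin M v v)) := by gcongr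
  have h5 : ‖v‖ ^ 2 * (‖v‖⁻¹ * (‖v‖⁻¹ * toBilin M v v)) = toBilin M v v := by field_simp
  linarith

theorem contDiffAt_toBilin {f : E4 → Matrix (Fin 4) (Fin 4) ℝ} {p : E4} (h : MSmoothAt f p) :
    ContDiffAt ℝ ∞ (fun y => toBilin (f y)) p := by
  have : (fun y => toBilin (f y)) = fun y => ∑ i : Fin 4, ∑ j : Fin 4,
      (ContinuousLinearMap.toSpanSingleton ℝ ((EuclideanSpace.proj i : E4 →L[ℝ] ℝ).smulRight
        (EuclideanSpace.proj j : E4 →L[ℝ] ℝ))) (f y i j) := rfl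
  rw [this]
  exact ContDiffAt.sum fun i _ => ContDiffAt.sum fun j _ =>
    (ContinuousLinearMap.contDiff _).contDiffAt.comp p (h i j)

namespace Hirz

variable {m : ℕ} {x₁ : ℝ} {B : Bool × Bool → E4 → Matrix (Fin 4) (Fin 4) ℝ}
  {β : E4 → Matrix (Fin 4) (Fin 4) ℝ}

/-- The field of bilinear forms with given matrices in the four charts. -/
def glue (m : ℕ) (B : Bool × Bool → E4 → Matrix (Fin 4) (Fin 4) ℝ) : BilinField (Hirz m) :=
  fun p => toBilin (B (index p) (chart m (index p) p))

/-- The tangent space at a point is modelled through the preferred chart of that point, so the index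
is frozen at the value of f at y. -/
theorem mfderiv_eq_fderiv {f : E4 → Hirz m} {y : E4} (hf : MDifferentiableAt (𝓡 4) (𝓡 4) f y) :
    mfderiv (𝓡 4) (𝓡 4) f y = fderiv ℝ (fun q => chart m (index (f y)) (f q)) y := by
  have h := hf.mfderiv
  rw [h]
  simp only [writtenInExtChartAt, extChartAt, mfld_simps, fderivWithin_univ]
  rfl

theorem transition_comp {s s' : Bool × Bool} {q : Hirz m} (h : q ∈ (chart m s).source) :
    transition m s s' (chart m s q) = chart m s' q := by
  rw [transition, (chart m s).left_inv h]

/-- The definition uses the preferred chart, whose index may jump. Compatibility allows any chart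
containing the point, so that one chart can be kept on a neighbourhood. -/
theorem IsCompatible.pullbackForm_glue (h : IsCompatible x₁ m B β) (hx : 0 < x₁)
    (hm : (0 : ℝ) < m) {f : E4 → Hirz m} {y : E4} (hf : ContMDiffAt (𝓡 4) (𝓡 4) ∞ f y)
    {s : Bool × Bool} (hs : f y ∈ (chart m s).source) :
    pullbackForm f (glue m B) y = (jacobian ℝ (fun q => chart m s (f q)) y)ᵀ
      * B s (chart m s (f y)) * jacobian ℝ (fun q => chart m s (f q)) y := by
  have hd := hf.mdifferentiableAt (by simp)
  obtain ⟨t, ht⟩ : ∃ t, t = index (f y) := ⟨_, rfl⟩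
  have htm : f y ∈ (chart m t).source := ht ▸ mem_chart_index (f y)
  have e1 : pullbackForm f (glue m B) y = (jacobian ℝ (fun q => chart m t (f q)) y)ᵀ
      * B t (chart m t (f y)) * jacobian ℝ (fun q => chart m t (f q)) y := by
    ext i j
    rw [← toBilin_coordVec (_ * _ * _), ← toBilin_fderiv]
    simp only [pullbackForm, Matrix.of_apply]
    rw [mfderiv_eq_fderiv hd, ht]
    rfl
  have hcd : DifferentiableAt ℝ (fun q => chart m s (f q)) y := by
    have := ((contMDiffOn_chart s).contMDiffAt ((chart m s).open_source.mem_nhds hs)).comp y hf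
    exact this.contDiffAt.differentiableAt (by simp)
  have hT : chart m s (f y) ∈ transitionDomain m s t := by
    change (chart m s).symm (chart m s (f y)) ∈ (chart m t).source
    rwa [(chart m s).left_inv hs]
  have e2 : jacobian ℝ (fun q => chart m t (f q)) y
      = jacobian ℝ (Hirz.transition m s t) (chart m s (f y))
        * jacobian ℝ (fun q => chart m s (f q)) y := by
    rw [← jacobian_comp (Ψ := fun q => chart m s (f q)) (((contDiffOn_transition s t).contDiffAt
      ((isOpen_transitionDomain s t).mem_nhds hT)).differentiableAt (by simp)) hcd]
    have : (fun q => chart m t (f q)) =ᶠ[𝓝 y] fun q => Hirz.transition m s t (chart m s (f q)) := by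
      filter_upwards [hf.continuousAt ((chart m s).open_source.mem_nhds hs)] with q hq
      exact (transition_comp hq).symm
    unfold jacobian
    rw [this.fderiv_eq]
  rw [e1, e2, ← h.transition hx hm s t hT, transition_comp hs]
  simp only [Matrix.transpose_mul, Matrix.mul_assoc]

theorem jacobian_id (y : E4) : jacobian ℝ (fun q => q) y = 1 := by
  ext i j
  simp [jacobian, coordVec, Matrix.one_apply]

theorem IsCompatible.pullbackForm_chart_symm (h : IsCompatible x₁ m B β) (hx : 0 < x₁)
    (hm : (0 : ℝ) < m) (s : Bool × Bool) :
    pullbackForm (chart m s).symm (glue m B) = B s := by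
  funext y
  have hs : (chart m s).symm y ∈ (chart m s).source := (chart m s).map_target (mem_univ y)
  rw [h.pullbackForm_glue hx hm (contMDiff_chart_symm s y) hs]
  have e : ∀ q, chart m s ((chart m s).symm q) = q := fun q => (chart m s).right_inv (mem_univ q)
  simp only [e, jacobian_id, Matrix.transpose_one, Matrix.one_mul, Matrix.mul_one]

theorem contMDiffOn_pagePoint : ContMDiffOn (𝓡 4) (𝓡 4) ∞ (pagePoint x₁ m) (coordBox x₁) :=
  (contMDiff_chart_symm (false, false)).comp_contMDiffOn (contDiffOn_pageChart x₁ m).contMDiffOn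

theorem IsCompatible.pullbackForm_pagePoint (h : IsCompatible x₁ m B β) (hx : 0 < x₁)
    (hm : (0 : ℝ) < m) {p : E4} (hp : p ∈ coordBox x₁) :
    pullbackForm (pagePoint x₁ m) (glue m B) p = β p := by
  have hs : pagePoint x₁ m p ∈ (chart m (false, false)).source :=
    (chart m (false, false)).map_target (mem_univ _)
  rw [h.pullbackForm_glue hx hm (contMDiffOn_pagePoint.contMDiffAt
    ((isOpen_coordBox x₁).mem_nhds hp)) hs]
  have e : ∀ q, chart m (false, false) (pagePoint x₁ m q) = pageChart x₁ m q := fun q =>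
    (chart m (false, false)).right_inv (mem_univ _)
  simp only [e]
  rw [h.pullback _ p hp]
  have e1 : flipCoords (false, false) p = p := by
    ext i
    fin_cases i <;> simp [flipCoords]
  have e2 : flipMatrix (false, false) = 1 := by
    rw [flipMatrix, ← Matrix.diagonal_one]
    congr 1
    ext i
    fin_cases i <;> simp
  rw [e1, e2, Matrix.one_mul, Matrix.mul_one]

/-- In the trivialization at p₀ the glued form reads `toBilin (B s ·)` for the single index s of p₀,
although nearby points may have other indices: the coordinate change of the tangent bundle is the
derivative of the transition map, which compatibility absorbs. -/
theorem IsCompatible.contMDiff_glue (h : IsCompatible x₁ m B β) (hx : 0 < x₁)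
    (hm : (0 : ℝ) < m) :
    ContMDiff (𝓡 4) ((𝓡 4).prod 𝓘(ℝ, E4 →L[ℝ] E4 →L[ℝ] ℝ)) ∞
      (fun p : Hirz m => Bundle.TotalSpace.mk' (E4 →L[ℝ] E4 →L[ℝ] ℝ)
        (E := fun p : Hirz m => TangentSpace (𝓡 4) p →L[ℝ] TangentSpace (𝓡 4) p →L[ℝ] ℝ)
        p (glue m B p)) := by
  intro p₀
  rw [contMDiffAt_hom_bundle]
  refine ⟨contMDiffAt_id, ?_⟩
  obtain ⟨s, hs⟩ : ∃ s, s = index p₀ := ⟨_, rfl⟩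
  have hp₀ : p₀ ∈ (chart m s).source := hs ▸ mem_chart_index p₀
  have hsm : ContMDiffAt (𝓡 4) 𝓘(ℝ, E4 →L[ℝ] E4 →L[ℝ] ℝ) ∞
      (fun p => toBilin (B s (chart m s p))) p₀ := by
    have h1 : ContDiffAt ℝ ∞ (fun y => toBilin (B s y)) (chart m s p₀) :=
      contDiffAt_toBilin (h.smooth s _)
    exact h1.contMDiffAt.comp p₀ ((contMDiffOn_chart s).contMDiffAt
      ((chart m s).open_source.mem_nhds hp₀))
  refine hsm.congr_of_eventuallyEq ?_
  filter_upwards [(chart m s).open_source.mem_nhds hp₀] with p hp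
  have hp' : p ∈ (trivializationAt E4 (TangentSpace (𝓡 4)) p₀).baseSet := by
    rw [TangentBundle.trivializationAt_baseSet, chartAt_eq, ← hs]
    exact hp
  have hT : chart m s p ∈ transitionDomain m s (index p) := by
    change (chart m s).symm (chart m s p) ∈ (chart m (index p)).source
    rw [(chart m s).left_inv hp]
    exact mem_chart_index p
  have hsym : ∀ v : E4, (trivializationAt E4 (TangentSpace (𝓡 4)) p₀).symm p v
      = fderiv ℝ (Hirz.transition m s (index p)) (chart m s p) v := fun v => by
    rw [← Bundle.Trivialization.symmL_apply (R := ℝ), TangentBundle.symmL_trivializationAt_eq_core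
      (by rw [chartAt_eq, ← hs]; exact hp), tangentBundleCore_coordChange_achart]
    swap
    · exact hp'
    simp only [extChartAt, mfld_simps, fderivWithin_univ, chartAt_eq, ← hs]
    rfl
  ext v w
  refine (inCoordinates_apply_eq₂ hp' hp' (mem_univ _)).trans ?_
  rw [hsym, hsym]
  have key := toBilin_fderiv (B (index p) (chart m (index p) p))
    (Hirz.transition m s (index p)) (chart m s p) v w
  rw [← transition_comp hp, h.transition hx hm s (index p) hT] at key
  rw [← key, transition_comp hp, Bundle.Trivialization.linearMapAt_apply]
  exact if_pos (mem_univ p)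

end Hirz

/-! ### The metric and the Maxwell field on the bundle -/

namespace Hirz

variable {m : ℕ} {α Λ c x₁ : ℝ}

theorem pageP_neg (α Λ c x : ℝ) : pageP α Λ c (-x) = pageP α Λ c x := by
  unfold pageP
  ring

theorem flipMatrix_mul_cosq_mul (s : Bool × Bool) (w : Fin 4 → ℝ) :
    flipMatrix s * cosq w * flipMatrix s = cosq (w ᵥ* flipMatrix s) := by
  rw [← transpose_mul_cosq_mul, flipMatrix_transpose]

/-- The coefficients are even in x and depend on θ through sin²θ, and each covector only changes by
a sign. In dψ + cos θ dφ the signs of cos θ and dφ cancel. -/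
theorem pageMetric_flipCoords (α Λ c : ℝ) (s : Bool × Bool) (p : E4) :
    flipMatrix s * pageMetric α Λ c (flipCoords s p) * flipMatrix s = pageMetric α Λ c p := by
  have e0 : flipCoords s p 0 ^ 2 = p 0 ^ 2 := by
    rcases s with ⟨_ | _, _ | _⟩ <;> simp [flipCoords]
  have eP : pageP α Λ c (flipCoords s p 0) = pageP α Λ c (p 0) := by
    rcases s with ⟨_ | _, _ | _⟩ <;> simp [flipCoords, pageP_neg]
  have es : sin (flipCoords s p 2) ^ 2 = sin (p 2) ^ 2 := by
    rcases s with ⟨_ | _, _ | _⟩ <;> simp [flipCoords]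
  have ec : cos (flipCoords s p 2) = (if s.1 then -1 else 1) * cos (p 2) := by
    rcases s with ⟨_ | _, _ | _⟩ <;> simp [flipCoords]
  simp only [pageMetric, e0, eP, es, ec, Matrix.mul_add, Matrix.add_mul, Matrix.mul_smul,
    Matrix.smul_mul, smul_add, flipMatrix_mul_cosq_mul]
  have key : ∀ (w w' : Fin 4 → ℝ) (ε : ℝ), ε ^ 2 = 1 → w' = ε • w → cosq w' = cosq w := by
    rintro w w' ε hε rfl
    ext i j
    simp only [cosq_apply, Pi.smul_apply, smul_eq_mul]
    linear_combination w i * w j * hε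
  have hε : ∀ b : Bool, (if b then -1 else 1 : ℝ) ^ 2 = 1 := by rintro (_ | _) <;> simp
  rw [key ![1, 0, 0, 0] (![1, 0, 0, 0] ᵥ* flipMatrix s) _ (hε s.2),
    key ![0, 1, 0, cos (p 2)] (![0, 1, 0, (if s.1 then -1 else 1) * cos (p 2)] ᵥ* flipMatrix s) 1
      (one_pow 2),
    key ![0, 0, 1, 0] (![0, 0, 1, 0] ᵥ* flipMatrix s) _ (hε s.1),
    key ![0, 0, 0, 1] (![0, 0, 0, 1] ᵥ* flipMatrix s) _ (hε s.1)]
  all_goals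
    ext i
    rcases s with ⟨_ | _, _ | _⟩ <;> fin_cases i <;> simp [flipMatrix, Matrix.vecMul_diagonal]

theorem isCompatible_chartMetric (h : IsRegularSolution α Λ c x₁ m) :
    IsCompatible x₁ m (fun _ => chartMetric α Λ x₁ m) (pageMetric α Λ c) where
  smooth _ y := h.mSmoothAt_chartMetric y
  pullback s p hp := by rw [← h.pullback_chartMetric hp, pageMetric_flipCoords]

/-- The matrices of the Maxwell field in the four charts. -/
def chartField (x₁ : ℝ) (m : ℕ) (a b : ℝ) (s : Bool × Bool) (y : E4) :
    Matrix (Fin 4) (Fin 4) ℝ :=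
  if s.2 then fieldStrength (chartPotential x₁ m b a) y
  else fieldStrength (chartPotential x₁ m a b) y

/-- Reflection in x exchanges the two fractions in the profile, hence a and b; the flip of the base
leaves dψ + cos θ dφ unchanged. Charts at the opposite pole of the fibre therefore use the potential
with a and b interchanged. -/
theorem pageField_flipCoords (a b : ℝ) (s : Bool × Bool) {p : E4} (h1 : 1 - p 0 ≠ 0)
    (h2 : 1 + p 0 ≠ 0) :
    flipMatrix s * fieldStrength (pagePotential a b) (flipCoords s p) * flipMatrix s
      = if s.2 then fieldStrength (pagePotential b a) p
        else fieldStrength (pagePotential a b) p := by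
  have h1' : 1 - flipCoords s p 0 ≠ 0 := by
    rcases s with ⟨_ | _, _ | _⟩ <;> simpa [flipCoords]
  have h2' : 1 + flipCoords s p 0 ≠ 0 := by
    rcases s with ⟨_ | _, _ | _⟩ <;> simpa [flipCoords, ← sub_eq_add_neg]
  have hs : sin (flipCoords s p 2) = sin (p 2) := by
    rcases s with ⟨_ | _, _ | _⟩ <;> simp [flipCoords]
  have hc : cos (flipCoords s p 2) = (if s.1 then -1 else 1) * cos (p 2) := by
    rcases s with ⟨_ | _, _ | _⟩ <;> simp [flipCoords]
  rw [fieldStrength_pagePotential a b h1' h2', fieldStrength_pagePotential a b h1 h2,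
    fieldStrength_pagePotential b a h1 h2, hs, hc]
  have hd : pageProfile a b (flipCoords s p 0)
      = if s.2 then pageProfile b a (p 0) else pageProfile a b (p 0) := by
    rcases s with ⟨_ | _, _ | _⟩ <;> simp [flipCoords, pageProfile, ← sub_eq_add_neg, add_comm]
  have hd' : 2 * a / (1 - flipCoords s p 0) ^ 2 - 2 * b / (1 + flipCoords s p 0) ^ 2
      = if s.2 then -(2 * b / (1 - p 0) ^ 2 - 2 * a / (1 + p 0) ^ 2)
        else 2 * a / (1 - p 0) ^ 2 - 2 * b / (1 + p 0) ^ 2 := by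
    rcases s with ⟨_ | _, _ | _⟩ <;> simp [flipCoords, ← sub_eq_add_neg]
  rw [hd, hd']
  generalize 2 * b / (1 - p 0) ^ 2 - 2 * a / (1 + p 0) ^ 2 = u
  generalize 2 * a / (1 - p 0) ^ 2 - 2 * b / (1 + p 0) ^ 2 = v
  generalize pageProfile a b (p 0) = w
  generalize pageProfile b a (p 0) = z
  ext i j
  rw [flipMatrix, Matrix.mul_diagonal, Matrix.diagonal_mul]
  rcases s with ⟨_ | _, _ | _⟩ <;> fin_cases i <;> fin_cases j <;> simp [biaxialField]

theorem isCompatible_chartField (h : IsRegularSolution α Λ c x₁ m) (a b : ℝ) :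
    IsCompatible x₁ m (chartField x₁ m a b) (fieldStrength (pagePotential a b)) where
  smooth s y := by
    have := fun a b => contDiffAt_fieldStrength (p := y) fun i =>
      (contDiff_chartPotential h.toIsAdmissible m a b i).contDiffAt
    rcases s with ⟨_, _ | _⟩
    · exact this a b
    · exact this b a
  pullback s p hp := by
    have hd := (h.toIsAdmissible.coordBox_subset hp).1
    rw [abs_lt] at hd
    rw [pageField_flipCoords a b s (by linarith [hd.2] : 0 < 1 - p 0).ne'
      (by linarith [hd.1] : 0 < 1 + p 0).ne']
    rcases s with ⟨_, _ | _⟩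
    · exact (h.pullback_field a b hp).symm
    · exact (h.pullback_field b a hp).symm

/-- The Riemannian metric on the bundle. -/
def bundleMetric (h : IsRegularSolution α Λ c x₁ m) :
    Bundle.ContMDiffRiemannianMetric (𝓡 4) ∞ E4 (fun p : Hirz m => TangentSpace (𝓡 4) p) where
  inner := glue m fun _ => chartMetric α Λ x₁ m
  symm p v w := by
    refine (toBilin_apply _ _ _).trans (Eq.trans ?_ (toBilin_apply _ _ _).symm)
    rw [Finset.sum_comm]
    refine Finset.sum_congr rfl fun i _ => Finset.sum_congr rfl fun j _ => ?_
    have := chartMetric_symm α Λ x₁ m (chart m (index p) p) i j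
    change chartMetric α Λ x₁ m (chart m (index p) p) j i * _ * _
      = chartMetric α Λ x₁ m (chart m (index p) p) i j * _ * _
    rw [this]
    exact mul_right_comm _ _ _
  pos p v hv := by
    refine lt_of_lt_of_eq ?_ (toBilin_eq_dotProduct _ _ _).symm
    have := (h.posDef_chartMetric (chart m (index p) p)).dotProduct_mulVec_pos
      (x := WithLp.ofLp (show E4 from v)) (fun e => hv (by
        have : (show E4 from v) = 0 := by
          ext i
          exact congrFun e i
        exact this))
    simpa using this
  isVonNBounded p := isVonNBounded_toBilin (h.posDef_chartMetric (chart m (index p) p))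
  contMDiff := (isCompatible_chartMetric h).contMDiff_glue h.pos h.cast_pos

/-- The Maxwell field on the bundle. -/
def bundleField (x₁ : ℝ) (m : ℕ) (a b : ℝ) : BilinField (Hirz m) := glue m (chartField x₁ m a b)

/-- The constraint on ab is symmetric, so the charts in which a and b are interchanged also carry
solutions. -/
theorem solvesEinsteinMaxwellOn (h : IsRegularSolution α Λ c x₁ m) {a b : ℝ}
    (hab : a * b = -(c * α ^ 2 / 4)) :
    SolvesEinsteinMaxwellOn Λ (bundleMetric h) (bundleField x₁ m a b) := by
  rintro _ ⟨s, rfl⟩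
  rw [chart_target, bundleField,
    (isCompatible_chartField h a b).pullbackForm_chart_symm h.pos h.cast_pos]
  have e : pullbackForm (chart m s).symm (bundleMetric h).inner = chartMetric α Λ x₁ m :=
    (isCompatible_chartMetric h).pullbackForm_chart_symm h.pos h.cast_pos s
  rw [e]
  rcases s with ⟨_, _ | _⟩
  · exact h.solves_chartMetric hab
  · exact h.solves_chartMetric (by linarith)

end Hirz

/-! ### Maps into the sphere -/

section Sphere

open scoped ComplexConjugate

/-- The complex number formed by the first two coordinates. -/
def planeCoord (v : EuclideanSpace ℝ (Fin 3)) : ℂ := (v 0 : ℂ) + v 1 * Complex.I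

theorem normSq_planeCoord (v : EuclideanSpace ℝ (Fin 3)) :
    Complex.normSq (planeCoord v) = v 0 ^ 2 + v 1 ^ 2 := by
  simp [planeCoord, Complex.normSq_apply, sq]

theorem contDiff_planeCoord : ContDiff ℝ ∞ planeCoord :=
  (Complex.ofRealCLM.contDiff.comp (by fun_prop)).add
    ((Complex.ofRealCLM.contDiff.comp (by fun_prop)).mul contDiff_const)

theorem sphere_coord_sq (b : S2) : Complex.normSq (planeCoord b.1) + b.1 2 ^ 2 = 1 := by
  have h : ‖b.1‖ = 1 := by simpa using b.2
  have h2 := EuclideanSpace.norm_sq_eq b.1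
  rw [h, Fin.sum_univ_three] at h2
  simp only [Real.norm_eq_abs, sq_abs] at h2
  rw [normSq_planeCoord]
  linarith

theorem mem_sphere_of_coord_sq {z : ℂ} {t : ℝ} (h : Complex.normSq z + t ^ 2 = 1) :
    !₂[z.re, z.im, t] ∈ Metric.sphere (0 : EuclideanSpace ℝ (Fin 3)) 1 := by
  rw [mem_sphere_zero_iff_norm, EuclideanSpace.norm_eq, Real.sqrt_eq_one, Fin.sum_univ_three]
  rw [Complex.normSq_apply] at h
  simp only [Real.norm_eq_abs, sq_abs]
  change z.re ^ 2 + z.im ^ 2 + t ^ 2 = 1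
  linarith

open Classical in
/-- The point of the sphere with given coordinates. -/
def spherePoint (z : ℂ) (t : ℝ) : S2 :=
  if h : Complex.normSq z + t ^ 2 = 1 then ⟨!₂[z.re, z.im, t], mem_sphere_of_coord_sq h⟩
  else ⟨!₂[(1 : ℂ).re, (1 : ℂ).im, 0], mem_sphere_of_coord_sq (by simp)⟩

theorem coe_spherePoint {z : ℂ} {t : ℝ} (h : Complex.normSq z + t ^ 2 = 1) :
    (spherePoint z t).1 = !₂[z.re, z.im, t] := by
  rw [spherePoint, dif_pos h]

theorem planeCoord_spherePoint {z : ℂ} {t : ℝ} (h : Complex.normSq z + t ^ 2 = 1) :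
    planeCoord (spherePoint z t).1 = z := by
  rw [coe_spherePoint h]
  simp [planeCoord]

theorem spherePoint_two {z : ℂ} {t : ℝ} (h : Complex.normSq z + t ^ 2 = 1) :
    (spherePoint z t).1 2 = t := by
  rw [coe_spherePoint h]
  rfl

theorem spherePoint_coord (b : S2) : spherePoint (planeCoord b.1) (b.1 2) = b := by
  refine Subtype.ext ?_
  rw [coe_spherePoint (sphere_coord_sq b)]
  ext i
  fin_cases i <;> simp [planeCoord]

theorem sphere_ext {b b' : S2} (h : planeCoord b.1 = planeCoord b'.1) (h' : b.1 2 = b'.1 2) :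
    b = b' := by
  rw [← spherePoint_coord b, ← spherePoint_coord b', h, h']

variable {E H N : Type*} [NormedAddCommGroup E] [NormedSpace ℝ E] [TopologicalSpace H]
  {I : ModelWithCorners ℝ E H} [TopologicalSpace N] [ChartedSpace H N]

/-- Smoothness of a map into the sphere can be checked in the ambient space. -/
theorem contMDiffOn_sphere {f : N → S2} {U : Set N}
    (h : ContMDiffOn I 𝓘(ℝ, EuclideanSpace ℝ (Fin 3)) ∞ (fun q => (f q).1) U) :
    ContMDiffOn I (𝓡 2) ∞ f U := by
  intro q hq
  have hf : ContinuousWithinAt f U q :=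
    IsInducing.subtypeVal.continuousWithinAt_iff.2 (h.continuousOn q hq)
  obtain ⟨v, hv⟩ : ∃ v, v = f q := ⟨_, rfl⟩
  let e := chartAt (EuclideanSpace ℝ (Fin 2)) v
  have : Fact (Module.finrank ℝ (EuclideanSpace ℝ (Fin 3)) = 2 + 1) :=
    ⟨finrank_euclideanSpace_fin⟩
  let L := (OrthonormalBasis.fromOrthogonalSpanSingleton (𝕜 := ℝ)
    2 (ne_zero_of_mem_unit_sphere (-v))).repr
  have he : ∀ x : S2, e x = L (stereoToFun (-v.1) x.1) := fun _ => rfl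
  have hq' : f q ∈ e.source := hv ▸ mem_chart_source _ v
  have hne : innerSL ℝ (-v.1) (f q).1 ≠ 1 := by
    rw [← hv]
    have : ‖v.1‖ = 1 := by simpa using v.2
    simp [this]
    norm_num
  have ho : IsOpen {x | innerSL ℝ (-v.1) x ≠ 1} := isOpen_ne.preimage (innerSL ℝ (-v.1)).continuous
  have h1 : ContMDiffAt 𝓘(ℝ, EuclideanSpace ℝ (Fin 3)) (𝓡 2) ∞
      (fun x => L (stereoToFun (-v.1) x)) (f q).1 :=
    (L.contDiff.contDiffAt.comp _ (contDiffOn_stereoToFun.contDiffAt (ho.mem_nhds hne))).contMDiffAt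
  have h2 : ContMDiffAt (𝓡 2) (𝓡 2) ∞ e.symm (e (f q)) :=
    (contMDiffOn_chart_symm (I := 𝓡 2) (n := ∞) (x := v)).contMDiffAt
      (e.open_target.mem_nhds (e.map_source hq'))
  have h3 := h2.comp_contMDiffWithinAt q (h1.comp_contMDiffWithinAt q (h q hq))
  refine h3.congr_of_eventuallyEq ?_ (e.left_inv hq').symm
  filter_upwards [hf (e.open_source.mem_nhds hq')] with x hx
  exact (e.left_inv hx).symm

theorem contDiff_sphereVector : ContDiff ℝ ∞ fun w : ℂ × ℝ => !₂[w.1.re, w.1.im, w.2] := by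
  refine contDiff_piLp 2 |>.2 fun i => ?_
  fin_cases i
  · exact Complex.reCLM.contDiff.comp contDiff_fst
  · exact Complex.imCLM.contDiff.comp contDiff_fst
  · exact contDiff_snd

theorem contMDiffOn_spherePoint {f : N → ℂ × ℝ} {U : Set N}
    (hf : ContMDiffOn I 𝓘(ℝ, ℂ × ℝ) ∞ f U)
    (h : ∀ q ∈ U, Complex.normSq (f q).1 + (f q).2 ^ 2 = 1) :
    ContMDiffOn I (𝓡 2) ∞ (fun q => spherePoint (f q).1 (f q).2) U :=
  contMDiffOn_sphere ((contDiff_sphereVector.contMDiff.comp_contMDiffOn hf).congr fun q hq =>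
    coe_spherePoint (h q hq))

theorem contMDiff_coe_S2 :
    ContMDiff (𝓡 2) 𝓘(ℝ, EuclideanSpace ℝ (Fin 3)) ∞ (fun b : S2 => b.1) := by
  have : Fact (Module.finrank ℝ (EuclideanSpace ℝ (Fin 3)) = 2 + 1) :=
    ⟨finrank_euclideanSpace_fin⟩
  exact contMDiff_coe_sphere (n := 2)

theorem contMDiff_coe_S2_prod : ContMDiff ((𝓡 2).prod (𝓡 2))
    𝓘(ℝ, EuclideanSpace ℝ (Fin 3) × EuclideanSpace ℝ (Fin 3)) ∞
    (fun b : S2 × S2 => (b.1.1, b.2.1)) :=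
  (contMDiff_coe_S2.comp contMDiff_fst).prodMk_space (contMDiff_coe_S2.comp contMDiff_snd)

end Sphere

namespace Hirz

open scoped ComplexConjugate

variable {m : ℕ}

/-! ### The bundle projection -/

section Frames

variable {E H N : Type*} [NormedAddCommGroup E] [NormedSpace ℝ E] [TopologicalSpace H]
  {I : ModelWithCorners ℝ E H} [TopologicalSpace N] [ChartedSpace H N]

open Classical in
/-- The class of a frame. -/
def ofFrame (m : ℕ) (x : FramePoint) : Hirz m :=
  if h : x ∈ frameSet then mk x h else mk (1, 0, 0, 1) (by simp [frameSet])

theorem ofFrame_eq {x : FramePoint} (h : x ∈ frameSet) : ofFrame m x = mk x h := dif_pos h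

theorem val_ofFrame {x : FramePoint} (h : x ∈ frameSet) :
    (ofFrame m x).val = frameInvariants m x := by
  rw [ofFrame_eq h, val_mk]

theorem exists_ofFrame (p : Hirz m) : ∃ x ∈ frameSet, ofFrame m x = p := by
  obtain ⟨x, hx, rfl⟩ := p.exists_mk
  exact ⟨x, hx, ofFrame_eq hx⟩

theorem ofFrame_eq_iff {x y : FramePoint} (hx : x ∈ frameSet) (hy : y ∈ frameSet) :
    ofFrame m x = ofFrame m y ↔
      ∃ l : ℂ, Complex.normSq l = 1 ∧ y = (l * x.1, l * x.2.1, l ^ m * x.2.2.1, x.2.2.2) := by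
  rw [← frameInvariants_eq_iff hx hy, ← val_ofFrame hx, ← val_ofFrame hy, val_injective.eq_iff]

theorem flip_ofFrame (s : Bool × Bool) {x : FramePoint} (hx : x ∈ frameSet) :
    flip s (ofFrame m x) = ofFrame m (flipFrame s x) :=
  val_injective (by
    rw [val_flip, val_ofFrame hx, val_ofFrame (flipFrame_mem s hx), frameInvariants_flipFrame])

theorem flip_flip (s : Bool × Bool) (p : Hirz m) : flip s (flip s p) = p :=
  (flipHomeo s).left_inv p

theorem contMDiff_flip (s : Bool × Bool) : ContMDiff (𝓡 4) (𝓡 4) ∞ (flip s : Hirz m → Hirz m) :=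
  contMDiff_of_val ((contDiff_flipAmbient s).contMDiff.comp contMDiff_val)

theorem contMDiffOn_ofFrame {g : N → FramePoint} {U : Set N}
    (hg : ContMDiffOn I 𝓘(ℝ, FramePoint) ∞ g U) (h : ∀ q ∈ U, g q ∈ frameSet) :
    ContMDiffOn I (𝓡 4) ∞ (fun q => ofFrame m (g q)) U :=
  contMDiffOn_of_val (((contDiff_frameInvariants m).contMDiff.comp_contMDiffOn hg).congr
    fun q hq => val_ofFrame (h q hq))

theorem chart_symm_eq_ofFrame (s : Bool × Bool) (y : E4) :
    (chart m s).symm y = ofFrame m (flipFrame s (frameOf y)) :=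
  val_injective (by
    rw [val_chart_symm, val_ofFrame (flipFrame_mem s (frameOf_mem y))])

end Frames

/-- The first two invariants form the Hopf map, and the relation is (|a|² + |b|²)² = 1. -/
theorem invariants_base (p : Hirz m) : Complex.normSq (2 * p.val.2.1) + p.val.1 ^ 2 = 1 := by
  obtain ⟨⟨a, b, c, t⟩, hx, rfl⟩ := p.exists_ofFrame
  rw [val_ofFrame hx]
  obtain ⟨h1, h2⟩ := hx
  simp only at h1 h2
  simp only [frameInvariants, map_mul, Complex.normSq_conj]
  have : Complex.normSq 2 = 4 := by norm_num [Complex.normSq_apply]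
  rw [this]
  have e : Complex.normSq b = 1 - Complex.normSq a := by linarith
  rw [e]
  ring

/-- The bundle projection. -/
def proj (p : Hirz m) : S2 := spherePoint (2 * p.val.2.1) p.val.1

theorem coe_proj (p : Hirz m) : (proj p).1 = !₂[2 * p.val.2.1.re, 2 * p.val.2.1.im, p.val.1] := by
  rw [proj, coe_spherePoint (invariants_base p)]
  simp

theorem planeCoord_proj (p : Hirz m) : planeCoord (proj p).1 = 2 * p.val.2.1 :=
  planeCoord_spherePoint (invariants_base p)

theorem proj_two (p : Hirz m) : (proj p).1 2 = p.val.1 := spherePoint_two (invariants_base p)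

theorem contMDiff_proj : ContMDiff (𝓡 4) (𝓡 2) ∞ (proj (m := m)) := by
  have h : ContDiff ℝ ∞ fun v : BundleAmbient => (2 * v.2.1, v.1) := by fun_prop
  exact contMDiffOn_univ.1 (contMDiffOn_spherePoint (h.contMDiff.comp contMDiff_val).contMDiffOn
    fun p _ => invariants_base p)

/-- The action of the symmetries on the base. -/
def flipBase (s : Bool) (b : S2) : S2 :=
  if s then spherePoint (conj (planeCoord b.1)) (-b.1 2) else b

theorem flipBase_rel (b : S2) :
    Complex.normSq (conj (planeCoord b.1)) + (-b.1 2) ^ 2 = 1 := by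
  rw [Complex.normSq_conj, neg_sq]
  exact sphere_coord_sq b

theorem flipBase_flipBase (s : Bool) (b : S2) : flipBase s (flipBase s b) = b := by
  cases s
  · rfl
  · simp only [flipBase, if_true]
    rw [planeCoord_spherePoint (flipBase_rel b), spherePoint_two (flipBase_rel b), Complex.conj_conj,
      neg_neg, spherePoint_coord]

theorem contMDiff_flipBase (s : Bool) : ContMDiff (𝓡 2) (𝓡 2) ∞ (flipBase s) := by
  cases s
  · exact contMDiff_id
  · have h : ContDiff ℝ ∞ fun v : EuclideanSpace ℝ (Fin 3) => (conj (planeCoord v), -v 2) :=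
      (contDiff_conj.comp contDiff_planeCoord).prodMk (by fun_prop)
    exact contMDiffOn_univ.1 (contMDiffOn_spherePoint
      (h.contMDiff.comp contMDiff_coe_S2).contMDiffOn fun b _ => flipBase_rel b)

theorem proj_flip (s : Bool) (p : Hirz m) : proj (flip (s, false) p) = flipBase s (proj p) := by
  cases s
  · rfl
  · simp only [flipBase, if_true]
    rw [planeCoord_proj, proj_two, proj, val_flip]
    have : conj (2 : ℂ) = 2 := map_ofNat _ 2
    simp [flipAmbient, this]

theorem neg_one_lt_proj_iff (s : Bool) (p : Hirz m) :
    -1 < (flipBase s (proj p)).1 2 ↔ -1 < (flip (s, false) p).val.1 := by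
  rw [← proj_flip, proj_two]

/-- Where a ≠ 0 the square root is |a|, so the first entry is ζ times a phase. This phase undoes the
circle action and identifies the fibre with the unit sphere. -/
theorem fibre_rel {p : Hirz m} (hp : -1 < p.val.1) :
    Complex.normSq (((√((1 + p.val.1) / 2) ^ m)⁻¹ : ℝ) * p.val.2.2.1) + p.val.2.2.2.2 ^ 2 = 1 := by
  obtain ⟨⟨a, b, c, t⟩, hx, rfl⟩ := p.exists_ofFrame
  rw [val_ofFrame hx] at hp ⊢
  obtain ⟨h1, h2⟩ := hx
  change -1 < Complex.normSq a - Complex.normSq b at hp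
  simp only at h1 h2
  have ha0 : 0 < Complex.normSq a := by linarith
  simp only [frameInvariants]
  have e : (1 + (Complex.normSq a - Complex.normSq b)) / 2 = Complex.normSq a := by linarith
  rw [e, map_mul, Complex.normSq_ofReal, map_mul, map_pow, Complex.normSq_conj, ← sq, inv_pow, ← pow_mul,
    mul_comm m 2, pow_mul, Real.sq_sqrt ha0.le]
  have : Complex.normSq a ^ m ≠ 0 := by positivity
  field_simp
  linarith

/-- The coordinate on the fibre over the complement of a pole. -/
def fibrePart (p : Hirz m) : S2 :=
  spherePoint (((√((1 + p.val.1) / 2) ^ m)⁻¹ : ℝ) * p.val.2.2.1) p.val.2.2.2.2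

theorem contMDiffOn_fibrePart :
    ContMDiffOn (𝓡 4) (𝓡 2) ∞ (fibrePart (m := m)) {p | -1 < p.val.1} := by
  have h0 : ContDiffOn ℝ ∞ (fun v : BundleAmbient => 1 + v.1) {v | -1 < v.1} := by fun_prop
  have p0 : ∀ v ∈ {v : BundleAmbient | -1 < v.1}, 0 < (1 + v.1) / 2 := fun v hv => by
    have : -1 < v.1 := hv
    linarith
  have hs : ContDiffOn ℝ ∞ (fun v : BundleAmbient => (√((1 + v.1) / 2) ^ m)⁻¹) {v | -1 < v.1} :=
    (((h0.div_const 2).sqrt fun v hv => (p0 v hv).ne').pow m).inv fun v hv =>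
      (pow_pos (Real.sqrt_pos.2 (p0 v hv)) m).ne'
  have h : ContDiffOn ℝ ∞ (fun v : BundleAmbient =>
      (((((√((1 + v.1) / 2) ^ m)⁻¹ : ℝ) : ℂ) * v.2.2.1), v.2.2.2.2)) {v | -1 < v.1} :=
    ((Complex.ofRealCLM.contDiff.comp_contDiffOn hs).mul (by fun_prop)).prodMk (by fun_prop)
  exact contMDiffOn_spherePoint (h.contMDiffOn.comp contMDiff_val.contMDiffOn fun p hp => hp)
    fun p hp => fibre_rel hp

/-- A frame with given base point and fibre coordinate. -/
def sectionFrame (w : EuclideanSpace ℝ (Fin 3) × EuclideanSpace ℝ (Fin 3)) : FramePoint :=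
  ((√((1 + w.1 2) / 2) : ℝ), ((2 * √((1 + w.1 2) / 2))⁻¹ : ℝ) * planeCoord w.1, planeCoord w.2,
    w.2 2)

theorem sectionFrame_mem {b f : S2} (hb : -1 < b.1 2) : sectionFrame (b.1, f.1) ∈ frameSet := by
  have h := sphere_coord_sq b
  have h1 : 0 < (1 + b.1 2) / 2 := by linarith
  refine ⟨?_, sphere_coord_sq f⟩
  simp only [sectionFrame, map_mul, Complex.normSq_ofReal, ← sq, inv_pow, mul_pow,
    Real.sq_sqrt h1.le]
  have e : Complex.normSq (planeCoord b.1) = (1 - b.1 2) * (1 + b.1 2) := by linarith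
  rw [e]
  have : 1 + b.1 2 ≠ 0 := by linarith
  field_simp
  ring

theorem contDiffOn_sectionFrame : ContDiffOn ℝ ∞ sectionFrame {w | -1 < w.1 2} := by
  have h0 : ContDiffOn ℝ ∞ (fun w : EuclideanSpace ℝ (Fin 3) × EuclideanSpace ℝ (Fin 3) =>
      1 + w.1 2) {w | -1 < w.1 2} := by fun_prop
  have p0 : ∀ w ∈ {w : EuclideanSpace ℝ (Fin 3) × EuclideanSpace ℝ (Fin 3) | -1 < w.1 2},
      0 < (1 + w.1 2) / 2 := fun v hv => by
    have : -1 < v.1 2 := hv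
    linarith
  have hs := (h0.div_const 2).sqrt fun v hv => (p0 v hv).ne'
  have hi := (contDiffOn_const (c := (2 : ℝ)).mul hs).inv fun v hv =>
    (mul_pos two_pos (Real.sqrt_pos.2 (p0 v hv))).ne'
  exact (Complex.ofRealCLM.contDiff.comp_contDiffOn hs).prodMk
    (((Complex.ofRealCLM.contDiff.comp_contDiffOn hi).mul
      (contDiff_planeCoord.comp contDiff_fst).contDiffOn).prodMk
      ((contDiff_planeCoord.comp contDiff_snd).contDiffOn.prodMk (by fun_prop)))

/-- Over the complement of the pole a = 0 each orbit has a representative with positive first entry,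
obtained by the phase conj a/|a|; `sectionFrame` produces this representative. -/
theorem sectionFrame_left_inv {p : Hirz m} (hp : -1 < p.val.1) :
    ofFrame m (sectionFrame ((proj p).1, (fibrePart p).1)) = p := by
  have hb : -1 < (proj p).1 2 := by rwa [proj_two]
  have hr := fibre_rel hp
  obtain ⟨⟨a, b, c, t⟩, hx, rfl⟩ := p.exists_ofFrame
  have hv := val_ofFrame (m := m) hx
  obtain ⟨h1, h2⟩ := id hx
  simp only at h1 h2
  rw [eq_comm, ofFrame_eq_iff hx (sectionFrame_mem hb)]
  simp only [sectionFrame, fibrePart, planeCoord_spherePoint hr, spherePoint_two hr, proj_two,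
    planeCoord_proj]
  rw [hv] at hp ⊢
  change -1 < Complex.normSq a - Complex.normSq b at hp
  simp only [frameInvariants]
  have e : (1 + (Complex.normSq a - Complex.normSq b)) / 2 = Complex.normSq a := by linarith
  have ha0 : 0 < Complex.normSq a := by linarith
  have ha : a ≠ 0 := by simpa using ha0.ne'
  have hn0 : (0 : ℝ) < ‖a‖ := norm_pos_iff.2 ha
  have hnc : ((‖a‖ : ℝ) : ℂ) ≠ 0 := by exact_mod_cast hn0.ne'
  have hac : conj a * a = ((‖a‖ : ℝ) : ℂ) ^ 2 := by
    rw [mul_comm, Complex.mul_conj, Complex.normSq_eq_norm_sq]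
    push_cast
    ring
  rw [e, Complex.normSq_eq_norm_sq, Real.sqrt_sq hn0.le]
  refine ⟨conj a / ‖a‖, ?_, ?_⟩
  · rw [map_div₀, Complex.normSq_conj, Complex.normSq_ofReal, Complex.normSq_eq_norm_sq]
    field_simp
  · refine Prod.ext ?_ (Prod.ext ?_ (Prod.ext ?_ rfl))
    · change (‖a‖ : ℂ) = conj a / ‖a‖ * a
      rw [div_mul_eq_mul_div, hac]
      field_simp
    · change (((2 * ‖a‖)⁻¹ : ℝ) : ℂ) * (2 * (b * conj a)) = conj a / ‖a‖ * b
      push_cast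
      field_simp
    · change (((‖a‖ ^ m)⁻¹ : ℝ) : ℂ) * (c * conj a ^ m) = (conj a / ‖a‖) ^ m * c
      push_cast
      rw [div_pow]
      field_simp

theorem val_sectionFrame_fst {b f : S2} (hb : -1 < b.1 2) :
    (ofFrame m (sectionFrame (b.1, f.1))).val.1 = b.1 2 := by
  rw [val_ofFrame (sectionFrame_mem hb)]
  have h1 : 0 < (1 + b.1 2) / 2 := by linarith
  have h2 := (sectionFrame_mem (f := f) hb).1
  have h3 : Complex.normSq (sectionFrame (b.1, f.1)).1 = (1 + b.1 2) / 2 := by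
    simp only [sectionFrame, Complex.normSq_ofReal]
    exact Real.mul_self_sqrt h1.le
  simp only [frameInvariants]
  linarith

theorem proj_sectionFrame {b f : S2} (hb : -1 < b.1 2) :
    proj (ofFrame m (sectionFrame (b.1, f.1))) = b := by
  refine sphere_ext ?_ (by rw [proj_two, val_sectionFrame_fst hb])
  have h1 : 0 < √((1 + b.1 2) / 2) := Real.sqrt_pos.2 (by linarith)
  have h2 : ((√((1 + b.1 2) / 2) : ℝ) : ℂ) ≠ 0 := by exact_mod_cast h1.ne'
  rw [planeCoord_proj, val_ofFrame (sectionFrame_mem hb)]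
  simp only [frameInvariants, sectionFrame, Complex.conj_ofReal]
  push_cast
  field_simp

theorem fibrePart_sectionFrame {b f : S2} (hb : -1 < b.1 2) :
    fibrePart (ofFrame m (sectionFrame (b.1, f.1))) = f := by
  have h1 : 0 < √((1 + b.1 2) / 2) := Real.sqrt_pos.2 (by linarith)
  have h2 : ((√((1 + b.1 2) / 2) : ℝ) : ℂ) ≠ 0 := by exact_mod_cast h1.ne'
  rw [fibrePart, val_sectionFrame_fst hb, val_ofFrame (sectionFrame_mem hb)]
  conv_rhs => rw [← spherePoint_coord f]
  congr 1
  simp only [frameInvariants, sectionFrame, Complex.conj_ofReal]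
  push_cast
  field_simp

theorem contMDiffOn_sectionFrame (s : Bool) : ContMDiffOn ((𝓡 2).prod (𝓡 2)) (𝓡 4) ∞
    (fun w : S2 × S2 => flip (s, false) (ofFrame m (sectionFrame ((flipBase s w.1).1, w.2.1))))
    ({b | -1 < (flipBase s b).1 2} ×ˢ univ) := by
  refine (contMDiff_flip _).comp_contMDiffOn (contMDiffOn_ofFrame ?_ fun w hw =>
    sectionFrame_mem hw.1)
  have h : ContMDiff ((𝓡 2).prod (𝓡 2))
      𝓘(ℝ, EuclideanSpace ℝ (Fin 3) × EuclideanSpace ℝ (Fin 3)) ∞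
      (fun w : S2 × S2 => ((flipBase s w.1).1, w.2.1)) :=
    contMDiff_coe_S2_prod.comp (((contMDiff_flipBase s).comp contMDiff_fst).prodMk contMDiff_snd)
  exact contDiffOn_sectionFrame.contMDiffOn.comp h.contMDiffOn fun w hw => hw.1

theorem isOpen_trivBase (s : Bool) : IsOpen {b : S2 | -1 < (flipBase s b).1 2} := by
  have c : Continuous fun v : EuclideanSpace ℝ (Fin 3) => v 2 := by fun_prop
  exact isOpen_lt continuous_const (c.comp (continuous_subtype_val.comp
    (contMDiff_flipBase s).continuous))

theorem contMDiffOn_trivMap (s : Bool) : ContMDiffOn (𝓡 4) ((𝓡 2).prod (𝓡 2)) ∞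
    (fun p : Hirz m => (proj p, fibrePart (flip (s, false) p)))
    (proj ⁻¹' {b | -1 < (flipBase s b).1 2}) :=
  contMDiff_proj.contMDiffOn.prodMk
    (contMDiffOn_fibrePart.comp (contMDiff_flip _).contMDiffOn
      fun p hp => (neg_one_lt_proj_iff s p).1 hp)

/-- The trivializations over the complements of the poles. -/
def triv (m : ℕ) (s : Bool) : Bundle.Trivialization S2 (proj (m := m)) where
  toFun p := (proj p, fibrePart (flip (s, false) p))
  invFun w := flip (s, false) (ofFrame m (sectionFrame ((flipBase s w.1).1, w.2.1)))
  source := proj ⁻¹' {b | -1 < (flipBase s b).1 2}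
  target := {b | -1 < (flipBase s b).1 2} ×ˢ univ
  map_source' p hp := ⟨hp, mem_univ _⟩
  map_target' w hw := by
    have : -1 < (flipBase s w.1).1 2 := hw.1
    rw [mem_preimage, proj_flip, proj_sectionFrame this, mem_ofPred_eq]
    rwa [flipBase_flipBase]
  left_inv' p hp := by
    have hp' := (neg_one_lt_proj_iff s p).1 hp
    rw [← proj_flip, sectionFrame_left_inv hp', flip_flip]
  right_inv' w hw := by
    have : -1 < (flipBase s w.1).1 2 := hw.1
    rw [flip_flip, fibrePart_sectionFrame this, proj_flip, proj_sectionFrame this, flipBase_flipBase]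
  open_source := (isOpen_trivBase s).preimage contMDiff_proj.continuous
  open_target := (isOpen_trivBase s).prod isOpen_univ
  continuousOn_toFun := (contMDiffOn_trivMap s).continuousOn
  continuousOn_invFun := (contMDiffOn_sectionFrame s).continuousOn
  baseSet := {b | -1 < (flipBase s b).1 2}
  open_baseSet := isOpen_trivBase s
  source_eq := rfl
  target_eq := rfl
  proj_toFun _ _ := rfl

theorem isSmoothSphereBundle_proj : IsSmoothSphereBundle (proj (m := m)) := by
  refine ⟨contMDiff_proj, fun b => ?_⟩
  obtain ⟨s, hs⟩ : ∃ s, -1 < (flipBase s b).1 2 := by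
    by_cases h : -1 < b.1 2
    · exact ⟨false, h⟩
    · refine ⟨true, ?_⟩
      rw [flipBase, if_pos rfl, spherePoint_two (flipBase_rel b)]
      linarith
  exact ⟨triv m s, hs, contMDiffOn_trivMap s, contMDiffOn_sectionFrame s⟩

end Hirz

/-! ### The coordinates (x, ψ, θ, φ) as a dense parametrization -/

namespace Hirz

open scoped ComplexConjugate

variable {m : ℕ} {α Λ c x₁ : ℝ} {y z : E4}

theorem pagePoint_eq_ofFrame (hy : y ∈ coordBox x₁) :
    pagePoint x₁ m y = ofFrame m (pageFrame x₁ m y) := by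
  rw [pagePoint_eq hy, ofFrame_eq (pageFrame_mem hy)]

theorem cos_half_pos (hy : y ∈ coordBox x₁) : 0 < cos (y 2 / 2) :=
  cos_pos_of_mem_Ioo ⟨by linarith [hy.2.2.1, pi_pos], by linarith [hy.2.2.2]⟩

theorem sin_half_pos (hy : y ∈ coordBox x₁) : 0 < sin (y 2 / 2) :=
  sin_pos_of_pos_of_lt_pi (by linarith [hy.2.2.1]) (by linarith [hy.2.2.2, pi_pos])

theorem coe_proj_pagePoint (hy : y ∈ coordBox x₁) :
    (proj (pagePoint x₁ m y) : EuclideanSpace ℝ (Fin 3)) =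
      !₂[sin (y 2) * cos (y 3), sin (y 2) * sin (y 3), cos (y 2)] := by
  rw [coe_proj, pagePoint_eq_ofFrame hy, val_ofFrame (pageFrame_mem hy)]
  have e1 : (frameInvariants m (pageFrame x₁ m y)).1 = cos (y 2) := by
    simp only [frameInvariants, pageFrame, map_mul, normSq_cexpI, mul_one, Complex.normSq_ofReal]
    conv_rhs => rw [← mul_div_cancel₀ (y 2) (two_ne_zero (α := ℝ)), cos_two_mul]
    nlinarith [sin_sq_add_cos_sq (y 2 / 2)]
  have e2 : (frameInvariants m (pageFrame x₁ m y)).2.1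
      = ((sin (y 2) / 2 : ℝ) : ℂ) * cexpI (y 3) := by
    simp only [frameInvariants, pageFrame, map_mul, conj_cexpI, Complex.conj_ofReal, neg_neg]
    have h1 : sin (y 2) = 2 * sin (y 2 / 2) * cos (y 2 / 2) := by
      rw [← sin_two_mul, mul_div_cancel₀ (y 2) (two_ne_zero (α := ℝ))]
    have h2 : cexpI (y 3) = cexpI (y 3 / 2) * cexpI (y 3 / 2) := by rw [← cexpI_add, add_halves]
    rw [h1, h2]
    generalize cexpI (y 3 / 2) = w
    push_cast
    ring
  rw [e1, e2]
  simp only [Complex.re_ofReal_mul, Complex.im_ofReal_mul, cexpI]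
  congr 1
  ext i
  fin_cases i
  · change 2 * (sin (y 2) / 2 * cos (y 3)) = sin (y 2) * cos (y 3)
    ring
  · change 2 * (sin (y 2) / 2 * sin (y 3)) = sin (y 2) * sin (y 3)
    ring
  · rfl

/-- The second frame entry forces the phase l = e^{i(φ' - φ)/2}, and the first, with the opposite
phase, then forces φ' - φ ∈ 2πℤ. The fibre entry, on which l acts by its m-th power, gives ψ' - ψ =
(φ' - φ) + 4πk/m. This is the lattice. -/
theorem pagePoint_eq_iff (hm : 1 ≤ m) (hy : y ∈ coordBox x₁) (hz : z ∈ coordBox x₁) :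
    pagePoint x₁ m y = pagePoint x₁ m z ↔ z 0 = y 0 ∧ z 2 = y 2 ∧ ∃ k l : ℤ,
      z 1 = y 1 + 4 * π / m * k + 2 * π * l ∧ z 3 = y 3 + 2 * π * l := by
  have hx : 0 < x₁ := by linarith [hy.1, hy.2.1]
  have hm0 : (m : ℝ) ≠ 0 := by exact_mod_cast (by omega : m ≠ 0)
  rw [pagePoint_eq_ofFrame hy, pagePoint_eq_ofFrame hz,
    ofFrame_eq_iff (pageFrame_mem hy) (pageFrame_mem hz)]
  simp only [pageFrame, Prod.mk.injEq]
  constructor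
  · rintro ⟨l, hl, h1, h2, h3, h4⟩
    have e0 : z 0 = y 0 := by
      field_simp at h4
      exact h4
    have hc : cos (z 2 / 2) = cos (y 2 / 2) := by
      have := congrArg Complex.normSq h1
      simp only [map_mul, normSq_cexpI, hl, Complex.normSq_ofReal, mul_one, one_mul] at this
      exact (mul_self_inj (cos_half_pos hz).le (cos_half_pos hy).le).1 this
    have e2 : z 2 = y 2 := by
      have := injOn_cos (x₁ := z 2 / 2) (x₂ := y 2 / 2)
        ⟨by linarith [hz.2.2.1], by linarith [hz.2.2.2, pi_pos]⟩
        ⟨by linarith [hy.2.2.1], by linarith [hy.2.2.2, pi_pos]⟩ hc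
      linarith
    rw [e2] at h1 h2
    rw [e0] at h3
    have n1 : ((cos (y 2 / 2) : ℝ) : ℂ) ≠ 0 := by exact_mod_cast (cos_half_pos hy).ne'
    have n2 : ((sin (y 2 / 2) : ℝ) : ℂ) ≠ 0 := by exact_mod_cast (sin_half_pos hy).ne'
    have n3 : ((√(1 - (y 0 / x₁) ^ 2) : ℝ) : ℂ) ≠ 0 := by
      rw [Ne, Complex.ofReal_eq_zero]
      exact (Real.sqrt_pos.2 (one_sub_div_sq_pos hy)).ne'
    rw [mul_left_comm] at h1 h2 h3
    have h1 := mul_left_cancel₀ n1 h1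
    have h2 := mul_left_cancel₀ n2 h2
    have h3 := mul_left_cancel₀ n3 h3
    have hlv : l = cexpI (z 3 / 2 - y 3 / 2) := by
      rw [sub_eq_add_neg, cexpI_add, h2, mul_assoc, ← cexpI_add, add_neg_cancel, cexpI_zero, mul_one]
    rw [hlv, ← cexpI_add, cexpI_eq_iff] at h1
    obtain ⟨n, hn⟩ := h1
    rw [hlv, ← cexpI_nat_mul, ← cexpI_add, cexpI_eq_iff] at h3
    obtain ⟨k, hk⟩ := h3
    -- The integer n comes from the entry of phase -φ/2, hence the sign.
    refine ⟨e0, e2, k, -n, ?_, ?_⟩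
    · have hz3 : z 3 / 2 - y 3 / 2 = -(π * n) := by linarith
      rw [hz3] at hk
      have : z 1 = y 1 - 2 * π * n + 4 * π * k / m := by
        field_simp
        linarith
      rw [this]
      push_cast
      field_simp
      ring
    · push_cast
      linarith
  · rintro ⟨e0, e2, k, l, e1, e3⟩
    rw [e0, e2, e1, e3]
    refine ⟨cexpI (π * l), normSq_cexpI _, ?_, ?_, ?_, rfl⟩
    · rw [mul_left_comm, ← cexpI_add]
      congr 1
      rw [cexpI_eq_iff]
      exact ⟨-l, by push_cast; ring⟩
    · rw [mul_left_comm, ← cexpI_add]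
      congr 2
      ring
    · rw [mul_left_comm, ← cexpI_nat_mul, ← cexpI_add]
      congr 1
      rw [cexpI_eq_iff]
      refine ⟨k, ?_⟩
      field_simp
      ring

theorem dense_image_pagePoint (hx : 0 < x₁) (hm : (0 : ℝ) < m) :
    Dense (pagePoint x₁ m '' coordBox x₁) := by
  rw [dense_iff_inter_open]
  rintro V hV ⟨p, hp⟩
  obtain ⟨s, hs⟩ : ∃ s, s = index p := ⟨_, rfl⟩
  have hps : p ∈ (chart m s).source := hs ▸ mem_chart_index p
  have hW : IsOpen ((chart m s).symm ⁻¹' V) := hV.preimage (contMDiff_chart_symm s).continuous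
  obtain ⟨_, hy, q, hq, rfl⟩ := (dense_image_pageChart hx hm).inter_open_nonempty _ hW
    ⟨chart m s p, by rwa [mem_preimage, (chart m s).left_inv hps]⟩
  exact ⟨_, hy, flipCoords s q, flipCoords_mem s hq, (flip_pagePoint s hq).symm⟩

theorem isSphereBundleExtension (h : IsRegularSolution α Λ c x₁ m) :
    IsSphereBundleExtension α Λ c x₁ m proj (bundleMetric h) (pagePoint x₁ m) where
  bundle := isSmoothSphereBundle_proj
  smooth := contMDiffOn_pagePoint
  isometry _ hy := (isCompatible_chartMetric h).pullbackForm_pagePoint h.pos h.cast_pos hy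
  identify _ hy _ hz := pagePoint_eq_iff h.one_le hy hz
  base _ hy := coe_proj_pagePoint hy
  dense := dense_image_pagePoint h.pos h.cast_pos

end Hirz

namespace Hirz

open scoped ComplexConjugate

/-! ### Twisting by rotations of the fibre -/

/-- The rotation of the sphere given by the quaternion with components `p`, `q`. -/
def rotate (p q : ℂ) (w : ℂ × ℝ) : ℂ × ℝ :=
  (((Complex.normSq p + Complex.normSq q)⁻¹ : ℝ)
      * (conj p ^ 2 * w.1 - q ^ 2 * conj w.1 + 2 * conj p * q * (w.2 : ℝ)),
    (Complex.normSq p + Complex.normSq q)⁻¹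
      * ((Complex.normSq p - Complex.normSq q) * w.2 - 2 * (p * q * conj w.1).re))

/-- Up to normalisation `rotate` is the action of the quaternion with components p and q on ℝ³ = ℂ ×
ℝ. All its identities are polynomial consequences of r(|p|² + |q|²) = 1. -/
theorem rotate_norm {p q : ℂ} (h : Complex.normSq p + Complex.normSq q ≠ 0) (w : ℂ × ℝ) :
    Complex.normSq (rotate p q w).1 + (rotate p q w).2 ^ 2 = Complex.normSq w.1 + w.2 ^ 2 := by
  have hr := inv_mul_cancel₀ h
  rw [rotate]
  generalize (Complex.normSq p + Complex.normSq q)⁻¹ = r at *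
  obtain ⟨⟨c, d⟩, t⟩ := w
  obtain ⟨a, b⟩ := p
  obtain ⟨e, f⟩ := q
  simp only [Complex.normSq_mk] at hr
  simp only [map_mul, Complex.normSq_ofReal, Complex.normSq_apply, Complex.add_re,
    Complex.add_im, Complex.sub_re, Complex.sub_im, Complex.mul_re, Complex.mul_im, sq,
    Complex.conj_re, Complex.conj_im, Complex.ofReal_re, Complex.ofReal_im, Complex.re_ofNat,
    Complex.im_ofNat]
  linear_combination (r * (a * a + b * b + (e * e + f * f)) + 1) * (c * c + d * d + t * t) * hr

theorem rotate_rotate {p q : ℂ} (h : Complex.normSq p + Complex.normSq q ≠ 0) (w : ℂ × ℝ) :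
    rotate (conj p) (-q) (rotate p q w) = w := by
  have hr := inv_mul_cancel₀ h
  simp only [rotate, Complex.normSq_conj, Complex.normSq_neg]
  generalize (Complex.normSq p + Complex.normSq q)⁻¹ = r at *
  obtain ⟨⟨c, d⟩, t⟩ := w
  obtain ⟨a, b⟩ := p
  obtain ⟨e, f⟩ := q
  simp only [Complex.normSq_mk] at hr
  refine Prod.ext (Complex.ext ?_ ?_) ?_ <;>
    simp only [Complex.normSq_mk, Complex.add_re, Complex.neg_re, Complex.neg_im, Complex.add_im,
      Complex.sub_re, Complex.sub_im, Complex.mul_re, Complex.mul_im, sq, Complex.conj_re,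
      Complex.conj_im, Complex.ofReal_re, Complex.ofReal_im, Complex.re_ofNat, Complex.im_ofNat]
  · linear_combination (r * (a * a + b * b + (e * e + f * f)) + 1) * c * hr
  · linear_combination (r * (a * a + b * b + (e * e + f * f)) + 1) * d * hr
  · linear_combination (r * (a * a + b * b + (e * e + f * f)) + 1) * t * hr

/-- Rotating the fibre commutes with the circle actions. -/
theorem rotate_smul {l p q : ℂ} (hl : Complex.normSq l = 1) (k e : ℕ) (w : ℂ × ℝ) :
    rotate (l ^ k * p) (l ^ (k + e) * q) (l ^ (2 * k + e) * w.1, w.2)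
      = (l ^ e * (rotate p q w).1, (rotate p q w).2) := by
  have hl' : l * conj l = 1 := by rw [Complex.mul_conj, hl, Complex.ofReal_one]
  have hk : l ^ k * conj l ^ k = 1 := by rw [← mul_pow, hl', one_pow]
  have he : l ^ e * conj l ^ e = 1 := by rw [← mul_pow, hl', one_pow]
  refine Prod.ext ?_ ?_
  · simp only [rotate, map_mul, map_pow, hl, one_pow, one_mul, pow_add, mul_comm 2 k, pow_mul]
    generalize (Complex.normSq p + Complex.normSq q)⁻¹ = r
    generalize l ^ k = L at *
    generalize conj l ^ k = L' at *
    generalize l ^ e = K at *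
    generalize conj l ^ e = K' at *
    have h1 : L' ^ 2 * L ^ 2 = 1 := by rw [← mul_pow, mul_comm, hk, one_pow]
    have h2 : (L * K) ^ 2 * (L' ^ 2 * K') = K := by
      calc _ = (L * L') ^ 2 * (K * K') * K := by ring
        _ = K := by rw [hk, he]; ring
    have h3 : L' * (L * K) = K := by
      calc _ = (L * L') * K := by ring
        _ = K := by rw [hk, one_mul]
    linear_combination (r : ℂ) * (K * conj p ^ 2 * w.1 * h1 - q ^ 2 * conj w.1 * h2
      + 2 * conj p * q * (w.2 : ℂ) * h3)
  · simp only [rotate, map_mul, map_pow, hl, one_pow, one_mul]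
    congr 3
    congr 1
    rw [pow_add, pow_add, mul_comm 2 k, pow_mul]
    generalize l ^ k = L at *
    generalize conj l ^ k = L' at *
    generalize l ^ e = K at *
    generalize conj l ^ e = K' at *
    linear_combination p * q * conj w.1 * (L * L' * K * K' + K * K') * hk + p * q * conj w.1 * he

theorem contDiffOn_rotate : ContDiffOn ℝ ∞ (fun z : ℂ × ℂ × ℂ × ℝ => rotate z.1 z.2.1 z.2.2)
    {z | Complex.normSq z.1 + Complex.normSq z.2.1 ≠ 0} := by
  have c1 := contDiff_normSq.comp (contDiff_fst (𝕜 := ℝ) (E := ℂ) (F := ℂ × ℂ × ℝ) (n := ∞))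
  have hq : ContDiff ℝ ∞ fun z : ℂ × ℂ × ℂ × ℝ => z.2.1 := by fun_prop
  have hw : ContDiff ℝ ∞ fun z : ℂ × ℂ × ℂ × ℝ => z.2.2.1 := by fun_prop
  have ht : ContDiff ℝ ∞ fun z : ℂ × ℂ × ℂ × ℝ => z.2.2.2 := by fun_prop
  have hp : ContDiff ℝ ∞ fun z : ℂ × ℂ × ℂ × ℝ => z.1 := by fun_prop
  have c2 := contDiff_normSq.comp hq
  have cp := contDiff_conj.comp hp
  have cw := contDiff_conj.comp hw
  have hi := (c1.add c2).contDiffOn.inv (s := {z : ℂ × ℂ × ℂ × ℝ |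
    Complex.normSq z.1 + Complex.normSq z.2.1 ≠ 0}) fun z hz => hz
  refine ((Complex.ofRealCLM.contDiff.comp_contDiffOn hi).mul (((((cp.pow 2).mul hw).sub
    ((hq.pow 2).mul cw)).add (((contDiff_const (c := (2 : ℂ))).mul cp).mul hq |>.mul
      (Complex.ofRealCLM.contDiff.comp ht))).contDiffOn)).prodMk
    (hi.mul (((c1.sub c2).mul ht).sub ((contDiff_const (c := (2 : ℝ))).mul
      (Complex.reCLM.contDiff.comp ((hp.mul hq).mul cw)))).contDiffOn)

/-- Maps of frames which descend to the quotients. -/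
structure IsFrameMap (m m' : ℕ) (f : FramePoint → FramePoint) : Prop where
  maps : ∀ x ∈ frameSet, f x ∈ frameSet
  equivariant : ∀ l : ℂ, Complex.normSq l = 1 → ∀ x ∈ frameSet,
    f (l * x.1, l * x.2.1, l ^ m * x.2.2.1, x.2.2.2)
      = (l * (f x).1, l * (f x).2.1, l ^ m' * (f x).2.2.1, (f x).2.2.2)
  smooth : ContDiffOn ℝ ∞ f {x | Complex.normSq x.1 + Complex.normSq x.2.1 ≠ 0}

variable {m m' k e : ℕ} {f f' : FramePoint → FramePoint}

/-- The map of quotients induced by a map of frames. -/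
def descend (m m' : ℕ) (f : FramePoint → FramePoint) (p : Hirz m) : Hirz m' :=
  ofFrame m' (f (Classical.choose p.exists_ofFrame))

theorem IsFrameMap.descend_ofFrame (h : IsFrameMap m m' f) {x : FramePoint} (hx : x ∈ frameSet) :
    descend m m' f (ofFrame m x) = ofFrame m' (f x) := by
  obtain ⟨h1, h2⟩ := Classical.choose_spec (ofFrame m x).exists_ofFrame
  rw [descend]
  obtain ⟨l, hl, e⟩ := (ofFrame_eq_iff hx h1).1 h2.symm
  rw [e, eq_comm, ofFrame_eq_iff (h.maps x hx) (h.maps _ (e ▸ h1))]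
  exact ⟨l, hl, h.equivariant l hl x hx⟩

theorem IsFrameMap.contMDiff_descend (h : IsFrameMap m m' f) :
    ContMDiff (𝓡 4) (𝓡 4) ∞ (descend m m' f) := by
  refine contMDiff_of_chart_symm fun s => ?_
  have e : ∀ y, flipFrame s (frameOf y) ∈ frameSet := fun y => flipFrame_mem s (frameOf_mem y)
  simp only [chart_symm_eq_ofFrame, h.descend_ofFrame (e _)]
  refine contMDiffOn_univ.1 (contMDiffOn_ofFrame (ContDiffOn.contMDiffOn ?_) fun y _ =>
    h.maps _ (e y))
  exact h.smooth.comp ((contDiff_flipFrame s).comp contDiff_frameOf).contDiffOn fun y _ => by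
    change Complex.normSq _ + Complex.normSq _ ≠ 0
    rw [(e y).1]
    exact one_ne_zero

/-- A diffeomorphism of quotients from inverse maps of frames. -/
def diffeoOfFrameMaps (h : IsFrameMap m m' f) (h' : IsFrameMap m' m f')
    (l : ∀ x ∈ frameSet, f' (f x) = x) (r : ∀ x ∈ frameSet, f (f' x) = x) :
    Hirz m ≃ₘ^∞⟮𝓡 4, 𝓡 4⟯ Hirz m' where
  toFun := descend m m' f
  invFun := descend m' m f'
  left_inv p := by
    obtain ⟨x, hx, rfl⟩ := p.exists_ofFrame
    rw [h.descend_ofFrame hx, h'.descend_ofFrame (h.maps x hx), l x hx]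
  right_inv p := by
    obtain ⟨x, hx, rfl⟩ := p.exists_ofFrame
    rw [h'.descend_ofFrame hx, h.descend_ofFrame (h'.maps x hx), r x hx]
  contMDiff_toFun := h.contMDiff_descend
  contMDiff_invFun := h'.contMDiff_descend

/-- The rotation of the fibres which changes the degree by an even number. -/
def twistFrame (k e : ℕ) (x : FramePoint) : FramePoint :=
  (x.1, x.2.1, rotate (x.2.1 ^ k) (x.1 ^ (k + e)) x.2.2)

/-- The inverse of `twistFrame`. -/
def untwistFrame (k e : ℕ) (x : FramePoint) : FramePoint :=
  (x.1, x.2.1, rotate (conj (x.2.1 ^ k)) (-x.1 ^ (k + e)) x.2.2)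

theorem twist_ne_zero {a b : ℂ} (h : Complex.normSq a + Complex.normSq b ≠ 0) (k j : ℕ) :
    Complex.normSq (b ^ k) + Complex.normSq (a ^ j) ≠ 0 := by
  have h1 := Complex.normSq_nonneg (b ^ k)
  have h2 := Complex.normSq_nonneg (a ^ j)
  intro h0
  have e1 : b ^ k = 0 := Complex.normSq_eq_zero.1 (by linarith)
  have e2 : a ^ j = 0 := Complex.normSq_eq_zero.1 (by linarith)
  have hb : b = 0 := by_contra fun hb => pow_ne_zero k hb e1
  have ha : a = 0 := by_contra fun ha => pow_ne_zero j ha e2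
  simp [ha, hb] at h

theorem untwist_ne_zero {a b : ℂ} (h : Complex.normSq a + Complex.normSq b ≠ 0) (k j : ℕ) :
    Complex.normSq (conj (b ^ k)) + Complex.normSq (-a ^ j) ≠ 0 := by
  rw [Complex.normSq_conj, Complex.normSq_neg]
  exact twist_ne_zero h k j

theorem frame_ne_zero {x : FramePoint} (hx : x ∈ frameSet) :
    Complex.normSq x.1 + Complex.normSq x.2.1 ≠ 0 := by
  rw [hx.1]
  exact one_ne_zero

/-- The quaternion entries z₁ᵏ and z₀^{k+e} have weights k and k + e under the circle and never
vanish together on the three-sphere. By `rotate_smul` the rotation converts fibre weight 2k + e into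
e, so an even change of degree is undone over the whole base. -/
theorem isFrameMap_twistFrame (k e : ℕ) : IsFrameMap (2 * k + e) e (twistFrame k e) where
  maps x hx := ⟨hx.1, (rotate_norm (twist_ne_zero (frame_ne_zero hx) k (k + e)) x.2.2).trans hx.2⟩
  equivariant l hl x _ := by
    simp only [twistFrame, mul_pow]
    rw [rotate_smul hl k e x.2.2]
  smooth := by
    have h : ContDiff ℝ ∞ fun x : FramePoint => (x.2.1 ^ k, x.1 ^ (k + e), x.2.2) :=
      ContDiff.prodMk (ContDiff.pow (by fun_prop) k)
        (ContDiff.prodMk (ContDiff.pow (by fun_prop) _) (by fun_prop))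
    exact ContDiffOn.prodMk (by fun_prop) (ContDiffOn.prodMk (by fun_prop)
      (contDiffOn_rotate.comp h.contDiffOn fun x hx => twist_ne_zero hx k (k + e)))

theorem isFrameMap_untwistFrame (k e : ℕ) : IsFrameMap e (2 * k + e) (untwistFrame k e) where
  maps x hx := ⟨hx.1, (rotate_norm (untwist_ne_zero (frame_ne_zero hx) k (k + e)) x.2.2).trans hx.2⟩
  equivariant l hl x hx := by
    have h0 := untwist_ne_zero (frame_ne_zero hx) k (k + e)
    have h1 := rotate_rotate h0 x.2.2
    rw [Complex.conj_conj, neg_neg] at h1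
    -- Equivariance of the inverse is deduced from that of the rotation, applied to the already
    -- untwisted point and then inverted once more.
    have h2 := rotate_smul (p := x.2.1 ^ k) (q := x.1 ^ (k + e)) hl k e
      (rotate (conj (x.2.1 ^ k)) (-x.1 ^ (k + e)) x.2.2)
    rw [h1] at h2
    have h3 : Complex.normSq (l ^ k * x.2.1 ^ k) + Complex.normSq (l ^ (k + e) * x.1 ^ (k + e)) ≠ 0 := by
      rw [map_mul, map_mul, map_pow _ l, map_pow _ l, hl, one_pow, one_pow, one_mul, one_mul]
      exact twist_ne_zero (frame_ne_zero hx) k (k + e)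
    have h4 := rotate_rotate h3 (l ^ (2 * k + e) * (rotate (conj (x.2.1 ^ k)) (-x.1 ^ (k + e)) x.2.2).1,
      (rotate (conj (x.2.1 ^ k)) (-x.1 ^ (k + e)) x.2.2).2)
    rw [h2] at h4
    simp only [untwistFrame, mul_pow]
    rw [h4]
  smooth := by
    have h : ContDiff ℝ ∞ fun x : FramePoint => (conj (x.2.1 ^ k), -x.1 ^ (k + e), x.2.2) :=
      ContDiff.prodMk (contDiff_conj.comp (ContDiff.pow (by fun_prop) k))
        (ContDiff.prodMk (ContDiff.neg (ContDiff.pow (by fun_prop) _)) (by fun_prop))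
    exact ContDiffOn.prodMk (by fun_prop) (ContDiffOn.prodMk (by fun_prop)
      (contDiffOn_rotate.comp h.contDiffOn fun x hx => untwist_ne_zero hx k (k + e)))

/-- The bundles of degrees of the same parity are diffeomorphic. -/
def twist (k e : ℕ) : Hirz (2 * k + e) ≃ₘ^∞⟮𝓡 4, 𝓡 4⟯ Hirz e :=
  diffeoOfFrameMaps (isFrameMap_twistFrame k e) (isFrameMap_untwistFrame k e)
    (fun x hx => by
      have := rotate_rotate (twist_ne_zero (frame_ne_zero hx) k (k + e)) x.2.2
      rw [untwistFrame, twistFrame]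
      dsimp only
      rw [this])
    (fun x hx => by
      have := rotate_rotate (untwist_ne_zero (frame_ne_zero hx) k (k + e)) x.2.2
      rw [Complex.conj_conj, neg_neg] at this
      rw [untwistFrame, twistFrame]
      dsimp only
      rw [this])

theorem proj_twist (k e : ℕ) (p : Hirz (2 * k + e)) : proj (twist k e p) = proj p := by
  obtain ⟨x, hx, rfl⟩ := p.exists_ofFrame
  change proj (descend (2 * k + e) e (twistFrame k e) (ofFrame _ x)) = _
  have h := isFrameMap_twistFrame k e
  rw [h.descend_ofFrame hx, proj, proj, val_ofFrame hx, val_ofFrame (h.maps x hx)]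
  rfl

end Hirz

namespace Hirz

open scoped ComplexConjugate

/-! ### The trivial bundle -/

theorem fibre_rel_zero (p : Hirz 0) :
    Complex.normSq p.val.2.2.1 + p.val.2.2.2.2 ^ 2 = 1 := by
  obtain ⟨x, hx, rfl⟩ := p.exists_ofFrame
  rw [val_ofFrame hx]
  simpa [frameInvariants] using hx.2

/-- The invariants of a point of the product. -/
def productVal (w : EuclideanSpace ℝ (Fin 3) × EuclideanSpace ℝ (Fin 3)) : BundleAmbient :=
  (w.1 2, planeCoord w.1 / 2, planeCoord w.2, planeCoord w.2, w.2 2)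

theorem productVal_mem (b f : S2) :
    productVal (b.1, f.1) ∈ frameInvariants 0 '' frameSet := by
  by_cases hb : -1 < b.1 2
  · refine ⟨_, sectionFrame_mem (f := f) hb, ?_⟩
    have h1 := val_sectionFrame_fst (m := 0) (f := f) hb
    have h2 := congrArg (fun b : S2 => planeCoord b.1) (proj_sectionFrame (m := 0) (f := f) hb)
    simp only [planeCoord_proj] at h2
    rw [val_ofFrame (sectionFrame_mem hb)] at h1 h2
    refine Prod.ext h1 (Prod.ext ?_ ?_)
    · change _ = planeCoord b.1 / 2
      rw [← h2]
      ring
    · simp [frameInvariants, sectionFrame, productVal]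
  -- At the remaining pole `sectionFrame` degenerates. In degree zero the frame with base entries
  -- (0, 1) has the required invariants.
  · have h := sphere_coord_sq b
    have h0 := Complex.normSq_nonneg (planeCoord b.1)
    have e1 : b.1 2 = -1 := by nlinarith
    have e2 : planeCoord b.1 = 0 := Complex.normSq_eq_zero.1 (by rw [e1] at h; linarith)
    refine ⟨(0, 1, planeCoord f.1, f.1 2), ⟨by simp, sphere_coord_sq f⟩, ?_⟩
    simp [frameInvariants, productVal, e1, e2]

theorem contDiff_productVal : ContDiff ℝ ∞ productVal := by
  have h1 := contDiff_planeCoord.comp (contDiff_fst (𝕜 := ℝ) (n := ∞)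
    (E := EuclideanSpace ℝ (Fin 3)) (F := EuclideanSpace ℝ (Fin 3)))
  have h2 := contDiff_planeCoord.comp (contDiff_snd (𝕜 := ℝ) (n := ∞)
    (E := EuclideanSpace ℝ (Fin 3)) (F := EuclideanSpace ℝ (Fin 3)))
  exact ContDiff.prodMk (by fun_prop) ((h1.div_const 2).prodMk (h2.prodMk (h2.prodMk (by fun_prop))))

/-- The bundle of degree zero is a product. -/
def productDiffeo : Hirz 0 ≃ₘ^∞⟮𝓡 4, (𝓡 2).prod (𝓡 2)⟯ (S2 × S2) where
  toFun p := (proj p, spherePoint p.val.2.2.1 p.val.2.2.2.2)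
  invFun w := ⟨productVal (w.1.1, w.2.1), productVal_mem w.1 w.2⟩
  left_inv p := by
    refine val_injective ?_
    change productVal ((proj p).1, (spherePoint _ _).1) = p.val
    rw [productVal]
    simp only [planeCoord_proj, proj_two, planeCoord_spherePoint (fibre_rel_zero p),
      spherePoint_two (fibre_rel_zero p)]
    obtain ⟨x, hx, rfl⟩ := p.exists_ofFrame
    rw [val_ofFrame hx]
    simp [frameInvariants]
  right_inv w := by
    have e : spherePoint (2 * (planeCoord w.1.1 / 2)) (w.1.1 2) = w.1 := by
      rw [mul_div_cancel₀ _ two_ne_zero, spherePoint_coord]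
    exact Prod.ext e (spherePoint_coord w.2)
  contMDiff_toFun := by
    refine contMDiff_proj.prodMk ?_
    have h : ContDiff ℝ ∞ fun v : BundleAmbient => (v.2.2.1, v.2.2.2.2) := by fun_prop
    exact contMDiffOn_univ.1 (contMDiffOn_spherePoint (h.contMDiff.comp contMDiff_val).contMDiffOn
      fun p _ => fibre_rel_zero p)
  contMDiff_invFun := contMDiff_of_val (contDiff_productVal.contMDiff.comp contMDiff_coe_S2_prod)

theorem isTrivialSphereBundle_of_even {m : ℕ} (hm : Even m) :
    IsTrivialSphereBundle (proj (m := m)) := by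
  obtain ⟨k, rfl⟩ : ∃ k, m = 2 * k + 0 := by
    obtain ⟨k, rfl⟩ := hm
    exact ⟨k, by omega⟩
  exact ⟨(twist k 0).trans productDiffeo, fun p => proj_twist k 0 p⟩

end Hirz

/-! ### The blow-up of the projective plane -/

namespace CP2

section Smoothness

variable {E H N : Type*} [NormedAddCommGroup E] [NormedSpace ℝ E] [TopologicalSpace H]
  {I : ModelWithCorners ℝ E H} [TopologicalSpace N] [ChartedSpace H N]

open Classical in
/-- The point with given homogeneous coordinates, with a default value for the zero vector. -/
def ofVec (v : Fin 3 → ℂ) : CP2 := if h : v ≠ 0 then mk ⟨v, h⟩ else affine 0 0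

theorem ofVec_eq {v : Fin 3 → ℂ} (h : v ≠ 0) : ofVec v = mk ⟨v, h⟩ := dif_pos h

theorem exists_ofVec (p : CP2) : ∃ v : Fin 3 → ℂ, v ≠ 0 ∧ ofVec v = p := by
  obtain ⟨⟨v, hv⟩, rfl⟩ := isQuotientMap_mk.surjective p
  exact ⟨v, hv, ofVec_eq hv⟩

theorem ofVec_eq_iff {v w : Fin 3 → ℂ} (hv : v ≠ 0) (hw : w ≠ 0) :
    ofVec v = ofVec w ↔ ∃ a : ℂ, a ≠ 0 ∧ a • w = v := by
  rw [ofVec_eq hv, ofVec_eq hw, mk_eq_iff]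
  refine exists_congr fun a => ⟨fun h => ⟨?_, h⟩, fun h => h.2⟩
  rintro rfl
  have h' : (0 : ℂ) • w = v := h
  exact hv (by rw [← h', zero_smul])

theorem ofVec_mem_dom {v : Fin 3 → ℂ} (hv : v ≠ 0) (i : Fin 3) : ofVec v ∈ dom i ↔ v i ≠ 0 := by
  rw [ofVec_eq hv, mk_mem_dom]

theorem affine_eq_ofVec (i : Fin 3) (w : C2) : affine i w = ofVec (homog i w).1 :=
  (ofVec_eq (homog i w).2).symm

theorem affineChart_mem_maximalAtlas (i : Fin 3) :
    affineChart i ∈ IsManifold.maximalAtlas 𝓘(ℝ, C2) ∞ CP2 :=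
  IsManifold.subset_maximalAtlas (mem_range_self i)

theorem contMDiff_affine (i : Fin 3) : ContMDiff 𝓘(ℝ, C2) 𝓘(ℝ, C2) ∞ (affine i) :=
  contMDiffOn_univ.1 (contMDiffOn_symm_of_mem_maximalAtlas (affineChart_mem_maximalAtlas i))

/-- Smoothness of a map out of the projective plane can be checked in affine coordinates. -/
theorem contMDiffAt_of_affine {f : CP2 → N} {p : CP2} {i : Fin 3} (hp : p ∈ dom i)
    (h : ContMDiffAt 𝓘(ℝ, C2) I ∞ (fun w => f (affine i w)) (coord i p)) :
    ContMDiffAt 𝓘(ℝ, C2) I ∞ f p := by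
  have h1 := h.comp p ((contMDiffOn_of_mem_maximalAtlas
    (affineChart_mem_maximalAtlas i)).contMDiffAt ((isOpen_dom i).mem_nhds hp))
  refine h1.congr_of_eventuallyEq ?_
  filter_upwards [(isOpen_dom i).mem_nhds hp] with q hq
  exact congrArg f ((affineChart i).left_inv hq).symm

theorem contMDiffOn_ofVec {f : N → Fin 3 → ℂ} {U : Set N}
    (hf : ContMDiffOn I 𝓘(ℝ, Fin 3 → ℂ) ∞ f U) (h0 : ∀ q ∈ U, f q ≠ 0) :
    ContMDiffOn I 𝓘(ℝ, C2) ∞ (fun q => ofVec (f q)) U := by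
  intro q hq
  obtain ⟨j, hj⟩ := Function.ne_iff.1 (h0 q hq)
  have hj : f q j ≠ 0 := hj
  have ha : ∀ v : Fin 3 → ℂ, v j ≠ 0 →
      ofVec v = affine j (WithLp.toLp 2 fun k => v (j.succAbove k) / v j) := fun v hv => by
    have hv0 : v ≠ 0 := fun e => hv (by rw [e]; rfl)
    rw [ofVec_eq hv0]
    exact ((affineChart j).left_inv ((mk_mem_dom j ⟨v, hv0⟩).2 hv)).symm
  have hg : ContDiffAt ℝ ∞
      (fun v : Fin 3 → ℂ => (WithLp.toLp 2 fun k => v (j.succAbove k) / v j : C2)) (f q) := by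
    refine (contDiffAt_piLp 2).2 fun k => ?_
    have c : ∀ l : Fin 3, ContDiffAt ℝ ∞ (fun v : Fin 3 → ℂ => v l) (f q) := fun l => by fun_prop
    exact ((c (j.succAbove k)).mul ((c j).inv hj)).congr_of_eventuallyEq
      (.of_forall fun v => div_eq_mul_inv _ _)
  have h1 := ((contMDiff_affine j) _).comp_contMDiffWithinAt q
    (hg.contMDiffAt.comp_contMDiffWithinAt q (hf q hq))
  refine h1.congr_of_eventuallyEq ?_ (ha _ hj)
  have hc : ContinuousWithinAt (fun q => f q j) U q :=
    (continuous_apply j).continuousAt.comp_continuousWithinAt (hf.continuousOn q hq)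
  filter_upwards [hc (isOpen_ne.mem_nhds hj)] with x hx
  exact ha _ hx

end Smoothness

end CP2

/-! ### The bundle of degree one and the connected sum -/

namespace Hirz

open scoped ComplexConjugate

/-- Square of the norm of the last two coordinates. -/
def tailSq (v : Fin 3 → ℂ) : ℝ := Complex.normSq (v 1) + Complex.normSq (v 2)

/-- The frame determined by homogeneous coordinates. -/
def projFrame (v : Fin 3 → ℂ) : FramePoint :=
  (((√(tailSq v))⁻¹ : ℝ) * v 1, ((√(tailSq v))⁻¹ : ℝ) * v 2,
    ((2 * √(tailSq v) / (tailSq v + Complex.normSq (v 0)) : ℝ) : ℂ) * v 0,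
    (tailSq v - Complex.normSq (v 0)) / (tailSq v + Complex.normSq (v 0)))

theorem tailSq_nonneg (v : Fin 3 → ℂ) : 0 ≤ tailSq v :=
  add_nonneg (Complex.normSq_nonneg _) (Complex.normSq_nonneg _)

theorem tailSq_smul (a : ℂ) (v : Fin 3 → ℂ) : tailSq (a • v) = ‖a‖ ^ 2 * tailSq v := by
  simp only [tailSq, Pi.smul_apply, smul_eq_mul, map_mul, Complex.normSq_eq_norm_sq a]
  ring

theorem ne_zero_of_tailSq {v : Fin 3 → ℂ} (h : tailSq v ≠ 0) : v ≠ 0 := by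
  rintro rfl
  simp [tailSq] at h

theorem projFrame_mem {v : Fin 3 → ℂ} (h : tailSq v ≠ 0) : projFrame v ∈ frameSet := by
  have h1 : 0 < tailSq v := lt_of_le_of_ne (tailSq_nonneg v) h.symm
  have h0 := Complex.normSq_nonneg (v 0)
  constructor
  · simp only [projFrame, map_mul, Complex.normSq_ofReal, ← sq, inv_pow, Real.sq_sqrt h1.le]
    rw [← mul_add]
    exact inv_mul_cancel₀ h
  · have h2 : tailSq v + Complex.normSq (v 0) ≠ 0 := by linarith [h1, h0] |> fun h : 0 < _ => h.ne'
    simp only [projFrame, map_mul, Complex.normSq_ofReal, ← sq, div_pow, mul_pow,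
      Real.sq_sqrt h1.le]
    field_simp
    ring

/-- Rescaling homogeneous coordinates by a acts on the normalised frame through the phase a/|a|,
with weight one on the fibre. This is why ℂP² minus a point lands in the bundle of degree one. -/
theorem projFrame_smul {a : ℂ} (ha : a ≠ 0) {v : Fin 3 → ℂ} (h : tailSq v ≠ 0) :
    projFrame (a • v) = (a / ‖a‖ * (projFrame v).1, a / ‖a‖ * (projFrame v).2.1,
      (a / ‖a‖) ^ 1 * (projFrame v).2.2.1, (projFrame v).2.2.2) := by
  have h1 : 0 < tailSq v := lt_of_le_of_ne (tailSq_nonneg v) h.symm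
  have hn : 0 < ‖a‖ := norm_pos_iff.2 ha
  have hnc : ((‖a‖ : ℝ) : ℂ) ≠ 0 := by exact_mod_cast hn.ne'
  have h0 := Complex.normSq_nonneg (v 0)
  have h2 : tailSq v + Complex.normSq (v 0) ≠ 0 := by linarith [h1, h0] |> fun h : 0 < _ => h.ne'
  have hs : √(‖a‖ ^ 2 * tailSq v) = ‖a‖ * √(tailSq v) := by
    rw [Real.sqrt_mul (sq_nonneg _), Real.sqrt_sq hn.le]
  have hsv : 0 < √(tailSq v) := Real.sqrt_pos.2 h1
  have h3 : ‖a‖ ^ 2 * tailSq v + Complex.normSq a * Complex.normSq (v 0)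
      = ‖a‖ ^ 2 * (tailSq v + Complex.normSq (v 0)) := by
    rw [Complex.normSq_eq_norm_sq a]
    ring
  have h4 : ‖a‖ ^ 2 * tailSq v - Complex.normSq a * Complex.normSq (v 0)
      = ‖a‖ ^ 2 * (tailSq v - Complex.normSq (v 0)) := by
    rw [Complex.normSq_eq_norm_sq a]
    ring
  simp only [projFrame, tailSq_smul, hs, Pi.smul_apply, smul_eq_mul, map_mul, h3, h4]
  generalize tailSq v + Complex.normSq (v 0) = n at *
  generalize tailSq v - Complex.normSq (v 0) = d at *
  generalize √(tailSq v) = r at *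
  have hnr : (n : ℂ) ≠ 0 := by exact_mod_cast h2
  have hrr : (r : ℂ) ≠ 0 := by exact_mod_cast hsv.ne'
  refine Prod.ext ?_ (Prod.ext ?_ (Prod.ext ?_ ?_)) <;> dsimp only <;> push_cast <;> field_simp

/-- The map of the projective plane to the bundle of degree one, regular outside a point. -/
def blowUp (p : CP2) : Hirz 1 := ofFrame 1 (projFrame (Classical.choose p.exists_ofVec))

theorem blowUp_ofVec {v : Fin 3 → ℂ} (h : tailSq v ≠ 0) :
    blowUp (CP2.ofVec v) = ofFrame 1 (projFrame v) := by
  obtain ⟨h1, h2⟩ := Classical.choose_spec (CP2.ofVec v).exists_ofVec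
  obtain ⟨a, ha, e⟩ := (CP2.ofVec_eq_iff h1 (ne_zero_of_tailSq h)).1 h2
  have h3 : tailSq (a • v) ≠ 0 := by
    rw [tailSq_smul]
    exact mul_ne_zero (pow_ne_zero 2 (norm_ne_zero_iff.2 ha)) h
  rw [blowUp, ← e, eq_comm, ofFrame_eq_iff (projFrame_mem h) (projFrame_mem h3)]
  refine ⟨a / ‖a‖, ?_, projFrame_smul ha h⟩
  have hn : ‖a‖ ≠ 0 := norm_ne_zero_iff.2 ha
  rw [map_div₀, Complex.normSq_ofReal, Complex.normSq_eq_norm_sq]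
  field_simp

/-- Homogeneous coordinates in terms of a frame. -/
def frameVec (x : FramePoint) : Fin 3 → ℂ := ![((1 + x.2.2.2)⁻¹ : ℝ) * x.2.2.1, x.1, x.2.1]

theorem tailSq_frameVec {x : FramePoint} (hx : x ∈ frameSet) : tailSq (frameVec x) = 1 := hx.1

theorem frameVec_ne_zero {x : FramePoint} (hx : x ∈ frameSet) : frameVec x ≠ 0 :=
  ne_zero_of_tailSq (by rw [tailSq_frameVec hx]; exact one_ne_zero)

/-- The map of the bundle of degree one to the projective plane. -/
def blowDown (p : Hirz 1) : CP2 := CP2.ofVec (frameVec (Classical.choose p.exists_ofFrame))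

theorem blowDown_ofFrame {x : FramePoint} (hx : x ∈ frameSet) :
    blowDown (ofFrame 1 x) = CP2.ofVec (frameVec x) := by
  obtain ⟨h1, h2⟩ := Classical.choose_spec (ofFrame 1 x).exists_ofFrame
  obtain ⟨l, hl, e⟩ := (ofFrame_eq_iff hx h1).1 h2.symm
  rw [blowDown, e, CP2.ofVec_eq_iff (frameVec_ne_zero (e ▸ h1)) (frameVec_ne_zero hx)]
  refine ⟨l, ?_, ?_⟩
  · rintro rfl
    simp at hl
  · ext i
    fin_cases i
    · change l * (((1 + x.2.2.2)⁻¹ : ℝ) * x.2.2.1) = ((1 + x.2.2.2)⁻¹ : ℝ) * (l ^ 1 * x.2.2.1)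
      ring
    · rfl
    · rfl

/-- The coordinate `t` on the fibres. -/
def height (p : Hirz 1) : ℝ := p.val.2.2.2.2

theorem height_ofFrame {x : FramePoint} (hx : x ∈ frameSet) : height (ofFrame 1 x) = x.2.2.2 := by
  rw [height, val_ofFrame hx]
  rfl

theorem continuous_height : Continuous height := by
  have h : Continuous fun v : BundleAmbient => v.2.2.2.2 := by fun_prop
  exact h.comp continuous_val

theorem blowDown_blowUp {v : Fin 3 → ℂ} (h : tailSq v ≠ 0) :
    blowDown (blowUp (CP2.ofVec v)) = CP2.ofVec v := by
  have h1 : 0 < tailSq v := lt_of_le_of_ne (tailSq_nonneg v) h.symm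
  have h0 := Complex.normSq_nonneg (v 0)
  have h2 : 0 < tailSq v + Complex.normSq (v 0) := by linarith
  have hsv : 0 < √(tailSq v) := Real.sqrt_pos.2 h1
  rw [blowUp_ofVec h, blowDown_ofFrame (projFrame_mem h),
    CP2.ofVec_eq_iff (frameVec_ne_zero (projFrame_mem h)) (ne_zero_of_tailSq h)]
  refine ⟨((√(tailSq v))⁻¹ : ℝ), by exact_mod_cast (inv_pos.2 hsv).ne', ?_⟩
  ext i
  fin_cases i
  · have e : 1 + (tailSq v - Complex.normSq (v 0)) / (tailSq v + Complex.normSq (v 0))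
        = 2 * √(tailSq v) ^ 2 / (tailSq v + Complex.normSq (v 0)) := by
      rw [Real.sq_sqrt h1.le]
      field_simp
      ring
    simp only [frameVec, projFrame, e]
    change (((√(tailSq v))⁻¹ : ℝ) : ℂ) * v 0 = _ * (_ * v 0)
    rw [← mul_assoc, ← Complex.ofReal_mul]
    congr 2
    field_simp
  · rfl
  · rfl

theorem projFrame_frameVec {x : FramePoint} (hx : x ∈ frameSet) (ht : -1 < x.2.2.2) :
    projFrame (frameVec x) = x := by
  have h1 : 0 < 1 + x.2.2.2 := by linarith
  have e : Complex.normSq (frameVec x 0) = (1 - x.2.2.2) / (1 + x.2.2.2) := by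
    change Complex.normSq (((1 + x.2.2.2)⁻¹ : ℝ) * x.2.2.1) = _
    rw [map_mul, Complex.normSq_ofReal]
    have := hx.2
    rw [show Complex.normSq x.2.2.1 = (1 - x.2.2.2) * (1 + x.2.2.2) by linarith]
    field_simp
  have e2 : 1 + (1 - x.2.2.2) / (1 + x.2.2.2) = 2 / (1 + x.2.2.2) := by
    field_simp
    ring
  simp only [projFrame, e, tailSq_frameVec hx, Real.sqrt_one, e2]
  refine Prod.ext ?_ (Prod.ext ?_ (Prod.ext ?_ ?_))
  · change ((1⁻¹ : ℝ) : ℂ) * x.1 = x.1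
    simp
  · change ((1⁻¹ : ℝ) : ℂ) * x.2.1 = x.2.1
    simp
  · change ((2 * 1 / (2 / (1 + x.2.2.2)) : ℝ) : ℂ) * (((1 + x.2.2.2)⁻¹ : ℝ) * x.2.2.1) = x.2.2.1
    rw [← mul_assoc, ← Complex.ofReal_mul]
    have : 2 * 1 / (2 / (1 + x.2.2.2)) * (1 + x.2.2.2)⁻¹ = 1 := by field_simp
    rw [this]
    simp
  · field_simp
    ring

theorem height_blowUp {v : Fin 3 → ℂ} (h : tailSq v ≠ 0) :
    height (blowUp (CP2.ofVec v))
      = (tailSq v - Complex.normSq (v 0)) / (tailSq v + Complex.normSq (v 0)) := by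
  rw [blowUp_ofVec h, height_ofFrame (projFrame_mem h)]
  rfl

theorem neg_one_lt_height_blowUp {v : Fin 3 → ℂ} (h : tailSq v ≠ 0) :
    -1 < height (blowUp (CP2.ofVec v)) := by
  have h1 : 0 < tailSq v := lt_of_le_of_ne (tailSq_nonneg v) h.symm
  have h0 := Complex.normSq_nonneg (v 0)
  rw [height_blowUp h, lt_div_iff₀ (by linarith)]
  linarith

theorem ofVec_ne_affine_zero_iff {v : Fin 3 → ℂ} (hv : v ≠ 0) :
    CP2.ofVec v ∈ ({CP2.affine 0 0}ᶜ : Set CP2) ↔ tailSq v ≠ 0 := by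
  rw [mem_compl_singleton_iff, CP2.affine_eq_ofVec, Ne,
    CP2.ofVec_eq_iff hv (CP2.homog 0 0).2, not_iff_not]
  have hh : (CP2.homog 0 0).1 = ![1, 0, 0] := by
    ext i
    fin_cases i <;> rfl
  rw [hh]
  constructor
  · rintro ⟨a, -, rfl⟩
    simp [tailSq]
  · intro h
    have h1 := Complex.normSq_nonneg (v 1)
    have h2 := Complex.normSq_nonneg (v 2)
    have e1 : v 1 = 0 := Complex.normSq_eq_zero.1 (by unfold tailSq at h; linarith)
    have e2 : v 2 = 0 := Complex.normSq_eq_zero.1 (by unfold tailSq at h; linarith)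
    refine ⟨v 0, fun e0 => hv ?_, ?_⟩
    · ext i
      fin_cases i <;> assumption
    · ext i
      fin_cases i <;> simp [e1, e2]

theorem contDiffOn_projFrame : ContDiffOn ℝ ∞ projFrame {v | tailSq v ≠ 0} := by
  have c : ∀ l : Fin 3, ContDiff ℝ ∞ (fun v : Fin 3 → ℂ => v l) := fun l => by fun_prop
  have cn := fun l => contDiff_normSq.comp (c l)
  have ct : ContDiff ℝ ∞ tailSq := (cn 1).add (cn 2)
  have hp : ∀ v ∈ {v | tailSq v ≠ 0}, 0 < tailSq v := fun v hv =>
    lt_of_le_of_ne (tailSq_nonneg v) (Ne.symm hv)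
  have hs := ct.contDiffOn.sqrt (s := {v | tailSq v ≠ 0}) fun v hv => hv
  have hi := hs.inv fun v hv => (Real.sqrt_pos.2 (hp v hv)).ne'
  have hd : ∀ v ∈ {v | tailSq v ≠ 0}, tailSq v + Complex.normSq (v 0) ≠ 0 := fun v hv =>
    (add_pos_of_pos_of_nonneg (hp v hv) (Complex.normSq_nonneg _)).ne'
  have hir := Complex.ofRealCLM.contDiff.comp_contDiffOn hi
  exact (hir.mul (c 1).contDiffOn).prodMk ((hir.mul (c 2).contDiffOn).prodMk
    (((Complex.ofRealCLM.contDiff.comp_contDiffOn ((contDiffOn_const.mul hs).div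
      (ct.add (cn 0)).contDiffOn hd)).mul (c 0).contDiffOn).prodMk
      ((ct.sub (cn 0)).contDiffOn.div (ct.add (cn 0)).contDiffOn hd)))

theorem isOpen_tailSq : IsOpen {v | tailSq v ≠ 0} := by
  have c : ∀ l : Fin 3, ContDiff ℝ ∞ (fun v : Fin 3 → ℂ => v l) := fun l => by fun_prop
  have ct : Continuous tailSq :=
    ((contDiff_normSq.comp (c 1)).add (contDiff_normSq.comp (c 2))).continuous
  exact isOpen_ne.preimage ct

theorem contMDiffOn_blowUp :
    ContMDiffOn 𝓘(ℝ, CP2.C2) (𝓡 4) ∞ blowUp ({CP2.affine 0 0}ᶜ : Set CP2) := by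
  intro p hp
  refine ContMDiffAt.contMDiffWithinAt ?_
  obtain ⟨v, hv, rfl⟩ := p.exists_ofVec
  obtain ⟨j, hj⟩ := Function.ne_iff.1 hv
  have hd : CP2.ofVec v ∈ CP2.dom j := (CP2.ofVec_mem_dom hv j).2 hj
  refine CP2.contMDiffAt_of_affine hd ?_
  have hh : ContDiff ℝ ∞ fun w : CP2.C2 => (CP2.homog j w).1 :=
    contDiff_pi.2 fun k => CP2.contDiff_homog j k
  have hW : IsOpen {w : CP2.C2 | tailSq (CP2.homog j w).1 ≠ 0} :=
    isOpen_tailSq.preimage hh.continuous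
  have hq : CP2.coord j (CP2.ofVec v) ∈ {w : CP2.C2 | tailSq (CP2.homog j w).1 ≠ 0} := by
    change tailSq (CP2.homog j (CP2.coord j (CP2.ofVec v))).1 ≠ 0
    rw [← ofVec_ne_affine_zero_iff (CP2.homog j _).2, ← CP2.affine_eq_ofVec]
    have e : CP2.affine j (CP2.coord j (CP2.ofVec v)) = CP2.ofVec v :=
      (CP2.affineChart j).left_inv hd
    rwa [e]
  have h1 : ContMDiffOn 𝓘(ℝ, CP2.C2) (𝓡 4) ∞ (fun w => blowUp (CP2.affine j w))
      {w : CP2.C2 | tailSq (CP2.homog j w).1 ≠ 0} :=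
    (contMDiffOn_ofFrame (contDiffOn_projFrame.comp hh.contDiffOn fun w hw => hw).contMDiffOn
      fun w hw => projFrame_mem hw).congr fun w hw => by
        rw [CP2.affine_eq_ofVec, blowUp_ofVec hw]
        rfl
  exact h1.contMDiffAt (hW.mem_nhds hq)

theorem contDiffOn_frameVec : ContDiffOn ℝ ∞ frameVec {x | -1 < x.2.2.2} := by
  refine contDiffOn_pi.2 fun i => ?_
  fin_cases i
  · have h : ContDiffOn ℝ ∞ (fun x : FramePoint => 1 + x.2.2.2) {x | -1 < x.2.2.2} := by fun_prop
    have hi := h.inv fun x hx => by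
      have : -1 < x.2.2.2 := hx
      linarith [this] |> fun h : 0 < 1 + x.2.2.2 => h.ne'
    exact (Complex.ofRealCLM.contDiff.comp_contDiffOn hi).mul (by fun_prop)
  · exact ContDiff.contDiffOn (contDiff_fst (𝕜 := ℝ))
  · exact ContDiff.contDiffOn ((contDiff_fst (𝕜 := ℝ)).comp contDiff_snd)

theorem contMDiffOn_blowDown : ContMDiffOn (𝓡 4) 𝓘(ℝ, CP2.C2) ∞ blowDown {p | -1 < height p} := by
  intro p hp
  refine ContMDiffAt.contMDiffWithinAt ?_
  obtain ⟨s, hs⟩ : ∃ s, s = index p := ⟨_, rfl⟩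
  have hps : p ∈ (chart 1 s).source := hs ▸ mem_chart_index p
  refine contMDiffAt_of_chart_symm hps ?_
  have hm : ∀ y, flipFrame s (frameOf y) ∈ frameSet := fun y => flipFrame_mem s (frameOf_mem y)
  have hc : ContDiff ℝ ∞ fun y => flipFrame s (frameOf y) :=
    (contDiff_flipFrame s).comp contDiff_frameOf
  have hW : IsOpen {y : E4 | -1 < (flipFrame s (frameOf y)).2.2.2} := by
    have h : Continuous fun x : FramePoint => x.2.2.2 := by fun_prop
    exact isOpen_lt continuous_const (h.comp hc.continuous)
  have hq : chart 1 s p ∈ {y : E4 | -1 < (flipFrame s (frameOf y)).2.2.2} := by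
    change -1 < (flipFrame s (frameOf (chart 1 s p))).2.2.2
    rw [← height_ofFrame (hm _), ← chart_symm_eq_ofFrame, (chart 1 s).left_inv hps]
    exact hp
  simp only [chart_symm_eq_ofFrame, blowDown_ofFrame (hm _)]
  exact (CP2.contMDiffOn_ofVec (contDiffOn_frameVec.comp hc.contDiffOn fun y hy => hy).contMDiffOn
    fun y _ => frameVec_ne_zero (hm y)).contMDiffAt (hW.mem_nhds hq)

/-- The complement of a point of the projective plane as an open subset of the bundle. -/
def blowUpChart : OpenPartialHomeomorph CP2 (Hirz 1) where
  toFun := blowUp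
  invFun := blowDown
  source := {CP2.affine 0 0}ᶜ
  target := {p | -1 < height p}
  map_source' p hp := by
    obtain ⟨v, hv, rfl⟩ := p.exists_ofVec
    exact neg_one_lt_height_blowUp ((ofVec_ne_affine_zero_iff hv).1 hp)
  map_target' p _ := by
    obtain ⟨x, hx, rfl⟩ := p.exists_ofFrame
    rw [blowDown_ofFrame hx, ofVec_ne_affine_zero_iff (frameVec_ne_zero hx), tailSq_frameVec hx]
    exact one_ne_zero
  left_inv' p hp := by
    obtain ⟨v, hv, rfl⟩ := p.exists_ofVec
    exact blowDown_blowUp ((ofVec_ne_affine_zero_iff hv).1 hp)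
  right_inv' p hp := by
    obtain ⟨x, hx, rfl⟩ := p.exists_ofFrame
    rw [mem_ofPred_eq, height_ofFrame hx] at hp
    rw [blowDown_ofFrame hx, blowUp_ofVec (by rw [tailSq_frameVec hx]; exact one_ne_zero),
      projFrame_frameVec hx hp]
  open_source := by
    have e : ({CP2.affine 0 0}ᶜ : Set CP2) = CP2.dom 1 ∪ CP2.dom 2 := by
      ext p
      obtain ⟨v, hv, rfl⟩ := p.exists_ofVec
      rw [ofVec_ne_affine_zero_iff hv, mem_union, CP2.ofVec_mem_dom hv, CP2.ofVec_mem_dom hv]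
      have h1 := Complex.normSq_nonneg (v 1)
      have h2 := Complex.normSq_nonneg (v 2)
      rw [tailSq, Ne, add_eq_zero_iff_of_nonneg h1 h2, Complex.normSq_eq_zero,
        Complex.normSq_eq_zero, not_and_or]
    rw [e]
    exact (CP2.isOpen_dom 1).union (CP2.isOpen_dom 2)
  open_target := isOpen_lt continuous_const continuous_height
  continuousOn_toFun := contMDiffOn_blowUp.continuousOn
  continuousOn_invFun := contMDiffOn_blowDown.continuousOn

theorem height_flip (p : Hirz 1) : height (flip (false, true) p) = -height p := by
  rw [height, val_flip]
  rfl

theorem tailSq_homog (v : CP2.C2) : tailSq (CP2.homog 0 v).1 = ‖v‖ ^ 2 := by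
  rw [EuclideanSpace.norm_sq_eq, Fin.sum_univ_two, ← Complex.normSq_eq_norm_sq,
    ← Complex.normSq_eq_norm_sq]
  rfl

theorem homog_zero (v : CP2.C2) : (CP2.homog 0 v).1 = ![1, v 0, v 1] := by
  ext i
  fin_cases i <;> rfl

theorem projFrame_homog (v : CP2.C2) : projFrame (CP2.homog 0 v).1
    = (((‖v‖⁻¹ : ℝ) : ℂ) * v 0, ((‖v‖⁻¹ : ℝ) : ℂ) * v 1,
      ((2 * ‖v‖ / (‖v‖ ^ 2 + 1) : ℝ) : ℂ), (‖v‖ ^ 2 - 1) / (‖v‖ ^ 2 + 1)) := by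
  have h := tailSq_homog v
  rw [homog_zero] at h ⊢
  simp only [projFrame, h, Real.sqrt_sq (norm_nonneg v)]
  simp

/-- Removing the section t = -1 leaves ℂP² minus the point [1:0:0], and the flip t → -t gives the
second copy. On the disc [1:w] the base frame is w/|w| and t = (|w|² - 1)/(|w|² + 1). Reversing t
thus replaces |w| by its inverse and keeps the direction, which is the gluing map w/|w|². Both
copies use the same holomorphic disc, as required for opposite orientations. -/
theorem isCP2SumCP2bar_one : IsCP2SumCP2bar (Hirz 1) := by
  have h0 : ∀ v : CP2.C2, v ≠ 0 → tailSq (CP2.homog 0 v).1 ≠ 0 := fun v hv => by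
    rw [tailSq_homog]
    exact pow_ne_zero 2 (norm_ne_zero_iff.2 hv)
  have hb : ∀ v : CP2.C2, v ≠ 0 → blowUp (CP2.affine 0 v) = ofFrame 1 (projFrame (CP2.homog 0 v).1) :=
    fun v hv => by rw [CP2.affine_eq_ofVec, blowUp_ofVec (h0 v hv)]
  refine ⟨blowUpChart, blowUpChart.trans (flipHomeo (false, true)).toOpenPartialHomeomorph, rfl,
    ?_, contMDiffOn_blowUp, contMDiffOn_blowDown, ?_, ?_, ?_, ?_, ?_⟩
  · simp [blowUpChart]
  · exact (contMDiff_flip (false, true)).comp_contMDiffOn (contMDiffOn_blowUp.mono (by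
      simp [blowUpChart]))
  · exact contMDiffOn_blowDown.comp (contMDiff_flip (false, true)).contMDiffOn fun p hp => hp.2
  · refine eq_univ_of_forall fun p => ?_
    by_cases hp : -1 < height p
    · exact .inl hp
    · refine .inr ⟨mem_univ _, ?_⟩
      change -1 < height (flip (false, true) p)
      rw [height_flip]
      linarith
  · ext p
    constructor
    · rintro ⟨hp : -1 < height p, -, hp' : -1 < height (flip (false, true) p)⟩
      rw [height_flip] at hp'
      obtain ⟨x, hx, rfl⟩ := p.exists_ofFrame
      rw [height_ofFrame hx] at hp hp'
      have ht : 0 < 1 + x.2.2.2 := by linarith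
      have hz : x.2.2.1 ≠ 0 := fun e => by
        have := hx.2
        rw [e, map_zero] at this
        nlinarith
      have hc : (((1 + x.2.2.2)⁻¹ : ℝ) : ℂ) * x.2.2.1 ≠ 0 :=
        mul_ne_zero (by exact_mod_cast (inv_pos.2 ht).ne') hz
      have hd : CP2.ofVec (frameVec x) ∈ CP2.dom 0 :=
        (CP2.ofVec_mem_dom (frameVec_ne_zero hx) 0).2 hc
      have ha : CP2.affine 0 (CP2.coord 0 (CP2.ofVec (frameVec x))) = CP2.ofVec (frameVec x) :=
        (CP2.affineChart 0).left_inv hd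
      have ht1 : tailSq (frameVec x) ≠ 0 := by
        rw [tailSq_frameVec hx]
        exact one_ne_zero
      refine ⟨_, fun e : CP2.coord 0 (CP2.ofVec (frameVec x)) = 0 => ?_, ?_⟩
      · exact (ofVec_ne_affine_zero_iff (frameVec_ne_zero hx)).2 ht1 (by rw [← ha, e]; rfl)
      · change blowUp (CP2.affine 0 (CP2.coord 0 (CP2.ofVec (frameVec x)))) = _
        rw [ha, blowUp_ofVec ht1, projFrame_frameVec hx hp]
    · rintro ⟨v, hv, rfl⟩
      have hv : v ≠ 0 := hv
      have hn : 0 < ‖v‖ := norm_pos_iff.2 hv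
      have hh : height (blowUp (CP2.affine 0 v)) = (‖v‖ ^ 2 - 1) / (‖v‖ ^ 2 + 1) := by
        rw [hb v hv, height_ofFrame (projFrame_mem (h0 v hv)), projFrame_homog]
      refine ⟨?_, mem_univ _, ?_⟩
      · change -1 < height (blowUp (CP2.affine 0 v))
        rw [hh, lt_div_iff₀ (by positivity)]
        nlinarith
      · change -1 < height (flip (false, true) (blowUp (CP2.affine 0 v)))
        rw [height_flip, hh, neg_lt_neg_iff, div_lt_one (by positivity)]
        linarith
  · intro v hv
    have hn : 0 < ‖v‖ := norm_pos_iff.2 hv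
    have hw : (‖v‖ ^ 2)⁻¹ • v ≠ 0 := smul_ne_zero (inv_ne_zero (pow_ne_zero 2 hn.ne')) hv
    have hwn : ‖(‖v‖ ^ 2)⁻¹ • v‖ = ‖v‖⁻¹ := by
      rw [norm_smul, norm_inv, norm_pow, norm_norm]
      field_simp
    change blowUp (CP2.affine 0 v) = flip (false, true) (blowUp (CP2.affine 0 ((‖v‖ ^ 2)⁻¹ • v)))
    rw [hb v hv, hb _ hw, flip_ofFrame _ (projFrame_mem (h0 _ hw)), projFrame_homog,
      projFrame_homog, hwn]
    congr 1
    have hnc : ((‖v‖ : ℝ) : ℂ) ≠ 0 := by exact_mod_cast hn.ne'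
    refine Prod.ext ?_ (Prod.ext ?_ (Prod.ext ?_ ?_))
    · change ((‖v‖⁻¹ : ℝ) : ℂ) * v 0 = ((‖v‖⁻¹⁻¹ : ℝ) : ℂ) * (((‖v‖ ^ 2)⁻¹ : ℝ) • v 0)
      rw [Complex.real_smul]
      push_cast
      field_simp
    · change ((‖v‖⁻¹ : ℝ) : ℂ) * v 1 = ((‖v‖⁻¹⁻¹ : ℝ) : ℂ) * (((‖v‖ ^ 2)⁻¹ : ℝ) • v 1)
      rw [Complex.real_smul]
      push_cast
      field_simp
    · change ((2 * ‖v‖ / (‖v‖ ^ 2 + 1) : ℝ) : ℂ) = ((2 * ‖v‖⁻¹ / (‖v‖⁻¹ ^ 2 + 1) : ℝ) : ℂ)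
      congr 1
      field_simp
      ring
    · change (‖v‖ ^ 2 - 1) / (‖v‖ ^ 2 + 1) = -((‖v‖⁻¹ ^ 2 - 1) / (‖v‖⁻¹ ^ 2 + 1))
      field_simp
      ring

theorem isCP2SumCP2bar_of_diffeo {M M' : Type} [TopologicalSpace M] [ChartedSpace E4 M]
    [TopologicalSpace M'] [ChartedSpace E4 M'] (d : M ≃ₘ^∞⟮𝓡 4, 𝓡 4⟯ M')
    (h : IsCP2SumCP2bar M) : IsCP2SumCP2bar M' := by
  obtain ⟨i, j, hi, hj, i1, i2, j1, j2, hu, hin, hg⟩ := h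
  have hs : ∀ k : OpenPartialHomeomorph CP2 M,
      (k.transHomeomorph d.toHomeomorph).target = d.symm ⁻¹' k.target := fun k => rfl
  refine ⟨i.transHomeomorph d.toHomeomorph, j.transHomeomorph d.toHomeomorph, hi, hj,
    d.contMDiff.comp_contMDiffOn i1, i2.comp d.symm.contMDiff.contMDiffOn fun p hp => hp,
    d.contMDiff.comp_contMDiffOn j1, j2.comp d.symm.contMDiff.contMDiffOn fun p hp => hp, ?_, ?_,
    fun v hv => congrArg d (hg v hv)⟩
  · rw [hs, hs, ← preimage_union, hu, preimage_univ]
  · rw [hs, hs, ← preimage_inter, hin]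
    ext p
    constructor
    · rintro ⟨v, hv, e⟩
      exact ⟨v, hv, (congrArg d e).trans (d.apply_symm_apply p)⟩
    · rintro ⟨v, hv, rfl⟩
      exact ⟨v, hv, (d.symm_apply_apply _).symm⟩

theorem isCP2SumCP2bar_of_odd {m : ℕ} (hm : Odd m) : IsCP2SumCP2bar (Hirz m) := by
  obtain ⟨k, rfl⟩ := hm
  exact isCP2SumCP2bar_of_diffeo (twist k 1).symm isCP2SumCP2bar_one

end Hirz

end

theorem mainTheorem7 :
    -- the near-horizon limit of the extremal Kerr–Newman–`Λ` black hole
    (∀ Λ a M q r₀ s μ : ℝ, 0 < a → 0 < r₀ → 0 < knXi Λ a →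
      knDelta Λ a M q r₀ = 0 → deriv (knDelta Λ a M q) r₀ = 0 → 0 < knC Λ a r₀ →
      0 < s → 0 < μ →
      ∀ p : E4, |p 0| < π → 0 < adsR (p 0) (p 1) → |s * p 2| < a → ∀ i j,
        Tendsto
          (fun ε : ℝ =>
            ((coordPullback ℝ (nearHorizonMap Λ a r₀ s ε) (knMetric Λ a M q) p i j : ℝ) : ℂ))
          (𝓝[>] 0)
          (𝓝 (nhMetric Λ ((1 / (μ * knC Λ a r₀) : ℝ) : ℂ) ((2 * μ * r₀ * s : ℝ) : ℂ)
            ((4 * μ * s ^ 2 : ℝ) : ℂ) ((μ * q ^ 2 / s ^ 2 : ℝ) : ℂ) (toComplexPoint p) i j)))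
    -- its analytic continuation
    ∧ (∀ α Λ c ℓ : ℝ, 0 < α → 0 < ℓ → ∀ p ∈ pageDomain α Λ c, ∀ i j,
        coordPullback ℂ (continuationMap α)
          (nhMetric Λ ((ℓ : ℂ) ^ 2) (2 * Complex.I * (α : ℂ) ^ 2 / (ℓ : ℂ) ^ 2)
            (4 * (α : ℂ) ^ 2 / (ℓ : ℂ) ^ 2) ((c : ℂ) / (ℓ : ℂ) ^ 2))
          (toComplexPoint p) i j = ((pageMetric α Λ c p i j : ℝ) : ℂ))
    -- the continued metrics are Riemannian Einstein–Maxwell metrics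
    ∧ (∀ α Λ c : ℝ, 0 < α →
        (∀ p ∈ pageDomain α Λ c, (pageMetric α Λ c p).PosDef) ∧
        (∀ p ∈ pageDomain α Λ c, scalarCurvature (pageMetric α Λ c) p = 4 * Λ) ∧
        ∃ F : E4 → Matrix (Fin 4) (Fin 4) ℝ,
          SolvesEinsteinMaxwell Λ (pageMetric α Λ c) F (pageDomain α Λ c))
    -- the integrality condition is the absence of conical singularities
    ∧ (∀ (α Λ c x₁ : ℝ) (m : ℕ), IsAdmissible α Λ c x₁ → 1 ≤ m →
        (HasNoConicalSingularity α Λ c x₁ m ↔ (m : ℝ) = regularityValue c x₁))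
    -- smooth extension to a sphere bundle under the integrality condition
    ∧ (∀ (α Λ c x₁ : ℝ) (m : ℕ), IsRegularSolution α Λ c x₁ m →
        0 < Λ ∧
        ∃ (M : Type) (_ : TopologicalSpace M) (_ : T2Space M) (_ : SecondCountableTopology M)
          (_ : CompactSpace M) (_ : ChartedSpace E4 M) (_ : IsManifold (𝓡 4) ∞ M)
          (proj : M → S2)
          (g : Bundle.ContMDiffRiemannianMetric (𝓡 4) ∞ E4
            (fun p : M => TangentSpace (𝓡 4) p))
          (F : BilinField M) (Φ : E4 → M),
          IsSphereBundleExtension α Λ c x₁ m proj g Φ ∧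
          SolvesEinsteinMaxwellOn Λ g F ∧
          (Even m → IsTrivialSphereBundle proj) ∧
          (Odd m → IsCP2SumCP2bar M))
    -- the solutions of the integrality condition
    ∧ (∀ c : ℝ, 0 < c → ∀ Λ : ℝ, 0 < Λ → ∀ m : ℕ, 1 ≤ m →
        ∃! s : ℝ × ℝ, IsRegularSolution s.1 Λ c s.2 m)
    ∧ (∀ c : ℝ, c < 0 → ∀ (α Λ x₁ : ℝ) (m : ℕ), IsRegularSolution α Λ c x₁ m → m = 1)
    ∧ (∃ c : ℝ, c < 0 ∧ ∀ Λ : ℝ, 0 < Λ →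
        {s : ℝ × ℝ | IsRegularSolution s.1 Λ c s.2 1}.ncard = 2) := by
  refine ⟨?_, ?_, ?_, ?_, ?_, ?_, ?_, exists_ncard_isRegularSolution_eq_two⟩
  · intro Λ a M q r₀ s μ ha hr hΞ h0 h1 hC hs hμ p ht hR hx i j
    exact tendsto_coordPullback_nearHorizonMap Λ a M q r₀ s μ ha hr hΞ h0 h1 hC hs hμ p ht hR hx i j
  · intro α Λ c ℓ hα hℓ p hp i j
    exact coordPullback_continuationMap_nhMetric α Λ c ℓ hα hℓ p hp i j
  · intro α Λ c hα
    -- The choice a = 1 and b = -cα²/4 meets the constraint on ab for every sign of c, so the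
    -- Maxwell field is real.
    refine ⟨fun p hp => posDef_pageMetric hα.ne' hp,
      fun p hp => scalarCurvature_pageMetric hα.ne' hp, _,
      solvesEinsteinMaxwell_pageMetric hα.ne' (a := 1) (b := -(c * α ^ 2 / 4)) (one_mul _)⟩
  · intro α Λ c x₁ m h hm
    exact hasNoConicalSingularity_iff_regularityValue α Λ c x₁ m h hm
  · intro α Λ c x₁ m h
    exact ⟨h.lambda_pos, Hirz m, inferInstance, inferInstance, inferInstance, inferInstance,
      inferInstance, inferInstance, Hirz.proj, Hirz.bundleMetric h,
      Hirz.bundleField x₁ m 1 (-(c * α ^ 2 / 4)), Hirz.pagePoint x₁ m,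
      Hirz.isSphereBundleExtension h, Hirz.solvesEinsteinMaxwellOn h (one_mul _),
      fun hm => Hirz.isTrivialSphereBundle_of_even hm, fun hm => Hirz.isCP2SumCP2bar_of_odd hm⟩
  · intro c hc Λ hΛ m hm
    exact existsUnique_isRegularSolution hc hΛ hm
  · intro c hc α Λ x₁ m h
    exact IsRegularSolution.eq_one_of_neg hc h
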